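/- Let $n,r\ge 1$, $\mathbf m=(m_1,\dots,m_r)\in\mathbb Z_{>0}^r$, $m=m_1+\dots+m_r$, and $\mathbf Q=(Q_0,\dots,Q_{r-1})\in(\mathbb C^\times)^r$. All algebras are over $\mathbb C$. *Hecke algebras.* $\mathscr H=\mathscr H_{n,r}^{q=1}$ is the Ariki–Koike algebra at $q=1$: generators $T_0,\dots,T_{n-1}$, relations $\prod_{k=0}^{r-1}(T_0-Q_k)=0$, $(T_i-1)(T_i+1)=0$ $(1\le i\le n-1)$, $T_0T_1T_0T_1=T_1T_0T_1T_0$, $T_iT_{i+1}T_i=T_{i+1}T_iT_{i+1}$ $(1\le i\le n-2)$, $T_iT_j=T_jT_i$ $(|i-j|>1)$. Put $L_i=T_{i-1}\cdots T_1T_0T_1\cdots T_{i-1}$ and $L_j^{\langle k\rangle}=(L_j-Q_0)\cdots(L_j-Q_{k-1})$. Let $\widehat{\mathscr H}=\mathbb C[\mathfrak S_n]\ltimes\mathbb C[X_1^{\pm1},\dots,X_n^{\pm1}]$ be the affine Hecke algebra at $q=1$; it maps onto $\mathscr H$ by $T_i\mapsto T_i$, $X_j\mapsto L_j$. *Permutation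 modules.* Let $\Lambda=\Lambda_{n,r}(\mathbf m)$ be the set of $\mu=(\mu^{(1)},\dots,\mu^{(r)})$ with $\mu^{(k)}\in\mathbb Z_{\ge0}^{m_k}$ and total sum $n$. Such a $\mu$ is identified by concatenation with a composition $(\mu_1,\dots,\mu_m)$ of $n$. Let $a_k^\mu=|\mu^{(1)}|+\dots+|\mu^{(k)}|$, let $c_j^\mu=k$ if $a_{k-1}^\mu<j\le a_k^\mu$, and let $\mathfrak S_\mu\subseteq\mathfrak S_n$ be the parabolic subgroup of $(\mu_1,\dots,\mu_m)$. Put $m_\mu=\big(\sum_{w\in\mathfrak S_\mu}T_w\big)\prod_{k=1}^{r-1}\prod_{i=1}^{a_k^\mu}(L_i-Q_k)$ and $M^\mu=m_\mu\mathscr H$. The cyclotomic Schur algebra at $q=1$ is $\mathscr S_{n,r}^{q=1}(\mathbf m)=\operatorname{End}_{\mathscr H^{\mathrm{opp}}}\big(\bigoplus_{\mu\in\Lambda}M^\mu\big)$. *Shifted loop Lie algebra.* For $1\le i\le m-1$ put $b_i=1$, $\eta_i=Q_k$ if $i=m_1+\dots+m_k$ for some $k$, and $b_i=0$, $\eta_i=1$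 otherwise. With $\mathbf b_{\mathbf m}=(b_i)_i$ and the Cartan matrix $(a_{ij})$ of $\mathfrak{sl}_m$, $L^{\eta}_{[\mathbf b_{\mathbf m}]}\mathfrak{sl}_m$ is the Lie algebra with generators $E_{i,t},F_{i,t},H_{i,t}$ $(1\le i\le m-1,\ t\in\mathbb Z)$ and relations $[H_{i,t},H_{j,s}]=0$; $[H_{i,t},E_{j,s}]=a_{ij}E_{j,s+t}$; $[H_{i,t},F_{j,s}]=-a_{ij}F_{j,s+t}$; $[E_{i,t},F_{j,s}]=\delta_{i,j}\big(H_{i,s+t}+\delta_{(b_i>0)}(-\eta_i^{-1})^{b_i}H_{i,s+t+b_i}\big)$; $[E_{i,t},E_{j,s}]=[F_{i,t},F_{j,s}]=0$ if $j\ne i\pm1$; $[E_{i,t},E_{i\pm1,s}]=[E_{i,t+1},E_{i\pm1,s-1}]$; $[F_{i,t},F_{i\pm1,s}]=[F_{i,t+1},F_{i\pm1,s-1}]$; $[E_{i,s},[E_{i,t},E_{i\pm1,u}]]=[F_{i,s},[F_{i,t},F_{i\pm1,u}]]=0$. Let $U_{[\mathbf b_{\mathbf m}]}$ be its enveloping algebra,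 and $U_{[0]}$ the one for the shift $0$ in place of $\mathbf b_{\mathbf m}$. The Lie homomorphism $\iota$ from the Lie algebra with shift $\mathbf b_{\mathbf m}$ to the one with shift $0$ is $E_{i,t}\mapsto E_{i,t}$, $H_{i,t}\mapsto H_{i,t}$, $F_{i,t}\mapsto F_{i,t}+\delta_{(b_i>0)}(-\eta_i^{-1})^{b_i}F_{i,t+b_i}$. *The space $V_{n,r}$.* Let $\widehat V=\mathbb C^m\otimes\mathbb C[x^{\pm1}]$ with the standard basis $v_1,\dots,v_m$ of $\mathbb C^m$. $U_{[0]}$ acts on $\widehat V$ by $E_{i,t}(v_j\otimes x^p)=\delta_{i+1,j}v_{j-1}\otimes x^{p+t}$, $F_{i,t}(v_j\otimes x^p)=\delta_{i,j}v_{j+1}\otimes x^{p+t}$, $H_{i,t}(v_j\otimes x^p)=(\delta_{i,j}-\delta_{i+1,j})v_j\otimes x^{p+t}$, and on $\widehat V^{\otimes n}$ through the coproduct; $\widehat{\mathscr H}$ acts on $\widehat V^{\otimes n}$ from the right, $T_i$ by exchanging the tensor factors $i$ and $i+1$, $X_j$ by multiplication by $x$ in the factor $j$. Let $L=\mathbb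 Cw$ be the trivial $U_{[\mathbf b_{\mathbf m}]}$-module and $V_{n,r}=L\otimes(\widehat V^{\otimes n}\otimes_{\widehat{\mathscr H}}\mathscr H)$, with the action of $U_{[\mathbf b_{\mathbf m}]}$ through $U_{[\mathbf b_{\mathbf m}]}\to U_{[\mathbf b_{\mathbf m}]}\otimes U_{[0]}$, $y\mapsto y\otimes1+1\otimes\iota(y)$ for $y$ in the Lie algebra. For $\mu\in\Lambda$ let $v_\mu=w\otimes(v_1^{\otimes\mu_1}\otimes\dots\otimes v_m^{\otimes\mu_m}\otimes1)$, where $v_j$ stands for $v_j\otimes 1\in\widehat V$, and let $\mathcal I_{V_{n,r}}$ be the right $\mathscr H$-submodule of $V_{n,r}$ generated by all $v_\mu\cdot L_j^{\langle c_j^\mu\rangle}$ $(\mu\in\Lambda,\ 1\le j\le n)$. *The tensor space.* For $1\le j\le m$ let $c_j=k$ if $m_1+\dots+m_{k-1}<j\le m_1+\dots+m_k$. Let $\mathbb V$ be the quotient of $\widehat V$ by the $\mathbb C[x^{\pm1}]$-submodule generated by the $v_j\otimes(x-Q_0)\cdots(x-Q_{c_j-1})$ $(1\le j\le m)$. $U_{[\mathbf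 b_{\mathbf m}]}$ acts on $\mathbb V$ by the above formulas for $E_{i,t}$ and $H_{i,t}$, and by $F_{i,t}(v_j\otimes x^p)=\delta_{i,j}v_{j+1}\otimes x^{p+t}$ if $b_i=0$, $F_{i,t}(v_j\otimes x^p)=\delta_{i,j}v_{j+1}\otimes(x^{p+t}-\eta_i^{-1}x^{p+t+1})$ if $b_i=1$. It acts on $\mathbb V^{\otimes n}$ through its coproduct; let $\rho:U_{[\mathbf b_{\mathbf m}]}\to\operatorname{End}_{\mathbb C}(\mathbb V^{\otimes n})$ be this representation. $\mathscr H$ acts on $\mathbb V^{\otimes n}$ from the right, $T_i$ $(i\ge1)$ by exchanging the factors $i$ and $i+1$, $L_j$ by multiplication by $x$ in the factor $j$; let $\sigma:\mathscr H^{\mathrm{opp}}\to\operatorname{End}_{\mathbb C}(\mathbb V^{\otimes n})$ be this representation. **Theorem.** Assume $m_i\ge n$ for all $i=1,\dots,r$. (i) $\mathcal I_{V_{n,r}}$ is a $U_{[\mathbf b_{\mathbf m}]}$-submodule of $V_{n,r}$, and $\mathbb V^{\otimes n}\cong V_{n,r}/\mathcal I_{V_{n,r}}$ as $(U_{[\mathbf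 b_{\mathbf m}]},\mathscr H)$-bimodules. (ii) $\mathbb V^{\otimes n}\cong\bigoplus_{\mu\in\Lambda}M^\mu$ as right $\mathscr H$-modules. (iii) $\operatorname{Im}\rho\cong\mathscr S_{n,r}^{q=1}(\mathbf m)$ as algebras, and these are quasi-hereditary algebras. Moreover $\operatorname{Im}\sigma\cong\mathscr H$ as algebras. (iv) $\operatorname{Im}\rho=\operatorname{End}_{\mathscr H^{\mathrm{opp}}}(\mathbb V^{\otimes n})$ and $\operatorname{Im}\sigma=\operatorname{End}_{U_{[\mathbf b_{\mathbf m}]}}(\mathbb V^{\otimes n})$. -/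

import Mathlib

open scoped TensorProduct
attribute [local instance] LieRing.ofAssociativeRing
noncomputable section
namespace SchurWeyl

/-- `i` of the pair `(i, i + 1)` of neighbours attached to `i : Fin (k - 1)` (zero-based). -/
def lo {k : ℕ} (i : Fin (k - 1)) : Fin k := ⟨i, by omega⟩

/-- `i + 1` of the pair `(i, i + 1)` of neighbours attached to `i : Fin (k - 1)` (zero-based). -/
def hi {k : ℕ} (i : Fin (k - 1)) : Fin k := ⟨i + 1, by omega⟩

theorem lo_ne_hi {k : ℕ} (i : Fin (k - 1)) : lo i ≠ hi i := by
  simp [lo, hi, Fin.ext_iff]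

section TensorPower

/-- The tensor power `W ^ ⊗ n` over `ℂ`. -/
abbrev TPow (n : ℕ) (W : Type) [AddCommGroup W] [Module ℂ W] : Type :=
  PiTensorProduct ℂ (fun _ : Fin n => W)

variable {W : Type} [AddCommGroup W] [Module ℂ W] {n : ℕ}

/-- `1 ⊗ … ⊗ f ⊗ … ⊗ 1` with `f` in the tensor factor `j`, as a linear map. -/
def placeMap (j : Fin n) (f : Module.End ℂ W) : Module.End ℂ (TPow n W) :=
  PiTensorProduct.map (Function.update (fun _ => (LinearMap.id : W →ₗ[ℂ] W)) j f)

theorem placeMap_tprod (j : Fin n) (f : Module.End ℂ W) (v : Fin n → W) :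
    placeMap j f (PiTensorProduct.tprod ℂ v) =
      PiTensorProduct.tprod ℂ (Function.update v j (f (v j))) := by
  rw [placeMap, PiTensorProduct.map_tprod]
  congr 1
  funext i
  by_cases h : i = j
  · subst h; simp
  · simp [h]

/-- `f ↦ 1 ⊗ … ⊗ f ⊗ … ⊗ 1` with `f` in the tensor factor `j`, as a homomorphism of algebras. -/
def place (j : Fin n) : Module.End ℂ W →ₐ[ℂ] Module.End ℂ (TPow n W) where
  toFun := placeMap j
  map_one' := by
    ext v
    simp [placeMap_tprod]
  map_mul' f g := by
    ext v
    simp [placeMap_tprod]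
  map_zero' := by
    ext v
    simp only [LinearMap.compMultilinearMap_apply, placeMap_tprod, LinearMap.zero_apply]
    exact (PiTensorProduct.tprod ℂ).map_update_zero v j
  map_add' f g := by
    ext v
    simp [placeMap_tprod]
  commutes' c := by
    ext v
    simp [placeMap_tprod, Algebra.algebraMap_eq_smul_one]

theorem place_tprod (j : Fin n) (f : Module.End ℂ W) (v : Fin n → W) :
    place j f (PiTensorProduct.tprod ℂ v) =
      PiTensorProduct.tprod ℂ (Function.update v j (f (v j))) :=
  placeMap_tprod j f v

theorem place_comm {i j : Fin n} (h : i ≠ j) (f g : Module.End ℂ W) :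
    place i f * place j g = place j g * place i f := by
  ext v
  simp [place_tprod, Function.update_of_ne h, Function.update_of_ne h.symm,
    Function.update_comm h]

/-- Place permutation: the factor `v j` moves to the position `w j`. -/
def permEnd (w : Equiv.Perm (Fin n)) : Module.End ℂ (TPow n W) :=
  (PiTensorProduct.reindex ℂ (fun _ : Fin n => W) w).toLinearMap

theorem permEnd_tprod (w : Equiv.Perm (Fin n)) (v : Fin n → W) :
    permEnd w (PiTensorProduct.tprod ℂ v) = PiTensorProduct.tprod ℂ (fun i => v (w.symm i)) :=
  PiTensorProduct.reindex_tprod w v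

theorem permEnd_one : permEnd (W := W) (1 : Equiv.Perm (Fin n)) = 1 := by
  ext v
  simp only [LinearMap.compMultilinearMap_apply, permEnd_tprod, Module.End.one_apply]
  rfl

theorem permEnd_mul (w u : Equiv.Perm (Fin n)) :
    permEnd (W := W) (w * u) = permEnd w * permEnd u := by
  ext v
  simp [permEnd_tprod, Equiv.Perm.mul_def]

theorem permEnd_place (w : Equiv.Perm (Fin n)) (j : Fin n) (f : Module.End ℂ W) :
    permEnd w * place j f = place (w j) f * permEnd w := by
  ext v
  simp only [LinearMap.compMultilinearMap_apply, Module.End.mul_apply, place_tprod, permEnd_tprod]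
  congr 1
  funext i
  by_cases h : i = w j
  · subst h
    rw [Function.update_self, Equiv.symm_apply_apply, Function.update_self]
  · have : w.symm i ≠ j := fun h' => h (by rw [← h']; simp)
    simp [h, this]

/-- The primitive (Lie algebra) action on the tensor power, `f ↦ ∑ j, 1 ⊗ … ⊗ f ⊗ … ⊗ 1`: the
effect of the iterated coproduct `x ↦ x ⊗ 1 + 1 ⊗ x`. -/
def tensorLie : Module.End ℂ W →ₗ⁅ℂ⁆ Module.End ℂ (TPow n W) :=
  { ∑ j : Fin n, (place j).toLinearMap with
    map_lie' := by
      intro f g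
      simp only [AddHom.toFun_eq_coe, LinearMap.coe_toAddHom, LinearMap.sum_apply,
        AlgHom.toLinearMap_apply, Ring.lie_def, map_sub, map_mul, Finset.sum_mul_sum]
      rw [Finset.sum_comm (f := fun i j => place i g * place j f), ← Finset.sum_sub_distrib,
        ← Finset.sum_sub_distrib]
      refine Finset.sum_congr rfl fun i _ => ?_
      rw [← Finset.sum_sub_distrib, Finset.sum_eq_single i]
      · intro j _ h
        rw [place_comm h.symm, sub_self]
      · simp }

theorem tensorLie_apply (f : Module.End ℂ W) :
    tensorLie f = ∑ j : Fin n, place j f := by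
  change (∑ j : Fin n, (place j).toLinearMap) f = _
  simp

theorem permEnd_tensorLie (w : Equiv.Perm (Fin n)) (f : Module.End ℂ W) :
    permEnd w * tensorLie f = tensorLie f * permEnd w := by
  rw [tensorLie_apply, Finset.mul_sum, Finset.sum_mul]
  simp only [permEnd_place]
  exact Equiv.sum_comp w (fun j => place j f * permEnd w)

theorem place_tensorLie (j : Fin n) {x f : Module.End ℂ W} (h : x * f = f * x) :
    place j x * tensorLie f = tensorLie f * place j x := by
  rw [tensorLie_apply, Finset.mul_sum, Finset.sum_mul]
  refine Finset.sum_congr rfl fun i _ => ?_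
  by_cases hij : i = j
  · subst hij; rw [← map_mul, h, map_mul]
  · exact (place_comm hij f x).symm

end TensorPower

section ShiftedLoop

/-- Generators `E_{i,t}`, `F_{i,t}`, `H_{i,t}` (`1 ≤ i ≤ M - 1`, `t ∈ ℤ`), with `i` zero-based. -/
inductive LoopGen (M : ℕ) : Type
  | E (i : Fin (M - 1)) (t : ℤ) : LoopGen M
  | F (i : Fin (M - 1)) (t : ℤ) : LoopGen M
  | H (i : Fin (M - 1)) (t : ℤ) : LoopGen M

variable {M : ℕ}

/-- `i` and `j` are neighbours, `j = i ± 1`. -/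
def Adj (i j : Fin (M - 1)) : Prop := (i : ℕ) + 1 = j ∨ (j : ℕ) + 1 = i

/-- The coefficient `δ_(b_i > 0) (- η_i⁻¹) ^ b_i`. -/
def shiftCoeff (η : Fin (M - 1) → ℂˣ) (b : Fin (M - 1) → ℕ) (i : Fin (M - 1)) : ℂ :=
  if 0 < b i then (-((η i : ℂ))⁻¹) ^ b i else 0

/-- The defining relations of the shifted loop Lie algebra of `sl_M`, for families
`E`, `F`, `H` of elements of a Lie algebra. -/
inductive LoopRel (η : Fin (M - 1) → ℂˣ) (b : Fin (M - 1) → ℕ) {L : Type} [LieRing L]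
    [LieAlgebra ℂ L] (E F H : Fin (M - 1) → ℤ → L) : L → L → Prop
  | hh (i j t s) : LoopRel η b E F H ⁅H i t, H j s⁆ 0
  | he (i j t s) : LoopRel η b E F H ⁅H i t, E j s⁆ (CartanMatrix.A (M - 1) i j • E j (s + t))
  | hf (i j t s) : LoopRel η b E F H ⁅H i t, F j s⁆ (-(CartanMatrix.A (M - 1) i j • F j (s + t)))
  | ef (i j t s) : LoopRel η b E F H ⁅E i t, F j s⁆
      (if i = j then H i (s + t) + shiftCoeff η b i • H i (s + t + b i) else 0)
  | ee (i j t s) : ¬ Adj i j → LoopRel η b E F H ⁅E i t, E j s⁆ 0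
  | ff (i j t s) : ¬ Adj i j → LoopRel η b E F H ⁅F i t, F j s⁆ 0
  | ee' (i j t s) : Adj i j → LoopRel η b E F H ⁅E i t, E j s⁆ ⁅E i (t + 1), E j (s - 1)⁆
  | ff' (i j t s) : Adj i j → LoopRel η b E F H ⁅F i t, F j s⁆ ⁅F i (t + 1), F j (s - 1)⁆
  | eee (i j s t u) : Adj i j → LoopRel η b E F H ⁅E i s, ⁅E i t, E j u⁆⁆ 0
  | fff (i j s t u) : Adj i j → LoopRel η b E F H ⁅F i s, ⁅F i t, F j u⁆⁆ 0

theorem LoopRel.map {η : Fin (M - 1) → ℂˣ} {b : Fin (M - 1) → ℕ} {L L' : Type} [LieRing L]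
    [LieAlgebra ℂ L] [LieRing L'] [LieAlgebra ℂ L'] {E F H : Fin (M - 1) → ℤ → L}
    (φ : L →ₗ⁅ℂ⁆ L') {x y : L} (h : LoopRel η b E F H x y) :
    LoopRel η b (fun i t => φ (E i t)) (fun i t => φ (F i t)) (fun i t => φ (H i t))
      (φ x) (φ y) := by
  cases h with
  | hh i j t s => simpa using LoopRel.hh i j t s
  | he i j t s => simpa using LoopRel.he i j t s
  | hf i j t s => simpa using LoopRel.hf i j t s
  | ef i j t s =>
    have := LoopRel.ef (η := η) (b := b) (E := fun i t => φ (E i t)) (F := fun i t => φ (F i t))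
      (H := fun i t => φ (H i t)) i j t s
    split_ifs with hij <;> simpa [hij] using this
  | ee i j t s ha => simpa using LoopRel.ee i j t s ha
  | ff i j t s ha => simpa using LoopRel.ff i j t s ha
  | ee' i j t s ha => simpa using LoopRel.ee' i j t s ha
  | ff' i j t s ha => simpa using LoopRel.ff' i j t s ha
  | eee i j t s u ha => simpa using LoopRel.eee i j t s u ha
  | fff i j t s u ha => simpa using LoopRel.fff i j t s u ha

variable (η : Fin (M - 1) → ℂˣ) (b : Fin (M - 1) → ℕ)

/-- The ideal of the free Lie algebra generated by the defining relations. -/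
def loopIdeal : LieIdeal ℂ (FreeLieAlgebra ℂ (LoopGen M)) :=
  LieSubmodule.lieSpan ℂ _ {z | ∃ x y, LoopRel η b
    (fun i t => FreeLieAlgebra.of ℂ (LoopGen.E i t))
    (fun i t => FreeLieAlgebra.of ℂ (LoopGen.F i t))
    (fun i t => FreeLieAlgebra.of ℂ (LoopGen.H i t)) x y ∧ z = x - y}

/-- The shifted loop Lie algebra `L^η_[b] sl_M`. -/
abbrev ShiftedLoop : Type := FreeLieAlgebra ℂ (LoopGen M) ⧸ loopIdeal η b

/-- The quotient map from the free Lie algebra. -/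
def ShiftedLoop.mkHom : FreeLieAlgebra ℂ (LoopGen M) →ₗ⁅ℂ⁆ ShiftedLoop η b :=
  { (loopIdeal η b).toSubmodule.mkQ with map_lie' := rfl }

/-- The generator `E_{i,t}`. -/
def ShiftedLoop.E (i : Fin (M - 1)) (t : ℤ) : ShiftedLoop η b :=
  ShiftedLoop.mkHom η b (FreeLieAlgebra.of ℂ (LoopGen.E i t))

/-- The generator `F_{i,t}`. -/
def ShiftedLoop.F (i : Fin (M - 1)) (t : ℤ) : ShiftedLoop η b :=
  ShiftedLoop.mkHom η b (FreeLieAlgebra.of ℂ (LoopGen.F i t))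

/-- The generator `H_{i,t}`. -/
def ShiftedLoop.H (i : Fin (M - 1)) (t : ℤ) : ShiftedLoop η b :=
  ShiftedLoop.mkHom η b (FreeLieAlgebra.of ℂ (LoopGen.H i t))

variable {η b}

theorem ShiftedLoop.mkHom_rel {x y : FreeLieAlgebra ℂ (LoopGen M)}
    (h : LoopRel η b (fun i t => FreeLieAlgebra.of ℂ (LoopGen.E i t))
      (fun i t => FreeLieAlgebra.of ℂ (LoopGen.F i t))
      (fun i t => FreeLieAlgebra.of ℂ (LoopGen.H i t)) x y) :
    ShiftedLoop.mkHom η b x = ShiftedLoop.mkHom η b y := by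
  rw [← sub_eq_zero, ← map_sub]
  exact (Submodule.Quotient.mk_eq_zero _).2 (LieSubmodule.subset_lieSpan ⟨x, y, h, rfl⟩)

/-- A homomorphism out of the shifted loop Lie algebra, from images of the generators that satisfy
the defining relations. -/
def ShiftedLoop.lift {L : Type} [LieRing L] [LieAlgebra ℂ L] (E F H : Fin (M - 1) → ℤ → L)
    (h : ∀ x y, LoopRel η b E F H x y → x = y) : ShiftedLoop η b →ₗ⁅ℂ⁆ L :=
  let φ : FreeLieAlgebra ℂ (LoopGen M) →ₗ⁅ℂ⁆ L := FreeLieAlgebra.lift ℂ fun g =>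
    match g with
    | .E i t => E i t
    | .F i t => F i t
    | .H i t => H i t
  have hφ : loopIdeal η b ≤ φ.ker := by
    rw [loopIdeal, LieSubmodule.lieSpan_le]
    rintro _ ⟨x, y, hxy, rfl⟩
    have := h (φ x) (φ y) (by simpa [φ] using hxy.map φ)
    simp [LieHom.mem_ker, this]
  { (loopIdeal η b).toSubmodule.liftQ (φ : FreeLieAlgebra ℂ (LoopGen M) →ₗ[ℂ] L)
      (fun _ hx => LieHom.mem_ker.1 (hφ hx)) with
    map_lie' := by
      intro x y
      obtain ⟨x, rfl⟩ := Submodule.Quotient.mk_surjective _ x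
      obtain ⟨y, rfl⟩ := Submodule.Quotient.mk_surjective _ y
      exact φ.map_lie x y }

section Lift

variable {L : Type} [LieRing L] [LieAlgebra ℂ L] (E F H : Fin (M - 1) → ℤ → L)
  (h : ∀ x y, LoopRel η b E F H x y → x = y)

theorem ShiftedLoop.lift_E (i t) : ShiftedLoop.lift E F H h (ShiftedLoop.E η b i t) = E i t :=
  FreeLieAlgebra.lift_of_apply _ _

theorem ShiftedLoop.lift_F (i t) : ShiftedLoop.lift E F H h (ShiftedLoop.F η b i t) = F i t :=
  FreeLieAlgebra.lift_of_apply _ _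

theorem ShiftedLoop.lift_H (i t) : ShiftedLoop.lift E F H h (ShiftedLoop.H η b i t) = H i t :=
  FreeLieAlgebra.lift_of_apply _ _

end Lift

/-- The defining relations hold in the shifted loop Lie algebra. -/
theorem ShiftedLoop.rel_holds {x y : ShiftedLoop η b}
    (h : LoopRel η b (ShiftedLoop.E η b) (ShiftedLoop.F η b) (ShiftedLoop.H η b) x y) :
    x = y := by
  have key : ∀ {x y : FreeLieAlgebra ℂ (LoopGen M)}, _ → _ := fun {x y} =>
    ShiftedLoop.mkHom_rel (η := η) (b := b) (x := x) (y := y)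
  cases h with
  | hh i j t s => simpa [ShiftedLoop.E, ShiftedLoop.F, ShiftedLoop.H] using key (LoopRel.hh i j t s)
  | he i j t s => simpa [ShiftedLoop.E, ShiftedLoop.F, ShiftedLoop.H] using key (LoopRel.he i j t s)
  | hf i j t s => simpa [ShiftedLoop.E, ShiftedLoop.F, ShiftedLoop.H] using key (LoopRel.hf i j t s)
  | ef i j t s =>
    have := key (LoopRel.ef i j t s)
    rw [LieHom.map_lie] at this
    refine this.trans ?_
    split_ifs with hij <;> simp [ShiftedLoop.H]
  | ee i j t s ha => simpa [ShiftedLoop.E, ShiftedLoop.F, ShiftedLoop.H] using key (LoopRel.ee i j t s ha)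
  | ff i j t s ha => simpa [ShiftedLoop.E, ShiftedLoop.F, ShiftedLoop.H] using key (LoopRel.ff i j t s ha)
  | ee' i j t s ha => simpa [ShiftedLoop.E, ShiftedLoop.F, ShiftedLoop.H] using key (LoopRel.ee' i j t s ha)
  | ff' i j t s ha => simpa [ShiftedLoop.E, ShiftedLoop.F, ShiftedLoop.H] using key (LoopRel.ff' i j t s ha)
  | eee i j t s u ha => simpa [ShiftedLoop.E, ShiftedLoop.F, ShiftedLoop.H] using key (LoopRel.eee i j t s u ha)
  | fff i j t s u ha => simpa [ShiftedLoop.E, ShiftedLoop.F, ShiftedLoop.H] using key (LoopRel.fff i j t s u ha)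

/-- The shift homomorphism `ι_[b]♯ : L^η_[b] sl_M → L^η_[0] sl_M = L sl_M`. -/
def shiftHom (η : Fin (M - 1) → ℂˣ) (b : Fin (M - 1) → ℕ) :
    ShiftedLoop η b →ₗ⁅ℂ⁆ ShiftedLoop η (0 : Fin (M - 1) → ℕ) :=
  ShiftedLoop.lift (ShiftedLoop.E η 0)
    (fun i t => ShiftedLoop.F η 0 i t + shiftCoeff η b i • ShiftedLoop.F η 0 i (t + b i))
    (ShiftedLoop.H η 0) (by
      have key : ∀ {x y : ShiftedLoop η (0 : Fin (M - 1) → ℕ)}, _ → _ := fun {x y} =>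
        ShiftedLoop.rel_holds (η := η) (b := 0) (x := x) (y := y)
      have hc : ∀ i, shiftCoeff η (0 : Fin (M - 1) → ℕ) i = 0 := fun i => by simp [shiftCoeff]
      intro x y h
      cases h with
      | hh i j t s => exact key (LoopRel.hh i j t s)
      | he i j t s => exact key (LoopRel.he i j t s)
      | hf i j t s =>
        rw [lie_add, lie_smul, key (LoopRel.hf i j t s), key (LoopRel.hf i j t _),
          show s + b j + t = s + t + b j by ring, smul_add, neg_add, smul_neg,
          smul_comm (shiftCoeff η b j)]
      | ef i j t s =>
        rw [lie_add, lie_smul, key (LoopRel.ef i j t s), key (LoopRel.ef i j t _)]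
        split_ifs with hij
        · subst hij
          rw [hc, zero_smul, zero_smul, add_zero, add_zero,
            show s + b i + t = s + t + b i by ring]
        · simp
      | ee i j t s ha => exact key (LoopRel.ee i j t s ha)
      | ff i j t s ha =>
        simp only [lie_add, add_lie, smul_lie, lie_smul, key (LoopRel.ff i j _ _ ha)]
        simp
      | ee' i j t s ha => exact key (LoopRel.ee' i j t s ha)
      | ff' i j t s ha =>
        simp only [lie_add, add_lie, smul_lie, lie_smul]
        rw [key (LoopRel.ff' i j t s ha), key (LoopRel.ff' i j (t + b i) s ha),
          key (LoopRel.ff' i j t (s + b j) ha), key (LoopRel.ff' i j (t + b i) (s + b j) ha),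
          show t + b i + 1 = t + 1 + b i by ring, show s + b j - 1 = s - 1 + b j by ring]
      | eee i j s t u ha => exact key (LoopRel.eee i j s t u ha)
      | fff i j s t u ha =>
        simp only [lie_add, add_lie, smul_lie, lie_smul, key (LoopRel.fff i j _ _ _ ha)]
        simp)

end ShiftedLoop

section LoopModule

open LaurentPolynomial

variable {M : ℕ}

variable (M) in
/-- The affinization `V ⊗ ℂ[x, x⁻¹]` of `V = ℂ ^ M`, i.e. the free `ℂ[x, x⁻¹]`-module on
`v_1, …, v_M`; the vector `v_j ⊗ f` is `Pi.single j f`. -/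
abbrev VHat : Type := Fin M → ℂ[T;T⁻¹]

/-- The matrix of `E_{i,t}`: it sends `v_{i+1} ⊗ x ^ k` to `v_i ⊗ x ^ (k + t)`. -/
def matE (i : Fin (M - 1)) (t : ℤ) : Matrix (Fin M) (Fin M) ℂ[T;T⁻¹] :=
  Matrix.single (lo i) (hi i) (T t)

/-- The matrix of `F_{i,t}`: it sends `v_i ⊗ x ^ k` to `v_{i+1} ⊗ x ^ (k + t)`. -/
def matF (i : Fin (M - 1)) (t : ℤ) : Matrix (Fin M) (Fin M) ℂ[T;T⁻¹] :=
  Matrix.single (hi i) (lo i) (T t)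

/-- The matrix of `H_{i,t}`. -/
def matH (i : Fin (M - 1)) (t : ℤ) : Matrix (Fin M) (Fin M) ℂ[T;T⁻¹] :=
  Matrix.single (lo i) (lo i) (T t) - Matrix.single (hi i) (hi i) (T t)

theorem single_mul_ite (a b c d : Fin M) (x y : ℂ[T;T⁻¹]) :
    Matrix.single a b x * Matrix.single c d y =
      if b = c then Matrix.single a d (x * y) else 0 := by
  split_ifs with h
  · subst h; simp
  · simp [h]

/-- The relative positions of two nodes. -/
theorem node_cases (i j : Fin (M - 1)) :
    (i = j ∧ ¬ Adj i j ∧ CartanMatrix.A (M - 1) i j = 2) ∨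
    (i ≠ j ∧ Adj i j ∧ CartanMatrix.A (M - 1) i j = -1 ∧ hi i = lo j ∧ lo i ≠ lo j ∧
      lo i ≠ hi j ∧ lo j ≠ hi j ∧ lo j ≠ lo i ∧ hi j ≠ lo i ∧ hi j ≠ lo j) ∨
    (i ≠ j ∧ Adj i j ∧ CartanMatrix.A (M - 1) i j = -1 ∧ hi j = lo i ∧ lo j ≠ lo i ∧
      lo j ≠ hi i ∧ lo i ≠ hi i ∧ lo i ≠ lo j ∧ hi i ≠ lo j ∧ hi i ≠ lo i) ∨
    (i ≠ j ∧ ¬ Adj i j ∧ CartanMatrix.A (M - 1) i j = 0 ∧ lo i ≠ lo j ∧ lo i ≠ hi j ∧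
      hi i ≠ lo j ∧ hi i ≠ hi j ∧ lo j ≠ lo i ∧ hi j ≠ lo i ∧ lo j ≠ hi i ∧ hi j ≠ hi i) := by
  have hA : CartanMatrix.A (M - 1) i j = if i = j then 2
    else if (i : ℕ) + 1 = j ∨ (j : ℕ) + 1 = i then -1 else 0 := rfl
  rw [hA]
  simp only [Adj, lo, hi, Fin.ext_iff, Ne]
  split_ifs <;> omega

theorem mat_rel (η : Fin (M - 1) → ℂˣ) (x y : Matrix (Fin M) (Fin M) ℂ[T;T⁻¹])
    (h : LoopRel η 0 matE matF matH x y) : x = y := by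
  have hT : ∀ a b : ℤ, (T a : ℂ[T;T⁻¹]) * T b = T (a + b) := fun a b => (T_add a b).symm
  cases h with
  | hh i j t s =>
    simp only [Ring.lie_def, matH, sub_mul, mul_sub, single_mul_ite, hT, add_comm s t]
    rcases node_cases i j with ⟨rfl, _⟩ | ⟨h0, h1, h2, h3⟩ | ⟨h0, h1, h2, h3⟩ |
      ⟨h0, h1, h2, h3⟩
    · simp
    all_goals clear hT; simp_all
  | he i j t s =>
    simp only [Ring.lie_def, matH, matE, sub_mul, mul_sub, single_mul_ite, hT, add_comm t s]
    have h := lo_ne_hi i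
    have h' := h.symm
    rcases node_cases i j with ⟨rfl, _, h2⟩ | ⟨h0, h1, h2, h3⟩ | ⟨h0, h1, h2, h3⟩ |
      ⟨h0, h1, h2, h3⟩
    all_goals clear hT; simp_all [two_smul]
  | hf i j t s =>
    simp only [Ring.lie_def, matH, matF, sub_mul, mul_sub, single_mul_ite, hT, add_comm t s]
    have h := lo_ne_hi i
    have h' := h.symm
    rcases node_cases i j with ⟨rfl, _, h2⟩ | ⟨h0, h1, h2, h3⟩ | ⟨h0, h1, h2, h3⟩ |
      ⟨h0, h1, h2, h3⟩
    all_goals clear hT; simp_all [two_smul]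
    abel
  | ef i j t s =>
    simp only [Ring.lie_def, matH, matF, matE, single_mul_ite, hT, add_comm t s]
    have h := lo_ne_hi i
    have h' := h.symm
    rcases node_cases i j with ⟨rfl, _, h2⟩ | ⟨h0, h1, h2, h3⟩ | ⟨h0, h1, h2, h3⟩ |
      ⟨h0, h1, h2, h3⟩
    all_goals clear hT; simp_all [shiftCoeff]
  | ee i j t s ha =>
    simp only [Ring.lie_def, matE, single_mul_ite, hT, add_comm t s]
    have h := lo_ne_hi i
    have h' := h.symm
    rcases node_cases i j with ⟨rfl, _, h2⟩ | ⟨h0, h1, h2, h3⟩ | ⟨h0, h1, h2, h3⟩ |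
      ⟨h0, h1, h2, h3⟩
    all_goals clear hT; simp_all
  | ff i j t s ha =>
    simp only [Ring.lie_def, matF, single_mul_ite, hT, add_comm t s]
    have h := lo_ne_hi i
    have h' := h.symm
    rcases node_cases i j with ⟨rfl, _, h2⟩ | ⟨h0, h1, h2, h3⟩ | ⟨h0, h1, h2, h3⟩ |
      ⟨h0, h1, h2, h3⟩
    all_goals clear hT; simp_all
  | ee' i j t s ha =>
    simp only [Ring.lie_def, matE, single_mul_ite, hT, show t + 1 + (s - 1) = t + s by ring,
      show s - 1 + (t + 1) = s + t by ring]
  | ff' i j t s ha =>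
    simp only [Ring.lie_def, matF, single_mul_ite, hT, show t + 1 + (s - 1) = t + s by ring,
      show s - 1 + (t + 1) = s + t by ring]
  | eee i j s t u ha =>
    simp only [Ring.lie_def, matE, mul_sub, sub_mul, single_mul_ite, hT, mul_ite, ite_mul,
      mul_zero, zero_mul]
    have h := lo_ne_hi i
    have h' := h.symm
    rcases node_cases i j with ⟨rfl, _, h2⟩ | ⟨h0, h1, h2, h3⟩ | ⟨h0, h1, h2, h3⟩ |
      ⟨h0, h1, h2, h3⟩
    all_goals clear hT; simp_all
  | fff i j s t u ha =>
    simp only [Ring.lie_def, matF, mul_sub, sub_mul, single_mul_ite, hT, mul_ite, ite_mul,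
      mul_zero, zero_mul]
    have h := lo_ne_hi i
    have h' := h.symm
    rcases node_cases i j with ⟨rfl, _, h2⟩ | ⟨h0, h1, h2, h3⟩ | ⟨h0, h1, h2, h3⟩ |
      ⟨h0, h1, h2, h3⟩
    all_goals clear hT; simp_all

/-- The action of `L^η_[0] sl_M = L sl_M` on `VHat M`, by `ℂ[x, x⁻¹]`-linear maps. -/
def loopMat (η : Fin (M - 1) → ℂˣ) :
    ShiftedLoop η (0 : Fin (M - 1) → ℕ) →ₗ⁅ℂ⁆ Matrix (Fin M) (Fin M) ℂ[T;T⁻¹] :=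
  ShiftedLoop.lift matE matF matH (mat_rel η)

/-- A matrix over `ℂ[x, x⁻¹]` as a `ℂ`-linear endomorphism of `VHat M`. -/
def matEnd : Matrix (Fin M) (Fin M) ℂ[T;T⁻¹] →ₐ[ℂ] Module.End ℂ (VHat M) where
  toFun A := (Matrix.toLin' A).restrictScalars ℂ
  map_one' := by ext; simp
  map_mul' A B := by ext; simp
  map_zero' := by ext; simp
  map_add' A B := by ext; simp
  commutes' c := by
    refine LinearMap.ext fun v => ?_
    simp [Algebra.algebraMap_eq_smul_one, Matrix.smul_mulVec]

/-- The representation of `U_[0]` on `VHat M ^ ⊗ n` through the coproduct. -/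
def loopTensorRep (n : ℕ) (η : Fin (M - 1) → ℂˣ) :
    UniversalEnvelopingAlgebra ℂ (ShiftedLoop η (0 : Fin (M - 1) → ℕ)) →ₐ[ℂ]
      Module.End ℂ (TPow n (VHat M)) :=
  UniversalEnvelopingAlgebra.lift ℂ
    (tensorLie.comp (matEnd.toLieHom.comp (loopMat η)))

end LoopModule

section Blocks

variable {r : ℕ} (m : Fin r → ℕ+)

/-- `m_1 + … + m_r`. -/
abbrev total : ℕ := ∑ k, (m k : ℕ)

/-- The lexicographic bijection `ξ : Γ(m) → {1, …, m_1 + … + m_r}`, zero-based. -/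
def xi : ((k : Fin r) × Fin (m k : ℕ)) ≃ Fin (total m) := finSigmaFinEquiv

/-- The block `k` with `ξ⁻¹ j = (_, k)`; the integer `c_j` is `block m j + 1`. -/
def block (j : Fin (total m)) : Fin r := ((xi m).symm j).1

/-- `ξ⁻¹ i = (m_k, k)` for some `k`. -/
def IsBlockEnd (i : Fin (total m - 1)) : Prop :=
  (((xi m).symm (lo i)).2 : ℕ) + 1 = m (block m (lo i))

theorem block_hi_of_not_end {i : Fin (total m - 1)} (h : ¬ IsBlockEnd m i) :
    block m (hi i) = block m (lo i) := by
  unfold IsBlockEnd block at *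
  set p := (xi m).symm (lo i) with hp
  have hlt : (p.2 : ℕ) + 1 < m p.1 := lt_of_le_of_ne p.2.2 h
  have hlo : ((xi m p : Fin _) : ℕ) = (i : ℕ) := by rw [hp, Equiv.apply_symm_apply]; rfl
  have : (xi m).symm (hi i) = ⟨p.1, ⟨p.2 + 1, hlt⟩⟩ := by
    rw [Equiv.symm_apply_eq, Fin.ext_iff]
    simp only [xi, finSigmaFinEquiv_apply] at hlo ⊢
    simp only [hi]
    omega
  rw [this]

theorem block_hi_of_end {i : Fin (total m - 1)} (h : IsBlockEnd m i) :
    (block m (hi i) : ℕ) = block m (lo i) + 1 := by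
  unfold IsBlockEnd block at *
  set p := (xi m).symm (lo i) with hp
  have hlo : ((xi m p : Fin _) : ℕ) = (i : ℕ) := by rw [hp, Equiv.apply_symm_apply]; rfl
  have hsum : ∀ (k : ℕ) (hk : k < r), ∑ j : Fin (k + 1), (m (Fin.castLE hk j) : ℕ) =
      ∑ j : Fin k, (m (Fin.castLE hk.le j) : ℕ) + m ⟨k, hk⟩ := by
    intro k hk
    rw [Fin.sum_univ_castSucc]
    rfl
  simp only [xi, finSigmaFinEquiv_apply] at hlo
  have h1 : (p.1 : ℕ) + 1 < r := by
    by_contra hcon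
    have hr : (p.1 : ℕ) + 1 = r := by omega
    have h2 := hsum p.1 p.1.2
    have h3 : ∑ j : Fin (p.1 + 1), (m (Fin.castLE p.1.2 j) : ℕ) = total m :=
      Fintype.sum_equiv (finCongr hr) _ _ (fun j => rfl)
    have h4 := i.2
    simp only [Fin.eta] at h2
    omega
  have : (xi m).symm (hi i) = ⟨⟨p.1 + 1, h1⟩, ⟨0, (m _).pos⟩⟩ := by
    rw [Equiv.symm_apply_eq, Fin.ext_iff]
    simp only [xi, finSigmaFinEquiv_apply]
    have h2 := hsum p.1 p.1.2
    simp only [Fin.eta] at h2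
    simp only [hi]
    omega
  rw [this]

open scoped Classical in
/-- The shift `b_m`. -/
def bShift (i : Fin (total m - 1)) : ℕ := if IsBlockEnd m i then 1 else 0

open scoped Classical in
/-- The parameter `η`: `η_i = Q_k` if `ξ⁻¹ i = (m_k, k)`, and `η_i = 1` otherwise. As blocks are
zero-based here, `k = block m (lo i) + 1`; and `k < r` holds, as `i` is not the last index. -/
def etaParam (Q : Fin r → ℂˣ) (i : Fin (total m - 1)) : ℂˣ :=
  if h : IsBlockEnd m i ∧ (block m (lo i) : ℕ) + 1 < r then Q ⟨block m (lo i) + 1, h.2⟩ else 1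

end Blocks

section TruncatedSpace

open LaurentPolynomial

variable {r : ℕ} (m : Fin r → ℕ+) (Q : Fin r → ℂˣ)

/-- `(X - Q_0) (X - Q_1) … (X - Q_k)`. -/
def cycPoly (k : Fin r) : Polynomial ℂ :=
  ∏ i ∈ Finset.Iic k, (Polynomial.X - Polynomial.C (Q i : ℂ))

/-- The `ℂ[x, x⁻¹]`-submodule `I_Q` generated by the `v_j ⊗ (x - Q_0) … (x - Q_{c_j - 1})`. -/
def IQ : Submodule ℂ[T;T⁻¹] (VHat (total m)) :=
  Submodule.span _ (Set.range fun j =>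
    Pi.single j (Polynomial.toLaurent (cycPoly Q (block m j))))

/-- The space `𝕍 = VHat / I_Q`. -/
def VV : Type := VHat (total m) ⧸ IQ m Q

instance : AddCommGroup (VV m Q) := inferInstanceAs (AddCommGroup (VHat (total m) ⧸ IQ m Q))

instance : Module ℂ[T;T⁻¹] (VV m Q) :=
  inferInstanceAs (Module ℂ[T;T⁻¹] (VHat (total m) ⧸ IQ m Q))

instance : Module ℂ (VV m Q) := inferInstanceAs (Module ℂ (VHat (total m) ⧸ IQ m Q))

instance : IsScalarTower ℂ ℂ[T;T⁻¹] (VV m Q) :=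
  inferInstanceAs (IsScalarTower ℂ ℂ[T;T⁻¹] (VHat (total m) ⧸ IQ m Q))

/-- Matrices that preserve `I_Q`. -/
def stab : Subalgebra ℂ (Matrix (Fin (total m)) (Fin (total m)) ℂ[T;T⁻¹]) where
  carrier := {A | ∀ v ∈ IQ m Q, Matrix.toLin' A v ∈ IQ m Q}
  mul_mem' {A B} hA hB v hv := by
    rw [Matrix.toLin'_mul]
    exact hA _ (hB v hv)
  add_mem' {A B} hA hB v hv := by
    rw [map_add]
    exact add_mem (hA v hv) (hB v hv)
  algebraMap_mem' c v hv := by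
    have : Matrix.toLin' (algebraMap ℂ (Matrix (Fin (total m)) (Fin (total m)) ℂ[T;T⁻¹]) c) v =
        c • v := by
      simp [Algebra.algebraMap_eq_smul_one, Matrix.smul_mulVec]
    rw [this]
    exact Submodule.smul_of_tower_mem _ c hv

/-- The action on `𝕍` of the matrices that preserve `I_Q`. -/
def stabEnd : stab m Q →ₐ[ℂ] Module.End ℂ (VV m Q) where
  toFun A := ((IQ m Q).mapQ (IQ m Q) (Matrix.toLin' A.1) A.2).restrictScalars ℂ
  map_one' := by
    refine LinearMap.ext fun v => ?_
    obtain ⟨v, rfl⟩ := Submodule.Quotient.mk_surjective _ v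
    exact congrArg (Submodule.Quotient.mk (p := IQ m Q)) (by simp)
  map_mul' A B := by
    refine LinearMap.ext fun v => ?_
    obtain ⟨v, rfl⟩ := Submodule.Quotient.mk_surjective _ v
    exact congrArg (Submodule.Quotient.mk (p := IQ m Q)) (by simp)
  map_zero' := by
    refine LinearMap.ext fun v => ?_
    obtain ⟨v, rfl⟩ := Submodule.Quotient.mk_surjective _ v
    exact congrArg (Submodule.Quotient.mk (p := IQ m Q)) (a₂ := 0) (by simp)
  map_add' A B := by
    refine LinearMap.ext fun v => ?_
    obtain ⟨v, rfl⟩ := Submodule.Quotient.mk_surjective _ v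
    exact congrArg (Submodule.Quotient.mk (p := IQ m Q))
      (a₂ := Matrix.toLin' A.1 v + Matrix.toLin' B.1 v) (by simp)
  commutes' c := by
    refine LinearMap.ext fun v => ?_
    obtain ⟨v, rfl⟩ := Submodule.Quotient.mk_surjective _ v
    exact congrArg (Submodule.Quotient.mk (p := IQ m Q)) (a₂ := c • v)
      (by simp [Algebra.algebraMap_eq_smul_one, Matrix.smul_mulVec])

theorem mem_stab {A : Matrix (Fin (total m)) (Fin (total m)) ℂ[T;T⁻¹]}
    (h : ∀ j, Matrix.toLin' A (Pi.single j (Polynomial.toLaurent (cycPoly Q (block m j)))) ∈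
      IQ m Q) : A ∈ stab m Q := by
  intro v hv
  have : IQ m Q ≤ (IQ m Q).comap (Matrix.toLin' A) := by
    conv_lhs => rw [IQ]
    rw [Submodule.span_le]
    rintro _ ⟨j, rfl⟩
    exact h j
  exact this hv

theorem single_mem_IQ (j : Fin (total m)) (f : ℂ[T;T⁻¹])
    (h : Polynomial.toLaurent (cycPoly Q (block m j)) ∣ f) :
    (Pi.single j f : VHat (total m)) ∈ IQ m Q := by
  obtain ⟨g, rfl⟩ := h
  have := (IQ m Q).smul_mem g (Submodule.subset_span ⟨j, rfl⟩)
  rw [← Pi.single_smul, smul_eq_mul, mul_comm] at this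
  exact this

theorem toLin_single_single (a b j : Fin (total m)) (x f : ℂ[T;T⁻¹]) :
    Matrix.toLin' (Matrix.single a b x) (Pi.single j f) =
      if b = j then Pi.single a (x * f) else 0 := by
  rw [Matrix.toLin'_apply, Matrix.single_mulVec]
  split_ifs with h
  · subst h; rw [Pi.single_eq_same]; rfl
  · rw [Pi.single_eq_of_ne h, mul_zero]
    exact Function.update_eq_self _ _

theorem cycPoly_dvd {k l : Fin r} (h : k ≤ l) : cycPoly Q k ∣ cycPoly Q l :=
  Finset.prod_dvd_prod_of_subset _ _ _ (Finset.Iic_subset_Iic.2 h)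

theorem cycPoly_succ {k l : Fin r} (h : (l : ℕ) = k + 1) :
    cycPoly Q l = (Polynomial.X - Polynomial.C (Q l : ℂ)) * cycPoly Q k := by
  have : Finset.Iic l = insert l (Finset.Iic k) := by
    ext x
    simp only [Finset.mem_Iic, Finset.mem_insert, Fin.le_def, Fin.ext_iff]
    omega
  rw [cycPoly, this, Finset.prod_insert (by simp [Fin.le_def, h]), cycPoly]

theorem block_lo_le_hi (i : Fin (total m - 1)) : block m (lo i) ≤ block m (hi i) := by
  by_cases h : IsBlockEnd m i
  · have := block_hi_of_end m h
    rw [Fin.le_def]; omega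
  · rw [block_hi_of_not_end m h]

theorem matE_mem_stab (i : Fin (total m - 1)) (t : ℤ) : matE i t ∈ stab m Q := by
  refine mem_stab m Q fun j => ?_
  rw [matE, toLin_single_single]
  split_ifs with h
  · subst h
    exact single_mem_IQ m Q _ _ (Dvd.dvd.mul_left
      (map_dvd Polynomial.toLaurent (cycPoly_dvd Q (block_lo_le_hi m i))) _)
  · exact zero_mem _

theorem single_diag_mem_stab (a : Fin (total m)) (x : ℂ[T;T⁻¹]) :
    Matrix.single a a x ∈ stab m Q := by
  refine mem_stab m Q fun j => ?_
  rw [toLin_single_single]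
  split_ifs with h
  · subst h
    exact single_mem_IQ m Q _ _ (Dvd.intro_left _ rfl)
  · exact zero_mem _

theorem matH_mem_stab (i : Fin (total m - 1)) (t : ℤ) : matH i t ∈ stab m Q :=
  sub_mem (single_diag_mem_stab m Q _ _) (single_diag_mem_stab m Q _ _)

theorem matF_mem_stab (i : Fin (total m - 1)) (t : ℤ) :
    matF i t + shiftCoeff (etaParam m Q) (bShift m) i • matF i (t + bShift m i) ∈ stab m Q := by
  refine mem_stab m Q fun j => ?_
  rw [matF, matF, Matrix.smul_single, ← Matrix.single_add, toLin_single_single]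
  split_ifs with hj
  · subst hj
    refine single_mem_IQ m Q _ _ ?_
    by_cases h : IsBlockEnd m i
    · have hb := block_hi_of_end m h
      have hr : (block m (lo i) : ℕ) + 1 < r := hb ▸ (block m (hi i)).2
      have hη : etaParam m Q i = Q (block m (hi i)) := by
        rw [etaParam, dif_pos ⟨h, hr⟩]
        congr 1
        exact Fin.ext hb.symm
      have hb1 : bShift m i = 1 := if_pos h
      rw [cycPoly_succ Q hb, map_mul]
      refine mul_dvd_mul ?_ dvd_rfl
      refine ⟨(-(Q (block m (hi i)) : ℂ)⁻¹) • T t, ?_⟩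
      rw [shiftCoeff, hη, hb1, if_pos one_pos, pow_one]
      simp only [map_sub, Polynomial.toLaurent_X, Polynomial.toLaurent_C, Nat.cast_one, T_add,
        LaurentPolynomial.smul_eq_C_mul]
      have hC : (C (Q (block m (hi i)) : ℂ) : ℂ[T;T⁻¹]) * C ((Q (block m (hi i)) : ℂ)⁻¹) = 1 := by
        rw [← map_mul, mul_inv_cancel₀ (Units.ne_zero _), map_one]
      rw [map_neg]
      linear_combination (-(T t : ℂ[T;T⁻¹])) * hC
    · rw [block_hi_of_not_end m h]
      exact Dvd.intro_left _ rfl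
  · exact zero_mem _

theorem rel_of_hom {M : ℕ} {η : Fin (M - 1) → ℂˣ} {b : Fin (M - 1) → ℕ} {L : Type} [LieRing L]
    [LieAlgebra ℂ L] (φ : ShiftedLoop η b →ₗ⁅ℂ⁆ L) {E F H : Fin (M - 1) → ℤ → L}
    (hE : ∀ i t, φ (ShiftedLoop.E η b i t) = E i t) (hF : ∀ i t, φ (ShiftedLoop.F η b i t) = F i t)
    (hH : ∀ i t, φ (ShiftedLoop.H η b i t) = H i t) {x y : L} (h : LoopRel η b E F H x y) :
    x = y := by
  have key : ∀ {x y : ShiftedLoop η b}, LoopRel η b (ShiftedLoop.E η b) (ShiftedLoop.F η b)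
      (ShiftedLoop.H η b) x y → φ x = φ y := fun h => congrArg φ (ShiftedLoop.rel_holds h)
  cases h with
  | hh i j t s => simpa [hE, hF, hH] using key (LoopRel.hh i j t s)
  | he i j t s => simpa [hE, hF, hH] using key (LoopRel.he i j t s)
  | hf i j t s => simpa [hE, hF, hH] using key (LoopRel.hf i j t s)
  | ef i j t s =>
    have := key (LoopRel.ef i j t s)
    rw [LieHom.map_lie, hE, hF] at this
    refine this.trans ?_
    split_ifs with hij <;> simp [hH]
  | ee i j t s ha => simpa [hE, hF, hH] using key (LoopRel.ee i j t s ha)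
  | ff i j t s ha => simpa [hE, hF, hH] using key (LoopRel.ff i j t s ha)
  | ee' i j t s ha => simpa [hE, hF, hH] using key (LoopRel.ee' i j t s ha)
  | ff' i j t s ha => simpa [hE, hF, hH] using key (LoopRel.ff' i j t s ha)
  | eee i j t s u ha => simpa [hE, hF, hH] using key (LoopRel.eee i j t s u ha)
  | fff i j t s u ha => simpa [hE, hF, hH] using key (LoopRel.fff i j t s u ha)

/-- The shifted loop Lie algebra with the shift `b_m` and the parameter `η`. -/
abbrev GLoop : Type := ShiftedLoop (etaParam m Q) (bShift m)

/-- The universal enveloping algebra `U_[b_m]`. -/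
abbrev UShift : Type := UniversalEnvelopingAlgebra ℂ (GLoop m Q)

/-- The universal enveloping algebra `U_[0] = U(L sl)`. -/
abbrev UZero : Type :=
  UniversalEnvelopingAlgebra ℂ (ShiftedLoop (etaParam m Q) (0 : Fin (total m - 1) → ℕ))

/-- The action of the shifted loop Lie algebra on `𝕍`: on `v_j ⊗ x ^ p` the generators `E_{i,t}`,
`F_{i,t}`, `H_{i,t}` act by the matrix units `matE`, `matF`, `matH`, the action of `F_{i,t}` being
multiplied by `1 - Q_k⁻¹ x` if `ξ⁻¹ i = (m_k, k)`. -/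
def vvLie : GLoop m Q →ₗ⁅ℂ⁆ Module.End ℂ (VV m Q) :=
  (stabEnd m Q).toLieHom.comp (ShiftedLoop.lift
    (fun i t => (⟨matE i t, matE_mem_stab m Q i t⟩ : stab m Q))
    (fun i t => ⟨matF i t + shiftCoeff (etaParam m Q) (bShift m) i • matF i (t + bShift m i),
      matF_mem_stab m Q i t⟩)
    (fun i t => ⟨matH i t, matH_mem_stab m Q i t⟩)
    (fun x y h => Subtype.ext (rel_of_hom
      ((loopMat (etaParam m Q)).comp (shiftHom (etaParam m Q) (bShift m)))
      (by intro i t; simp [shiftHom, loopMat, ShiftedLoop.lift_E])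
      (by intro i t; simp [shiftHom, loopMat, ShiftedLoop.lift_F])
      (by intro i t; simp [shiftHom, loopMat, ShiftedLoop.lift_H])
      (h.map (stab m Q).val.toLieHom))))

/-- The representation `ρ_{n,r}` of `U_[b_m]` on `𝕍 ^ ⊗ n` through the coproduct. -/
def rho (n : ℕ) : UShift m Q →ₐ[ℂ] Module.End ℂ (TPow n (VV m Q)) :=
  UniversalEnvelopingAlgebra.lift ℂ (tensorLie.comp (vvLie m Q))

end TruncatedSpace

section Hecke

open MulOpposite

/-- The defining relations of the Ariki-Koike algebra at `q = 1` in the generators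
`T_0, …, T_{n-1}`. -/
inductive AKRel (n : ℕ) {r : ℕ} (Q : Fin r → ℂˣ) :
    FreeAlgebra ℂ (Fin n) → FreeAlgebra ℂ (Fin n) → Prop
  | cyc (h : 0 < n) : AKRel n Q (Polynomial.aeval (FreeAlgebra.ι ℂ (⟨0, h⟩ : Fin n))
      (∏ k : Fin r, (Polynomial.X - Polynomial.C (Q k : ℂ)))) 0
  | quad (i : Fin n) (h : 1 ≤ (i : ℕ)) :
      AKRel n Q ((FreeAlgebra.ι ℂ i - 1) * (FreeAlgebra.ι ℂ i + 1)) 0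
  | braid0 (i j : Fin n) (hi : (i : ℕ) = 0) (hj : (j : ℕ) = 1) :
      AKRel n Q
        (FreeAlgebra.ι ℂ i * FreeAlgebra.ι ℂ j * FreeAlgebra.ι ℂ i * FreeAlgebra.ι ℂ j)
        (FreeAlgebra.ι ℂ j * FreeAlgebra.ι ℂ i * FreeAlgebra.ι ℂ j * FreeAlgebra.ι ℂ i)
  | braid (i j : Fin n) (hi : 1 ≤ (i : ℕ)) (hj : (j : ℕ) = i + 1) :
      AKRel n Q (FreeAlgebra.ι ℂ i * FreeAlgebra.ι ℂ j * FreeAlgebra.ι ℂ i)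
        (FreeAlgebra.ι ℂ j * FreeAlgebra.ι ℂ i * FreeAlgebra.ι ℂ j)
  | comm (i j : Fin n) (h : (i : ℕ) + 1 < j) :
      AKRel n Q (FreeAlgebra.ι ℂ i * FreeAlgebra.ι ℂ j) (FreeAlgebra.ι ℂ j * FreeAlgebra.ι ℂ i)

/-- The Ariki-Koike algebra `H_{n,r}` over `ℂ` at `q = 1` with parameters `Q_0, …, Q_{r-1}`. -/
def ArikiKoike (n : ℕ) {r : ℕ} (Q : Fin r → ℂˣ) : Type := RingQuot (AKRel n Q)

variable {n r : ℕ} (Q : Fin r → ℂˣ)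

instance : Ring (ArikiKoike n Q) := inferInstanceAs (Ring (RingQuot (AKRel n Q)))

instance : Algebra ℂ (ArikiKoike n Q) := inferInstanceAs (Algebra ℂ (RingQuot (AKRel n Q)))

namespace ArikiKoike

/-- The quotient map from the free algebra. -/
def mk : FreeAlgebra ℂ (Fin n) →ₐ[ℂ] ArikiKoike n Q := RingQuot.mkAlgHom ℂ (AKRel n Q)

/-- The generator `T_i`, `0 ≤ i ≤ n - 1`. -/
def T (i : Fin n) : ArikiKoike n Q := mk Q (FreeAlgebra.ι ℂ i)

variable {Q} in
theorem mk_rel {x y : FreeAlgebra ℂ (Fin n)} (h : AKRel n Q x y) : mk Q x = mk Q y :=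
  RingQuot.mkAlgHom_rel ℂ h

theorem T_cyc (h : 0 < n) : Polynomial.aeval (T Q (⟨0, h⟩ : Fin n))
    (∏ k : Fin r, (Polynomial.X - Polynomial.C (Q k : ℂ))) = 0 := by
  have := mk_rel (AKRel.cyc (Q := Q) h)
  rwa [map_zero, ← Polynomial.aeval_algHom_apply] at this

theorem T_sq {i : Fin n} (h : 1 ≤ (i : ℕ)) : T Q i * T Q i = 1 := by
  have := mk_rel (AKRel.quad (Q := Q) i h)
  simp only [map_mul, map_sub, map_add, map_one, map_zero] at this
  change (T Q i - 1) * (T Q i + 1) = 0 at this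
  have h2 : (T Q i - 1) * (T Q i + 1) = T Q i * T Q i - 1 := by noncomm_ring
  rw [h2] at this
  exact sub_eq_zero.1 this

theorem T_braid0 {i j : Fin n} (hi : (i : ℕ) = 0) (hj : (j : ℕ) = 1) :
    T Q i * T Q j * T Q i * T Q j = T Q j * T Q i * T Q j * T Q i := by
  simpa only [map_mul, T] using mk_rel (AKRel.braid0 (Q := Q) i j hi hj)

theorem T_braid {i j : Fin n} (hi : 1 ≤ (i : ℕ)) (hj : (j : ℕ) = i + 1) :
    T Q i * T Q j * T Q i = T Q j * T Q i * T Q j := by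
  simpa only [map_mul, T] using mk_rel (AKRel.braid (Q := Q) i j hi hj)

theorem T_comm {i j : Fin n} (h : (i : ℕ) + 1 < j) : Commute (T Q i) (T Q j) := by
  have := mk_rel (AKRel.comm (Q := Q) i j h)
  rwa [map_mul, map_mul] at this

variable {Q} in
/-- A homomorphism out of the Ariki-Koike algebra. -/
def lift {A : Type} [Ring A] [Algebra ℂ A] (f : Fin n → A)
    (h : ∀ x y, AKRel n Q x y → FreeAlgebra.lift ℂ f x = FreeAlgebra.lift ℂ f y) :
    ArikiKoike n Q →ₐ[ℂ] A :=
  RingQuot.liftAlgHom ℂ ⟨FreeAlgebra.lift ℂ f, fun {x y} hxy => h x y hxy⟩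

/-- `L_{j+1} = T_j … T_1 T_0 T_1 … T_j` for `j < n` (irrelevant value for `j ≥ n`). -/
def Lnat : ℕ → ArikiKoike n Q
  | 0 => if h : 0 < n then T Q ⟨0, h⟩ else 1
  | j + 1 => if h : j + 1 < n then T Q ⟨j + 1, h⟩ * Lnat j * T Q ⟨j + 1, h⟩ else 1

/-- The Jucys-Murphy elements `L_1, …, L_n`, indexed by `0, …, n - 1`. -/
def L (j : Fin n) : ArikiKoike n Q := Lnat Q j

theorem L_hi (i : Fin (n - 1)) : L Q (hi i) = T Q (hi i) * L Q (lo i) * T Q (hi i) := by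
  have h : (i : ℕ) + 1 < n := by omega
  change Lnat Q (i + 1) = _
  rw [Lnat, dif_pos h]
  rfl

theorem comm_Lnat_of_lt (i : Fin n) : ∀ j : ℕ, j + 1 < i → Commute (T Q i) (Lnat Q j)
  | 0, h => by
    rw [Lnat, dif_pos (by omega)]
    exact (T_comm Q (by simpa using h)).symm
  | j + 1, h => by
    rw [Lnat, dif_pos (by omega)]
    have h1 : Commute (T Q i) (T Q ⟨j + 1, by omega⟩) := (T_comm Q (by simpa using h)).symm
    exact (h1.mul_right (comm_Lnat_of_lt i j (by omega))).mul_right h1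

theorem comm_Lnat_of_gt (i : Fin n) (hi : 1 ≤ (i : ℕ)) :
    ∀ j : ℕ, (i : ℕ) < j → j < n → Commute (T Q i) (Lnat Q j)
  | 0, h, _ => by omega
  | j + 1, h, hn => by
    rw [Lnat, dif_pos hn]
    rcases Nat.lt_or_ge (i : ℕ) j with hij | hij
    · have h1 : Commute (T Q i) (T Q ⟨j + 1, hn⟩) := T_comm Q (by simpa using hij)
      exact (h1.mul_right (comm_Lnat_of_gt i hi j hij (by omega))).mul_right h1
    · obtain rfl : j = (i : ℕ) := by omega
      obtain ⟨k, hk⟩ : ∃ k, (i : ℕ) = k + 1 := ⟨i - 1, by omega⟩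
      have hL : Lnat Q (i : ℕ) = T Q i * Lnat Q k * T Q i := by
        obtain ⟨i, hi'⟩ := i
        simp only at hk
        subst hk
        rw [Lnat, dif_pos hi']
      have hb := T_braid Q (i := i) (j := ⟨i + 1, hn⟩) hi rfl
      have hc : Commute (T Q ⟨i + 1, hn⟩) (Lnat Q k) :=
        comm_Lnat_of_lt Q ⟨i + 1, hn⟩ k (by simp only; omega)
      rw [hL]
      set a := T Q i
      set b := T Q (⟨i + 1, hn⟩ : Fin n)
      set l := Lnat (n := n) Q k
      change a * (b * (a * l * a) * b) = b * (a * l * a) * b * a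
      calc a * (b * (a * l * a) * b) = (a * b * a) * l * (a * b) := by noncomm_ring
        _ = (b * a * b) * l * (a * b) := by rw [hb]
        _ = b * a * (b * l) * (a * b) := by noncomm_ring
        _ = b * a * (l * b) * (a * b) := by rw [hc.eq]
        _ = b * a * l * (b * a * b) := by noncomm_ring
        _ = b * a * l * (a * b * a) := by rw [hb]
        _ = b * (a * l * a) * b * a := by noncomm_ring

theorem comm_Lnat_zero : ∀ j : ℕ, j < n → Commute (Lnat Q 0 : ArikiKoike n Q) (Lnat Q j)
  | 0, _ => Commute.refl _
  | 1, h => by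
    have h0 : 0 < n := by omega
    have := T_braid0 Q (i := (⟨0, h0⟩ : Fin n)) (j := ⟨1, h⟩) rfl rfl
    simp only [Lnat, dif_pos h0, dif_pos h, zero_add]
    change _ * _ = _ * _
    simpa only [mul_assoc] using this
  | j + 2, h => by
    have h1 : Commute (Lnat Q 0 : ArikiKoike n Q) (T Q ⟨j + 2, h⟩) :=
      (comm_Lnat_of_lt Q ⟨j + 2, h⟩ 0 (by simp)).symm
    rw [show (Lnat Q (j + 2) : ArikiKoike n Q) = T Q ⟨j + 2, h⟩ * Lnat Q (j + 1) * T Q ⟨j + 2, h⟩ by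
      rw [Lnat, dif_pos h]]
    exact (h1.mul_right (comm_Lnat_zero (j + 1) (by omega))).mul_right h1

theorem comm_Lnat_lt : ∀ i j : ℕ, i < j → j < n → Commute (Lnat Q i : ArikiKoike n Q) (Lnat Q j)
  | 0, j, _, h => comm_Lnat_zero Q j h
  | i + 1, j, hij, h => by
    rw [show (Lnat Q (i + 1) : ArikiKoike n Q) =
      T Q ⟨i + 1, by omega⟩ * Lnat Q i * T Q ⟨i + 1, by omega⟩ by
        rw [Lnat, dif_pos (by omega)]]
    have h1 : Commute (T Q ⟨i + 1, by omega⟩) (Lnat Q j : ArikiKoike n Q) :=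
      comm_Lnat_of_gt Q _ (by simp) j hij h
    exact (h1.mul_left (comm_Lnat_lt i j (by omega) h)).mul_left h1

theorem L_comm (i j : Fin n) : Commute (L Q i) (L Q j) := by
  rcases lt_trichotomy (i : ℕ) j with h | h | h
  · exact comm_Lnat_lt Q _ _ h j.2
  · rw [Fin.ext h]
  · exact (comm_Lnat_lt Q _ _ h i.2).symm

theorem T_comm_L (i : Fin (n - 1)) (j : Fin n) (h1 : j ≠ lo i) (h2 : j ≠ hi i) :
    Commute (T Q (hi i)) (L Q j) := by
  simp only [lo, hi, Ne, Fin.ext_iff] at h1 h2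
  rcases Nat.lt_or_ge (j : ℕ) i with h | h
  · exact comm_Lnat_of_lt Q _ _ (by simpa [hi] using h)
  · exact comm_Lnat_of_gt Q _ (by simp [hi]) _ (by simp [hi]; omega) j.2

theorem isUnit_T_zero (h : 0 < n) : IsUnit (T Q (⟨0, h⟩ : Fin n)) := by
  have hcyc := T_cyc Q h
  set f : Polynomial ℂ := ∏ k : Fin r, (Polynomial.X - Polynomial.C (Q k : ℂ)) with hf
  have h0 : f.coeff 0 ≠ 0 := by
    rw [Polynomial.coeff_zero_eq_eval_zero, hf, Polynomial.eval_prod, Finset.prod_ne_zero_iff]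
    intro k _
    simp
  set t := T Q (⟨0, h⟩ : Fin n)
  have hx : Polynomial.aeval t f.divX * t + algebraMap ℂ _ (f.coeff 0) = 0 := by
    rw [← hcyc]
    conv_rhs => rw [← Polynomial.divX_mul_X_add f]
    simp
  have hcomm : Commute (Polynomial.aeval t f.divX) t := by
    have := Polynomial.X_mul (p := f.divX)
    have := congrArg (Polynomial.aeval t) this
    simp only [map_mul, Polynomial.aeval_X] at this
    exact this.symm
  have hx' : t * ((-(f.coeff 0)⁻¹) • Polynomial.aeval t f.divX) = 1 := by
    rw [mul_smul_comm, ← hcomm.eq, eq_neg_of_add_eq_zero_left hx, Algebra.algebraMap_eq_smul_one,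
      smul_neg, neg_smul, neg_neg, smul_smul, inv_mul_cancel₀ h0, one_smul]
  refine ⟨⟨t, (-(f.coeff 0)⁻¹) • Polynomial.aeval t f.divX, hx', ?_⟩, rfl⟩
  rw [smul_mul_assoc, hcomm.eq, ← mul_smul_comm, hx']

theorem isUnit_Lnat : ∀ j : ℕ, IsUnit (Lnat Q j : ArikiKoike n Q)
  | 0 => by
    rw [Lnat]
    split_ifs with h
    · exact isUnit_T_zero Q h
    · exact isUnit_one
  | j + 1 => by
    rw [Lnat]
    split_ifs with h
    · have hT : IsUnit (T Q (⟨j + 1, h⟩ : Fin n)) :=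
        ⟨⟨_, _, T_sq Q (by simp), T_sq Q (by simp)⟩, rfl⟩
      exact (hT.mul (isUnit_Lnat j)).mul hT
    · exact isUnit_one

theorem isUnit_L (j : Fin n) : IsUnit (L Q j) := isUnit_Lnat Q j

end ArikiKoike

end Hecke

section AffineHecke

open MulOpposite

/-- Generators `T_i` (`1 ≤ i ≤ n - 1`), `X_j` and `X_j⁻¹` (`1 ≤ j ≤ n`), zero-based: `T i` belongs
to the adjacent transposition of `lo i` and `hi i`. -/
inductive AffGen (n : ℕ) : Type
  | T (i : Fin (n - 1)) : AffGen n
  | X (j : Fin n) : AffGen n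
  | Xinv (j : Fin n) : AffGen n

/-- The defining relations of the affine Hecke algebra of type `GL_n` at `q = 1`, for elements
`T i`, `X j`, `Y j = X j⁻¹` of a ring. -/
inductive AffRel {n : ℕ} {A : Type} [Ring A] (T : Fin (n - 1) → A) (X Y : Fin n → A) :
    A → A → Prop
  | quad (i) : AffRel T X Y ((T i - 1) * (T i + 1)) 0
  | braid (i j : Fin (n - 1)) (h : (j : ℕ) = i + 1) : AffRel T X Y (T i * T j * T i) (T j * T i * T j)
  | comm (i j : Fin (n - 1)) (h : (i : ℕ) + 1 < j) : AffRel T X Y (T i * T j) (T j * T i)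
  | XY (j) : AffRel T X Y (X j * Y j) 1
  | YX (j) : AffRel T X Y (Y j * X j) 1
  | XX (i j) : AffRel T X Y (X i * X j) (X j * X i)
  | TXT (i) : AffRel T X Y (T i * X (lo i) * T i) (X (hi i))
  | TX (i j) (h₁ : j ≠ lo i) (h₂ : j ≠ hi i) : AffRel T X Y (T i * X j) (X j * T i)

theorem AffRel.map {n : ℕ} {A B : Type} [Ring A] [Ring B] [Algebra ℂ A] [Algebra ℂ B]
    {T : Fin (n - 1) → A} {X Y : Fin n → A} (φ : A →ₐ[ℂ] B) {x y : A} (h : AffRel T X Y x y) :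
    AffRel (fun i => φ (T i)) (fun j => φ (X j)) (fun j => φ (Y j)) (φ x) (φ y) := by
  cases h with
  | quad i => simpa using AffRel.quad i
  | braid i j h => simpa using AffRel.braid i j h
  | comm i j h => simpa using AffRel.comm i j h
  | XY j => simpa using AffRel.XY j
  | YX j => simpa using AffRel.YX j
  | XX i j => simpa using AffRel.XX i j
  | TXT i => simpa using AffRel.TXT i
  | TX i j h₁ h₂ => simpa using AffRel.TX i j h₁ h₂

/-- The affine Hecke algebra of type `GL_n` over `ℂ` at `q = 1`. -/
def AffineHecke (n : ℕ) : Type :=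
  RingQuot (AffRel (n := n) (fun i => FreeAlgebra.ι ℂ (AffGen.T i))
    (fun j => FreeAlgebra.ι ℂ (AffGen.X j)) (fun j => FreeAlgebra.ι ℂ (AffGen.Xinv j)))

variable {n : ℕ}

instance : Ring (AffineHecke n) := inferInstanceAs (Ring (RingQuot _))

instance : Algebra ℂ (AffineHecke n) := inferInstanceAs (Algebra ℂ (RingQuot _))

namespace AffineHecke

/-- The quotient map from the free algebra. -/
def mk : FreeAlgebra ℂ (AffGen n) →ₐ[ℂ] AffineHecke n := RingQuot.mkAlgHom ℂ _

theorem mk_surjective : Function.Surjective (mk (n := n)) := RingQuot.mkAlgHom_surjective ℂ _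

/-- A homomorphism out of the affine Hecke algebra. -/
def lift {A : Type} [Ring A] [Algebra ℂ A] (T : Fin (n - 1) → A) (X Y : Fin n → A)
    (h : ∀ x y, AffRel T X Y x y → x = y) : AffineHecke n →ₐ[ℂ] A :=
  RingQuot.liftAlgHom ℂ ⟨FreeAlgebra.lift ℂ fun g =>
    match g with
    | .T i => T i
    | .X j => X j
    | .Xinv j => Y j, fun {x y} hxy => h _ _ (by
      have := hxy.map (FreeAlgebra.lift ℂ fun g : AffGen n =>
        match g with
        | .T i => T i
        | .X j => X j
        | .Xinv j => Y j)
      simpa only [FreeAlgebra.lift_ι_apply] using this)⟩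

theorem lift_mk {A : Type} [Ring A] [Algebra ℂ A] (T : Fin (n - 1) → A) (X Y : Fin n → A)
    (h : ∀ x y, AffRel T X Y x y → x = y) (a : FreeAlgebra ℂ (AffGen n)) :
    lift T X Y h (mk a) = FreeAlgebra.lift ℂ (fun g : AffGen n =>
      match g with
      | .T i => T i
      | .X j => X j
      | .Xinv j => Y j) a :=
  RingQuot.liftAlgHom_mkAlgHom_apply ..

/-- The surjection of the affine Hecke algebra onto the Ariki-Koike algebra:
`T_i ↦ T_i`, `X_j ↦ L_j`, `X_j⁻¹ ↦ L_j⁻¹`. -/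
def toAK {r : ℕ} (Q : Fin r → ℂˣ) : AffineHecke n →ₐ[ℂ] ArikiKoike n Q :=
  lift (fun i => ArikiKoike.T Q (hi i)) (ArikiKoike.L Q) (fun j => Ring.inverse (ArikiKoike.L Q j))
    (by
      have hs : ∀ i : Fin (n - 1), ArikiKoike.T Q (hi i) * ArikiKoike.T Q (hi i) = 1 :=
        fun i => ArikiKoike.T_sq Q (by simp [hi])
      intro x y h
      cases h with
      | quad i =>
        have : (ArikiKoike.T Q (hi i) - 1) * (ArikiKoike.T Q (hi i) + 1) =
          ArikiKoike.T Q (hi i) * ArikiKoike.T Q (hi i) - 1 := by noncomm_ring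
        rw [this, hs, sub_self]
      | braid i j h => exact ArikiKoike.T_braid Q (by simp [hi]) (by simp [hi, h])
      | comm i j h => exact ArikiKoike.T_comm Q (by simpa [hi] using h)
      | XY j => exact Ring.mul_inverse_cancel _ (ArikiKoike.isUnit_L Q j)
      | YX j => exact Ring.inverse_mul_cancel _ (ArikiKoike.isUnit_L Q j)
      | XX i j => exact ArikiKoike.L_comm Q i j
      | TXT i => exact (ArikiKoike.L_hi Q i).symm
      | TX i j h₁ h₂ => exact ArikiKoike.T_comm_L Q i j h₁ h₂)

end AffineHecke

/-- The adjacent transposition of `lo i` and `hi i`. -/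
def adjSwap {n : ℕ} (i : Fin (n - 1)) : Equiv.Perm (Fin n) := Equiv.swap (lo i) (hi i)

theorem adjSwap_sq (i : Fin (n - 1)) : adjSwap i * adjSwap i = 1 := Equiv.swap_mul_self _ _

theorem adjSwap_braid {i j : Fin (n - 1)} (h : (j : ℕ) = i + 1) :
    adjSwap i * adjSwap j * adjSwap i = adjSwap j * adjSwap i * adjSwap j := by
  have h1 : lo j = hi i := by simp [lo, hi, h]
  have h2 : lo i ≠ hi j := by simp only [lo, hi, Ne, Fin.ext_iff]; omega
  have h3 := lo_ne_hi i
  have h4 : hi i ≠ hi j := by simp only [hi, Ne, Fin.ext_iff]; omega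
  rw [adjSwap, adjSwap, h1]
  have e1 : Equiv.swap (lo i) (hi i) * Equiv.swap (hi i) (hi j) * Equiv.swap (lo i) (hi i) =
      Equiv.swap (lo i) (hi j) := by
    rw [Equiv.swap_comm (lo i) (hi i), Equiv.swap_comm (hi i) (hi j)]
    exact Equiv.swap_mul_swap_mul_swap h4.symm h2.symm
  have e2 : Equiv.swap (hi i) (hi j) * Equiv.swap (lo i) (hi i) * Equiv.swap (hi i) (hi j) =
      Equiv.swap (hi j) (lo i) := Equiv.swap_mul_swap_mul_swap h3 h2
  rw [e1, e2, Equiv.swap_comm]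

theorem adjSwap_comm {i j : Fin (n - 1)} (h : (i : ℕ) + 1 < j) :
    adjSwap i * adjSwap j = adjSwap j * adjSwap i := by
  refine (Equiv.Perm.Disjoint.commute (Equiv.Perm.disjoint_swap_swap ?_)).eq
  simp only [lo, hi, List.nodup_cons, List.mem_cons, List.not_mem_nil, Fin.ext_iff, or_false,
    List.nodup_nil, not_false_eq_true, and_true]
  omega

section Actions

variable {W : Type} [AddCommGroup W] [Module ℂ W]

/-- The right action of the affine Hecke algebra on `W ^ ⊗ n` for a space `W` with an invertible
endomorphism `x` (inverse `y`): `T_i` exchanges the neighbouring tensor factors and `X_j` acts by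
`x` on the factor `j`. -/
def affAct (n : ℕ) (x y : Module.End ℂ W) (hxy : x * y = 1) (hyx : y * x = 1) :
    (AffineHecke n)ᵐᵒᵖ →ₐ[ℂ] Module.End ℂ (TPow n W) :=
  AlgHom.opComm (AffineHecke.lift (fun i => op (permEnd (adjSwap i))) (fun j => op (place j x))
    (fun j => op (place j y)) (by
      intro a b h
      apply unop_injective
      cases h with
      | quad i =>
        have : ∀ z : Module.End ℂ (TPow n W), z * z = 1 → (z + 1) * (z - 1) = 0 := by
          intro z hz
          have : (z + 1) * (z - 1) = z * z - 1 := by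
            rw [mul_sub, add_mul, mul_one, one_mul]; abel
          rw [this, hz, sub_self]
        simpa using this _ (by rw [← permEnd_mul, adjSwap_sq, permEnd_one])
      | braid i j h =>
        simp only [unop_mul, unop_op, ← permEnd_mul, ← mul_assoc, adjSwap_braid h]
      | comm i j h =>
        simp only [unop_mul, unop_op, ← permEnd_mul, adjSwap_comm h]
      | XY j => simp only [unop_mul, unop_op, ← map_mul, hyx, map_one, unop_one]
      | YX j => simp only [unop_mul, unop_op, ← map_mul, hxy, map_one, unop_one]
      | XX i j =>
        simp only [unop_mul, unop_op]
        by_cases hij : i = j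
        · rw [hij]
        · exact place_comm (Ne.symm hij) x x
      | TXT i =>
        simp only [unop_mul, unop_op]
        rw [← mul_assoc, permEnd_place, mul_assoc, ← permEnd_mul, adjSwap_sq, permEnd_one, mul_one]
        simp [adjSwap]
      | TX i j h₁ h₂ =>
        simp only [unop_mul, unop_op]
        rw [permEnd_place, adjSwap, Equiv.swap_apply_of_ne_of_ne h₁ h₂]))

/-- An endomorphism that commutes with the place permutations and with `x` in every factor commutes
with the affine Hecke algebra. -/
theorem affAct_commute (x y : Module.End ℂ W) (hxy : x * y = 1) (hyx : y * x = 1)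
    (f : Module.End ℂ (TPow n W))
    (h1 : ∀ w : Equiv.Perm (Fin n), permEnd w * f = f * permEnd w)
    (h2 : ∀ j, place j x * f = f * place j x) (h3 : ∀ j, place j y * f = f * place j y)
    (a : (AffineHecke n)ᵐᵒᵖ) :
    affAct n x y hxy hyx a * f = f * affAct n x y hxy hyx a := by
  obtain ⟨a, rfl⟩ := op_surjective a
  obtain ⟨a, rfl⟩ := AffineHecke.mk_surjective a
  have key : ∀ a, affAct n x y hxy hyx (op (AffineHecke.mk a)) = unop (FreeAlgebra.lift ℂ
      (fun g : AffGen n =>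
      match g with
      | .T i => op (permEnd (adjSwap i))
      | .X j => op (place j x)
      | .Xinv j => op (place j y)) a) := fun a =>
    congrArg unop (AffineHecke.lift_mk _ _ _ _ a)
  rw [key]
  induction a using FreeAlgebra.induction with
  | grade0 c => simp [Algebra.algebraMap_eq_smul_one]
  | grade1 g =>
    rw [FreeAlgebra.lift_ι_apply]
    cases g with
    | T i => exact h1 _
    | X j => exact h2 j
    | Xinv j => exact h3 j
  | mul a b ha hb =>
    rw [map_mul, unop_mul, mul_assoc, ha, ← mul_assoc, hb, mul_assoc]
  | add a b ha hb => rw [map_add, unop_add, add_mul, mul_add, ha, hb]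

theorem unop_aeval_op {A : Type} [Ring A] [Algebra ℂ A] (z : A) (p : Polynomial ℂ) :
    unop (Polynomial.aeval (op z) p) = Polynomial.aeval z p := by
  induction p using Polynomial.induction_on' with
  | add p q hp hq => rw [map_add, map_add, unop_add, hp, hq]
  | monomial k c => simp [Polynomial.aeval_monomial, Algebra.algebraMap_eq_smul_one]

/-- The right action of the Ariki-Koike algebra at `q = 1` on `W ^ ⊗ n` for a space `W` with an
endomorphism `x` with `(x - Q_0) … (x - Q_{r-1}) = 0`: `T_0 = L_1` acts by `x` on the first factor
and `T_i`, `i ≥ 1`, exchanges the tensor factors `i` and `i + 1`. -/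
def akAct (n : ℕ) {r : ℕ} (Q : Fin r → ℂˣ) (x : Module.End ℂ W)
    (hx : Polynomial.aeval x (∏ k : Fin r, (Polynomial.X - Polynomial.C (Q k : ℂ))) = 0) :
    (ArikiKoike n Q)ᵐᵒᵖ →ₐ[ℂ] Module.End ℂ (TPow n W) :=
  AlgHom.opComm (ArikiKoike.lift
    (fun i => op (if h : (i : ℕ) = 0 then place i x
      else permEnd (adjSwap ⟨(i : ℕ) - 1, by omega⟩))) (by
      intro a b h
      apply unop_injective
      have hsq : ∀ i : Fin (n - 1), permEnd (W := W) (adjSwap i) * permEnd (adjSwap i) = 1 :=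
        fun i => by rw [← permEnd_mul, adjSwap_sq, permEnd_one]
      cases h with
      | cyc h =>
        rw [← Polynomial.aeval_algHom_apply, FreeAlgebra.lift_ι_apply, unop_aeval_op, dif_pos rfl,
          Polynomial.aeval_algHom_apply, hx, map_zero, map_zero, unop_zero]
      | quad i h =>
        have hi : ¬ (i : ℕ) = 0 := by omega
        simp only [map_mul, map_sub, map_add, map_one, map_zero, FreeAlgebra.lift_ι_apply, unop_mul,
          unop_sub, unop_add, unop_one, unop_zero, unop_op, dif_neg hi]
        rw [mul_sub, add_mul, hsq, mul_one, one_mul]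
        abel
      | braid0 i j hi0 hj =>
        have hj0 : ¬ (j : ℕ) = 0 := by omega
        simp only [map_mul, FreeAlgebra.lift_ι_apply, unop_mul, unop_op, dif_pos hi0, dif_neg hj0]
        set k : Fin (n - 1) := ⟨(j : ℕ) - 1, by omega⟩
        have hi' : i = lo k := Fin.ext (by simp [lo, k, hi0, hj])
        have hs : permEnd (W := W) (adjSwap k) * place i x =
            place (hi k) x * permEnd (adjSwap k) := by
          rw [permEnd_place, hi']; simp [adjSwap]
        have hne : hi k ≠ i := by rw [hi']; exact (lo_ne_hi k).symm
        have h1 : permEnd (adjSwap k) * place i x * permEnd (adjSwap k) = place (hi k) x := by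
          rw [hs, mul_assoc, hsq, mul_one]
        have h2 := place_comm hne x x
        rw [← h1] at h2
        simpa only [mul_assoc] using h2
      | braid i j hi hj =>
        have hi0 : ¬ (i : ℕ) = 0 := by omega
        have hj0 : ¬ (j : ℕ) = 0 := by omega
        simp only [map_mul, FreeAlgebra.lift_ι_apply, unop_mul, unop_op, dif_neg hi0, dif_neg hj0,
          ← permEnd_mul, ← mul_assoc]
        rw [adjSwap_braid (by simp only; omega)]
      | comm i j h =>
        have hj0 : ¬ (j : ℕ) = 0 := by omega
        simp only [map_mul, FreeAlgebra.lift_ι_apply, unop_mul, unop_op, dif_neg hj0]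
        by_cases hi0 : (i : ℕ) = 0
        · simp only [dif_pos hi0]
          rw [permEnd_place, adjSwap, Equiv.swap_apply_of_ne_of_ne]
          · simp only [lo, Ne, Fin.ext_iff]; omega
          · simp only [hi, Ne, Fin.ext_iff]; omega
        · simp only [dif_neg hi0, ← permEnd_mul]
          exact congrArg permEnd (adjSwap_comm (by simp only; omega)).symm))

end Actions

end AffineHecke

section Balanced

open MulOpposite TensorProduct

variable {A B M : Type} [Ring A] [Algebra ℂ A] [Ring B] [Algebra ℂ B] [AddCommGroup M] [Module ℂ M]
  (σ : Aᵐᵒᵖ →ₐ[ℂ] Module.End ℂ M) (φ : A →ₐ[ℂ] B)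

/-- The relations `m a ⊗ b = m ⊗ a b` that define `M ⊗_A B`. -/
def balRel : Submodule ℂ (M ⊗[ℂ] B) :=
  Submodule.span ℂ {z | ∃ (a : A) (v : M) (b : B), z = σ (op a) v ⊗ₜ[ℂ] b - v ⊗ₜ[ℂ] (φ a * b)}

/-- The tensor product `M ⊗_A B` of the right `A`-module `M` (with the action `σ`) and of `B`, as a
left `A`-module through `φ : A → B`. -/
def BalTensor : Type := (M ⊗[ℂ] B) ⧸ balRel σ φ

instance : AddCommGroup (BalTensor σ φ) := inferInstanceAs (AddCommGroup ((M ⊗[ℂ] B) ⧸ balRel σ φ))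

instance : Module ℂ (BalTensor σ φ) := inferInstanceAs (Module ℂ ((M ⊗[ℂ] B) ⧸ balRel σ φ))

namespace BalTensor

/-- The canonical map `M ⊗_ℂ B → M ⊗_A B`. -/
def mk : M ⊗[ℂ] B →ₗ[ℂ] BalTensor σ φ := (balRel σ φ).mkQ

/-- An endomorphism of `M ⊗_ℂ B` that preserves the relations, as an endomorphism of `M ⊗_A B`. -/
def descend (f : Module.End ℂ (M ⊗[ℂ] B)) (hf : balRel σ φ ≤ (balRel σ φ).comap f) :
    Module.End ℂ (BalTensor σ φ) := (balRel σ φ).mapQ (balRel σ φ) f hf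

theorem descend_mk (f : Module.End ℂ (M ⊗[ℂ] B)) (hf) (z : M ⊗[ℂ] B) :
    descend σ φ f hf (mk σ φ z) = mk σ φ (f z) := rfl

theorem hom_ext {f g : Module.End ℂ (BalTensor σ φ)}
    (h : ∀ z, f (mk σ φ z) = g (mk σ φ z)) : f = g :=
  LinearMap.ext fun z => by
    obtain ⟨z, rfl⟩ := Submodule.Quotient.mk_surjective _ z
    exact h z

theorem right_le (b : Bᵐᵒᵖ) : balRel σ φ ≤
    (balRel σ φ).comap (LinearMap.lTensor M (LinearMap.mulRight ℂ b.unop)) := by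
  conv_lhs => rw [balRel]
  rw [Submodule.span_le]
  rintro _ ⟨a, v, c, rfl⟩
  refine Submodule.subset_span ⟨a, v, c * b.unop, ?_⟩
  simp [mul_assoc]

/-- The right action of `B` on `M ⊗_A B`. -/
def right : Bᵐᵒᵖ →ₐ[ℂ] Module.End ℂ (BalTensor σ φ) where
  toFun b := descend σ φ _ (right_le σ φ b)
  map_one' := hom_ext σ φ fun z => by
    rw [descend_mk]
    exact congrArg (mk σ φ) (by simp)
  map_mul' b c := hom_ext σ φ fun z => by
    rw [Module.End.mul_apply, descend_mk, descend_mk, descend_mk]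
    refine congrArg (mk σ φ) ?_
    rw [unop_mul, LinearMap.mulRight_mul, LinearMap.lTensor_comp, LinearMap.comp_apply]
  map_zero' := hom_ext σ φ fun z => by
    rw [descend_mk, unop_zero]
    simp
  map_add' b c := hom_ext σ φ fun z => by
    rw [LinearMap.add_apply, descend_mk, descend_mk, descend_mk, ← map_add]
    refine congrArg (mk σ φ) ?_
    induction z with
    | zero => simp
    | tmul v d => simp [mul_add, TensorProduct.tmul_add]
    | add z w hz hw => rw [map_add, hz, hw, map_add, map_add]; abel
  commutes' c := hom_ext σ φ fun z => by
    rw [descend_mk, Module.algebraMap_end_apply, ← map_smul]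
    refine congrArg (mk σ φ) ?_
    induction z with
    | zero => simp
    | tmul v d => simp [Algebra.algebraMap_eq_smul_one]
    | add z w hz hw => rw [map_add, hz, hw, smul_add]

theorem left_le (f : Subalgebra.centralizer ℂ (Set.range σ)) : balRel σ φ ≤
    (balRel σ φ).comap (LinearMap.rTensor B f.1) := by
  conv_lhs => rw [balRel]
  rw [Submodule.span_le]
  rintro _ ⟨a, v, c, rfl⟩
  refine Submodule.subset_span ⟨a, f.1 v, c, ?_⟩
  have := (Subalgebra.mem_centralizer_iff ℂ).1 f.2 _ ⟨op a, rfl⟩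
  have := LinearMap.congr_fun this v
  simp only [Module.End.mul_apply] at this
  simp [this]

/-- The left action on `M ⊗_A B` of the endomorphisms of the right `A`-module `M`. -/
def left : Subalgebra.centralizer ℂ (Set.range σ) →ₐ[ℂ] Module.End ℂ (BalTensor σ φ) where
  toFun f := descend σ φ _ (left_le σ φ f)
  map_one' := hom_ext σ φ fun z => by
    rw [descend_mk]
    exact congrArg (mk σ φ) (LinearMap.congr_fun (LinearMap.rTensor_id B M) z)
  map_mul' f g := hom_ext σ φ fun z => by
    rw [Module.End.mul_apply, descend_mk, descend_mk, descend_mk]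
    exact congrArg (mk σ φ) (LinearMap.congr_fun (LinearMap.rTensor_comp B f.1 g.1) z)
  map_zero' := hom_ext σ φ fun z => by
    rw [descend_mk]
    simp
  map_add' f g := hom_ext σ φ fun z => by
    rw [LinearMap.add_apply, descend_mk, descend_mk, descend_mk, ← map_add]
    refine congrArg (mk σ φ) ?_
    simp
  commutes' c := hom_ext σ φ fun z => by
    rw [descend_mk, Module.algebraMap_end_apply, ← map_smul]
    refine congrArg (mk σ φ) ?_
    induction z with
    | zero => simp
    | tmul v d => simp [Algebra.algebraMap_eq_smul_one, TensorProduct.smul_tmul']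
    | add z w hz hw => rw [map_add, hz, hw, smul_add]

end BalTensor

end Balanced

section Bimodules

open MulOpposite TensorProduct LaurentPolynomial

theorem uea_lift_mem {g A : Type} [LieRing g] [LieAlgebra ℂ g] [Ring A] [Algebra ℂ A]
    (S : Subalgebra ℂ A) (f : g →ₗ⁅ℂ⁆ A) (hf : ∀ x, f x ∈ S)
    (u : UniversalEnvelopingAlgebra ℂ g) : UniversalEnvelopingAlgebra.lift ℂ f u ∈ S := by
  let f' : g →ₗ⁅ℂ⁆ S :=
    { toFun := fun x => ⟨f x, hf x⟩
      map_add' := fun x y => Subtype.ext (map_add f x y)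
      map_smul' := fun c x => Subtype.ext (map_smul f c x)
      map_lie' := fun {x y} => Subtype.ext (LieHom.map_lie f x y) }
  have : UniversalEnvelopingAlgebra.lift ℂ f =
      S.val.comp (UniversalEnvelopingAlgebra.lift ℂ f') := by
    apply UniversalEnvelopingAlgebra.hom_ext
    ext x
    simp [f']
  rw [this]
  exact (UniversalEnvelopingAlgebra.lift ℂ f' u).2

variable {r : ℕ} (n : ℕ) (m : Fin r → ℕ+) (Q : Fin r → ℂˣ)

/-- Multiplication by an element of `ℂ[x, x⁻¹]` on `VHat M`. -/
abbrev mulHat (M : ℕ) : ℂ[T;T⁻¹] →ₐ[ℂ] Module.End ℂ (VHat M) := Algebra.lsmul ℂ ℂ (VHat M)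

/-- The right action of the affine Hecke algebra on `VHat M ^ ⊗ n`. -/
def affVHat (M : ℕ) : (AffineHecke n)ᵐᵒᵖ →ₐ[ℂ] Module.End ℂ (TPow n (VHat M)) :=
  affAct n (mulHat M (LaurentPolynomial.T 1)) (mulHat M (LaurentPolynomial.T (-1)))
    (by rw [← map_mul, ← LaurentPolynomial.T_add, add_neg_cancel, LaurentPolynomial.T_zero, map_one])
    (by rw [← map_mul, ← LaurentPolynomial.T_add, neg_add_cancel, LaurentPolynomial.T_zero, map_one])

theorem loopTensorRep_mem {M : ℕ} (η : Fin (M - 1) → ℂˣ)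
    (u : UniversalEnvelopingAlgebra ℂ (ShiftedLoop η (0 : Fin (M - 1) → ℕ))) :
    loopTensorRep n η u ∈ Subalgebra.centralizer ℂ (Set.range (affVHat n M)) := by
  refine uea_lift_mem (Subalgebra.centralizer ℂ (Set.range (affVHat n M)))
    (tensorLie.comp (matEnd.toLieHom.comp (loopMat η))) (fun x => ?_) u
  rw [Subalgebra.mem_centralizer_iff]
  rintro _ ⟨a, rfl⟩
  have hx : ∀ f : ℂ[T;T⁻¹], mulHat M f * matEnd (loopMat η x) = matEnd (loopMat η x) * mulHat M f :=
    fun f => LinearMap.ext fun v => ((Matrix.toLin' (loopMat η x)).map_smul f v).symm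
  exact affAct_commute _ _ _ _ _ (fun w => permEnd_tensorLie w _)
    (fun j => place_tensorLie j (hx _)) (fun j => place_tensorLie j (hx _)) a

/-- The space `VHat ^ ⊗ n ⊗_{affine Hecke} H_{n,r}`. -/
abbrev VTilde : Type := BalTensor (affVHat n (total m)) (AffineHecke.toAK (n := n) Q)

/-- The representation of `U_[0]` on `VHat ^ ⊗ n ⊗_{affine Hecke} H_{n,r}`. -/
def rhoTilde : UZero m Q →ₐ[ℂ] Module.End ℂ (VTilde n m Q) :=
  (BalTensor.left _ _).comp
    ((loopTensorRep n (etaParam m Q)).codRestrict _ (loopTensorRep_mem n (etaParam m Q)))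

/-- The homomorphism `Δ_{b_m}♯ : U_[b_m] → U_[b_m] ⊗ U_[0]`, `x ↦ x ⊗ 1 + 1 ⊗ ι_[b_m]♯ x` for `x` in
the Lie algebra. -/
def deltaSharp : UShift m Q →ₐ[ℂ] UShift m Q ⊗[ℂ] UZero m Q :=
  UniversalEnvelopingAlgebra.lift ℂ
    { toFun := fun x => UniversalEnvelopingAlgebra.ι ℂ x ⊗ₜ[ℂ] 1 +
        1 ⊗ₜ[ℂ] UniversalEnvelopingAlgebra.ι ℂ (shiftHom (etaParam m Q) (bShift m) x)
      map_add' := fun x y => by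
        simp only [map_add, TensorProduct.add_tmul, TensorProduct.tmul_add]; abel
      map_smul' := fun c x => by
        simp only [map_smul, TensorProduct.smul_tmul', TensorProduct.tmul_smul, smul_add,
          RingHom.id_apply]
      map_lie' := fun {x y} => by
        simp only [LieHom.map_lie, Ring.lie_def, mul_add, add_mul,
          Algebra.TensorProduct.tmul_mul_tmul, one_mul, mul_one, TensorProduct.sub_tmul,
          TensorProduct.tmul_sub]
        abel }

/-- The one-dimensional module `L = ℂ w` on which all generators act by zero. -/
def rhoTriv : UShift m Q →ₐ[ℂ] Module.End ℂ ℂ := UniversalEnvelopingAlgebra.lift ℂ 0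

/-- The space `V_{n,r} = L ⊗ (VHat ^ ⊗ n ⊗_{affine Hecke} H_{n,r})`. -/
abbrev Vnr : Type := ℂ ⊗[ℂ] VTilde n m Q

/-- The representation of `U_[b_m]` on `V_{n,r}` through `Δ_{b_m}♯`. -/
def rhoV : UShift m Q →ₐ[ℂ] Module.End ℂ (Vnr n m Q) :=
  (Module.endTensorEndAlgHom (R := ℂ) (S := ℂ) (A := ℂ) (M := ℂ) (N := VTilde n m Q)).comp
    ((Algebra.TensorProduct.map (rhoTriv m Q) (rhoTilde n m Q)).comp (deltaSharp m Q))

/-- The right action of `H_{n,r}` on `V_{n,r}`. -/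
def sigmaV : (ArikiKoike n Q)ᵐᵒᵖ →ₐ[ℂ] Module.End ℂ (Vnr n m Q) :=
  (Module.End.lTensorAlgHom ℂ (VTilde n m Q) ℂ).comp (BalTensor.right _ _)

/-- Multiplication by an element of `ℂ[x, x⁻¹]` on `𝕍`. -/
abbrev mulVV : ℂ[T;T⁻¹] →ₐ[ℂ] Module.End ℂ (VV m Q) := Algebra.lsmul ℂ ℂ (VV m Q)

theorem mulVV_cyc : Polynomial.aeval (mulVV m Q (T 1))
    (∏ k : Fin r, (Polynomial.X - Polynomial.C (Q k : ℂ))) = 0 := by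
  have key : ∀ f : Polynomial ℂ, Polynomial.aeval (mulVV m Q (T 1)) f =
      mulVV m Q (Polynomial.toLaurent f) := by
    intro f
    rw [Polynomial.aeval_algHom_apply]
    congr 1
    have h : Polynomial.aeval (T 1 : ℂ[T;T⁻¹]) = Polynomial.toLaurentAlg (R := ℂ) := by
      ext
      simp
    rw [h]
    rfl
  rw [key]
  refine LinearMap.ext fun v => ?_
  obtain ⟨v, rfl⟩ := Submodule.Quotient.mk_surjective _ v
  refine (Submodule.Quotient.mk_eq_zero (IQ m Q)).2 ?_
  change Polynomial.toLaurent (∏ k : Fin r, (Polynomial.X - Polynomial.C (Q k : ℂ))) • v ∈ IQ m Q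
  rw [← Finset.univ_sum_single v, Finset.smul_sum]
  refine Submodule.sum_mem _ fun j _ => ?_
  rw [← Pi.single_smul, smul_eq_mul]
  exact single_mem_IQ m Q _ _ (Dvd.dvd.mul_right (map_dvd Polynomial.toLaurent
    (Finset.prod_dvd_prod_of_subset _ _ _ (Finset.subset_univ _))) _)

/-- The right action `σ_{n,r}` of `H_{n,r}` on `𝕍 ^ ⊗ n`. -/
def sigma : (ArikiKoike n Q)ᵐᵒᵖ →ₐ[ℂ] Module.End ℂ (TPow n (VV m Q)) :=
  akAct n Q (mulVV m Q (T 1)) (mulVV_cyc m Q)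

end Bimodules

section Permutation

variable {r n : ℕ} (m : Fin r → ℕ+) (Q : Fin r → ℂˣ)

/-- The `r`-compositions `μ = (μ^(1), …, μ^(r))` of `n`, with `m_k` parts in the component `k`. -/
def RComp (n : ℕ) {r : ℕ} (m : Fin r → ℕ+) : Type :=
  {μ : (k : Fin r) → Fin (m k : ℕ) → ℕ // ∑ k, ∑ i, μ k i = n}

instance : DecidableEq (RComp n m) := Classical.decEq _

variable {m}

namespace RComp

/-- The composition of `n` with `m_1 + … + m_r` parts that corresponds to an `r`-composition. -/
def flat (μ : RComp n m) (j : Fin (total m)) : ℕ := μ.1 ((xi m).symm j).1 ((xi m).symm j).2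

theorem sum_flat (μ : RComp n m) : ∑ j, flat μ j = n := by
  have h : ∀ p, flat μ (xi m p) = μ.1 p.1 p.2 := fun p => by
    rw [flat, Equiv.symm_apply_apply]
  rw [← Equiv.sum_comp (xi m), Fintype.sum_congr _ _ h, Fintype.sum_sigma]
  exact μ.2

/-- The index `i` with `μ_1 + … + μ_{i-1} < p ≤ μ_1 + … + μ_i` (zero-based). -/
def row (μ : RComp n m) (p : Fin n) : Fin (total m) :=
  (finSigmaFinEquiv.symm (Fin.cast (sum_flat μ).symm p)).1

/-- `a_k^μ = |μ^(1)| + … + |μ^(k)|`; here `k` is the zero-based index of the next component. -/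
def aSum (μ : RComp n m) (k : Fin r) : ℕ := ∑ l ∈ Finset.Iio k, ∑ i, μ.1 l i

/-- The parabolic subgroup `𝔖_μ`. -/
def parabolic (μ : RComp n m) : Subgroup (Equiv.Perm (Fin n)) :=
  Subgroup.closure {w | ∃ i : Fin (n - 1), row μ (lo i) = row μ (hi i) ∧ w = adjSwap i}

end RComp

theorem exists_word : ∀ {n : ℕ} (w : Equiv.Perm (Fin n)),
    ∃ l : List (Fin (n - 1)), (l.map adjSwap).prod = w
  | 0, w => ⟨[], Subsingleton.elim _ _⟩
  | n + 1, w => by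
    have hw : w ∈ Submonoid.closure (Set.range fun i : Fin n => Equiv.swap i.castSucc i.succ) := by
      rw [Equiv.Perm.mclosure_swap_castSucc_succ]; trivial
    induction hw using Submonoid.closure_induction with
    | mem x hx =>
      obtain ⟨i, rfl⟩ := hx
      exact ⟨[i], by simp only [List.map_cons, List.map_nil, List.prod_singleton]; rfl⟩
    | one => exact ⟨[], rfl⟩
    | mul x y _ _ hx hy =>
      obtain ⟨l, rfl⟩ := hx
      obtain ⟨l', rfl⟩ := hy
      exact ⟨l ++ l', by simp⟩

/-- `l` is a reduced expression of `w`. -/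
def IsReducedWord {n : ℕ} (w : Equiv.Perm (Fin n)) (l : List (Fin (n - 1))) : Prop :=
  (l.map adjSwap).prod = w ∧ ∀ l' : List (Fin (n - 1)), (l'.map adjSwap).prod = w →
    l.length ≤ l'.length

theorem exists_reducedWord {n : ℕ} (w : Equiv.Perm (Fin n)) : ∃ l, IsReducedWord w l := by
  obtain ⟨l, hl, hmin⟩ := WellFounded.has_min (measure (List.length (α := Fin (n - 1)))).wf
    {l | (l.map adjSwap).prod = w} (exists_word w)
  exact ⟨l, hl, fun l' hl' => not_lt.1 (hmin l' hl')⟩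

namespace ArikiKoike

/-- `T_w = T_{i_1} … T_{i_l}` for a reduced expression `s_{i_1} … s_{i_l}` of `w` (the product does
not depend on the expression). -/
def Tw (w : Equiv.Perm (Fin n)) : ArikiKoike n Q :=
  ((exists_reducedWord w).choose.map fun i => T Q (hi i)).prod

/-- `L_j^⟨k⟩ = (L_j - Q_0) … (L_j - Q_{k-1})`, here with the zero-based `k - 1` as the argument. -/
def Lcyc (j : Fin n) (k : Fin r) : ArikiKoike n Q := Polynomial.aeval (L Q j) (cycPoly Q k)

open scoped Classical in
/-- The element `x_μ`. -/
def xMu (μ : RComp n m) : ArikiKoike n Q :=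
  ∑ w ∈ Finset.univ.filter (fun w => w ∈ μ.parabolic), Tw Q w

/-- The element `m_μ = x_μ ∏_{k=1}^{r-1} ∏_{i=1}^{a_k^μ} (L_i - Q_k)`; the factors commute, and
`k = 0` contributes nothing. -/
def mMu (μ : RComp n m) : ArikiKoike n Q :=
  xMu Q μ * (List.ofFn fun k : Fin r => (List.ofFn fun i : Fin n =>
    if (i : ℕ) < μ.aSum k then L Q i - algebraMap ℂ _ (Q k : ℂ) else 1).prod).prod

/-- The right ideal `M^μ = m_μ H_{n,r}`. -/
def MMu (μ : RComp n m) : Submodule (ArikiKoike n Q)ᵐᵒᵖ (ArikiKoike n Q) :=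
  Submodule.span _ {mMu Q μ}

end ArikiKoike

variable (n m)

/-- The right `H_{n,r}`-module `⊕_μ M^μ`. -/
def SumM : Type := DirectSum (RComp n m) fun μ => ArikiKoike.MMu Q μ

instance : AddCommGroup (SumM n m Q) :=
  inferInstanceAs (AddCommGroup (DirectSum (RComp n m) fun μ => ArikiKoike.MMu Q μ))

instance : Module (ArikiKoike n Q)ᵐᵒᵖ (SumM n m Q) :=
  inferInstanceAs (Module (ArikiKoike n Q)ᵐᵒᵖ
    (DirectSum (RComp n m) fun μ => ArikiKoike.MMu Q μ))

instance : Module ℂ (SumM n m Q) :=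
  inferInstanceAs (Module ℂ (DirectSum (RComp n m) fun μ => ArikiKoike.MMu Q μ))

instance : SMulCommClass (ArikiKoike n Q)ᵐᵒᵖ ℂ (SumM n m Q) :=
  inferInstanceAs (SMulCommClass (ArikiKoike n Q)ᵐᵒᵖ ℂ
    (DirectSum (RComp n m) fun μ => ArikiKoike.MMu Q μ))

instance : IsScalarTower ℂ (ArikiKoike n Q)ᵐᵒᵖ (SumM n m Q) :=
  inferInstanceAs (IsScalarTower ℂ (ArikiKoike n Q)ᵐᵒᵖ
    (DirectSum (RComp n m) fun μ => ArikiKoike.MMu Q μ))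

/-- The cyclotomic Schur algebra at `q = 1`. -/
abbrev CycSchur : Type := Module.End (ArikiKoike n Q)ᵐᵒᵖ (SumM n m Q)

end Permutation

section Ideal

open MulOpposite TensorProduct

variable {r : ℕ} (n : ℕ) (m : Fin r → ℕ+) (Q : Fin r → ℂˣ)

variable {n m} in
/-- The vector `v_μ = w ⊗ ((v_1 ⊗ … ⊗ v_1) ⊗ … ⊗ (v_m ⊗ … ⊗ v_m) ⊗ 1)` of `V_{n,r}`. -/
def vMu (μ : RComp n m) : Vnr n m Q :=
  (1 : ℂ) ⊗ₜ[ℂ] BalTensor.mk _ _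
    (PiTensorProduct.tprod ℂ (fun p => (Pi.single (μ.row p) 1 : VHat (total m))) ⊗ₜ[ℂ] 1)

/-- The right `H_{n,r}`-submodule of `V_{n,r}` generated by the `v_μ L_j^⟨c_j^μ⟩`. -/
def IV : Submodule ℂ (Vnr n m Q) :=
  Submodule.span ℂ {z | ∃ (μ : RComp n m) (j : Fin n) (h : (ArikiKoike n Q)ᵐᵒᵖ),
    z = sigmaV n m Q h (sigmaV n m Q (op (ArikiKoike.Lcyc Q j (block m (μ.row j)))) (vMu Q μ))}

theorem IV_stable (h : (ArikiKoike n Q)ᵐᵒᵖ) : IV n m Q ≤ (IV n m Q).comap (sigmaV n m Q h) := by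
  conv_lhs => rw [IV]
  rw [Submodule.span_le]
  rintro _ ⟨μ, j, h', rfl⟩
  refine Submodule.subset_span ⟨μ, j, h * h', ?_⟩
  rw [map_mul, Module.End.mul_apply]

end Ideal

section QuasiHereditary

/-- `J` is a heredity ideal of `B`: a two-sided ideal with `J² = J` and `J rad(B) J = 0` that is
projective as a left module. -/
def IsHeredityIdeal {B : Type} [Ring B] (J : Ideal B) : Prop :=
  J.IsTwoSided ∧ J * J = J ∧ (∀ a ∈ J, ∀ x ∈ Ring.jacobson B, ∀ c ∈ J, a * x * c = 0) ∧
    Module.Projective B J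

/-- `A` is a quasi-hereditary algebra over the field `k`: it is finite-dimensional and has a chain
`0 = J_0 ≤ J_1 ≤ … ≤ J_t = A` of two-sided ideals such that `J_{i+1} / J_i` is a heredity ideal of
`A / J_i`. -/
def IsQuasiHereditary (k A : Type) [Field k] [Ring A] [Algebra k A] : Prop :=
  Module.Finite k A ∧ ∃ (t : ℕ) (J : ℕ → Ideal A) (_ : ∀ i, (J i).IsTwoSided),
    J 0 = ⊥ ∧ J t = ⊤ ∧ ∀ i < t, J i ≤ J (i + 1) ∧
      IsHeredityIdeal ((J (i + 1)).map (Ideal.Quotient.mk (J i)))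

end QuasiHereditary

end SchurWeyl

end

open SchurWeyl

/-! Since the parameters are nonzero, `𝕍` is a direct sum of modules `ℂ[x]/((x - q_0)…(x - q_d))`,
one for each index `p`, where `d` is the zero-based block of `p`. The vectors `z_{p,k} = (x -
q_{k+1})…(x - q_d) v_p` form a basis with `x z_k = q_k z_k + z_{k-1}`, whatever coincidences there
are among the parameters, and the kernel of `(x - q_0)…(x - q_k)` is the span of all `z_{p,j}` with
`j ≤ k` (`ChainBasis.mem_K_iff`). So an endomorphism commuting with `x` is the same as a free choice
of images of the `v_p` in these kernels. Everything is read off from this normal form for the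
algebra `Sch` of the operators on the tensor power that commute with the place permutations and with
`x` in each factor; it is the commutant of the Hecke action (`centralizer_akAct`).

Hecke side. As the last block has at least `n` indices, it contains a word `ω` with distinct
letters. The space `v_ω H` contains the `r^n n!` basis tensors whose words rearrange `ω`, while `H`
is spanned by `r^n n!` products of a Jucys-Murphy monomial and a normal word. Hence `h ↦ v_ω h` is
injective (`orbitMap_injective`), and the action is faithful. Elements of `Sch` carry `v_ω` to any
given tensor (`theta_vT`), so an operator commuting with `Sch` is determined by its value at `v_ω`,
which lies in `v_ω H`: this is the double centralizer property (`centralizer_Sch`). The weight space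
of a composition `μ` is embedded in `v_ω H` by an element of `Sch` that takes `v_μ` to `v_ω m_μ`;
this identifies it with `M^μ` and gives (ii) (`exists_equiv_SumM`).

Lie side. In characteristic zero `Sch` is generated by the primitive elements `∑ 1 ⊗ … ⊗ b ⊗ … ⊗ 1`
with `b` commuting with `x` (`Sch_le`). Commutators of the `E`'s and of the shifted `F`'s provide
all off-diagonal `b`, but the `H`'s provide only differences of diagonal entries. If there are more
than `n` indices, every word avoids some letter `p`, and on tensors avoiding `p` the entry at `p`
may be subtracted for free; the required projections are polynomials in operators already obtained
(`tensorLie_mem_of_differences`). If there are at most `n` indices there is only one block, `x` is a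
scalar, and no further diagonal entries are needed. So the image of `ρ` is `Sch` (`range_rho`).

Quasi-heredity. Give `z_{p,k}` degree `k`. Elements of `Sch` do not raise the degree in any factor,
and the operators with image in degree less than `s` form a chain of ideals. For each degree vector
there is a word with distinct letters, again because all blocks have at least `n` indices; the
operators `theta` and `chi` attached to these words form a dual basis of each ideal modulo the
preceding one, which makes the subquotient projective and idempotent. The condition on the radical
holds because the corner of degree `s` is an algebra of complex matrices closed under conjugate
transposition, where `Y* Y` nilpotent forces `Y = 0`.

For (i), the map `w ⊗ (t ⊗ h) ↦ t h` is a surjective bimodule homomorphism onto the tensor space,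
and its kernel is shown to be generated by the given vectors (`ker_actV`). -/

noncomputable section
namespace SchurWeyl

/-! ### Subspaces spanned by part of a basis -/

section CoordSpan

variable {ι V : Type} [AddCommGroup V] [Module ℂ V] (b : Module.Basis ι ℂ V)

/-- The vectors whose coordinates vanish outside `D`. -/
def coordSpan (D : Set ι) : Submodule ℂ V where
  carrier := {y | ∀ i, i ∉ D → b.repr y i = 0}
  add_mem' {x y} hx hy i hi := by simp [hx i hi, hy i hi]
  zero_mem' i _ := by simp
  smul_mem' c x hx i hi := by simp [hx i hi]

variable {b}

theorem basis_mem_coordSpan {D : Set ι} {i : ι} (h : i ∈ D) : b i ∈ coordSpan b D := by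
  classical
  intro j hj
  rw [b.repr_self, Finsupp.single_apply, if_neg]
  rintro rfl
  exact hj h

theorem coordSpan_le {D : Set ι} {N : Submodule ℂ V} (h : ∀ i ∈ D, b i ∈ N) :
    coordSpan b D ≤ N := by
  intro y hy
  rw [← b.linearCombination_repr y, Finsupp.linearCombination_apply]
  refine Submodule.sum_mem _ fun i _ => ?_
  by_cases hi : i ∈ D
  · exact N.smul_mem _ (h i hi)
  · simp [hy i hi]

theorem coordSpan_mono {D D' : Set ι} (h : D ⊆ D') : coordSpan b D ≤ coordSpan b D' :=
  fun _ hy i hi => hy i fun h' => hi (h h')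

end CoordSpan

section TensorMaps

variable {V : Type} [AddCommGroup V] [Module ℂ V] {n : ℕ}

/-- `f_1 ⊗ … ⊗ f_n` as an endomorphism of the tensor power. -/
abbrev tmap (f : Fin n → Module.End ℂ V) : Module.End ℂ (TPow n V) := PiTensorProduct.map f

theorem tmap_tprod (f : Fin n → Module.End ℂ V) (v : Fin n → V) :
    tmap f (PiTensorProduct.tprod ℂ v) = PiTensorProduct.tprod ℂ (fun i => f i (v i)) :=
  PiTensorProduct.map_tprod ..

theorem permEnd_tmap (w : Equiv.Perm (Fin n)) (f : Fin n → Module.End ℂ V) :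
    permEnd w * tmap f = tmap (fun i => f (w.symm i)) * permEnd w := by
  ext v
  simp only [LinearMap.compMultilinearMap_apply, Module.End.mul_apply, tmap_tprod, permEnd_tprod]

theorem place_tmap {x : Module.End ℂ V} {f : Fin n → Module.End ℂ V} (j : Fin n)
    (h : x * f j = f j * x) : place j x * tmap f = tmap f * place j x := by
  ext v
  simp only [LinearMap.compMultilinearMap_apply, Module.End.mul_apply, tmap_tprod, place_tprod]
  congr 1
  funext i
  by_cases hi : i = j
  · subst hi
    simpa using LinearMap.congr_fun h (v i)
  · simp [hi]

end TensorMaps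

/-! ### Chain bases: the normal form of `𝕍` as a module over `ℂ[x]` -/

/-- A basis `z_{p,k}` (`0 ≤ k ≤ d p`) of `V` on which `x` acts by
`x z_{p,k} = q_k z_{p,k} + z_{p,k-1}`. -/
structure ChainBasis {P V : Type} [AddCommGroup V] [Module ℂ V] (d : P → ℕ) (q : ℕ → ℂ)
    (x : Module.End ℂ V) where
  /-- The basis. -/
  z : Module.Basis ((p : P) × Fin (d p + 1)) ℂ V
  x_zero : ∀ p, x (z ⟨p, 0⟩) = q 0 • z ⟨p, 0⟩
  x_succ : ∀ p (k : Fin (d p)),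
    x (z ⟨p, k.succ⟩) = q (k + 1) • z ⟨p, k.succ⟩ + z ⟨p, k.castSucc⟩

namespace ChainBasis

open Polynomial

variable {P V : Type} [AddCommGroup V] [Module ℂ V] {d : P → ℕ} {q : ℕ → ℂ} {x : Module.End ℂ V}
  (B : ChainBasis d q x)

/-- The cyclic generator `v_p = z_{p,d p}`. -/
def v (p : P) : V := B.z ⟨p, Fin.last _⟩

/-- The span of the `z_{p,j}` with `j ≤ k`. -/
def K (k : ℕ) : Submodule ℂ V := coordSpan B.z {ζ | (ζ.2 : ℕ) ≤ k}

theorem v_mem_K (p : P) : B.v p ∈ B.K (d p) := basis_mem_coordSpan (by simp)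

/-- The factor `x - q_{k+1}` takes `z_{k+1}` to `z_k`; `j` is the distance from `k` to the cyclic
generator at the top of the chain. -/
theorem chain_aux (p : P) (j : ℕ) : ∀ (k : ℕ) (hk : k + j = d p),
    aeval x (∏ i ∈ Finset.Ioc k (d p), (X - C (q i))) (B.v p) = B.z ⟨p, ⟨k, by omega⟩⟩ := by
  induction j with
  | zero =>
    intro k hk
    obtain rfl : k = d p := by omega
    simp only [Finset.Ioc_self, Finset.prod_empty, map_one, Module.End.one_apply]
    rfl
  | succ j ih =>
    intro k hk
    have h1 : Finset.Ioc k (d p) = insert (k + 1) (Finset.Ioc (k + 1) (d p)) := by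
      ext a; simp only [Finset.mem_Ioc, Finset.mem_insert]; omega
    rw [h1, Finset.prod_insert (by simp), map_mul, Module.End.mul_apply, ih (k + 1) (by omega)]
    have := B.x_succ p ⟨k, by omega⟩
    simp only [Fin.succ_mk, Fin.castSucc_mk] at this
    simp [this, Module.algebraMap_end_apply]

theorem chain (p : P) (k : Fin (d p + 1)) :
    aeval x (∏ i ∈ Finset.Ioc (k : ℕ) (d p), (X - C (q i))) (B.v p) = B.z ⟨p, k⟩ :=
  B.chain_aux p (d p - k) k (by omega)

theorem aeval_cyc_z (p : P) : ∀ (k : ℕ) (hk : k ≤ d p),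
    aeval x (∏ i ∈ Finset.range (k + 1), (X - C (q i))) (B.z ⟨p, ⟨k, by omega⟩⟩) = 0 := by
  intro k
  induction k with
  | zero =>
    intro hk
    have := B.x_zero p
    simp only [zero_add, Finset.range_one, Finset.prod_singleton, map_sub, aeval_X, aeval_C,
      LinearMap.sub_apply, Module.algebraMap_end_apply]
    exact sub_eq_zero.2 this
  | succ k ih =>
    intro hk
    rw [Finset.prod_range_succ, map_mul, Module.End.mul_apply]
    have := B.x_succ p ⟨k, by omega⟩
    simp only [Fin.succ_mk, Fin.castSucc_mk] at this
    simp only [map_sub, aeval_X, aeval_C, LinearMap.sub_apply, Module.algebraMap_end_apply, this,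
      add_sub_cancel_left]
    exact ih (by omega)

/-- `(x - q_0) … (x - q_k)` kills the span of the `z_{p,j}` with `j ≤ k`. -/
theorem aeval_cyc_of_mem_K {k : ℕ} {y : V} (hy : y ∈ B.K k) :
    aeval x (∏ i ∈ Finset.range (k + 1), (X - C (q i))) y = 0 := by
  have h : B.K k ≤ LinearMap.ker (aeval x (∏ i ∈ Finset.range (k + 1), (X - C (q i)))) := by
    refine coordSpan_le ?_
    rintro ⟨p, j⟩ hj
    rw [LinearMap.mem_ker]
    have hjk : (j : ℕ) + 1 ≤ k + 1 := Nat.succ_le_succ hj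
    rw [← Finset.prod_sdiff (Finset.range_mono hjk), map_mul, Module.End.mul_apply,
      B.aeval_cyc_z p j (by omega), map_zero]
  exact h hy

/-- Transpose of the chain relation: the coordinate `j` receives `q_j` times itself and the
coordinate `j + 1`, except at the top of the chain. -/
theorem repr_x (y : V) (p : P) (j : Fin (d p + 1)) :
    B.z.repr (x y) ⟨p, j⟩ = q j * B.z.repr y ⟨p, j⟩ +
      if h : (j : ℕ) + 1 < d p + 1 then B.z.repr y ⟨p, ⟨j + 1, h⟩⟩ else 0 := by
  classical
  have key : (Finsupp.lapply (⟨p, j⟩ : (p : P) × Fin (d p + 1))).comp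
        (B.z.repr.toLinearMap.comp x) =
      q j • (Finsupp.lapply ⟨p, j⟩).comp B.z.repr.toLinearMap +
      if h : (j : ℕ) + 1 < d p + 1 then
        (Finsupp.lapply ⟨p, ⟨j + 1, h⟩⟩).comp B.z.repr.toLinearMap else 0 := by
    refine B.z.ext ?_
    rintro ⟨p', k⟩
    have hs : ∀ (p p' : P) (j : Fin (d p + 1)) (k : Fin (d p' + 1)),
        ((⟨p', k⟩ : (p : P) × Fin (d p + 1)) = ⟨p, j⟩) ↔ p' = p ∧ (k : ℕ) = j := by
      intro p p' j k
      constructor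
      · intro h
        cases h
        exact ⟨rfl, rfl⟩
      · rintro ⟨rfl, h⟩
        rw [Fin.ext h]
    induction k using Fin.cases with
    | zero =>
      have := B.x_zero p'
      split_ifs with h
      · simp [this, Finsupp.single_apply, hs]
        split_ifs with h1
        · rw [← h1.2]
        · rfl
      · simp [this, Finsupp.single_apply, hs]
        split_ifs with h1
        · rw [← h1.2]
        · rfl
    | succ k =>
      have := B.x_succ p' k
      split_ifs with h
      · simp only [LinearMap.comp_apply, LinearEquiv.coe_coe, this, map_add, map_smul,
          Module.Basis.repr_self, Finsupp.lapply_apply, Finsupp.single_apply, hs,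
          LinearMap.add_apply, LinearMap.smul_apply, Fin.val_succ, Fin.val_castSucc,
          smul_eq_mul, mul_ite, mul_one, mul_zero, add_left_inj]
        split_ifs with h1
        · rw [← h1.2]
        · rfl
      · simp only [LinearMap.comp_apply, LinearEquiv.coe_coe, this, map_add, map_smul,
          Module.Basis.repr_self, Finsupp.lapply_apply, Finsupp.single_apply, hs,
          LinearMap.add_apply, LinearMap.smul_apply, Fin.val_succ, Fin.val_castSucc,
          smul_eq_mul, mul_ite, mul_one, mul_zero, LinearMap.zero_apply]
        rw [if_neg (c := p' = p ∧ (k : ℕ) = j)]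
        · split_ifs with h1
          · rw [← h1.2]
          · rfl
        · rintro ⟨rfl, h2⟩
          omega
  have := LinearMap.congr_fun key y
  simp only [LinearMap.comp_apply, LinearMap.add_apply, LinearMap.smul_apply, LinearEquiv.coe_coe,
    Finsupp.lapply_apply, smul_eq_mul] at this
  rw [this]
  split_ifs with h <;> simp

/-- Apply the induction hypothesis to `(x - q_k) y`: the coordinates of `y` satisfy `(q_j - q_k) y_j
+ y_{j+1} = 0` for `j ≥ k`. For `j = k` the first term drops out, so `y_{k+1} = 0`, and the relation
then climbs the chain. No assumption on coincidences of the `q_j` is used. -/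
theorem repr_eq_zero_of_aeval_cyc : ∀ (k : ℕ) (y : V),
    aeval x (∏ i ∈ Finset.range k, (X - C (q i))) y = 0 →
      ∀ p (j : Fin (d p + 1)), k ≤ j → B.z.repr y ⟨p, j⟩ = 0 := by
  intro k
  induction k with
  | zero => intro y hy p j _; simp at hy; simp [hy]
  | succ k ih =>
    intro y hy p
    rw [Finset.prod_range_succ, map_mul, Module.End.mul_apply] at hy
    have h := ih _ hy p
    have key : ∀ (j : ℕ) (hj : j + 1 < d p + 1), k ≤ j → B.z.repr y ⟨p, ⟨j + 1, hj⟩⟩ = 0 := by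
      intro j
      induction j with
      | zero =>
        intro hj hk
        have h1 := h ⟨0, by omega⟩ hk
        obtain rfl : k = 0 := by omega
        simp only [map_sub, aeval_X, aeval_C, LinearMap.sub_apply, Module.algebraMap_end_apply,
          Finsupp.sub_apply, repr_x, map_smul, Finsupp.smul_apply, smul_eq_mul,
          add_sub_cancel_left] at h1
        rwa [dif_pos hj] at h1
      | succ j ihj =>
        intro hj hk
        have h1 := h ⟨j + 1, by omega⟩ hk
        simp only [map_sub, aeval_X, aeval_C, LinearMap.sub_apply, Module.algebraMap_end_apply,
          Finsupp.sub_apply, repr_x, map_smul, Finsupp.smul_apply, smul_eq_mul] at h1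
        rw [dif_pos hj] at h1
        rcases Nat.lt_or_ge j k with h2 | h2
        · obtain rfl : k = j + 1 := by omega
          rwa [add_sub_cancel_left] at h1
        · rw [ihj (by omega) h2] at h1
          simpa using h1
    rintro ⟨j, hj⟩ hkj
    obtain ⟨j, rfl⟩ : ∃ j', j = j' + 1 := ⟨j - 1, by simp only at hkj; omega⟩
    exact key j hj (by simp only at hkj; omega)

/-- Describes `K` as a kernel of a polynomial in `x`; hence everything that commutes with `x`
preserves it. -/
theorem mem_K_iff {k : ℕ} {y : V} :
    y ∈ B.K k ↔ aeval x (∏ i ∈ Finset.range (k + 1), (X - C (q i))) y = 0 := by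
  refine ⟨B.aeval_cyc_of_mem_K, fun h => ?_⟩
  rintro ⟨p, j⟩ hj
  exact B.repr_eq_zero_of_aeval_cyc _ y h p j (by simpa using hj)

/-- The endomorphism with `v_p ↦ y p` that commutes with `x`, for `y p ∈ K (d p)`. -/
def hom (y : P → V) : Module.End ℂ V :=
  B.z.constr ℂ fun ζ => aeval x (∏ i ∈ Finset.Ioc (ζ.2 : ℕ) (d ζ.1), (X - C (q i))) (y ζ.1)

theorem hom_z (y : P → V) (p : P) (k : Fin (d p + 1)) : B.hom y (B.z ⟨p, k⟩) =
    aeval x (∏ i ∈ Finset.Ioc (k : ℕ) (d p), (X - C (q i))) (y p) := by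
  rw [hom, Module.Basis.constr_basis]

@[simp]
theorem hom_v (y : P → V) (p : P) : B.hom y (B.v p) = y p := by
  rw [v, hom_z]; simp

/-- The only relation of the cyclic generator `v_p` is that `(x - q_0)…(x - q_{d p})` kills it, and
`hy` says that `y p` satisfies it too. The hypothesis enters only at the bottom of the chain. -/
theorem hom_comm {y : P → V} (hy : ∀ p, y p ∈ B.K (d p)) : x * B.hom y = B.hom y * x := by
  refine B.z.ext ?_
  rintro ⟨p, k⟩
  rw [Module.End.mul_apply, Module.End.mul_apply]
  induction k using Fin.cases with
  | zero =>
    have h1 := B.aeval_cyc_of_mem_K (hy p)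
    have h2 : Finset.range (d p + 1) = insert 0 (Finset.Ioc 0 (d p)) := by
      ext a; simp only [Finset.mem_Ioc, Finset.mem_insert, Finset.mem_range]; omega
    rw [B.x_zero, map_smul, hom_z]
    rw [h2, Finset.prod_insert (by simp), map_mul, Module.End.mul_apply] at h1
    simp only [map_sub, aeval_X, aeval_C, LinearMap.sub_apply, Module.algebraMap_end_apply] at h1
    exact sub_eq_zero.1 h1
  | succ k =>
    have h2 : Finset.Ioc (k : ℕ) (d p) = insert (k + 1 : ℕ) (Finset.Ioc (k + 1 : ℕ) (d p)) := by
      ext a; simp only [Finset.mem_Ioc, Finset.mem_insert]; omega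
    rw [B.x_succ, map_add, map_smul, hom_z, hom_z]
    simp only [Fin.val_succ, Fin.val_castSucc]
    rw [h2, Finset.prod_insert (by simp), map_mul, Module.End.mul_apply]
    simp [Module.algebraMap_end_apply]

end ChainBasis
end SchurWeyl
end

noncomputable section
namespace SchurWeyl

/-! ### The commutant `Sch` of the place permutations and of `x` in each factor -/

section Sch

variable {V : Type} [AddCommGroup V] [Module ℂ V]

/-- The endomorphisms of `V ^ ⊗ n` that commute with the place permutations and with `x` in every
tensor factor. -/
def Sch (n : ℕ) (x : Module.End ℂ V) : Subalgebra ℂ (Module.End ℂ (TPow n V)) :=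
  Subalgebra.centralizer ℂ (Set.range (permEnd (n := n) (W := V)) ∪ Set.range fun j => place j x)

variable {n : ℕ} {x : Module.End ℂ V}

theorem mem_Sch {f : Module.End ℂ (TPow n V)} : f ∈ Sch n x ↔
    (∀ w, permEnd w * f = f * permEnd w) ∧ ∀ j, place j x * f = f * place j x := by
  rw [Sch, Subalgebra.mem_centralizer_iff]
  constructor
  · intro h
    exact ⟨fun w => h _ (Or.inl ⟨w, rfl⟩), fun j => h _ (Or.inr ⟨j, rfl⟩)⟩
  · rintro ⟨h1, h2⟩ _ (⟨w, rfl⟩ | ⟨j, rfl⟩)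
    exacts [h1 w, h2 j]

theorem Sch_permEnd {f : Module.End ℂ (TPow n V)} (hf : f ∈ Sch n x) (w : Equiv.Perm (Fin n))
    (y : TPow n V) : f (permEnd w y) = permEnd w (f y) :=
  (LinearMap.congr_fun ((mem_Sch.1 hf).1 w) y).symm

theorem tmap_const_mem_Sch {b : Module.End ℂ V} (hb : x * b = b * x) :
    tmap (fun _ : Fin n => b) ∈ Sch n x :=
  mem_Sch.2 ⟨fun w => permEnd_tmap w _, fun j => place_tmap j hb⟩

theorem place_aeval_comm {f : Module.End ℂ (TPow n V)} (j : Fin n)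
    (h : place j x * f = f * place j x) (g : Polynomial ℂ) :
    place j (Polynomial.aeval x g) * f = f * place j (Polynomial.aeval x g) := by
  rw [← Polynomial.aeval_algHom_apply]
  induction g using Polynomial.induction_on' with
  | add a b ha hb => rw [map_add, add_mul, mul_add, ha, hb]
  | monomial k c =>
    have : Commute (place j x) f := h
    rw [Polynomial.aeval_monomial, mul_assoc, (this.pow_left k).eq, ← mul_assoc, ← mul_assoc,
      Algebra.commutes c f]

end Sch

namespace ChainBasis

open Polynomial

variable {P V : Type} [AddCommGroup V] [Module ℂ V] {d : P → ℕ} {q : ℕ → ℂ} {x : Module.End ℂ V}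
  (B : ChainBasis d q x) {n : ℕ}

/-- The basis of the tensor power formed by the tensors of the `z_{p,k}`. -/
def zT (n : ℕ) : Module.Basis (Fin n → (p : P) × Fin (d p + 1)) ℂ (TPow n V) :=
  Basis.piTensorProduct fun _ => B.z

theorem zT_apply (ζ : Fin n → (p : P) × Fin (d p + 1)) :
    B.zT n ζ = PiTensorProduct.tprod ℂ (fun i => B.z (ζ i)) :=
  Basis.piTensorProduct_apply _ _

theorem zT_repr_tprod (u : Fin n → V) (ζ : Fin n → (p : P) × Fin (d p + 1)) :
    (B.zT n).repr (PiTensorProduct.tprod ℂ u) ζ = ∏ i, B.z.repr (u i) (ζ i) :=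
  Basis.piTensorProduct_repr_tprod_apply _ _ _

/-- The tensor `v_{J 1} ⊗ … ⊗ v_{J n}`. -/
def vT (J : Fin n → P) : TPow n V := PiTensorProduct.tprod ℂ (fun i => B.v (J i))

theorem vT_eq (J : Fin n → P) : B.vT J = B.zT n (fun i => ⟨J i, Fin.last _⟩) :=
  (B.zT_apply _).symm

theorem permEnd_zT (w : Equiv.Perm (Fin n)) (ζ : Fin n → (p : P) × Fin (d p + 1)) :
    permEnd w (B.zT n ζ) = B.zT n (fun i => ζ (w.symm i)) := by
  rw [zT_apply, zT_apply, permEnd_tprod]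

theorem permEnd_vT (w : Equiv.Perm (Fin n)) (J : Fin n → P) :
    permEnd w (B.vT J) = B.vT (fun i => J (w.symm i)) := by
  rw [vT, vT, permEnd_tprod]

/-- The tensor product of the subspaces `K (κ i)`. -/
def KT (κ : Fin n → ℕ) : Submodule ℂ (TPow n V) :=
  coordSpan (B.zT n) {ζ | ∀ i, ((ζ i).2 : ℕ) ≤ κ i}

/-- The span of the basis tensors of degree less than `s`. -/
def Kdeg (n s : ℕ) : Submodule ℂ (TPow n V) :=
  coordSpan (B.zT n) {ζ | ∑ i, ((ζ i).2 : ℕ) < s}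

theorem vT_mem_KT (J : Fin n → P) : B.vT J ∈ B.KT (fun i => d (J i)) := by
  rw [vT_eq]
  exact basis_mem_coordSpan (by simp)

theorem KT_le_Kdeg {κ : Fin n → ℕ} {s : ℕ} (h : ∑ i, κ i < s) : B.KT κ ≤ B.Kdeg n s :=
  coordSpan_mono fun _ hζ => (Finset.sum_le_sum fun i _ => hζ i).trans_lt h

theorem repr_place_of_coord {g : Module.End ℂ V} (i : Fin n)
    (ζ : Fin n → (p : P) × Fin (d p + 1))
    (h : ∀ u, B.z.repr (g u) (ζ i) = B.z.repr u (ζ i)) (y : TPow n V) :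
    (B.zT n).repr (place i g y) ζ = (B.zT n).repr y ζ := by
  have key : ((B.zT n).coord ζ).comp (place i g) = (B.zT n).coord ζ := by
    ext u
    simp only [LinearMap.compMultilinearMap_apply, LinearMap.comp_apply, place_tprod,
      Module.Basis.coord_apply, zT_repr_tprod]
    refine Finset.prod_congr rfl fun j _ => ?_
    by_cases hj : j = i
    · subst hj; rw [Function.update_self, h]
    · rw [Function.update_of_ne hj]
  exact LinearMap.congr_fun key y

/-- A tensor product of kernels is the intersection of the kernels of the operators placed in the
single factors. -/
theorem mem_KT_iff {κ : Fin n → ℕ} {y : TPow n V} : y ∈ B.KT κ ↔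
    ∀ i, place i (aeval x (∏ j ∈ Finset.range (κ i + 1), (X - C (q j)))) y = 0 := by
  constructor
  · intro hy i
    have : B.KT κ ≤ LinearMap.ker
        (place i (aeval x (∏ j ∈ Finset.range (κ i + 1), (X - C (q j))))) := by
      refine coordSpan_le fun ζ hζ => ?_
      rw [LinearMap.mem_ker, zT_apply, place_tprod,
        B.aeval_cyc_of_mem_K (basis_mem_coordSpan (hζ i))]
      exact (PiTensorProduct.tprod ℂ).map_update_zero _ i
    exact this hy
  · intro h ζ hζ
    simp only [Set.mem_ofPred_eq, not_forall, not_le] at hζ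
    obtain ⟨i, hi⟩ := hζ
    set N := aeval x (∏ j ∈ Finset.range (κ i + 1), (X - C (q j))) with hN
    -- As `ζ i` has height above `κ i`, its coordinate functional vanishes on `ker N` and so factors
    -- as `l ∘ N`. The operator `u ↦ l (N u) z` then preserves this coordinate, but placed in the
    -- factor `i` it kills `y`.
    have hker : LinearMap.ker N ≤ LinearMap.ker (B.z.coord (ζ i)) := by
      intro u hu
      exact B.mem_K_iff.2 hu _ (by simpa using hi)
    obtain ⟨l, hl⟩ : ∃ l : V →ₗ[ℂ] ℂ, l.comp N = B.z.coord (ζ i) := by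
      have := LinearMap.range_dualMap_eq_dualAnnihilator_ker N
      have h2 : B.z.coord (ζ i) ∈ (LinearMap.ker N).dualAnnihilator :=
        (Submodule.mem_dualAnnihilator _).2 fun w hw => hker hw
      rw [← this] at h2
      exact h2
    have h3 := B.repr_place_of_coord (g := (l.smulRight (B.z (ζ i))) * N) i ζ (by
      intro u
      have := LinearMap.congr_fun hl u
      simp only [LinearMap.comp_apply, Module.Basis.coord_apply] at this
      simp [this]) y
    rw [← h3, map_mul, Module.End.mul_apply, h i]
    simp

/-- By `mem_KT_iff`, `KT κ` is cut out by polynomials in the placed `x`, with which `f` commutes. In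
other words, `f` raises the degree in no tensor factor. -/
theorem KT_stable {f : Module.End ℂ (TPow n V)} (hf : ∀ j, place j x * f = f * place j x)
    {κ : Fin n → ℕ} {y : TPow n V} (hy : y ∈ B.KT κ) : f y ∈ B.KT κ := by
  rw [mem_KT_iff] at hy ⊢
  intro i
  rw [← Module.End.mul_apply, place_aeval_comm i (hf i), Module.End.mul_apply, hy i, map_zero]

theorem Kdeg_stable {f : Module.End ℂ (TPow n V)} (hf : ∀ j, place j x * f = f * place j x)
    {s : ℕ} {y : TPow n V} (hy : y ∈ B.Kdeg n s) : f y ∈ B.Kdeg n s := by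
  have : B.Kdeg n s ≤ (B.Kdeg n s).comap f := coordSpan_le fun ζ hζ =>
    B.KT_le_Kdeg hζ (B.KT_stable hf (κ := fun i => (ζ i).2)
      (basis_mem_coordSpan (by simp)))
  exact this hy

theorem place_x_comm (i j : Fin n) : place j x * place i x = place i x * place j x := by
  by_cases h : i = j
  · rw [h]
  · exact place_comm (Ne.symm h) x x

theorem Kdeg_permEnd (w : Equiv.Perm (Fin n)) {s : ℕ} {y : TPow n V} (hy : y ∈ B.Kdeg n s) :
    permEnd w y ∈ B.Kdeg n s := by
  have : B.Kdeg n s ≤ (B.Kdeg n s).comap (permEnd w) := coordSpan_le fun ζ hζ => by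
    rw [Submodule.mem_comap, permEnd_zT]
    refine basis_mem_coordSpan ?_
    rw [Set.mem_ofPred_eq, Equiv.sum_comp w.symm (fun i => ((ζ i).2 : ℕ))]
    exact hζ
  exact this hy

/-- An endomorphism that commutes with the `place j x` maps into `N` if it maps the `v_J` there. -/
theorem map_mem_of_vT {f : Module.End ℂ (TPow n V)} (hf : ∀ j, place j x * f = f * place j x)
    {N : Submodule ℂ (TPow n V)} (hN : ∀ j, ∀ y ∈ N, place j x y ∈ N)
    {J : Fin n → P} (h : f (B.vT J) ∈ N) {ζ : Fin n → (p : P) × Fin (d p + 1)}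
    (hζ : ∀ i, (ζ i).1 = J i) : f (B.zT n ζ) ∈ N := by
  obtain rfl : J = fun i => (ζ i).1 := funext fun i => (hζ i).symm
  have hN' : ∀ j (g : ℂ[X]), ∀ y ∈ N, place j (aeval x g) y ∈ N := by
    intro j g y hy
    rw [← Polynomial.aeval_algHom_apply]
    induction g using Polynomial.induction_on' with
    | add a b ha hb => rw [map_add]; exact N.add_mem ha hb
    | monomial k c =>
      rw [Polynomial.aeval_monomial, Module.End.mul_apply, Module.algebraMap_end_apply]
      refine N.smul_mem _ ?_
      induction k with
      | zero => simpa using hy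
      | succ k ih => rw [pow_succ', Module.End.mul_apply]; exact hN j _ ih
  -- One factor at a time, `v` is replaced by `z` through a placed polynomial in `x`, which passes
  -- through `f` and preserves `N`.
  have key : ∀ s : Finset (Fin n), f (PiTensorProduct.tprod ℂ
      (fun i => if i ∈ s then B.z (ζ i) else B.v (ζ i).1)) ∈ N := by
    intro s
    induction s using Finset.induction_on with
    | empty => simpa [vT] using h
    | insert a s ha ih =>
      have h1 := hN' a (∏ i ∈ Finset.Ioc ((ζ a).2 : ℕ) (d (ζ a).1), (X - C (q i))) _ ih
      rw [← Module.End.mul_apply, place_aeval_comm a (hf a), Module.End.mul_apply, place_tprod,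
        if_neg ha, chain] at h1
      convert h1 using 3
      funext i
      by_cases hi : i = a
      · subst hi; simp
      · simp [hi]
  simpa [zT_apply] using key Finset.univ

theorem range_le_of_vT {f : Module.End ℂ (TPow n V)} (hf : ∀ j, place j x * f = f * place j x)
    {N : Submodule ℂ (TPow n V)} (hN : ∀ j, ∀ y ∈ N, place j x y ∈ N)
    (h : ∀ J, f (B.vT J) ∈ N) (y : TPow n V) : f y ∈ N := by
  have : (⊤ : Submodule ℂ (TPow n V)) ≤ N.comap f := by
    rw [← (B.zT n).span_eq, Submodule.span_le]
    rintro _ ⟨ζ, rfl⟩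
    exact B.map_mem_of_vT hf hN (h _) (fun _ => rfl)
  exact this trivial

/-- The `v_J` generate the tensor power over the polynomials in the placed `x`. -/
theorem ext_vT {f g : Module.End ℂ (TPow n V)} (hf : ∀ j, place j x * f = f * place j x)
    (hg : ∀ j, place j x * g = g * place j x) (h : ∀ J, f (B.vT J) = g (B.vT J)) : f = g := by
  rw [← sub_eq_zero]
  refine LinearMap.ext fun y => ?_
  have := B.range_le_of_vT (f := f - g) (fun j => by rw [mul_sub, sub_mul, hf, hg]) (N := ⊥)
    (fun j y hy => by rw [Submodule.mem_bot] at hy ⊢; rw [hy, map_zero])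
    (fun J => by simp [h]) y
  simpa using this

variable [DecidableEq P]

/-- The projection onto the span of the `z_{p,k}` for a fixed `p`. -/
def eps (p : P) : Module.End ℂ V := B.hom (Pi.single p (B.v p))

theorem single_v_mem (p p' : P) : (Pi.single p (B.v p) : P → V) p' ∈ B.K (d p') := by
  by_cases h : p' = p
  · subst h; simpa using B.v_mem_K p'
  · simp [h]

theorem eps_comm (p : P) : x * B.eps p = B.eps p * x := B.hom_comm (B.single_v_mem p)

theorem eps_z (p : P) (ζ : (p : P) × Fin (d p + 1)) :
    B.eps p (B.z ζ) = if ζ.1 = p then B.z ζ else 0 := by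
  obtain ⟨p', k⟩ := ζ
  rw [eps, hom_z]
  split_ifs with h
  · simp only at h; subst h
    rw [Pi.single_eq_same, chain]
  · rw [Pi.single_eq_of_ne h, map_zero]

theorem eps_v (p p' : P) : B.eps p (B.v p') = if p' = p then B.v p' else 0 := B.eps_z p _

theorem eps_eps (p p' : P) (u : V) : B.eps p (B.eps p' u) = if p' = p then B.eps p' u else 0 := by
  have : B.eps p * B.eps p' = if p' = p then B.eps p' else 0 := by
    refine B.z.ext fun ζ => ?_
    rw [Module.End.mul_apply, eps_z]
    by_cases h : ζ.1 = p'
    · subst h; rw [if_pos rfl, eps_z]; split_ifs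
      · rw [eps_z, if_pos rfl]
      · simp
    · rw [if_neg h, map_zero]
      split_ifs
      · rw [eps_z, if_neg h]
      · simp
  rw [← Module.End.mul_apply, this]
  split_ifs <;> simp

/-- The projection onto the span of the basis tensors whose word is in `D`. -/
def proj (D : Finset (Fin n → P)) : Module.End ℂ (TPow n V) :=
  ∑ J ∈ D, tmap fun i => B.eps (J i)

theorem proj_tprod (D : Finset (Fin n → P)) {J : Fin n → P} {u : Fin n → V}
    (h : ∀ i, B.eps (J i) (u i) = u i) : B.proj D (PiTensorProduct.tprod ℂ u) =
      if J ∈ D then PiTensorProduct.tprod ℂ u else 0 := by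
  have : ∀ J', tmap (fun i => B.eps (J' i)) (PiTensorProduct.tprod ℂ u) =
      if J = J' then PiTensorProduct.tprod ℂ u else 0 := by
    intro J'
    rw [tmap_tprod]
    split_ifs with hJ
    · subst hJ; simp only [h]
    · obtain ⟨i, hi⟩ := Function.ne_iff.1 hJ
      refine (PiTensorProduct.tprod ℂ).map_coord_zero i ?_
      rw [← h i, eps_eps, if_neg hi]
  rw [proj, LinearMap.sum_apply]
  simp only [this]
  rw [Finset.sum_ite_eq]

theorem proj_zT (D : Finset (Fin n → P)) (ζ : Fin n → (p : P) × Fin (d p + 1)) :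
    B.proj D (B.zT n ζ) = if (fun i => (ζ i).1) ∈ D then B.zT n ζ else 0 := by
  rw [zT_apply]
  exact B.proj_tprod D fun i => by rw [eps_z, if_pos rfl]

theorem proj_vT (D : Finset (Fin n → P)) (J : Fin n → P) :
    B.proj D (B.vT J) = if J ∈ D then B.vT J else 0 :=
  B.proj_tprod D fun i => by rw [eps_v, if_pos rfl]

theorem proj_mem_Sch {D : Finset (Fin n → P)}
    (h : ∀ (w : Equiv.Perm (Fin n)), ∀ J ∈ D, (fun i => J (w i)) ∈ D) : B.proj D ∈ Sch n x := by
  refine mem_Sch.2 ⟨fun w => ?_, fun j => ?_⟩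
  · rw [proj, Finset.mul_sum, Finset.sum_mul]
    refine Finset.sum_nbij' (fun J i => J (w.symm i)) (fun J i => J (w i)) (fun J hJ => h w.symm J hJ)
      (fun J hJ => h w J hJ) ?_ ?_ fun J _ => permEnd_tmap w _
    · intro J _; simp
    · intro J _; simp
  · rw [proj, Finset.mul_sum, Finset.sum_mul]
    exact Finset.sum_congr rfl fun J _ => place_tmap j (B.eps_comm _)

theorem proj_mul_proj (D D' : Finset (Fin n → P)) :
    B.proj D * B.proj D' = B.proj (D ∩ D') := by
  refine (B.zT n).ext fun ζ => ?_
  rw [Module.End.mul_apply, proj_zT, proj_zT]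
  by_cases h : (fun i => (ζ i).1) ∈ D' <;> simp [h, proj_zT]

/-- The rearrangements of a word. -/
def orb (J : Fin n → P) : Finset (Fin n → P) :=
  Finset.univ.image fun (w : Equiv.Perm (Fin n)) i => J (w i)

theorem mem_orb {J J' : Fin n → P} :
    J' ∈ orb J ↔ ∃ w : Equiv.Perm (Fin n), J' = fun i => J (w i) := by
  simp only [orb, Finset.mem_image, Finset.mem_univ, true_and, eq_comm]

theorem self_mem_orb (J : Fin n → P) : J ∈ orb J := mem_orb.2 ⟨1, rfl⟩

theorem proj_orb_mem (J : Fin n → P) : B.proj (orb J) ∈ Sch n x := by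
  refine B.proj_mem_Sch ?_
  intro w J' hJ'
  obtain ⟨u, rfl⟩ := mem_orb.1 hJ'
  exact mem_orb.2 ⟨u * w, rfl⟩

section Theta

variable (ω : Fin n → P)

/-- The endomorphism of `V` attached to `ζ` by `v_{ω i} ↦ z_{ζ i}`. -/
def thetaHom (ζ : Fin n → (p : P) × Fin (d p + 1)) : Module.End ℂ V :=
  B.hom fun p => ∑ i, if ω i = p then B.z (ζ i) else 0

open scoped Classical in
/-- For `y ∈ K_{d ∘ ω}` the element of `Sch` with `v_ω ↦ y` that vanishes on the other weight
spaces. -/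
def theta : TPow n V →ₗ[ℂ] Module.End ℂ (TPow n V) :=
  (B.zT n).constr ℂ fun ζ => if ∀ i, ((ζ i).2 : ℕ) ≤ d (ω i) then
    tmap (fun _ => B.thetaHom ω ζ) * B.proj (orb ω) else 0

theorem theta_mem (y : TPow n V) : B.theta ω y ∈ Sch n x := by
  have : (⊤ : Submodule ℂ (TPow n V)) ≤ (Subalgebra.toSubmodule (Sch n x)).comap (B.theta ω) := by
    rw [← (B.zT n).span_eq, Submodule.span_le]
    rintro _ ⟨ζ, rfl⟩
    rw [SetLike.mem_coe, Submodule.mem_comap, Subalgebra.mem_toSubmodule, theta,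
      Module.Basis.constr_basis]
    split_ifs with h
    · refine mul_mem (tmap_const_mem_Sch (B.hom_comm fun p => ?_)) (B.proj_orb_mem ω)
      refine Submodule.sum_mem _ fun i _ => ?_
      split_ifs with hi
      · exact basis_mem_coordSpan (by rw [← hi]; exact h i)
      · exact zero_mem _
    · exact zero_mem _
  exact this trivial

/-- Since the letters of `ω` are distinct, a single summand of `thetaHom` survives at each `ω i`.
With `theta_mem` this shows that every tensor in `KT (d ∘ ω)` is the value at `v_ω` of an element of
`Sch`. -/
theorem theta_vT (hω : Function.Injective ω) {y : TPow n V} (hy : y ∈ B.KT (fun i => d (ω i))) :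
    B.theta ω y (B.vT ω) = y := by
  have : B.KT (fun i => d (ω i)) ≤
      LinearMap.eqLocus (LinearMap.applyₗ (B.vT ω) ∘ₗ B.theta ω) LinearMap.id := by
    refine coordSpan_le fun ζ hζ => ?_
    rw [LinearMap.mem_eqLocus, LinearMap.comp_apply, theta, Module.Basis.constr_basis,
      if_pos (show ∀ i, ((ζ i).2 : ℕ) ≤ d (ω i) from hζ), LinearMap.applyₗ_apply_apply, Module.End.mul_apply, proj_vT,
      if_pos (self_mem_orb ω), vT, tmap_tprod, LinearMap.id_apply, zT_apply]
    congr 1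
    funext i
    rw [thetaHom, hom_v, Finset.sum_eq_single i]
    · simp
    · intro j _ hj
      rw [if_neg fun h => hj (hω h)]
    · simp
  exact this hy

theorem theta_proj (y : TPow n V) : B.theta ω y * B.proj (orb ω) = B.theta ω y := by
  have : LinearMap.mulRight ℂ (B.proj (orb ω)) ∘ₗ B.theta ω = B.theta ω := by
    refine (B.zT n).ext fun ζ => ?_
    rw [LinearMap.comp_apply, theta, Module.Basis.constr_basis]
    split_ifs
    · rw [LinearMap.mulRight_apply, mul_assoc, proj_mul_proj, Finset.inter_self]
    · simp
  exact LinearMap.congr_fun this y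

theorem theta_vT_of_notMem {J : Fin n → P} (hJ : J ∉ orb ω) (y : TPow n V) :
    B.theta ω y (B.vT J) = 0 := by
  rw [← theta_proj, Module.End.mul_apply, proj_vT, if_neg hJ, map_zero]

theorem theta_vT_comp (hω : Function.Injective ω) {y : TPow n V}
    (hy : y ∈ B.KT (fun i => d (ω i))) (w : Equiv.Perm (Fin n)) :
    B.theta ω y (B.vT fun i => ω (w i)) = permEnd w.symm y := by
  have h := Sch_permEnd (B.theta_mem ω y) w.symm (B.vT ω)
  rw [permEnd_vT, B.theta_vT ω hω hy] at h
  exact h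

end Theta

section Chi

variable (ω J : Fin n → P) (y : Fin n → V)

/-- The element of `Sch` with `v_{J ∘ w} ↦ ∑ y_{w' 1} ⊗ … ⊗ y_{w' n}`, the sum over all `w'` with
`J ∘ w' = J ∘ w`, for `y i` in the component `ω i`. -/
def chi : Module.End ℂ (TPow n V) :=
  B.proj (orb ω) * tmap (fun _ => B.hom fun p => ∑ i, if J i = p then y i else 0)

variable {J y} in
theorem chi_mem (hy : ∀ i, y i ∈ B.K (d (J i))) : B.chi ω J y ∈ Sch n x := by
  refine mul_mem (B.proj_orb_mem ω) (tmap_const_mem_Sch (B.hom_comm fun p => ?_))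
  refine Submodule.sum_mem _ fun i _ => ?_
  split_ifs with h
  · rw [← h]; exact hy i
  · exact zero_mem _

variable {y} in
-- The multilinear expansion runs over all maps `g`, and its term has the word `ω ∘ g`. As `ω` is
-- injective, this word is a rearrangement of `ω` exactly for bijective `g`, so the projection
-- leaves a sum over permutations.
theorem proj_tprod_sum (hω : Function.Injective ω) (hy : ∀ i, B.eps (ω i) (y i) = y i)
    (c : Fin n → Fin n → ℂ) : B.proj (orb ω) (PiTensorProduct.tprod ℂ fun i => ∑ j, c i j • y j) =
      ∑ w : Equiv.Perm (Fin n), (∏ i, c i (w i)) • PiTensorProduct.tprod ℂ fun i => y (w i) := by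
  classical
  rw [MultilinearMap.map_sum, map_sum]
  have h1 : ∀ g : Fin n → Fin n, B.proj (orb ω) (PiTensorProduct.tprod ℂ
      fun i => c i (g i) • y (g i)) = if Function.Bijective g then
        (∏ i, c i (g i)) • PiTensorProduct.tprod ℂ fun i => y (g i) else 0 := by
    intro g
    rw [MultilinearMap.map_smul_univ, map_smul, B.proj_tprod (orb ω) (J := fun i => ω (g i))
      fun i => hy (g i)]
    by_cases hg : Function.Bijective g
    · rw [if_pos hg, if_pos (mem_orb.2 ⟨Equiv.ofBijective g hg, by simp⟩)]
    · rw [if_neg hg, if_neg, smul_zero]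
      intro h
      obtain ⟨w, hw⟩ := mem_orb.1 h
      refine hg ?_
      have : g = w := funext fun i => hω (congrFun hw i)
      rw [this]; exact w.bijective
  simp only [h1]
  rw [← Finset.sum_filter]
  refine Finset.sum_bij' (fun g hg => Equiv.ofBijective g (Finset.mem_filter.1 hg).2)
    (fun w _ => w) ?_ ?_ ?_ ?_ ?_
  · simp
  · intro w _; exact Finset.mem_filter.2 ⟨by simp, w.bijective⟩
  · intro g _; rfl
  · intro w _; ext; rfl
  · intro g _; rfl

variable {y} in
theorem chi_vT (hω : Function.Injective ω) (hy : ∀ i, B.eps (ω i) (y i) = y i) (J' : Fin n → P) :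
    B.chi ω J y (B.vT J') = ∑ w : Equiv.Perm (Fin n),
      if (fun i => J (w i)) = J' then PiTensorProduct.tprod ℂ fun i => y (w i) else 0 := by
  rw [chi, Module.End.mul_apply, vT, tmap_tprod]
  simp only [hom_v]
  have := B.proj_tprod_sum ω hω hy (fun i j => if J j = J' i then 1 else 0)
  simp only [ite_smul, one_smul, zero_smul] at this
  rw [this]
  refine Finset.sum_congr rfl fun w _ => ?_
  split_ifs with h
  · subst h; simp
  · obtain ⟨i, hi⟩ := Function.ne_iff.1 h
    rw [Finset.prod_eq_zero (Finset.mem_univ i) (if_neg hi), zero_smul]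

end Chi

end ChainBasis
end SchurWeyl
end

noncomputable section
namespace SchurWeyl

/-! ### Heredity ideals from dual bases, and positivity of complex matrices -/

section Criterion

variable {R : Type} [Ring R] {J J' : Ideal R} [J.IsTwoSided]

theorem mem_map_mk (hJ : J ≤ J') {a : R} :
    Ideal.Quotient.mk J a ∈ J'.map (Ideal.Quotient.mk J) ↔ a ∈ J' := by
  rw [Ideal.mem_map_iff_of_surjective _ Ideal.Quotient.mk_surjective]
  constructor
  · rintro ⟨b, hb, h⟩
    have := hJ (Ideal.Quotient.eq.1 h)
    have h2 := J'.sub_mem hb this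
    rwa [sub_sub_cancel] at h2
  · exact fun h => ⟨a, h, rfl⟩

/-- A criterion for heredity ideals in terms of a dual basis. -/
theorem isHeredityIdeal_of_dualBasis [J'.IsTwoSided] (hJ : J ≤ J') {ι : Type} [Fintype ι]
    (F : ι → R →+ R) (e : ι → R) (he : ∀ i, e i ∈ J') (hF : ∀ i, ∀ y ∈ J, F i y ∈ J)
    (hF' : ∀ i, ∀ y ∈ J', F i y ∈ J') (hlin : ∀ i r, ∀ y ∈ J', F i (r * y) - r * F i y ∈ J)
    (hdual : ∀ y ∈ J', ∑ i, F i y * e i - y ∈ J)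
    (hrad : ∀ a ∈ J', ∀ y, Ideal.Quotient.mk J y ∈ Ring.jacobson (R ⧸ J) → ∀ c ∈ J',
      a * y * c ∈ J) :
    IsHeredityIdeal (J'.map (Ideal.Quotient.mk J)) := by
  set π := Ideal.Quotient.mk J
  have hπ : Function.Surjective π := Ideal.Quotient.mk_surjective
  have hts : (J'.map π).IsTwoSided := ⟨by
    intro a b ha
    obtain ⟨a, rfl⟩ := hπ a
    obtain ⟨b, rfl⟩ := hπ b
    rw [← map_mul, mem_map_mk hJ]
    exact J'.mul_mem_right _ ((mem_map_mk hJ).1 ha)⟩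
  refine ⟨hts, le_antisymm Ideal.mul_le_left ?_, ?_, ?_⟩
  -- Modulo `J`, `a` is the sum of the products `F_i(a) e_i`, and both factors lie in `J'`.
  · intro a ha
    obtain ⟨a, rfl⟩ := hπ a
    have ha' := (mem_map_mk hJ).1 ha
    have := Ideal.Quotient.eq.2 (hdual a ha')
    rw [← this, map_sum]
    refine Submodule.sum_mem _ fun i _ => ?_
    rw [map_mul]
    exact Ideal.mul_mem_mul ((mem_map_mk hJ).2 (hF' i a ha')) ((mem_map_mk hJ).2 (he i))
  · intro a ha y hy c hc
    obtain ⟨a, rfl⟩ := hπ a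
    obtain ⟨c, rfl⟩ := hπ c
    obtain ⟨y, rfl⟩ := hπ y
    rw [← map_mul, ← map_mul]
    exact Ideal.Quotient.eq_zero_iff_mem.2
      (hrad a ((mem_map_mk hJ).1 ha) y hy c ((mem_map_mk hJ).1 hc))
  -- The `F_i` are only additive on `R`, but they descend to the quotient and become linear on
  -- `J'/J`. Together with the `e_i` they exhibit `J'/J` as a retract of a free module.
  · let G : ι → R ⧸ J →+ R ⧸ J := fun i => QuotientAddGroup.map _ _ (F i) (fun y hy => hF i y hy)
    have hG : ∀ i a, G i (π a) = π (F i a) := fun i a => rfl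
    let inc : J'.map π →ₗ[R ⧸ J] (ι → R ⧸ J) :=
      { toFun := fun a i => G i a.1
        map_add' := fun a b => funext fun i => by simp
        map_smul' := fun r a => funext fun i => by
          obtain ⟨a, ha⟩ := a
          obtain ⟨a, rfl⟩ := hπ a
          obtain ⟨r, rfl⟩ := hπ r
          simp only [RingHom.id_apply, Pi.smul_apply, smul_eq_mul, SetLike.mk_smul_mk]
          rw [← map_mul, hG, hG, ← map_mul]
          exact Ideal.Quotient.eq.2 (hlin i r a ((mem_map_mk hJ).1 ha)) }
    let ret : (ι → R ⧸ J) →ₗ[R ⧸ J] J'.map π :=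
      Fintype.linearCombination (R ⧸ J) fun i => ⟨π (e i), (mem_map_mk hJ).2 (he i)⟩
    refine Module.Projective.of_split inc ret (LinearMap.ext ?_)
    rintro ⟨a, ha⟩
    obtain ⟨a, rfl⟩ := hπ a
    refine Subtype.ext ?_
    simp only [LinearMap.comp_apply, LinearMap.id_apply, ret, Fintype.linearCombination_apply,
      Submodule.coe_sum, SetLike.val_smul, smul_eq_mul, inc, LinearMap.coe_mk, AddHom.coe_mk, hG,
      ← map_mul, ← map_sum]
    exact Ideal.Quotient.eq.2 (hdual a ((mem_map_mk hJ).1 ha))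

end Criterion

open scoped ComplexOrder in
-- A Hermitian matrix whose square vanishes is zero. Starting from the exponent `2 ^ N ≥ N`, the
-- exponent is halved until `Y* Y = 0` remains.
theorem eq_zero_of_conjTranspose_mul_self_pow {ι : Type} [Fintype ι] [DecidableEq ι]
    (Y : Matrix ι ι ℂ) (N : ℕ) (h : (Y.conjTranspose * Y) ^ N = 0) : Y = 0 := by
  have key : ∀ k : ℕ, (Y.conjTranspose * Y) ^ 2 ^ k = 0 → Y.conjTranspose * Y = 0 := by
    intro k
    induction k with
    | zero => intro h; simpa using h
    | succ k ih =>
      intro h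
      refine ih ?_
      have hs : ((Y.conjTranspose * Y) ^ 2 ^ k).conjTranspose = (Y.conjTranspose * Y) ^ 2 ^ k := by
        rw [Matrix.conjTranspose_pow, Matrix.conjTranspose_mul, Matrix.conjTranspose_conjTranspose]
      rw [pow_succ, pow_mul, pow_two] at h
      rw [← Matrix.conjTranspose_mul_self_eq_zero, hs, h]
  refine Matrix.conjTranspose_mul_self_eq_zero.1 (key N ?_)
  have hN : N ≤ 2 ^ N := Nat.lt_two_pow_self.le
  rw [← Nat.sub_add_cancel hN, pow_add, h, mul_zero]

end SchurWeyl
end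

noncomputable section
namespace SchurWeyl
namespace ChainBasis

variable {P V : Type} [AddCommGroup V] [Module ℂ V] {d : P → ℕ} {q : ℕ → ℂ} {x : Module.End ℂ V}
  (B : ChainBasis d q x) {n : ℕ}

/-! ### Graded projections for the degree filtration -/

section Graded

open scoped Classical in
/-- The projection onto the span of the basis tensors `z_{p_1,κ_1} ⊗ … ⊗ z_{p_n,κ_n}`. -/
def pr (κ : Fin n → ℕ) : Module.End ℂ (TPow n V) :=
  (B.zT n).constr ℂ fun ζ => if ∀ i, ((ζ i).2 : ℕ) = κ i then B.zT n ζ else 0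

open scoped Classical in
theorem pr_zT (κ : Fin n → ℕ) (ζ : Fin n → (p : P) × Fin (d p + 1)) :
    B.pr κ (B.zT n ζ) = if ∀ i, ((ζ i).2 : ℕ) = κ i then B.zT n ζ else 0 := by
  rw [pr, Module.Basis.constr_basis]

theorem pr_mem_KT (κ : Fin n → ℕ) (y : TPow n V) : B.pr κ y ∈ B.KT κ := by
  have : (⊤ : Submodule ℂ (TPow n V)) ≤ (B.KT κ).comap (B.pr κ) := by
    rw [← (B.zT n).span_eq, Submodule.span_le]
    rintro _ ⟨ζ, rfl⟩
    rw [SetLike.mem_coe, Submodule.mem_comap, pr_zT]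
    split_ifs with h
    · exact basis_mem_coordSpan fun i => (h i).le
    · exact zero_mem _
  exact this trivial

theorem pr_eq_zero_of_KT {κ κ' : Fin n → ℕ} (h : ¬ κ ≤ κ') {y : TPow n V} (hy : y ∈ B.KT κ') :
    B.pr κ y = 0 := by
  have : B.KT κ' ≤ LinearMap.ker (B.pr κ) := coordSpan_le fun ζ hζ => by
    rw [LinearMap.mem_ker, pr_zT, if_neg]
    intro h'
    exact h fun i => (h' i).symm.le.trans (hζ i)
  exact this hy

theorem sub_pr_mem {κ : Fin n → ℕ} {y : TPow n V} (hy : y ∈ B.KT κ) :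
    B.pr κ y - y ∈ B.Kdeg n (∑ i, κ i) := by
  have : B.KT κ ≤ (B.Kdeg n (∑ i, κ i)).comap (B.pr κ - 1) := coordSpan_le fun ζ hζ => by
    rw [Submodule.mem_comap, LinearMap.sub_apply, pr_zT, Module.End.one_apply]
    split_ifs with h
    · rw [sub_self]; exact zero_mem _
    · rw [zero_sub]
      refine Submodule.neg_mem _ (basis_mem_coordSpan ?_)
      obtain ⟨i, hi⟩ := not_forall.1 h
      exact Finset.sum_lt_sum (fun j _ => hζ j) ⟨i, Finset.mem_univ _, lt_of_le_of_ne (hζ i) hi⟩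
  exact this hy

theorem pr_eq_zero_of_Kdeg {κ : Fin n → ℕ} {y : TPow n V} (hy : y ∈ B.Kdeg n (∑ i, κ i)) :
    B.pr κ y = 0 := by
  have : B.Kdeg n (∑ i, κ i) ≤ LinearMap.ker (B.pr κ) := coordSpan_le fun ζ hζ => by
    rw [LinearMap.mem_ker, pr_zT, if_neg]
    intro h'
    exact absurd hζ (by simp [h'])
  exact this hy

/-- A basis tensor with degree vector `κ'` is mapped by `f` into `KT κ'`. If `κ' = κ`, then `pr κ`
is the identity there up to lower degree. If `κ' ≠ κ` and the total of `κ'` is at most that of `κ`,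
then `κ ≤ κ'` fails and `pr κ` vanishes on both sides. -/
theorem pr_comm {f : Module.End ℂ (TPow n V)} (hf : ∀ j, place j x * f = f * place j x)
    {κ : Fin n → ℕ} {y : TPow n V} (hy : y ∈ B.Kdeg n (∑ i, κ i + 1)) :
    B.pr κ (f y) - f (B.pr κ y) ∈ B.Kdeg n (∑ i, κ i) := by
  have : B.Kdeg n (∑ i, κ i + 1) ≤
      (B.Kdeg n (∑ i, κ i)).comap (B.pr κ * f - f * B.pr κ) := coordSpan_le fun ζ hζ => by
    rw [Submodule.mem_comap, LinearMap.sub_apply, Module.End.mul_apply, Module.End.mul_apply, pr_zT]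
    have hz : B.zT n ζ ∈ B.KT (fun i => (ζ i).2) := basis_mem_coordSpan (by simp)
    have h1 := B.KT_stable hf hz
    split_ifs with h
    · obtain rfl : (fun i => ((ζ i).2 : ℕ)) = κ := funext h
      exact B.sub_pr_mem h1
    · rw [B.pr_eq_zero_of_KT _ h1, map_zero, sub_self]
      · exact zero_mem _
      · intro h2
        have h3 : ∑ i, ((ζ i).2 : ℕ) < ∑ i, κ i + 1 := hζ
        have h5 : ∑ i, κ i ≤ ∑ i, ((ζ i).2 : ℕ) := Finset.sum_le_sum fun i _ => h2 i
        have h4 := (Finset.sum_eq_sum_iff_of_le (fun i _ => h2 i)).1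
          (show ∑ i, κ i = ∑ i, ((ζ i).2 : ℕ) by omega)
        exact h fun i => (h4 i (Finset.mem_univ i)).symm
  exact this hy

theorem sum_pr_sub_mem {r : ℕ} (hd : ∀ p, d p < r) {s : ℕ} {y : TPow n V}
    (hy : y ∈ B.Kdeg n (s + 1)) :
    ∑ κ : {κ : Fin n → Fin r // ∑ i, (κ i : ℕ) = s}, B.pr (fun i => κ.1 i) y - y ∈
      B.Kdeg n s := by
  classical
  have : B.Kdeg n (s + 1) ≤ (B.Kdeg n s).comap
      (∑ κ : {κ : Fin n → Fin r // ∑ i, (κ i : ℕ) = s}, B.pr (fun i => κ.1 i) - 1) :=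
    coordSpan_le fun ζ hζ => by
    rw [Submodule.mem_comap, LinearMap.sub_apply, LinearMap.sum_apply, Module.End.one_apply]
    have hζ' : ∑ i, ((ζ i).2 : ℕ) < s + 1 := hζ
    rcases Nat.lt_or_ge (∑ i, ((ζ i).2 : ℕ)) s with h | h
    · rw [Finset.sum_eq_zero]
      · rw [zero_sub]
        exact Submodule.neg_mem _ (basis_mem_coordSpan h)
      · intro κ _
        refine B.pr_eq_zero_of_Kdeg (basis_mem_coordSpan ?_)
        rw [κ.2]
        exact h
    · have hs : ∑ i, ((ζ i).2 : ℕ) = s := by omega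
      rw [Finset.sum_eq_single ⟨fun i => ⟨(ζ i).2, by have := (ζ i).2.2; have := hd (ζ i).1; omega⟩,
        hs⟩]
      · rw [pr_zT, if_pos fun i => rfl, sub_self]
        exact zero_mem _
      · intro κ _ hκ
        rw [pr_zT, if_neg]
        intro h'
        exact hκ (Subtype.ext (funext fun i => Fin.ext (h' i).symm))
      · simp
  have := this hy
  rwa [Submodule.mem_comap, LinearMap.sub_apply, LinearMap.sum_apply, Module.End.one_apply] at this

end Graded

/-! ### The corner of degree `s` as a matrix algebra closed under conjugate transposition -/

section Corner

variable [DecidableEq P]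

/-- `v_q ↦ v_p` for words `p`, `q`, all other `v_q'` being mapped to `0`. -/
def unitT (J J' : Fin n → P) : Module.End ℂ (TPow n V) :=
  tmap fun i => B.hom (Pi.single (J' i) (B.v (J i)))

theorem unitT_vT (J J' I : Fin n → P) : B.unitT J J' (B.vT I) = if I = J' then B.vT J else 0 := by
  rw [unitT, vT, tmap_tprod]
  simp only [hom_v]
  split_ifs with h
  · subst h; simp [vT]
  · obtain ⟨i, hi⟩ := Function.ne_iff.1 h
    exact (PiTensorProduct.tprod ℂ).map_coord_zero i (by simp [hi])

theorem zT_repr_vT (J J' : Fin n → P) :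
    (B.zT n).repr (B.vT J') (fun i => ⟨J i, Fin.last _⟩) = if J' = J then 1 else 0 := by
  rw [vT_eq, Module.Basis.repr_self, Finsupp.single_apply]
  congr 1
  refine propext ⟨fun h => funext fun i => congrArg Sigma.fst (congrFun h i), ?_⟩
  rintro rfl; rfl

variable [Fintype P]

/-- The words of degree `s`. -/
def degWords (d : P → ℕ) (n s : ℕ) : Finset (Fin n → P) := {J | ∑ i, d (J i) = s}

theorem mem_degWords {P : Type} [Fintype P] {d : P → ℕ} {n s : ℕ} {J : Fin n → P} :
    J ∈ degWords d n s ↔ ∑ i, d (J i) = s := by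
  simp [degWords]

theorem proj_degWords_mem (s : ℕ) : B.proj (degWords d n s) ∈ Sch n x := by
  refine B.proj_mem_Sch fun w J hJ => ?_
  rw [mem_degWords] at hJ ⊢
  rw [← hJ, Equiv.sum_comp w (fun i => d (J i))]

/-- The matrix of the coefficients of the `v_J` with `J` of degree `s` in the `f v_{J'}`. -/
def degMat (s : ℕ) (f : Module.End ℂ (TPow n V)) : Matrix (Fin n → P) (Fin n → P) ℂ :=
  fun J J' => if J ∈ degWords d n s ∧ J' ∈ degWords d n s then
    (B.zT n).repr (f (B.vT J')) (fun i => ⟨J i, Fin.last _⟩) else 0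

/-- In the weight space of a word `J` of degree `s`, the tensor `v_J` is the only basis tensor of
degree `s`, all others being smaller. So modulo `Kdeg n s` the projection is known from the
coefficients of the `v_J`. -/
theorem proj_degWords_sub_mem (s : ℕ) (y : TPow n V) :
    B.proj (degWords d n s) y - ∑ J ∈ degWords d n s,
      (B.zT n).repr y (fun i => ⟨J i, Fin.last _⟩) • B.vT J ∈ B.Kdeg n s := by
  have : (⊤ : Submodule ℂ (TPow n V)) ≤ (B.Kdeg n s).comap (B.proj (degWords d n s) -
      ∑ J ∈ degWords d n s, ((B.zT n).coord (fun i => ⟨J i, Fin.last _⟩)).smulRight (B.vT J)) := by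
    rw [← (B.zT n).span_eq, Submodule.span_le]
    rintro _ ⟨ζ, rfl⟩
    rw [SetLike.mem_coe, Submodule.mem_comap, LinearMap.sub_apply, LinearMap.sum_apply, proj_zT]
    simp only [LinearMap.smulRight_apply, Module.Basis.coord_apply, Module.Basis.repr_self]
    by_cases hl : ζ = fun i => ⟨(ζ i).1, Fin.last _⟩
    · obtain ⟨J, rfl⟩ : ∃ J : Fin n → P, ζ = fun i => ⟨J i, Fin.last _⟩ := ⟨_, hl⟩
      have h1 : ∀ J', Finsupp.single (fun i => (⟨J i, Fin.last _⟩ : (p : P) × Fin (d p + 1)))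
          (1 : ℂ) (fun i => ⟨J' i, Fin.last _⟩) = if J = J' then 1 else 0 := by
        intro J'
        have := B.zT_repr_vT J' J
        rwa [vT_eq, Module.Basis.repr_self] at this
      simp only [h1, ite_smul, one_smul, zero_smul, Finset.sum_ite_eq, ← vT_eq, sub_self]
      exact zero_mem _
    · rw [Finset.sum_eq_zero, sub_zero]
      · split_ifs with h
        · refine basis_mem_coordSpan ?_
          rw [mem_degWords] at h
          rw [Set.mem_ofPred_eq, ← h]
          have hle : ∀ i, ((ζ i).2 : ℕ) ≤ d (ζ i).1 := fun i => Nat.lt_succ_iff.1 (ζ i).2.2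
          refine lt_of_le_of_ne (Finset.sum_le_sum fun i _ => hle i) fun h' => hl ?_
          have := (Finset.sum_eq_sum_iff_of_le (fun i _ => hle i)).1 h'
          funext i
          exact Sigma.ext rfl (heq_of_eq (Fin.ext (this i (Finset.mem_univ i))))
        · exact zero_mem _
      · intro J _
        rw [Finsupp.single_apply, if_neg, zero_smul]
        rintro rfl
        exact hl rfl
  have := this (x := y) trivial
  rwa [Submodule.mem_comap, LinearMap.sub_apply, LinearMap.sum_apply] at this

theorem repr_last_of_mem_Kdeg {s : ℕ} {J : Fin n → P} (hJ : J ∈ degWords d n s) {y : TPow n V}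
    (hy : y ∈ B.Kdeg n s) : (B.zT n).repr y (fun i => ⟨J i, Fin.last _⟩) = 0 := by
  refine hy _ ?_
  rw [mem_degWords] at hJ
  simp [hJ]

theorem degMat_eq_zero {s : ℕ} {f : Module.End ℂ (TPow n V)} (h : ∀ y, f y ∈ B.Kdeg n s) :
    B.degMat s f = 0 := by
  ext J J'
  rw [degMat]
  split_ifs with hJ
  · exact B.repr_last_of_mem_Kdeg hJ.1 (h _)
  · rfl

/-- The part of `g v_{J'}` neglected in `proj_degWords_sub_mem` has lower degree, stays there under
`f`, and so does not reach the coefficients of the `v_J`. -/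
theorem degMat_mul {s : ℕ} {f g : Module.End ℂ (TPow n V)}
    (hf : ∀ j, place j x * f = f * place j x) :
    B.degMat s (f * B.proj (degWords d n s) * g) = B.degMat s f * B.degMat s g := by
  ext J J'
  rw [Matrix.mul_apply, degMat]
  by_cases hJ' : J' ∈ degWords d n s
  swap
  · rw [if_neg fun h => hJ' h.2, Finset.sum_eq_zero]
    intro I _
    rw [degMat, degMat, if_neg fun h : I ∈ _ ∧ J' ∈ _ => hJ' h.2, mul_zero]
  by_cases hJ : J ∈ degWords d n s
  swap
  · rw [if_neg fun h => hJ h.1, Finset.sum_eq_zero]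
    intro I _
    rw [degMat, if_neg fun h : J ∈ _ ∧ I ∈ _ => hJ h.1, zero_mul]
  rw [if_pos ⟨hJ, hJ'⟩]
  have h1 := B.Kdeg_stable hf (B.proj_degWords_sub_mem s (g (B.vT J')))
  rw [map_sub] at h1
  have h2 := B.repr_last_of_mem_Kdeg hJ h1
  rw [map_sub, Finsupp.sub_apply, sub_eq_zero] at h2
  rw [mul_assoc, Module.End.mul_apply, Module.End.mul_apply, h2, map_sum, map_sum,
    Finsupp.finsetSum_apply, ← Finset.sum_subset (Finset.subset_univ (degWords d n s))]
  · refine Finset.sum_congr rfl fun I hI => ?_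
    rw [degMat, degMat, if_pos ⟨hJ, hI⟩, if_pos ⟨hI, hJ'⟩, map_smul, map_smul, Finsupp.smul_apply,
      smul_eq_mul, mul_comm]
  · intro I _ hI
    rw [degMat, if_neg fun h : J ∈ _ ∧ I ∈ _ => hI h.2, zero_mul]

theorem degMat_perm {s : ℕ} {f : Module.End ℂ (TPow n V)} (hf : f ∈ Sch n x)
    (w : Equiv.Perm (Fin n)) (J J' : Fin n → P) :
    B.degMat s f (fun i => J (w i)) (fun i => J' (w i)) = B.degMat s f J J' := by
  have h1 : ∀ J : Fin n → P, (fun i => J (w i)) ∈ degWords d n s ↔ J ∈ degWords d n s := by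
    intro J
    rw [mem_degWords, mem_degWords, Equiv.sum_comp w (fun i => d (J i))]
  have h2 : ∀ (y : TPow n V) ζ, (B.zT n).repr (permEnd w y) ζ =
      (B.zT n).repr y (fun i => ζ (w i)) := by
    intro y ζ
    have : ((B.zT n).coord ζ).comp (permEnd w) = (B.zT n).coord (fun i => ζ (w i)) := by
      refine (B.zT n).ext fun ξ => ?_
      rw [LinearMap.comp_apply, permEnd_zT, Module.Basis.coord_apply, Module.Basis.coord_apply,
        Module.Basis.repr_self, Module.Basis.repr_self, Finsupp.single_apply, Finsupp.single_apply]
      congr 1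
      refine propext ⟨?_, ?_⟩
      · rintro rfl; simp
      · rintro rfl; simp
    exact LinearMap.congr_fun this y
  have h3 : B.vT J' = permEnd w (B.vT fun i => J' (w i)) := by rw [permEnd_vT]; simp
  simp only [degMat, h1]
  rw [h3, Sch_permEnd hf, h2]

/-- An element of `Sch` with the conjugate transpose of `degMat s f` as its matrix. -/
def dag (s : ℕ) (f : Module.End ℂ (TPow n V)) : Module.End ℂ (TPow n V) :=
  ∑ J, ∑ J', star (B.degMat s f J' J) • B.unitT J J'

theorem degMat_dag {s : ℕ} (f : Module.End ℂ (TPow n V)) :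
    B.degMat s (B.dag s f) = (B.degMat s f).conjTranspose := by
  ext J J'
  rw [Matrix.conjTranspose_apply, degMat]
  split_ifs with h
  · simp only [dag, LinearMap.sum_apply, LinearMap.smul_apply, unitT_vT, smul_ite, smul_zero,
      Finset.sum_ite_eq, Finset.mem_univ, if_true, map_sum, map_smul, Finsupp.finsetSum_apply,
      Finsupp.smul_apply, zT_repr_vT, smul_eq_mul, mul_ite, mul_one, mul_zero, Finset.sum_ite_eq']
  · rw [degMat, if_neg fun h' => h h'.symm, star_zero]

/-- The place permutations are handled by `degMat_perm`. For `x`, a nonzero coefficient of `v_{J'}`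
in `f v_J` forces `d (J' i) ≤ d (J i)` for all `i`, and both words have total degree `s`, so these
degrees agree. Then `v_{J' i} ↦ v_{J i}` respects the relations of the cyclic generators, so the
reversed matrix unit commutes with `x` as well. -/
theorem dag_mem {s : ℕ} {f : Module.End ℂ (TPow n V)} (hf : f ∈ Sch n x) :
    B.dag s f ∈ Sch n x := by
  refine mem_Sch.2 ⟨fun w => ?_, fun j => ?_⟩
  · have h1 : ∀ J J', permEnd w * B.unitT J J' =
        B.unitT (fun i => J (w.symm i)) (fun i => J' (w.symm i)) * permEnd w :=
      fun J J' => permEnd_tmap w _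
    rw [dag, Finset.mul_sum, Finset.sum_mul]
    simp only [Finset.mul_sum, Finset.sum_mul, mul_smul_comm, smul_mul_assoc, h1]
    refine Fintype.sum_equiv (w.arrowCongr (Equiv.refl P)) _ _ fun J => ?_
    refine Fintype.sum_equiv (w.arrowCongr (Equiv.refl P)) _ _ fun J' => ?_
    have := B.degMat_perm (s := s) hf w.symm J' J
    rw [← this]
    rfl
  · rw [dag, Finset.mul_sum, Finset.sum_mul]
    refine Finset.sum_congr rfl fun J _ => ?_
    rw [Finset.mul_sum, Finset.sum_mul]
    refine Finset.sum_congr rfl fun J' _ => ?_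
    rw [mul_smul_comm, smul_mul_assoc]
    by_cases h0 : B.degMat s f J' J = 0
    · simp [h0]
    congr 1
    refine place_tmap j (B.hom_comm fun p => ?_)
    by_cases hp : p = J' j
    · subst hp
      rw [Pi.single_eq_same]
      refine coordSpan_mono ?_ (B.v_mem_K _)
      intro ζ hζ
      refine le_trans (show (ζ.2 : ℕ) ≤ d (J j) from hζ) (le_of_eq ?_)
      rw [degMat] at h0
      split_ifs at h0 with hJ
      · rw [mem_degWords, mem_degWords] at hJ
        have hle : ∀ i, d (J' i) ≤ d (J i) := by
          intro i
          by_contra hcon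
          refine h0 (B.KT_stable (mem_Sch.1 hf).2 (B.vT_mem_KT J) _ ?_)
          intro h
          exact hcon (by simpa using h i)
        exact ((Finset.sum_eq_sum_iff_of_le (fun i _ => hle i)).1 (hJ.1.trans hJ.2.symm) j
          (Finset.mem_univ j)).symm
      · exact absurd rfl h0
    · simp [hp]

/-- The matrix of a nilpotent element of the quotient vanishes if the same holds for its multiples. -/
theorem proj_mul_proj_mem_of_nilpotent {s : ℕ} {f : Module.End ℂ (TPow n V)} (hf : f ∈ Sch n x)
    {N : ℕ} (h : ∀ y, ((B.dag s f * B.proj (degWords d n s) * f * B.proj (degWords d n s)) ^ N) y ∈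
      B.Kdeg n s) (y : TPow n V) :
    (B.proj (degWords d n s) * f * B.proj (degWords d n s)) y ∈ B.Kdeg n s := by
  set E := B.proj (degWords d n s) with hE
  have hES := B.proj_degWords_mem (n := n) s
  rw [← hE] at hES
  have hdag := B.dag_mem (s := s) hf
  set g := B.dag s f * E * f with hg
  have hgS : g ∈ Sch n x := mul_mem (mul_mem hdag hES) hf
  have hmat : B.degMat s g = (B.degMat s f).conjTranspose * B.degMat s f := by
    rw [hg, hE, B.degMat_mul (mem_Sch.1 hdag).2, degMat_dag]
  -- The corner product inserts `E` between factors, so `(g E)^k g` stands for `k + 1` factors and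
  -- its matrix is the power `k + 1` of `Y* Y`, where `Y` is the matrix of `f`.
  have hpow : ∀ k, B.degMat s ((g * E) ^ k * g) = B.degMat s g ^ (k + 1) := by
    intro k
    induction k with
    | zero => simp
    | succ k ih =>
      rw [pow_succ', mul_assoc, hE, B.degMat_mul (mem_Sch.1 hgS).2, ← hE, ih,
        pow_succ' _ (k + 1)]
  have h0 : B.degMat s f = 0 := by
    refine eq_zero_of_conjTranspose_mul_self_pow _ (N + 1) ?_
    rw [← hmat, ← hpow]
    refine B.degMat_eq_zero fun y => ?_
    rw [Module.End.mul_apply]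
    exact h _
  refine B.range_le_of_vT (mem_Sch.1 (mul_mem (mul_mem hES hf) hES)).2
    (fun j y hy => B.Kdeg_stable (fun i => place_x_comm j i) hy) (fun J => ?_) y
  rw [Module.End.mul_apply, hE, proj_vT]
  split_ifs with hJ
  · have h1 := B.proj_degWords_sub_mem s (f (B.vT J))
    rwa [Finset.sum_eq_zero, sub_zero] at h1
    intro I hI
    have := congrFun (congrFun h0 I) J
    rw [degMat, if_pos ⟨hI, hJ⟩] at this
    rw [this, Matrix.zero_apply, zero_smul]
  · rw [map_zero]; exact zero_mem _

end Corner

end ChainBasis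
end SchurWeyl
end

noncomputable section
namespace SchurWeyl
-- The chain of degree ideals and quasi-heredity
namespace ChainBasis

variable {P V : Type} [AddCommGroup V] [Module ℂ V] {d : P → ℕ} {q : ℕ → ℂ} {x : Module.End ℂ V}
  (B : ChainBasis d q x) {n : ℕ} {R : Type} [Ring R] [Algebra ℂ R] (φ : R ≃ₐ[ℂ] Sch n x)

/-- The ideal of the elements that map into the span of the basis tensors of degree less than
`s`. -/
def degIdeal (s : ℕ) : Ideal R where
  carrier := {a | ∀ y, (φ a).1 y ∈ B.Kdeg n s}
  add_mem' {a b} ha hb y := by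
    rw [map_add]
    exact add_mem (ha y) (hb y)
  zero_mem' y := by
    rw [map_zero]
    exact zero_mem _
  smul_mem' c a ha y := by
    rw [smul_eq_mul, map_mul]
    exact B.Kdeg_stable (mem_Sch.1 (φ c).2).2 (ha y)

instance (s : ℕ) : (B.degIdeal φ s).IsTwoSided := ⟨fun {a} b ha y => by
  rw [map_mul]
  exact ha _⟩

theorem degIdeal_mono {s t : ℕ} (h : s ≤ t) : B.degIdeal φ s ≤ B.degIdeal φ t :=
  fun _ ha y => coordSpan_mono (fun _ hζ => lt_of_lt_of_le hζ h) (ha y)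

theorem mem_degIdeal_of_vT {s : ℕ} {a : R} (h : ∀ J, (φ a).1 (B.vT J) ∈ B.Kdeg n s) :
    a ∈ B.degIdeal φ s :=
  B.range_le_of_vT (mem_Sch.1 (φ a).2).2
    (fun j _ hy => B.Kdeg_stable (fun i => place_x_comm j i) hy) h

theorem isArtinianRing_of_equiv [Fintype P] (B : ChainBasis d q x) (φ : R ≃ₐ[ℂ] Sch n x) :
    IsArtinianRing R ∧ Module.Finite ℂ R := by
  have h1 : Module.Finite ℂ V := Module.Finite.of_basis B.z
  have h3 : Module.Finite ℂ (TPow n V) := Module.Finite.of_basis (B.zT n)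
  have h2 : Module.Finite ℂ R := Module.Finite.equiv φ.symm.toLinearEquiv
  exact ⟨IsArtinianRing.of_finite ℂ R, h2⟩

open scoped Classical in
/-- The elements of `V` that define `chi` for the dual basis. -/
def dualVec (ω J : Fin n → P) (i : Fin n) : V := if d (ω i) ≤ d (J i) then B.v (ω i) else 0

theorem dualVec_mem (ω J : Fin n → P) (i : Fin n) : B.dualVec ω J i ∈ B.K (d (J i)) := by
  rw [dualVec]
  split_ifs with h
  · exact coordSpan_mono (fun ζ hζ => le_trans (show (ζ.2 : ℕ) ≤ d (ω i) from hζ) h) (B.v_mem_K _)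
  · exact zero_mem _

variable [DecidableEq P]

theorem theta_mem_Kdeg {ω : Fin n → P} (hω : Function.Injective ω) {s : ℕ} {y : TPow n V}
    (hy : y ∈ B.KT fun i => d (ω i)) (hs : y ∈ B.Kdeg n s) (J : Fin n → P) :
    B.theta ω y (B.vT J) ∈ B.Kdeg n s := by
  by_cases hJ : J ∈ orb ω
  · obtain ⟨w, rfl⟩ := mem_orb.1 hJ
    rw [B.theta_vT_comp ω hω hy]
    exact B.Kdeg_permEnd _ hs
  · rw [B.theta_vT_of_notMem ω hJ]
    exact zero_mem _

section DualBasis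

variable (ω J : Fin n → P)

theorem eps_dualVec (i : Fin n) : B.eps (ω i) (B.dualVec ω J i) = B.dualVec ω J i := by
  rw [dualVec]
  split_ifs with h
  · rw [eps_v, if_pos rfl]
  · rw [map_zero]

/-- The dual coordinate `f ↦ theta (pr (f v_J))`. -/
def dualCoord : R →ₗ[ℂ] R :=
  φ.symm.toLinearMap ∘ₗ
    ((B.theta ω ∘ₗ B.pr (fun i => d (ω i)) ∘ₗ LinearMap.applyₗ (B.vT J) ∘ₗ (Sch n x).val.toLinearMap
      ∘ₗ φ.toLinearMap).codRestrict (Subalgebra.toSubmodule (Sch n x)) fun _ => B.theta_mem ω _)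

theorem dualCoord_apply (a : R) : (φ (B.dualCoord φ ω J a)).1 =
    B.theta ω (B.pr (fun i => d (ω i)) ((φ a).1 (B.vT J))) := by
  rw [dualCoord]
  exact congrArg Subtype.val (φ.apply_symm_apply _)

/-- The dual basis vector that belongs to `dualCoord`. -/
def dualElem : R := (n.factorial : ℂ)⁻¹ •
  φ.symm ⟨B.chi ω J (B.dualVec ω J), B.chi_mem ω (B.dualVec_mem ω J)⟩

theorem dualElem_apply : (φ (B.dualElem φ ω J)).1 =
    (n.factorial : ℂ)⁻¹ • B.chi ω J (B.dualVec ω J) := by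
  rw [dualElem, map_smul, φ.apply_symm_apply]
  rfl

variable {ω} in
-- `dualVec` is set to zero wherever `d (ω i)` exceeds `d (J i)`, to keep `chi` in `Sch`. Nothing is
-- lost: `f v_J` lies in `KT (d ∘ J)`, so its component of degree vector `d ∘ ω` vanishes unless `d
-- ∘ ω ≤ d ∘ J`.
theorem theta_pr_tprod (hω : Function.Injective ω) {f : Module.End ℂ (TPow n V)}
    (hf : ∀ j, place j x * f = f * place j x) (w : Equiv.Perm (Fin n)) :
    B.theta ω (B.pr (fun i => d (ω i)) (f (B.vT J)))
      (PiTensorProduct.tprod ℂ fun i => B.dualVec ω J (w i)) =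
      permEnd w.symm (B.pr (fun i => d (ω i)) (f (B.vT J))) := by
  by_cases h : (fun i => d (ω i)) ≤ fun i => d (J i)
  · rw [← B.theta_vT_comp ω hω (B.pr_mem_KT _ _)]
    congr 2
    funext i
    rw [dualVec, if_pos (h _)]
  · rw [B.pr_eq_zero_of_KT h (B.KT_stable hf (B.vT_mem_KT J))]
    simp

end DualBasis

variable [Fintype P]

/-- Elements whose class is in the radical vanish on the corner of degree `s`. -/
theorem corner_mem_of_jacobson {s : ℕ} {a : R}
    (ha : Ideal.Quotient.mk (B.degIdeal φ s) a ∈ Ring.jacobson (R ⧸ B.degIdeal φ s))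
    (y : TPow n V) :
    (B.proj (degWords d n s) * (φ a).1 * B.proj (degWords d n s)) y ∈ B.Kdeg n s := by
  have hart := (B.isArtinianRing_of_equiv φ).1
  have hart' : IsArtinianRing (R ⧸ B.degIdeal φ s) :=
    Function.Surjective.isArtinianRing (f := Ideal.Quotient.mk (B.degIdeal φ s))
      Ideal.Quotient.mk_surjective
  obtain ⟨N, hN⟩ : IsNilpotent (Ring.jacobson (R ⧸ B.degIdeal φ s)) :=
    IsSemiprimaryRing.isNilpotent
  set E : R := φ.symm ⟨B.proj (degWords d n s), B.proj_degWords_mem s⟩ with hE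
  set g : R := φ.symm ⟨B.dag s (φ a).1, B.dag_mem (φ a).2⟩ with hg
  refine B.proj_mul_proj_mem_of_nilpotent (φ a).2 (N := N) ?_ y
  -- The radical of an Artinian ring is nilpotent, and it contains the class of `a† E a E`, so a
  -- power of this element lies in the ideal; here `a†` is the conjugate transpose `dag`.
  have h1 : Ideal.Quotient.mk (B.degIdeal φ s) (g * E * a * E) ∈
      Ring.jacobson (R ⧸ B.degIdeal φ s) := by
    rw [map_mul, map_mul]
    exact Ideal.mul_mem_right _ _ (Ideal.mul_mem_left _ _ ha)
  have h2 := Ideal.pow_mem_pow h1 N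
  rw [hN, ← map_pow] at h2
  have h3 := Ideal.Quotient.eq_zero_iff_mem.1 (show _ = 0 from h2)
  intro y
  have h4 := h3 y
  rw [map_pow, map_mul, map_mul, map_mul, hE, hg, φ.apply_symm_apply, φ.apply_symm_apply] at h4
  exact h4

/-- The algebra `Sch` is quasi-hereditary if every block has enough indices. -/
theorem isQuasiHereditary_of_equiv (B : ChainBasis d q x) (φ : R ≃ₐ[ℂ] Sch n x) {r : ℕ}
    (hd : ∀ p, d p < r) (idx : Fin r → Fin n → P) (hidx : ∀ k i, d (idx k i) = k)
    (hinj : ∀ k k' i i', idx k i = idx k' i' → i = i') : IsQuasiHereditary ℂ R := by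
  -- All degrees of basis tensors are at most `n * r`, because `d p < r`; hence the ideal with bound
  -- `n * r + 1` is everything, and the one with bound `0` is zero.
  refine ⟨(B.isArtinianRing_of_equiv φ).2, n * r + 1, B.degIdeal φ, inferInstance, ?_, ?_, ?_⟩
  · rw [eq_bot_iff]
    intro a ha
    rw [Submodule.mem_bot, ← φ.map_eq_zero_iff]
    refine Subtype.ext (LinearMap.ext fun y => ?_)
    have h1 : B.Kdeg n 0 ≤ ⊥ := coordSpan_le fun ζ hζ => absurd hζ (by simp)
    exact h1 (ha y)
  · rw [eq_top_iff]
    intro a _ y ζ hζ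
    refine absurd (Nat.lt_succ_of_le ?_) hζ
    calc ∑ i, ((ζ i).2 : ℕ) ≤ ∑ i : Fin n, r := Finset.sum_le_sum fun i _ => by
          have := (ζ i).2.2; have := hd (ζ i).1; omega
      _ = n * r := by simp
  intro s _
  refine ⟨B.degIdeal_mono φ s.le_succ, ?_⟩
  -- For each degree vector `κ` of total `s`, a word with distinct letters that realizes it: the
  -- `i`-th letter is the `i`-th chosen index of the block `κ i`.
  set Ω : {κ : Fin n → Fin r // ∑ i, (κ i : ℕ) = s} → Fin n → P := fun κ i => idx (κ.1 i) i with hΩ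
  have hΩi : ∀ κ, Function.Injective (Ω κ) := fun κ i i' h => hinj _ _ _ _ h
  have hΩd : ∀ κ, (fun i => d (Ω κ i)) = fun i => (κ.1 i : ℕ) := fun κ => funext fun i => hidx _ _
  have hΩs : ∀ κ, ∑ i, d (Ω κ i) = s := fun κ => by
    rw [← κ.2]; exact Finset.sum_congr rfl fun i _ => hidx _ _
  have hKT : ∀ κ, B.KT (fun i => d (Ω κ i)) ≤ B.Kdeg n (s + 1) := fun κ =>
    B.KT_le_Kdeg (by rw [hΩs]; exact s.lt_succ_self)
  have horb : ∀ κ, orb (Ω κ) ⊆ degWords d n s := by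
    intro κ J hJ
    obtain ⟨w, rfl⟩ := mem_orb.1 hJ
    rw [mem_degWords, ← hΩs κ, Equiv.sum_comp w (fun i => d (Ω κ i))]
  -- At `v_{J'}` the sum becomes the average over `w` of `w⁻¹` applied to `∑_κ pr κ (y v_{J' ∘
  -- w⁻¹})`. On `Kdeg n (s + 1)` the sum of the `pr κ` is the identity up to lower degree, and `y`
  -- commutes with permutations, so each summand gives `y v_{J'}`.
  have hdual : ∀ y ∈ B.degIdeal φ (s + 1),
      ∑ i : {κ : Fin n → Fin r // ∑ i, (κ i : ℕ) = s} × (Fin n → P),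
        (B.dualCoord φ (Ω i.1) i.2).toAddMonoidHom y * B.dualElem φ (Ω i.1) i.2 - y ∈
          B.degIdeal φ s := by
    intro y hy
    refine B.mem_degIdeal_of_vT φ fun J' => ?_
    set f := (φ y).1 with hf
    have hfS : f ∈ Sch n x := (φ y).2
    have hval : ∀ i : {κ : Fin n → Fin r // ∑ i, (κ i : ℕ) = s} × (Fin n → P),
        (φ ((B.dualCoord φ (Ω i.1) i.2).toAddMonoidHom y * B.dualElem φ (Ω i.1) i.2)).1 (B.vT J') =
        (n.factorial : ℂ)⁻¹ • ∑ w : Equiv.Perm (Fin n), if (fun j => i.2 (w j)) = J' then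
          permEnd w.symm (B.pr (fun j => d (Ω i.1 j)) (f (B.vT i.2))) else 0 := by
      rintro ⟨κ, J⟩
      rw [map_mul]
      change (φ (B.dualCoord φ (Ω κ) J y)).1 ((φ (B.dualElem φ (Ω κ) J)).1 (B.vT J')) = _
      rw [dualElem_apply, dualCoord_apply, LinearMap.smul_apply, map_smul,
        B.chi_vT (Ω κ) J (hΩi κ) (B.eps_dualVec (Ω κ) J), map_sum]
      congr 1
      refine Finset.sum_congr rfl fun w _ => ?_
      split_ifs
      · exact B.theta_pr_tprod J (hΩi κ) (mem_Sch.1 hfS).2 w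
      · rw [map_zero]
    have hsum : (φ (∑ i : {κ : Fin n → Fin r // ∑ i, (κ i : ℕ) = s} × (Fin n → P),
        (B.dualCoord φ (Ω i.1) i.2).toAddMonoidHom y * B.dualElem φ (Ω i.1) i.2 - y)).1 (B.vT J') =
        (n.factorial : ℂ)⁻¹ • ∑ w : Equiv.Perm (Fin n), permEnd w.symm
          (∑ κ : {κ : Fin n → Fin r // ∑ i, (κ i : ℕ) = s},
            B.pr (fun i => κ.1 i) (f (B.vT fun i => J' (w.symm i))) -
              f (B.vT fun i => J' (w.symm i))) := by
      have h1 : ∀ w : Equiv.Perm (Fin n), permEnd w.symm (f (B.vT fun i => J' (w.symm i))) =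
          f (B.vT J') := by
        intro w
        rw [← Sch_permEnd hfS, permEnd_vT]
        simp
      simp only [map_sub, h1, Finset.sum_sub_distrib, Finset.sum_const, Finset.card_univ,
        Fintype.card_perm, Fintype.card_fin, smul_sub]
      rw [← Nat.cast_smul_eq_nsmul ℂ, smul_smul, inv_mul_cancel₀ (by
        exact_mod_cast n.factorial_ne_zero), one_smul]
      change (φ (∑ i : {κ : Fin n → Fin r // ∑ i, (κ i : ℕ) = s} × (Fin n → P),
        (B.dualCoord φ (Ω i.1) i.2).toAddMonoidHom y * B.dualElem φ (Ω i.1) i.2)).1 (B.vT J') -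
          f (B.vT J') = _
      congr 1
      rw [map_sum, AddSubmonoidClass.coe_finsetSum, LinearMap.sum_apply]
      simp only [hval]
      rw [← Finset.smul_sum, Finset.sum_comm]
      congr 1
      refine Finset.sum_congr rfl fun w _ => ?_
      rw [Fintype.sum_prod_type, map_sum]
      refine Finset.sum_congr rfl fun κ _ => ?_
      simp only [hΩd]
      rw [Finset.sum_eq_single fun i => J' (w.symm i)]
      · simp
      · intro J _ hJ
        rw [if_neg]
        rintro rfl
        exact hJ (by simp)
      · simp
    rw [hsum]
    refine Submodule.smul_mem _ _ (Submodule.sum_mem _ fun w _ => B.Kdeg_permEnd _ ?_)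
    exact B.sum_pr_sub_mem hd (hy _)
  have hcoord : ∀ (κ : {κ : Fin n → Fin r // ∑ i, (κ i : ℕ) = s}) (J : Fin n → P), ∀ y,
      (B.dualCoord φ (Ω κ) J).toAddMonoidHom y ∈ B.degIdeal φ (s + 1) := by
    intro κ J y
    refine B.mem_degIdeal_of_vT φ fun J' => ?_
    change (φ (B.dualCoord φ (Ω κ) J y)).1 (B.vT J') ∈ _
    rw [dualCoord_apply]
    exact B.theta_mem_Kdeg (hΩi κ) (B.pr_mem_KT _ _) (hKT κ (B.pr_mem_KT _ _)) J'
  have helem : ∀ (κ : {κ : Fin n → Fin r // ∑ i, (κ i : ℕ) = s}) (J : Fin n → P),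
      B.proj (degWords d n s) * (φ (B.dualElem φ (Ω κ) J)).1 = (φ (B.dualElem φ (Ω κ) J)).1 := by
    intro κ J
    rw [dualElem_apply, mul_smul_comm, chi, ← mul_assoc, proj_mul_proj,
      Finset.inter_eq_right.2 (horb κ)]
  have hcoord' : ∀ (κ : {κ : Fin n → Fin r // ∑ i, (κ i : ℕ) = s}) (J : Fin n → P) (y : R),
      (φ (B.dualCoord φ (Ω κ) J y)).1 * B.proj (degWords d n s) =
        (φ (B.dualCoord φ (Ω κ) J y)).1 := by
    intro κ J y
    rw [dualCoord_apply, ← theta_proj, mul_assoc, proj_mul_proj,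
      Finset.inter_eq_left.2 (horb κ)]
  refine isHeredityIdeal_of_dualBasis (B.degIdeal_mono φ s.le_succ)
    (ι := {κ : Fin n → Fin r // ∑ i, (κ i : ℕ) = s} × (Fin n → P))
    (fun i => (B.dualCoord φ (Ω i.1) i.2).toAddMonoidHom) (fun i => B.dualElem φ (Ω i.1) i.2)
    ?_ ?_ ?_ ?_ hdual ?_
  · rintro ⟨κ, J⟩
    refine B.mem_degIdeal_of_vT φ fun J' => ?_
    simp only
    rw [dualElem_apply, LinearMap.smul_apply,
      B.chi_vT (Ω κ) J (hΩi κ) (B.eps_dualVec (Ω κ) J)]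
    refine Submodule.smul_mem _ _ (Submodule.sum_mem _ fun w _ => ?_)
    split_ifs
    · by_cases h : ∀ i, d (Ω κ i) ≤ d (J i)
      · have : (fun i => B.dualVec (Ω κ) J (w i)) = fun i => B.v (Ω κ (w i)) :=
          funext fun i => by rw [dualVec, if_pos (h _)]
        rw [this]
        refine B.KT_le_Kdeg ?_ (B.vT_mem_KT fun i => Ω κ (w i))
        rw [Equiv.sum_comp w (fun i => d (Ω κ i)), hΩs]
        exact s.lt_succ_self
      · obtain ⟨i, hi⟩ := not_forall.1 h
        rw [(PiTensorProduct.tprod ℂ).map_coord_zero (w.symm i)]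
        · exact zero_mem _
        · rw [Equiv.apply_symm_apply, dualVec, if_neg hi]
    · exact zero_mem _
  · rintro ⟨κ, J⟩ y hy
    refine B.mem_degIdeal_of_vT φ fun J' => ?_
    change (φ (B.dualCoord φ (Ω κ) J y)).1 (B.vT J') ∈ _
    rw [dualCoord_apply, B.pr_eq_zero_of_Kdeg (by rw [hΩs]; exact hy _), map_zero]
    exact zero_mem _
  · rintro ⟨κ, J⟩ y hy
    exact hcoord κ J y
  · rintro ⟨κ, J⟩ a y hy
    refine B.mem_degIdeal_of_vT φ fun J' => ?_
    have ha := (mem_Sch.1 (φ a).2).2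
    -- Multiplication by `a` passes through `theta`: `a θ(u) = θ(a u)`, since both sides agree on
    -- the rearrangements of `v_ω` and vanish on the other `v_J`. The defect of linearity is
    -- therefore that of `pr κ`, which `pr_comm` bounds.
    have h1 : (φ (a * B.dualCoord φ (Ω κ) J y)).1 = B.theta (Ω κ)
        ((φ a).1 (B.pr (fun i => d (Ω κ i)) ((φ y).1 (B.vT J)))) := by
      have hpr := B.pr_mem_KT (fun i => d (Ω κ i)) ((φ y).1 (B.vT J))
      rw [map_mul]
      refine B.ext_vT (mem_Sch.1 ((φ a) * φ (B.dualCoord φ (Ω κ) J y)).2).2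
        (mem_Sch.1 (B.theta_mem _ _)).2 fun I => ?_
      change (φ a).1 ((φ (B.dualCoord φ (Ω κ) J y)).1 (B.vT I)) = _
      rw [dualCoord_apply]
      by_cases hI : I ∈ orb (Ω κ)
      · obtain ⟨w, rfl⟩ := mem_orb.1 hI
        rw [B.theta_vT_comp _ (hΩi κ) hpr, B.theta_vT_comp _ (hΩi κ) (B.KT_stable ha hpr),
          Sch_permEnd (φ a).2]
      · rw [B.theta_vT_of_notMem _ hI, B.theta_vT_of_notMem _ hI, map_zero]
    have h2 : (φ ((B.dualCoord φ (Ω κ) J).toAddMonoidHom (a * y) -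
        a * (B.dualCoord φ (Ω κ) J).toAddMonoidHom y)).1 = B.theta (Ω κ)
          (B.pr (fun i => d (Ω κ i)) ((φ a).1 ((φ y).1 (B.vT J))) -
            (φ a).1 (B.pr (fun i => d (Ω κ i)) ((φ y).1 (B.vT J)))) := by
      rw [map_sub, map_sub, ← h1]
      change (φ (B.dualCoord φ (Ω κ) J (a * y))).1 - _ = _
      rw [dualCoord_apply, map_mul]
      rfl
    rw [h2]
    refine B.theta_mem_Kdeg (hΩi κ) (Submodule.sub_mem _ (B.pr_mem_KT _ _)
      (B.KT_stable ha (B.pr_mem_KT _ _))) ?_ J'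
    have := B.pr_comm ha (κ := fun i => d (Ω κ i)) (y := (φ y).1 (B.vT J))
      (by rw [hΩs]; exact hy _)
    rwa [hΩs] at this
  -- After expansion of `a` and `c` in the dual basis, the middle factor `e_i y F_j(c)` lies in the
  -- corner of degree `s` by `helem` and `hcoord'`, and its class is in the radical; such elements
  -- vanish modulo lower degree.
  · intro a ha y hy c hc
    have key : ∀ i j : {κ : Fin n → Fin r // ∑ i, (κ i : ℕ) = s} × (Fin n → P),
        (B.dualCoord φ (Ω i.1) i.2 a * B.dualElem φ (Ω i.1) i.2) * y *
          (B.dualCoord φ (Ω j.1) j.2 c * B.dualElem φ (Ω j.1) j.2) ∈ B.degIdeal φ s := by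
      intro i j
      have h1 : B.dualElem φ (Ω i.1) i.2 * y * B.dualCoord φ (Ω j.1) j.2 c ∈ B.degIdeal φ s := by
        intro u
        have h2 := B.corner_mem_of_jacobson φ (a := B.dualElem φ (Ω i.1) i.2 * y *
          B.dualCoord φ (Ω j.1) j.2 c) (by
            rw [map_mul, map_mul]
            exact Ideal.mul_mem_right _ _ (Ideal.mul_mem_left _ _ hy)) u
        have h3 : (φ (B.dualElem φ (Ω i.1) i.2 * y * B.dualCoord φ (Ω j.1) j.2 c)).1 =
            (φ (B.dualElem φ (Ω i.1) i.2)).1 * (φ y).1 * (φ (B.dualCoord φ (Ω j.1) j.2 c)).1 := by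
          rw [map_mul, map_mul]; rfl
        rw [h3] at h2 ⊢
        rwa [mul_assoc _ _ (B.proj (degWords d n s)), mul_assoc _ _ (B.proj (degWords d n s)),
          hcoord', ← mul_assoc, ← mul_assoc, helem] at h2
      have h4 := Ideal.mul_mem_right (B.dualElem φ (Ω j.1) j.2) _
        (Ideal.mul_mem_left _ (B.dualCoord φ (Ω i.1) i.2 a) h1)
      simpa only [mul_assoc] using h4
    have ha' := Ideal.Quotient.eq.2 (hdual a ha)
    have hc' := Ideal.Quotient.eq.2 (hdual c hc)
    rw [← Ideal.Quotient.eq_zero_iff_mem, map_mul, map_mul, ← ha', ← hc', ← map_mul, ← map_mul,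
      Ideal.Quotient.eq_zero_iff_mem, Finset.sum_mul, Finset.sum_mul]
    refine Submodule.sum_mem _ fun i _ => ?_
    rw [Finset.mul_sum]
    exact Submodule.sum_mem _ fun j _ => key i j

end ChainBasis
end SchurWeyl
end

noncomputable section
namespace SchurWeyl

/-! ### `Sch` is generated by primitive elements -/

section Symmetrization

variable {V : Type} [AddCommGroup V] [Module ℂ V] {n : ℕ}

/-- The symmetrization of the tensor product of the `b i`, `i ∈ T`. -/
def symSum (T : Finset (Fin n)) (b : Fin n → Module.End ℂ V) : Module.End ℂ (TPow n V) :=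
  ∑ g : Equiv.Perm (Fin n), tmap fun i => if g i ∈ T then b (g i) else 1

theorem tmap_mul_place (f : Fin n → Module.End ℂ V) (j : Fin n) (c : Module.End ℂ V) :
    tmap f * place j c = tmap (Function.update f j (f j * c)) := by
  ext v
  simp only [LinearMap.compMultilinearMap_apply, Module.End.mul_apply, tmap_tprod, place_tprod]
  congr 1
  funext i
  by_cases hi : i = j
  · subst hi; simp
  · simp [hi]

/-- The new factor `b a` falls either on a place that already carries some `b c`, which it
multiplies, or on a free place; each of the free labels outside `T` contributes the same sum. -/
theorem symSum_mul_tensorLie (T : Finset (Fin n)) (b : Fin n → Module.End ℂ V) {a : Fin n}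
    (ha : a ∉ T) : symSum T b * tensorLie (b a) =
      ∑ c ∈ T, symSum T (Function.update b c (b c * b a)) +
        (Tᶜ.card : ℂ) • symSum (insert a T) b := by
  have h1 : symSum T b * tensorLie (b a) = ∑ c, ∑ g : Equiv.Perm (Fin n),
      tmap (fun i => if g i = c then (if c ∈ T then b c else 1) * b a else
        if g i ∈ T then b (g i) else 1) := by
    rw [symSum, tensorLie_apply, Finset.sum_mul_sum,
      Finset.sum_comm (s := (Finset.univ : Finset (Fin n)))]
    refine Finset.sum_congr rfl fun g _ => ?_
    refine Fintype.sum_equiv g _ _ fun j => ?_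
    rw [tmap_mul_place]
    congr 1
    funext i
    by_cases hi : i = j
    · subst hi; simp
    · simp [hi]
  rw [h1, ← Finset.sum_add_sum_compl T]
  congr 1
  · refine Finset.sum_congr rfl fun c hc => Finset.sum_congr rfl fun g _ => ?_
    congr 1
    funext i
    by_cases hi : g i = c
    · simp [hi, hc]
    · simp [hi]
  · rw [Nat.cast_smul_eq_nsmul, ← Finset.sum_const]
    refine Finset.sum_congr rfl fun c hc => ?_
    rw [Finset.mem_compl] at hc
    rw [symSum]
    -- Exchanging the labels `a` and `c` in the permutation renames the free label `c` to `a`.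
    refine Fintype.sum_equiv (Equiv.mulLeft (Equiv.swap a c)) _ _ fun g => ?_
    congr 1
    funext i
    simp only [Equiv.coe_mulLeft, Equiv.Perm.mul_apply, if_neg hc, one_mul, Finset.mem_insert]
    by_cases h2 : g i = c
    · rw [if_pos h2, h2, Equiv.swap_apply_right, if_pos (Or.inl rfl)]
    by_cases h3 : g i = a
    · rw [if_neg h2, h3, Equiv.swap_apply_left, if_neg ha, if_neg]
      rintro (h | h)
      · exact h2 (h3.trans h.symm)
      · exact hc h
    · rw [if_neg h2, Equiv.swap_apply_of_ne_of_ne h3 h2]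
      simp [h3]

/-- Solve the product formula for the sum over `insert a T`, dividing by the number of free labels.
The correction terms have the same `T` with modified `b`, so the induction must be over all families
`b` at once. -/
theorem symSum_mem {x : Module.End ℂ V} {R : Subalgebra ℂ (Module.End ℂ (TPow n V))}
    (hR : ∀ b, x * b = b * x → tensorLie b ∈ R) (T : Finset (Fin n)) :
    ∀ b : Fin n → Module.End ℂ V, (∀ i, x * b i = b i * x) → symSum T b ∈ R := by
  induction T using Finset.induction_on with
  | empty =>
    intro b _
    rw [symSum]
    refine sum_mem fun g _ => ?_
    simp only [Finset.notMem_empty, if_false]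
    rw [tmap, PiTensorProduct.map_one]
    exact one_mem _
  | insert a T ha ih =>
    intro b hb
    have h1 := symSum_mul_tensorLie T b ha
    have h2 : (Tᶜ.card : ℂ) ≠ 0 := by
      rw [Nat.cast_ne_zero]
      exact Finset.card_ne_zero_of_mem (Finset.mem_compl.2 ha)
    rw [← sub_eq_iff_eq_add'] at h1
    rw [← one_smul ℂ (symSum (insert a T) b), ← inv_mul_cancel₀ h2, ← smul_smul, ← h1]
    refine R.smul_mem (sub_mem (mul_mem (ih b hb) (hR _ (hb a))) (sum_mem fun c _ => ih _ ?_)) _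
    intro i
    by_cases hi : i = c
    · subst hi
      rw [Function.update_self, ← mul_assoc, hb, mul_assoc, hb, mul_assoc]
    · rw [Function.update_of_ne hi, hb]

end Symmetrization

namespace ChainBasis

variable {P V : Type} [AddCommGroup V] [Module ℂ V] {d : P → ℕ} {q : ℕ → ℂ} {x : Module.End ℂ V}
  {n : ℕ} [Fintype P]

/-- Expand `f v_J` in basis tensors. By `KT_stable` a coefficient is nonzero only if the height of
`ζ i` is at most `d (J i)` for all `i`, which is the condition for `v_{J i} ↦ z_{ζ i}` to extend to
a map commuting with `x`. -/
theorem mem_span_tmap (B : ChainBasis d q x) {f : Module.End ℂ (TPow n V)} (hf : ∀ j, place j x * f = f * place j x) :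
    f ∈ Submodule.span ℂ {g | ∃ b : Fin n → Module.End ℂ V, (∀ i, x * b i = b i * x) ∧
      g = tmap b} := by
  classical
  set g : Module.End ℂ (TPow n V) := ∑ J : Fin n → P, ∑ ζ : Fin n → (p : P) × Fin (d p + 1),
    (B.zT n).repr (f (B.vT J)) ζ •
      tmap (fun i => B.hom (Pi.single (J i) (B.z (ζ i)) : P → V)) with hg
  have hcomm : ∀ (J : Fin n → P) (ζ : Fin n → (p : P) × Fin (d p + 1)),
      (B.zT n).repr (f (B.vT J)) ζ ≠ 0 → ∀ i,
        x * B.hom (Pi.single (J i) (B.z (ζ i)) : P → V) =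
          B.hom (Pi.single (J i) (B.z (ζ i)) : P → V) * x := by
    intro J ζ h i
    refine B.hom_comm fun p => ?_
    by_cases hp : p = J i
    · subst hp
      rw [Pi.single_eq_same]
      refine basis_mem_coordSpan ?_
      by_contra hcon
      exact h (B.KT_stable hf (B.vT_mem_KT J) ζ fun h' => hcon (h' i))
    · simp [hp]
  have hfg : f = g := by
    refine B.ext_vT hf (fun j => ?_) fun J' => ?_
    · rw [hg, Finset.mul_sum, Finset.sum_mul]
      refine Finset.sum_congr rfl fun J _ => ?_
      rw [Finset.mul_sum, Finset.sum_mul]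
      refine Finset.sum_congr rfl fun ζ _ => ?_
      rw [mul_smul_comm, smul_mul_assoc]
      by_cases h : (B.zT n).repr (f (B.vT J)) ζ = 0
      · rw [h, zero_smul, zero_smul]
      · rw [place_tmap j (hcomm J ζ h j)]
    · have h1 : ∀ (J : Fin n → P) (ζ : Fin n → (p : P) × Fin (d p + 1)),
          tmap (fun i => B.hom (Pi.single (J i) (B.z (ζ i)) : P → V)) (B.vT J') =
            if J' = J then B.zT n ζ else 0 := by
        intro J ζ
        rw [vT, tmap_tprod]
        simp only [hom_v]
        split_ifs with h
        · subst h; simp [zT_apply]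
        · obtain ⟨i, hi⟩ := Function.ne_iff.1 h
          exact (PiTensorProduct.tprod ℂ).map_coord_zero i (by simp [hi])
      simp only [hg, LinearMap.sum_apply, LinearMap.smul_apply, h1, smul_ite, smul_zero]
      rw [Finset.sum_eq_single J']
      · simp only [if_true]
        exact ((B.zT n).sum_repr _).symm
      · intro J _ hJ
        simp [hJ.symm]
      · simp
  rw [hfg]
  refine Submodule.sum_mem _ fun J _ => Submodule.sum_mem _ fun ζ _ => ?_
  by_cases h : (B.zT n).repr (f (B.vT J)) ζ = 0
  · rw [h, zero_smul]; exact zero_mem _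
  · exact Submodule.smul_mem _ _ (Submodule.subset_span ⟨_, hcomm J ζ h, rfl⟩)

/-- `Sch` is generated by the elements `∑ j, 1 ⊗ … ⊗ b ⊗ … ⊗ 1` with `b` commuting with `x`. -/
theorem Sch_le (B : ChainBasis d q x) {R : Subalgebra ℂ (Module.End ℂ (TPow n V))}
    (hR : ∀ b, x * b = b * x → tensorLie b ∈ R) : Sch n x ≤ R := by
  intro f hf
  -- Sum of the conjugates by all permutations: it multiplies elements of `Sch` by `n!` and turns
  -- `b_1 ⊗ … ⊗ b_n` into its symmetrization.
  set A : Module.End ℂ (TPow n V) →ₗ[ℂ] Module.End ℂ (TPow n V) :=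
    ∑ g : Equiv.Perm (Fin n), LinearMap.mulLeft ℂ (permEnd g) ∘ₗ
      LinearMap.mulRight ℂ (permEnd g⁻¹) with hA
  have h1 : Submodule.span ℂ {g | ∃ b : Fin n → Module.End ℂ V, (∀ i, x * b i = b i * x) ∧
      g = tmap b} ≤ (Subalgebra.toSubmodule R).comap A := by
    rw [Submodule.span_le]
    rintro _ ⟨b, hb, rfl⟩
    have h2 : A (tmap b) = symSum Finset.univ b := by
      rw [hA, LinearMap.sum_apply, symSum]
      refine Fintype.sum_equiv (Equiv.inv _) _ _ fun g => ?_
      simp only [LinearMap.comp_apply, LinearMap.mulRight_apply, LinearMap.mulLeft_apply,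
        Finset.mem_univ, if_true]
      rw [← mul_assoc, permEnd_tmap, mul_assoc, ← permEnd_mul, mul_inv_cancel, permEnd_one, mul_one]
      rfl
    rw [SetLike.mem_coe, Submodule.mem_comap, h2]
    exact symSum_mem hR _ b hb
  have h3 := h1 (B.mem_span_tmap (mem_Sch.1 hf).2)
  have h4 : A f = (n.factorial : ℂ) • f := by
    rw [hA, LinearMap.sum_apply]
    simp only [LinearMap.comp_apply, LinearMap.mulRight_apply, LinearMap.mulLeft_apply]
    have : ∀ g : Equiv.Perm (Fin n), permEnd g * (f * permEnd g⁻¹) = f := by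
      intro g
      rw [← mul_assoc, (mem_Sch.1 hf).1, mul_assoc, ← permEnd_mul, mul_inv_cancel, permEnd_one,
        mul_one]
    simp only [this, Finset.sum_const, Finset.card_univ, Fintype.card_perm, Fintype.card_fin,
      Nat.cast_smul_eq_nsmul]
  rw [Submodule.mem_comap, h4] at h3
  have h5 : (n.factorial : ℂ) ≠ 0 := by exact_mod_cast n.factorial_ne_zero
  have := R.smul_mem h3 (n.factorial : ℂ)⁻¹
  rwa [smul_smul, inv_mul_cancel₀ h5, one_smul] at this

end ChainBasis
end SchurWeyl
end

noncomputable section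
namespace SchurWeyl

/-! ### The chain basis of `𝕍` -/

section VVBasis

open LaurentPolynomial

/-- The parameters as a function on `ℕ`. -/
def qf {r : ℕ} (Q : Fin r → ℂˣ) (k : ℕ) : ℂ := if h : k < r then (Q ⟨k, h⟩ : ℂ) else 1

/-- The default value `1` outside the range serves to make this hold without side conditions. -/
theorem qf_ne_zero {r : ℕ} (Q : Fin r → ℂˣ) (k : ℕ) : qf Q k ≠ 0 := by
  rw [qf]; split_ifs
  · exact Units.ne_zero _
  · exact one_ne_zero

theorem qf_fin {r : ℕ} (Q : Fin r → ℂˣ) (k : Fin r) : qf Q k = Q k := by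
  rw [qf, dif_pos k.2]

theorem cycPoly_eq {r : ℕ} (Q : Fin r → ℂˣ) (k : Fin r) : cycPoly Q k =
    ∏ i ∈ Finset.range ((k : ℕ) + 1), (Polynomial.X - Polynomial.C (qf Q i)) := by
  rw [cycPoly]
  refine Finset.prod_bij (fun i _ => (i : ℕ)) ?_ ?_ ?_ ?_
  · intro i hi
    rw [Finset.mem_Iic, Fin.le_def] at hi
    exact Finset.mem_range.2 (by omega)
  · intro i _ j _ h
    exact Fin.ext h
  · intro i hi
    rw [Finset.mem_range] at hi
    exact ⟨⟨i, by omega⟩, Finset.mem_Iic.2 (Fin.le_def.2 (by simp only; omega)), rfl⟩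
  · intro i _
    rw [qf_fin]

/-- Evaluation at `a` is available on Laurent polynomials because `a ≠ 0`, and it kills `X - a`. -/
theorem not_isUnit_X_sub_C {a : ℂ} (ha : a ≠ 0) :
    ¬ IsUnit (Polynomial.toLaurent (Polynomial.X - Polynomial.C a)) := by
  intro h
  have h1 := h.map (LaurentPolynomial.eval₂ (RingHom.id ℂ) (Units.mk0 a ha))
  simp at h1

variable {r : ℕ} (m : Fin r → ℕ+) (Q : Fin r → ℂˣ)

/-- The image of `v_p ⊗ g` in `𝕍`. -/
def vvMk (p : Fin (total m)) (g : ℂ[T;T⁻¹]) : VV m Q := (IQ m Q).mkQ (Pi.single p g)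

theorem vvMk_smul (p : Fin (total m)) (f g : ℂ[T;T⁻¹]) :
    vvMk m Q p (f * g) = f • vvMk m Q p g := by
  rw [vvMk, vvMk, ← smul_eq_mul, Pi.single_smul, map_smul]
  rfl

theorem vvMk_add (p : Fin (total m)) (f g : ℂ[T;T⁻¹]) :
    vvMk m Q p (f + g) = vvMk m Q p f + vvMk m Q p g := by
  rw [vvMk, Pi.single_add, map_add]
  rfl

theorem vvMk_smul_complex (p : Fin (total m)) (c : ℂ) (g : ℂ[T;T⁻¹]) :
    vvMk m Q p (c • g) = c • vvMk m Q p g := by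
  rw [vvMk, Pi.single_smul]
  rfl

/-- The component `p` of `𝕍`. -/
def vvComp (p : Fin (total m)) : VV m Q →ₗ[ℂ[T;T⁻¹]]
    ℂ[T;T⁻¹] ⧸ Ideal.span {Polynomial.toLaurent (cycPoly Q (block m p))} :=
  (IQ m Q).liftQ ((Ideal.span {Polynomial.toLaurent (cycPoly Q (block m p))}).mkQ ∘ₗ
    LinearMap.proj p) (by
      rw [IQ, Submodule.span_le]
      rintro _ ⟨j, rfl⟩
      rw [SetLike.mem_coe, LinearMap.mem_ker, LinearMap.comp_apply, LinearMap.proj_apply]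
      beta_reduce
      by_cases h : j = p
      · subst h
        rw [Pi.single_eq_same]
        exact (Submodule.Quotient.mk_eq_zero _).2 (Ideal.mem_span_singleton_self _)
      · rw [Pi.single_eq_of_ne (Ne.symm h), map_zero])

theorem vvComp_vvMk (p p' : Fin (total m)) (g : ℂ[T;T⁻¹]) : vvComp m Q p (vvMk m Q p' g) =
    if p' = p then Ideal.Quotient.mk _ g else 0 := by
  change (Ideal.span {Polynomial.toLaurent (cycPoly Q (block m p))}).mkQ
    ((Pi.single p' g : VHat (total m)) p) = _
  split_ifs with h
  · subst h; rw [Pi.single_eq_same]; rfl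
  · rw [Pi.single_eq_of_ne (Ne.symm h), map_zero]

/-- The polynomial `(X - q_{k+1}) … (X - q_d)`. -/
def tailPoly (d k : ℕ) : Polynomial ℂ :=
  ∏ i ∈ Finset.Ioc k d, (Polynomial.X - Polynomial.C (qf Q i))

/-- The vectors `z_{p,k}`. -/
def vvZ (ζ : (p : Fin (total m)) × Fin ((block m p : ℕ) + 1)) : VV m Q :=
  vvMk m Q ζ.1 (Polynomial.toLaurent (tailPoly Q (block m ζ.1) ζ.2))

theorem range_mul_tailPoly {d k : ℕ} (h : k ≤ d) :
    (∏ i ∈ Finset.range (k + 1), (Polynomial.X - Polynomial.C (qf Q i))) * tailPoly Q d k =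
      ∏ i ∈ Finset.range (d + 1), (Polynomial.X - Polynomial.C (qf Q i)) := by
  rw [tailPoly, ← Finset.prod_union]
  · congr 1
    ext i; simp only [Finset.mem_union, Finset.mem_range, Finset.mem_Ioc]; omega
  · rw [Finset.disjoint_left]
    intro i; simp only [Finset.mem_range, Finset.mem_Ioc]; omega

theorem tailPoly_succ {d k : ℕ} (h : k < d) :
    tailPoly Q d k = (Polynomial.X - Polynomial.C (qf Q (k + 1))) * tailPoly Q d (k + 1) := by
  have : Finset.Ioc k d = insert (k + 1) (Finset.Ioc (k + 1) d) := by
    ext i; simp only [Finset.mem_insert, Finset.mem_Ioc]; omega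
  rw [tailPoly, tailPoly, this, Finset.prod_insert (by simp)]

theorem vvMk_eq_zero {p : Fin (total m)} {g : ℂ[T;T⁻¹]}
    (h : Polynomial.toLaurent (cycPoly Q (block m p)) ∣ g) : vvMk m Q p g = 0 :=
  (Submodule.Quotient.mk_eq_zero _).2 (single_mem_IQ m Q p g h)

/-- In the component `p`, take the largest `k` with a nonzero coefficient and multiply by `(x -
q_0)…(x - q_{k-1})`. This kills all lower `z_j`, and what is left says that the block polynomial
divides itself with the factor `x - q_k` removed, so that `x - q_k` would be a unit. -/
theorem vvZ_linearIndependent : LinearIndependent ℂ (vvZ m Q) := by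
  rw [Fintype.linearIndependent_iff]
  intro c hc
  by_contra hcon
  push Not at hcon
  obtain ⟨⟨p, k₀⟩, hk₀⟩ := hcon
  set A := ℂ[T;T⁻¹] ⧸ Ideal.span {Polynomial.toLaurent (cycPoly Q (block m p))}
  have h1 : ∑ k, c ⟨p, k⟩ • (Ideal.Quotient.mk
      (Ideal.span {Polynomial.toLaurent (cycPoly Q (block m p))})
      (Polynomial.toLaurent (tailPoly Q (block m p) k)) : A) = 0 := by
    have := congrArg (vvComp m Q p) hc
    rw [map_zero, map_sum, Fintype.sum_sigma, Finset.sum_eq_single p] at this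
    · rw [← this]
      refine Finset.sum_congr rfl fun k _ => ?_
      rw [LinearMap.map_smul_of_tower, vvZ, vvComp_vvMk, if_pos rfl]
    · intro p' _ hp'
      refine Finset.sum_eq_zero fun k _ => ?_
      rw [LinearMap.map_smul_of_tower, vvZ, vvComp_vvMk, if_neg hp', smul_zero]
    · simp
  obtain ⟨k, hk, hmax⟩ := Finset.exists_max_image
    (Finset.univ.filter fun k => c ⟨p, k⟩ ≠ 0) (fun k => (k : ℕ)) ⟨k₀, by simpa using hk₀⟩
  simp only [Finset.mem_filter, Finset.mem_univ, true_and] at hk hmax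
  set f : Polynomial ℂ := ∏ i ∈ Finset.range (k : ℕ), (Polynomial.X - Polynomial.C (qf Q i)) with hf
  have h2 := congrArg (fun a => (Ideal.Quotient.mk _ (Polynomial.toLaurent f) : A) * a) h1
  simp only [Finset.mul_sum, mul_zero, mul_smul_comm, ← map_mul] at h2
  have hdvd : ∀ g : Polynomial ℂ, (Ideal.Quotient.mk _ (Polynomial.toLaurent g) : A) = 0 ↔
      Polynomial.toLaurent (cycPoly Q (block m p)) ∣ Polynomial.toLaurent g := by
    intro g
    rw [Ideal.Quotient.eq_zero_iff_mem, Ideal.mem_span_singleton]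
  rw [Finset.sum_eq_single k] at h2
  · have h3 := (smul_eq_zero.1 h2).resolve_left hk
    rw [hdvd] at h3
    have hkd : (k : ℕ) ≤ block m p := Nat.lt_succ_iff.1 k.2
    rw [cycPoly_eq, ← range_mul_tailPoly Q hkd, Finset.prod_range_succ, ← hf, mul_right_comm,
      map_mul] at h3
    obtain ⟨u, hu⟩ := h3
    have hne : Polynomial.toLaurent (f * tailPoly Q (block m p) k) ≠ 0 := by
      rw [Polynomial.toLaurent_ne_zero, hf, tailPoly]
      refine mul_ne_zero ?_ ?_
      all_goals
        refine Finset.prod_ne_zero_iff.2 fun i _ => Polynomial.X_sub_C_ne_zero _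
    refine not_isUnit_X_sub_C (qf_ne_zero Q k) (IsUnit.of_mul_eq_one u ?_)
    refine mul_left_cancel₀ hne ?_
    rw [mul_one, ← mul_assoc]
    exact hu.symm
  · intro j _ hj
    by_cases hcj : c ⟨p, j⟩ = 0
    · rw [hcj, zero_smul]
    · have hlt : (j : ℕ) < k := lt_of_le_of_ne (hmax j hcj) fun h => hj (Fin.ext h)
      rw [(hdvd _).2, smul_zero]
      refine map_dvd _ ?_
      rw [cycPoly_eq, ← range_mul_tailPoly Q (show (j : ℕ) ≤ block m p by omega), hf]
      exact mul_dvd_mul (Finset.prod_dvd_prod_of_subset _ _ _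
        (Finset.range_mono (by omega))) dvd_rfl
  · simp

theorem vvZ_zero (p : Fin (total m)) :
    (T 1 : ℂ[T;T⁻¹]) • vvZ m Q ⟨p, 0⟩ = qf Q 0 • vvZ m Q ⟨p, 0⟩ := by
  have h := vvMk_eq_zero m Q (p := p) (g := Polynomial.toLaurent (cycPoly Q (block m p))) dvd_rfl
  rw [cycPoly_eq, ← range_mul_tailPoly Q (Nat.zero_le _), zero_add, Finset.prod_range_one, map_mul,
    map_sub, Polynomial.toLaurent_X, Polynomial.toLaurent_C, sub_mul, sub_eq_add_neg, vvMk_add,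
    ← neg_mul, ← map_neg, ← smul_eq_C_mul, vvMk_smul, vvMk_smul_complex, neg_smul,
    ← sub_eq_add_neg, sub_eq_zero] at h
  exact h

theorem vvZ_succ (p : Fin (total m)) (k : Fin (block m p)) :
    (T 1 : ℂ[T;T⁻¹]) • vvZ m Q ⟨p, k.succ⟩ =
      qf Q (k + 1) • vvZ m Q ⟨p, k.succ⟩ + vvZ m Q ⟨p, k.castSucc⟩ := by
  rw [vvZ, vvZ]
  simp only [Fin.val_succ, Fin.val_castSucc]
  rw [tailPoly_succ Q k.2, ← vvMk_smul, ← vvMk_smul_complex, ← vvMk_add, map_mul, map_sub,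
    Polynomial.toLaurent_X, Polynomial.toLaurent_C, smul_eq_C_mul]
  congr 1
  ring

/-- The span contains every `v_p`. It is stable under `x` by the chain relations, and under `x⁻¹` by
induction up the chain, dividing by `q_k ≠ 0`. -/
theorem vvZ_span : ⊤ ≤ Submodule.span ℂ (Set.range (vvZ m Q)) := by
  set N := Submodule.span ℂ (Set.range (vvZ m Q))
  have hz : ∀ ζ, vvZ m Q ζ ∈ N := fun ζ => Submodule.subset_span ⟨ζ, rfl⟩
  have hcancel : ∀ v : VV m Q, (T (-1) : ℂ[T;T⁻¹]) • (T 1 : ℂ[T;T⁻¹]) • v = v := by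
    intro v
    rw [smul_smul, ← T_add, neg_add_cancel, T_zero, one_smul]
  have hst : ∀ (a : ℂ[T;T⁻¹]), (∀ ζ, a • vvZ m Q ζ ∈ N) → ∀ v ∈ N, a • v ∈ N := by
    intro a h v hv
    have : N ≤ N.comap (mulVV m Q a) := by
      rw [Submodule.span_le]
      rintro _ ⟨ζ, rfl⟩
      exact h ζ
    exact this hv
  have hx : ∀ v ∈ N, (T 1 : ℂ[T;T⁻¹]) • v ∈ N := by
    refine hst _ ?_
    rintro ⟨p, k⟩
    induction k using Fin.cases with
    | zero => rw [vvZ_zero]; exact N.smul_mem _ (hz _)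
    | succ k => rw [vvZ_succ]; exact N.add_mem (N.smul_mem _ (hz _)) (hz _)
  have hy : ∀ v ∈ N, (T (-1) : ℂ[T;T⁻¹]) • v ∈ N := by
    refine hst _ ?_
    rintro ⟨p, k⟩
    induction k using Fin.induction with
    | zero =>
      have := congrArg (fun v => (qf Q 0)⁻¹ • (T (-1) : ℂ[T;T⁻¹]) • v) (vvZ_zero m Q p)
      simp only [hcancel, smul_comm (T (-1) : ℂ[T;T⁻¹]) (qf Q 0), smul_smul,
        inv_mul_cancel₀ (qf_ne_zero Q 0), one_smul] at this
      rw [← this]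
      exact N.smul_mem _ (hz _)
    | succ k ih =>
      have := congrArg (fun v => (T (-1) : ℂ[T;T⁻¹]) • v) (vvZ_succ m Q p k)
      simp only [hcancel, smul_add, smul_comm (T (-1) : ℂ[T;T⁻¹]) (qf Q _)] at this
      have h2 := N.smul_mem (qf Q (k + 1))⁻¹ (N.sub_mem (hz ⟨p, k.succ⟩) ih)
      rwa [this, add_sub_cancel_right, smul_smul, inv_mul_cancel₀ (qf_ne_zero Q _), one_smul] at h2
  have hv : ∀ p, vvMk m Q p 1 ∈ N := by
    intro p
    have := hz ⟨p, Fin.last _⟩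
    simpa [vvZ, tailPoly] using this
  have hT : ∀ (t : ℤ) p, vvMk m Q p (T t) ∈ N := by
    intro t p
    induction t using Int.induction_on with
    | zero => rw [T_zero]; exact hv p
    | succ i ih => rw [add_comm, T_add, vvMk_smul]; exact hx _ ih
    | pred i ih => rw [sub_eq_neg_add, T_add, vvMk_smul]; exact hy _ ih
  have hg : ∀ p (g : ℂ[T;T⁻¹]), vvMk m Q p g ∈ N := by
    intro p g
    induction g using LaurentPolynomial.induction_on' with
    | add f g hf hg => rw [vvMk_add]; exact N.add_mem hf hg
    | C_mul_T t a => rw [← smul_eq_C_mul, vvMk_smul_complex]; exact N.smul_mem _ (hT t p)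
  intro v _
  obtain ⟨v, rfl⟩ := Submodule.Quotient.mk_surjective _ v
  rw [← Finset.univ_sum_single v]
  change (IQ m Q).mkQ _ ∈ N
  rw [map_sum]
  exact Submodule.sum_mem _ fun p _ => hg p _

/-- The chain basis of `𝕍`. -/
def vvBasis : ChainBasis (fun p => (block m p : ℕ)) (qf Q) (mulVV m Q (T 1)) where
  z := Module.Basis.mk (vvZ_linearIndependent m Q) (vvZ_span m Q)
  x_zero p := by
    rw [Module.Basis.mk_apply]
    exact vvZ_zero m Q p
  x_succ p k := by
    rw [Module.Basis.mk_apply, Module.Basis.mk_apply]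
    exact vvZ_succ m Q p k

theorem vvBasis_z (ζ) : (vvBasis m Q).z ζ = vvZ m Q ζ :=
  Module.Basis.mk_apply (vvZ_linearIndependent m Q) (vvZ_span m Q) ζ

theorem vvBasis_v (p : Fin (total m)) : (vvBasis m Q).v p = vvMk m Q p 1 := by
  rw [ChainBasis.v, vvBasis_z, vvZ]
  simp [tailPoly]

/-- The `i`-th index of the block `k`. -/
def blockIdx {n : ℕ} (hm : ∀ k, n ≤ (m k : ℕ)) (k : Fin r) (i : Fin n) : Fin (total m) :=
  xi m ⟨k, Fin.castLE (hm k) i⟩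

theorem block_blockIdx {n : ℕ} (hm : ∀ k, n ≤ (m k : ℕ)) (k : Fin r) (i : Fin n) :
    block m (blockIdx m hm k i) = k := by
  rw [block, blockIdx, Equiv.symm_apply_apply]

theorem blockIdx_inj {n : ℕ} (hm : ∀ k, n ≤ (m k : ℕ)) (k k' : Fin r) (i i' : Fin n)
    (h : blockIdx m hm k i = blockIdx m hm k' i') : i = i' := by
  have h1 := (xi m).injective h
  have hk : k = k' := congrArg Sigma.fst h1
  subst hk
  have h2 := eq_of_heq (Sigma.mk.inj h1).2
  exact Fin.castLE_injective _ h2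

end VVBasis
end SchurWeyl
end

noncomputable section
namespace SchurWeyl

/-! ### Normal words for the relations of the symmetric group -/

section NormalForm

variable {A : Type} [Monoid A] (t : ℕ → A)

/-- The product `t_j t_{j+1} … t_{j+l-1}`. -/
def ascProd : ℕ → ℕ → A
  | _, 0 => 1
  | j, l + 1 => t j * ascProd (j + 1) l

open scoped Classical in
/-- The normal forms of the words in `t_0, …, t_{k-1}`. -/
def normalWords : ℕ → Finset A
  | 0 => {1}
  | k + 1 => (Finset.range (k + 2) ×ˢ normalWords k).image fun p =>
      ascProd t p.1 (k + 1 - p.1) * p.2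

theorem card_normalWords_le : ∀ k, (normalWords t k).card ≤ (k + 1).factorial
  | 0 => by simp [normalWords]
  | k + 1 => by
    classical
    rw [normalWords, Nat.factorial_succ]
    refine Finset.card_image_le.trans ?_
    rw [Finset.card_product, Finset.card_range]
    exact Nat.mul_le_mul_left _ (card_normalWords_le k)

theorem one_mem_normalWords : ∀ k, (1 : A) ∈ normalWords t k
  | 0 => by simp [normalWords]
  | k + 1 => by
    classical
    rw [normalWords, Finset.mem_image]
    refine ⟨(k + 1, 1), ?_, by simp [ascProd]⟩
    simp [one_mem_normalWords k]

variable {t} {N : ℕ} (hsq : ∀ i < N, t i * t i = 1)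
  (hbraid : ∀ i, i + 1 < N → t i * t (i + 1) * t i = t (i + 1) * t i * t (i + 1))
  (hcomm : ∀ i j, i + 1 < j → j < N → Commute (t i) (t j))

theorem commute_ascProd (hcomm : ∀ i j, i + 1 < j → j < N → Commute (t i) (t j)) (i : ℕ) :
    ∀ l j, i + 1 < j → j + l ≤ N → Commute (t i) (ascProd t j l)
  | 0, _, _, _ => Commute.one_right _
  | l + 1, j, h, hN =>
    (hcomm i j h (by omega)).mul_right (commute_ascProd hcomm i l (j + 1) (by omega) (by omega))

/-- Passing from left to right through an ascending run that contains `t_i t_{i+1}` lowers the index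
of `t_{i+1}` by one: a braid relation at these two letters, commutation at the others. -/
theorem mul_ascProd
    (hbraid : ∀ i, i + 1 < N → t i * t (i + 1) * t i = t (i + 1) * t i * t (i + 1))
    (hcomm : ∀ i j, i + 1 < j → j < N → Commute (t i) (t j)) :
    ∀ l i j, j ≤ i → i + 1 < j + l → j + l ≤ N →
      t (i + 1) * ascProd t j l = ascProd t j l * t i
  | 0, i, j, h1, h2, _ => by omega
  | l + 1, i, j, h1, h2, hN => by
    rcases Nat.lt_or_ge j i with h | h
    · rw [ascProd, ← mul_assoc, ← (hcomm j (i + 1) (by omega) (by omega)).eq, mul_assoc,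
        mul_ascProd hbraid hcomm l i (j + 1) (by omega) (by omega) (by omega), mul_assoc]
    · obtain rfl : i = j := by omega
      obtain ⟨l, rfl⟩ : ∃ k, l = k + 1 := ⟨l - 1, by omega⟩
      have hc := commute_ascProd hcomm i l (i + 1 + 1) (by omega) (by omega)
      rw [ascProd, ascProd, ← mul_assoc, ← mul_assoc, ← hbraid i (by omega), mul_assoc _ (t i),
        hc.eq]
      simp only [mul_assoc]

/-- Compare `i` with the start `j` of the leading run `t_j … t_k`. If `i + 1 < j`, `t_i` commutes
past it to `u`; if `i + 1 = j`, it lengthens the run; if `i = j`, it cancels the first letter; if `i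
> j`, it passes through and reaches `u` as `t_{i-1}`. The run is empty for `j = k + 1`. -/
theorem mul_mem_normalWords (hsq : ∀ i < N, t i * t i = 1)
    (hbraid : ∀ i, i + 1 < N → t i * t (i + 1) * t i = t (i + 1) * t i * t (i + 1))
    (hcomm : ∀ i j, i + 1 < j → j < N → Commute (t i) (t j)) :
    ∀ k ≤ N, ∀ i < k, ∀ u ∈ normalWords t k, t i * u ∈ normalWords t k
  | 0, _, i, hi, _, _ => by omega
  | k + 1, hk, i, hi, u, hu => by
    classical
    rw [normalWords, Finset.mem_image] at hu ⊢
    obtain ⟨⟨j, u⟩, hj, rfl⟩ := hu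
    rw [Finset.mem_product, Finset.mem_range] at hj
    obtain ⟨hj, hu⟩ := hj
    simp only at hj hu ⊢
    have ih := mul_mem_normalWords hsq hbraid hcomm k (by omega)
    rcases Nat.lt_trichotomy (i + 1) j with h | h | h
    · refine ⟨(j, t i * u), by simpa using ⟨by omega, ih i (by omega) u hu⟩, ?_⟩
      simp only
      rw [← mul_assoc, ← mul_assoc,
        (commute_ascProd hcomm i (k + 1 - j) j h (by omega)).eq]
    · refine ⟨(i, u), by simpa using ⟨by omega, hu⟩, ?_⟩
      simp only
      rw [← mul_assoc, show k + 1 - i = (k + 1 - j) + 1 by omega, ascProd, h]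
    · rcases Nat.lt_or_ge j i with h' | h'
      · obtain ⟨i, rfl⟩ : ∃ i', i = i' + 1 := ⟨i - 1, by omega⟩
        refine ⟨(j, t i * u), by simpa using ⟨by omega, ih i (by omega) u hu⟩, ?_⟩
        simp only
        rw [← mul_assoc, ← mul_assoc,
          mul_ascProd hbraid hcomm (k + 1 - j) i j (by omega) (by omega) (by omega)]
      · obtain rfl : i = j := by omega
        refine ⟨(i + 1, u), by simpa using ⟨by omega, hu⟩, ?_⟩
        simp only
        rw [show k + 1 - i = (k + 1 - (i + 1)) + 1 by omega, ascProd, ← mul_assoc, ← mul_assoc,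
          hsq i (by omega), one_mul]

end NormalForm

/-! ### The upper bound `r^n n!` for the dimension of the Ariki-Koike algebra -/

namespace ArikiKoike

open Polynomial MulOpposite

variable {n r : ℕ} (Q : Fin r → ℂˣ)

theorem mk_surjective : Function.Surjective (mk (n := n) Q) :=
  RingQuot.mkAlgHom_surjective ℂ _

/-- Induction for the Ariki-Koike algebra. -/
theorem induction {p : ArikiKoike n Q → Prop} (h0 : ∀ c : ℂ, p (algebraMap ℂ _ c))
    (h1 : ∀ i, p (T Q i)) (hmul : ∀ a b, p a → p b → p (a * b))
    (hadd : ∀ a b, p a → p b → p (a + b)) (h : ArikiKoike n Q) : p h := by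
  obtain ⟨a, rfl⟩ := mk_surjective Q h
  induction a using FreeAlgebra.induction with
  | grade0 c => rw [AlgHom.commutes]; exact h0 c
  | grade1 i => exact h1 i
  | mul a b ha hb => rw [map_mul]; exact hmul _ _ ha hb
  | add a b ha hb => rw [map_add]; exact hadd _ _ ha hb

theorem L_zero (h : 0 < n) : L Q (⟨0, h⟩ : Fin n) = T Q ⟨0, h⟩ := by
  change Lnat Q 0 = _
  rw [Lnat, dif_pos h]

theorem T_hi_sq (i : Fin (n - 1)) : T Q (hi i) * T Q (hi i) = 1 := T_sq Q (by simp [hi])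

theorem eq_hi {i : Fin n} (h : (i : ℕ) ≠ 0) : i = hi ⟨(i : ℕ) - 1, by omega⟩ :=
  Fin.ext (by simp only [hi]; omega)

theorem aeval_conj {A : Type} [Ring A] [Algebra ℂ A] {t a : A} (ht : t * t = 1) (g : ℂ[X]) :
    aeval (t * a * t) g = t * aeval a g * t := by
  have hpow : ∀ k : ℕ, (t * a * t) ^ k = t * a ^ k * t := by
    intro k
    induction k with
    | zero => simp [ht]
    | succ k ih =>
      rw [pow_succ, ih, pow_succ]
      calc t * a ^ k * t * (t * a * t) = t * a ^ k * (t * t) * a * t := by noncomm_ring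
        _ = t * (a ^ k * a) * t := by rw [ht]; noncomm_ring
  induction g using Polynomial.induction_on' with
  | add p q hp hq => rw [map_add, map_add, hp, hq, mul_add, add_mul]
  | monomial k c =>
    simp only [aeval_monomial, hpow, Algebra.algebraMap_eq_smul_one, smul_mul_assoc, one_mul,
      mul_smul_comm]

/-- Each `L_j` is a conjugate of `T_0`, since the other `T_i` are involutions. -/
theorem L_cyc (j : Fin n) : aeval (L Q j) (∏ k : Fin r, (X - C (Q k : ℂ))) = 0 := by
  obtain ⟨j, hj⟩ := j
  induction j with
  | zero => rw [L_zero]; exact T_cyc Q hj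
  | succ j ih =>
    have h := L_hi Q (⟨j, by omega⟩ : Fin (n - 1))
    change L Q ⟨j + 1, hj⟩ = _ at h
    rw [h, aeval_conj (T_hi_sq Q _)]
    change _ * aeval (L Q ⟨j, by omega⟩) _ * _ = 0
    rw [ih, mul_zero, zero_mul]

theorem L_pow (j : Fin n) : ∃ c : ℕ → ℂ, L Q j ^ r = ∑ k ∈ Finset.range r, c k • L Q j ^ k := by
  have hmon : (∏ k : Fin r, (X - C (Q k : ℂ))).Monic := monic_prod_of_monic _ _ fun k _ => monic_X_sub_C _
  have hdeg : (∏ k : Fin r, (X - C (Q k : ℂ))).natDegree = r := by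
    rw [natDegree_prod_of_monic _ _ fun k _ => monic_X_sub_C _]
    simp
  have h := L_cyc Q j
  rw [hmon.as_sum, hdeg] at h
  simp only [map_add, map_sum, map_mul, map_pow, aeval_X, aeval_C] at h
  refine ⟨fun k => -(∏ k : Fin r, (X - C (Q k : ℂ))).coeff k, ?_⟩
  rw [eq_neg_of_add_eq_zero_left h, ← Finset.sum_neg_distrib]
  refine Finset.sum_congr rfl fun k _ => ?_
  rw [neg_smul, Algebra.algebraMap_eq_smul_one, smul_mul_assoc, one_mul]

instance : IsMulCommutative (Algebra.adjoin ℂ (Set.range (L (n := n) Q))) :=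
  Algebra.isMulCommutative_adjoin ℂ (by
    rintro _ ⟨i, rfl⟩ _ ⟨j, rfl⟩
    exact L_comm Q i j)

open scoped IsMulCommutative in
/-- Polynomials in the Jucys-Murphy elements. -/
def pol : MvPolynomial (Fin n) ℂ →ₐ[ℂ] ArikiKoike n Q :=
  (Algebra.adjoin ℂ (Set.range (L (n := n) Q))).val.comp
    (MvPolynomial.aeval (S₁ := Algebra.adjoin ℂ (Set.range (L (n := n) Q)))
      fun i => ⟨L Q i, Algebra.subset_adjoin ⟨i, rfl⟩⟩)

open scoped IsMulCommutative in
theorem pol_X (i : Fin n) : pol Q (MvPolynomial.X i) = L Q i := by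
  rw [pol, AlgHom.comp_apply, MvPolynomial.aeval_X]
  rfl

/-- At `q = 1` there is no correction term: `T_i` simply permutes the Jucys-Murphy elements. -/
theorem T_mul_L (i : Fin (n - 1)) (j : Fin n) :
    T Q (hi i) * L Q j = L Q (adjSwap i j) * T Q (hi i) := by
  by_cases h1 : j = lo i
  · subst h1
    rw [adjSwap, Equiv.swap_apply_left, L_hi, mul_assoc _ (T Q (hi i)), T_hi_sq, mul_one]
  · by_cases h2 : j = hi i
    · subst h2
      rw [adjSwap, Equiv.swap_apply_right, L_hi, ← mul_assoc, ← mul_assoc, T_hi_sq, one_mul]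
    · rw [adjSwap, Equiv.swap_apply_of_ne_of_ne h1 h2, (T_comm_L Q i j h1 h2).eq]

theorem T_mul_pol (i : Fin (n - 1)) (g : MvPolynomial (Fin n) ℂ) :
    T Q (hi i) * pol Q g = pol Q (MvPolynomial.rename (adjSwap i) g) * T Q (hi i) := by
  induction g using MvPolynomial.induction_on with
  | C c =>
    rw [MvPolynomial.rename_C, ← MvPolynomial.algebraMap_eq, AlgHom.commutes]
    exact (Algebra.commutes _ _).symm
  | add p q hp hq => simp only [map_add, mul_add, add_mul, hp, hq]
  | mul_X p j hp =>
    rw [map_mul, map_mul, map_mul, MvPolynomial.rename_X, pol_X, pol_X, ← mul_assoc, hp, mul_assoc,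
      T_mul_L, mul_assoc]

/-- The span of the monomials in the Jucys-Murphy elements with exponents less than `r`. -/
def monSpan : Submodule ℂ (ArikiKoike n Q) :=
  Submodule.span ℂ (Set.range fun a : Fin n → Fin r => pol Q (∏ i, MvPolynomial.X i ^ (a i : ℕ)))

theorem pol_mem_monSpan (hr : 0 < r) (g : MvPolynomial (Fin n) ℂ) : pol Q g ∈ monSpan Q := by
  induction g using MvPolynomial.induction_on with
  | C c =>
    rw [← MvPolynomial.algebraMap_eq, AlgHom.commutes, Algebra.algebraMap_eq_smul_one]
    refine Submodule.smul_mem _ _ (Submodule.subset_span ⟨fun _ => ⟨0, hr⟩, by simp⟩)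
  | add p q hp hq => rw [map_add]; exact add_mem hp hq
  | mul_X p j hp =>
    rw [map_mul, pol_X]
    have : monSpan Q ≤ (monSpan Q).comap (LinearMap.mulRight ℂ (L Q j)) := by
      conv_lhs => rw [monSpan]
      rw [Submodule.span_le]
      rintro _ ⟨a, rfl⟩
      have hprod : ∀ k : Fin r, ∏ i, (MvPolynomial.X i : MvPolynomial (Fin n) ℂ) ^
          (Function.update a j k i : ℕ) = (∏ i ∈ Finset.univ.erase j, MvPolynomial.X i ^ (a i : ℕ)) *
            MvPolynomial.X j ^ (k : ℕ) := by
        intro k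
        rw [← Finset.prod_erase_mul _ _ (Finset.mem_univ j), Function.update_self]
        congr 1
        refine Finset.prod_congr rfl fun i hi => ?_
        rw [Function.update_of_ne (Finset.ne_of_mem_erase hi)]
      have hmem : ∀ k : ℕ, k < r → pol Q (∏ i ∈ Finset.univ.erase j, MvPolynomial.X i ^ (a i : ℕ)) *
          L Q j ^ k ∈ monSpan Q := fun k hk => Submodule.subset_span
        ⟨Function.update a j ⟨k, hk⟩, by simp only; rw [hprod, map_mul, map_pow, pol_X]⟩
      rw [SetLike.mem_coe, Submodule.mem_comap, LinearMap.mulRight_apply]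
      have ha := hprod (a j)
      rw [Function.update_eq_self] at ha
      simp only
      rw [ha, map_mul, map_pow, pol_X, mul_assoc,
        ← pow_succ]
      rcases Nat.lt_or_ge ((a j : ℕ) + 1) r with h | h
      · exact hmem _ h
      · rw [show (a j : ℕ) + 1 = r by omega]
        obtain ⟨c, hc⟩ := L_pow Q j
        rw [hc, Finset.mul_sum]
        refine Submodule.sum_mem _ fun k hk => ?_
        rw [mul_smul_comm]
        exact Submodule.smul_mem _ _ (hmem k (Finset.mem_range.1 hk))
    exact this hp

/-- The generators `T_1, T_2, …`. -/
def Tnat (i : ℕ) : ArikiKoike n Q := if h : i + 1 < n then T Q ⟨i + 1, h⟩ else 1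

open scoped Classical in
/-- The spanning set of the Ariki-Koike algebra. -/
def spanSet : Finset (ArikiKoike n Q) :=
  (Finset.univ ×ˢ normalWords (Tnat (n := n) Q) (n - 1)).image
    fun p : (Fin n → Fin r) × _ => pol Q (∏ i, MvPolynomial.X i ^ (p.1 i : ℕ)) * p.2

theorem card_spanSet_le (hn : 0 < n) : (spanSet (n := n) Q).card ≤ r ^ n * n.factorial := by
  classical
  refine Finset.card_image_le.trans ?_
  rw [Finset.card_product, Finset.card_univ, Fintype.card_fun, Fintype.card_fin, Fintype.card_fin]
  refine Nat.mul_le_mul_left _ ((card_normalWords_le _ _).trans ?_)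
  rw [Nat.sub_add_cancel hn]

theorem Tnat_mul_mem (i : Fin (n - 1)) {u : ArikiKoike n Q}
    (hu : u ∈ normalWords (Tnat (n := n) Q) (n - 1)) :
    T Q (hi i) * u ∈ normalWords (Tnat (n := n) Q) (n - 1) := by
  have hT : Tnat Q (i : ℕ) = T Q (hi i) := dif_pos (by omega)
  rw [← hT]
  refine mul_mem_normalWords (N := n - 1) ?_ ?_ ?_ (n - 1) le_rfl i i.2 u hu
  · intro i hi
    rw [Tnat, dif_pos (by omega)]
    exact T_sq Q (by simp)
  · intro i hi
    rw [Tnat, dif_pos (by omega), Tnat, dif_pos (by omega)]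
    exact T_braid Q (by simp) (by simp)
  · intro i j hij hj
    rw [Tnat, dif_pos (by omega), Tnat, dif_pos (by omega)]
    exact T_comm Q (by simpa using hij)

/-- The span contains `1` and is a left ideal: `T_0 = L_1` is absorbed by the polynomial part, whose
exponents can be reduced below `r`, and `T_i` moves through the polynomial, permuting its variables,
into the normal word. -/
theorem span_spanSet (hr : 0 < r) : Submodule.span ℂ (spanSet (n := n) Q : Set (ArikiKoike n Q)) = ⊤ := by
  classical
  set N := Submodule.span ℂ (spanSet (n := n) Q : Set (ArikiKoike n Q)) with hN
  have h1 : ∀ (g : MvPolynomial (Fin n) ℂ), ∀ u ∈ normalWords (Tnat (n := n) Q) (n - 1),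
      pol Q g * u ∈ N := by
    intro g u hu
    have : monSpan Q ≤ N.comap (LinearMap.mulRight ℂ u) := by
      rw [monSpan, Submodule.span_le]
      rintro _ ⟨a, rfl⟩
      refine Submodule.subset_span ?_
      exact Finset.mem_coe.2 (Finset.mem_image.2 ⟨(a, u), by simpa using hu, rfl⟩)
    exact this (pol_mem_monSpan Q hr g)
  have h2 : ∀ h : ArikiKoike n Q, ∀ y ∈ N, h * y ∈ N := by
    intro h
    induction h using ArikiKoike.induction with
    | h0 c => intro y hy; rw [Algebra.algebraMap_eq_smul_one, smul_mul_assoc, one_mul]; exact N.smul_mem _ hy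
    | hmul a b ha hb => intro y hy; rw [mul_assoc]; exact ha _ (hb _ hy)
    | hadd a b ha hb => intro y hy; rw [add_mul]; exact add_mem (ha _ hy) (hb _ hy)
    | h1 i =>
      intro y hy
      have : N ≤ N.comap (LinearMap.mulLeft ℂ (T Q i)) := by
        conv_lhs => rw [hN]
        rw [Submodule.span_le]
        intro z hz
        obtain ⟨⟨a, u⟩, hu, rfl⟩ := Finset.mem_image.1 (Finset.mem_coe.1 hz)
        replace hu := (Finset.mem_product.1 hu).2
        simp only at hu
        rw [SetLike.mem_coe, Submodule.mem_comap, LinearMap.mulLeft_apply, ← mul_assoc]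
        by_cases hi0 : (i : ℕ) = 0
        · obtain ⟨i, hi⟩ := i
          simp only at hi0
          subst hi0
          rw [← L_zero, ← pol_X, ← map_mul]
          exact h1 _ _ hu
        · rw [eq_hi hi0, T_mul_pol, mul_assoc]
          exact h1 _ _ (Tnat_mul_mem Q _ hu)
      exact this hy
  rw [eq_top_iff]
  intro h _
  have := h2 h 1 (by simpa using h1 1 1 (one_mem_normalWords _ _))
  rwa [mul_one] at this

theorem finite (hr : 0 < r) : Module.Finite ℂ (ArikiKoike n Q) :=
  ⟨⟨spanSet Q, span_spanSet Q hr⟩⟩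

theorem finrank_le (hn : 0 < n) (hr : 0 < r) :
    Module.finrank ℂ (ArikiKoike n Q) ≤ r ^ n * n.factorial := by
  rw [← finrank_top, ← span_spanSet Q hr]
  exact (finrank_span_finset_le_card _).trans (card_spanSet_le Q hn)

end ArikiKoike
end SchurWeyl
end

noncomputable section
namespace SchurWeyl

open Polynomial MulOpposite

/-! ### The Hecke action on the tensor space, its faithfulness and its commutant -/

section Act

variable {n r : ℕ} (Q : Fin r → ℂˣ)

theorem ArikiKoike.lift_T {A : Type} [Ring A] [Algebra ℂ A] (f : Fin n → A)
    (h : ∀ x y, AKRel n Q x y → FreeAlgebra.lift ℂ f x = FreeAlgebra.lift ℂ f y) (i : Fin n) :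
    ArikiKoike.lift f h (ArikiKoike.T Q i) = f i := by
  have := RingQuot.liftAlgHom_mkAlgHom_apply (S := ℂ) (s := AKRel n Q) (FreeAlgebra.lift ℂ f)
    (fun {x y} hxy => h x y hxy) (FreeAlgebra.ι ℂ i)
  rw [FreeAlgebra.lift_ι_apply] at this
  exact this

variable {V : Type} [AddCommGroup V] [Module ℂ V] {x : Module.End ℂ V}
  (hx : aeval x (∏ k : Fin r, (X - C (Q k : ℂ))) = 0)

theorem akAct_T_hi (i : Fin (n - 1)) :
    akAct n Q x hx (op (ArikiKoike.T Q (hi i))) = permEnd (adjSwap i) := by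
  refine (congrArg unop (ArikiKoike.lift_T Q _ _ (hi i))).trans ?_
  rw [unop_op, dif_neg (by simp [hi])]
  rfl

theorem akAct_T_zero (h : 0 < n) :
    akAct n Q x hx (op (ArikiKoike.T Q ⟨0, h⟩)) = place ⟨0, h⟩ x := by
  refine (congrArg unop (ArikiKoike.lift_T Q _ _ _)).trans ?_
  rw [unop_op, dif_pos rfl]

theorem akAct_L (j : Fin n) : akAct n Q x hx (op (ArikiKoike.L Q j)) = place j x := by
  obtain ⟨j, hj⟩ := j
  induction j with
  | zero => rw [ArikiKoike.L_zero, akAct_T_zero]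
  | succ j ih =>
    have h := ArikiKoike.L_hi Q (⟨j, by omega⟩ : Fin (n - 1))
    change ArikiKoike.L Q ⟨j + 1, hj⟩ = _ at h
    have ih' : akAct n Q x hx (op (ArikiKoike.L Q (lo (⟨j, by omega⟩ : Fin (n - 1))))) = _ :=
      ih (by omega)
    rw [h, op_mul, op_mul, map_mul, map_mul, akAct_T_hi, ih', ← mul_assoc, permEnd_place, mul_assoc,
      ← permEnd_mul, adjSwap_sq, permEnd_one, mul_one]
    exact congrArg (fun j => place j x) (Equiv.swap_apply_left (lo _) (hi _))

theorem akAct_aeval_L (j : Fin n) (g : ℂ[X]) :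
    akAct n Q x hx (op (aeval (ArikiKoike.L Q j) g)) = place j (aeval x g) := by
  rw [← aeval_algHom_apply, ← akAct_L Q hx, aeval_algHom_apply]
  congr 1
  apply unop_injective
  rw [unop_op, unop_aeval_op]

theorem akAct_prod (l : List (Fin (n - 1))) :
    akAct n Q x hx (op (l.map fun i => ArikiKoike.T Q (hi i)).prod) =
      permEnd (l.map adjSwap).prod⁻¹ := by
  induction l with
  | nil => simp [permEnd_one]
  | cons i l ih =>
    rw [List.map_cons, List.prod_cons, op_mul, map_mul, ih, akAct_T_hi, List.map_cons,
      List.prod_cons, mul_inv_rev, permEnd_mul, inv_eq_of_mul_eq_one_left (adjSwap_sq i)]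

/-- The inverse appears because a right action is written by operators acting from the left. -/
theorem akAct_Tw (w : Equiv.Perm (Fin n)) :
    akAct n Q x hx (op (ArikiKoike.Tw Q w)) = permEnd w⁻¹ := by
  rw [ArikiKoike.Tw, akAct_prod, (exists_reducedWord w).choose_spec.1]

theorem akAct_mem (f : Module.End ℂ (TPow n V)) (hf : f ∈ Sch n x) (h : (ArikiKoike n Q)ᵐᵒᵖ) :
    akAct n Q x hx h * f = f * akAct n Q x hx h := by
  obtain ⟨h, rfl⟩ := op_surjective h
  obtain ⟨h1, h2⟩ := mem_Sch.1 hf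
  induction h using ArikiKoike.induction with
  | h0 c =>
    rw [← MulOpposite.algebraMap_apply, AlgHom.commutes]
    exact Algebra.commutes _ _
  | h1 i =>
    by_cases hi0 : (i : ℕ) = 0
    · obtain ⟨i, hi⟩ := i
      simp only at hi0
      subst hi0
      rw [akAct_T_zero]; exact h2 _
    · rw [ArikiKoike.eq_hi hi0, akAct_T_hi]; exact h1 _
  | hmul a b ha hb => rw [op_mul, map_mul, mul_assoc, ha, ← mul_assoc, hb, mul_assoc]
  | hadd a b ha hb => rw [op_add, map_add, add_mul, mul_add, ha, hb]

/-- The algebra acts through the place permutations (by the `T_w`) and the placed `x` (by the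
`L_j`), which are the operators that define `Sch`. -/
theorem centralizer_akAct :
    Subalgebra.centralizer ℂ ((akAct n Q x hx).range : Set _) = Sch n x := by
  ext f
  constructor
  · intro hf
    rw [Subalgebra.mem_centralizer_iff] at hf
    refine mem_Sch.2 ⟨fun w => ?_, fun j => ?_⟩
    · have := hf (akAct n Q x hx (op (ArikiKoike.Tw Q w⁻¹))) ⟨_, rfl⟩
      rwa [akAct_Tw, inv_inv] at this
    · have := hf (akAct n Q x hx (op (ArikiKoike.L Q j))) ⟨_, rfl⟩
      rwa [akAct_L] at this
  · intro hf
    rw [Subalgebra.mem_centralizer_iff]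
    rintro _ ⟨h, rfl⟩
    exact akAct_mem Q hx f hf h

end Act

/-- The anti-automorphism of the Ariki-Koike algebra that fixes the generators. -/
def ArikiKoike.antiHom {n r : ℕ} (Q : Fin r → ℂˣ) : ArikiKoike n Q →ₐ[ℂ] (ArikiKoike n Q)ᵐᵒᵖ :=
  ArikiKoike.lift (fun i => op (T Q i)) (by
    intro a b h
    apply unop_injective
    cases h with
    | cyc h =>
      rw [← aeval_algHom_apply, FreeAlgebra.lift_ι_apply, unop_aeval_op, T_cyc, map_zero, unop_zero]
    | quad i h =>
      simp only [map_mul, map_sub, map_add, map_one, map_zero, FreeAlgebra.lift_ι_apply, unop_mul,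
        unop_sub, unop_add, unop_one, unop_zero, unop_op]
      rw [mul_sub, add_mul, T_sq Q h, mul_one, one_mul]
      abel
    | braid0 i j hi hj =>
      simpa only [map_mul, FreeAlgebra.lift_ι_apply, unop_mul, unop_op, mul_assoc] using
        (T_braid0 Q hi hj).symm
    | braid i j hi hj =>
      simpa only [map_mul, FreeAlgebra.lift_ι_apply, unop_mul, unop_op, mul_assoc] using
        T_braid Q hi hj
    | comm i j h =>
      simpa only [map_mul, FreeAlgebra.lift_ι_apply, unop_mul, unop_op] using
        (T_comm Q h).eq.symm)

theorem ArikiKoike.unop_antiHom_antiHom {n r : ℕ} (Q : Fin r → ℂˣ) (h : ArikiKoike n Q) :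
    unop (antiHom Q (unop (antiHom Q h))) = h := by
  induction h using ArikiKoike.induction with
  | h0 c =>
    rw [AlgHom.commutes, MulOpposite.algebraMap_apply, unop_op, AlgHom.commutes,
      MulOpposite.algebraMap_apply, unop_op]
  | h1 i => rw [antiHom, lift_T, unop_op, lift_T, unop_op]
  | hmul a b ha hb => rw [map_mul, unop_mul, map_mul, unop_mul, ha, hb]
  | hadd a b ha hb => rw [map_add, unop_add, map_add, unop_add, ha, hb]

/-- The Ariki-Koike algebra is isomorphic to its opposite. -/
def ArikiKoike.antiEquiv {n r : ℕ} (Q : Fin r → ℂˣ) :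
    ArikiKoike n Q ≃ₐ[ℂ] (ArikiKoike n Q)ᵐᵒᵖ :=
  AlgEquiv.ofBijective (antiHom Q)
    ⟨fun a b h => by rw [← unop_antiHom_antiHom Q a, h, unop_antiHom_antiHom],
      fun a => ⟨unop (antiHom Q (unop a)), unop_injective (unop_antiHom_antiHom Q _)⟩⟩

namespace ChainBasis

variable {P V : Type} [AddCommGroup V] [Module ℂ V] {d : P → ℕ} {q : ℕ → ℂ} {x : Module.End ℂ V}
  (B : ChainBasis d q x) {n r : ℕ} (Q : Fin r → ℂˣ)
  (hx : aeval x (∏ k : Fin r, (X - C (Q k : ℂ))) = 0) (ω : Fin n → P)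

/-- The orbit map `h ↦ v_ω h`. -/
def orbitMap : ArikiKoike n Q →ₗ[ℂ] TPow n V :=
  LinearMap.applyₗ (B.vT ω) ∘ₗ (akAct n Q x hx).toLinearMap ∘ₗ
    (MulOpposite.opLinearEquiv ℂ).toLinearMap

theorem orbitMap_apply (h : ArikiKoike n Q) :
    B.orbitMap Q hx ω h = akAct n Q x hx (op h) (B.vT ω) := rfl

theorem orbitMap_mul (h h' : ArikiKoike n Q) :
    B.orbitMap Q hx ω (h * h') = akAct n Q x hx (op h') (B.orbitMap Q hx ω h) := by
  rw [orbitMap_apply, op_mul, map_mul, Module.End.mul_apply, orbitMap_apply]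

/-- `T_w` produces the rearrangement `v_{ω ∘ w}`, and the `L_j` then move down the chain in each
factor. -/
theorem zT_mem_range_orbitMap (w : Equiv.Perm (Fin n)) {ζ : Fin n → (p : P) × Fin (d p + 1)}
    (hζ : ∀ i, (ζ i).1 = ω (w i)) : B.zT n ζ ∈ LinearMap.range (B.orbitMap Q hx ω) := by
  refine B.map_mem_of_vT (f := 1) (J := fun i => ω (w i)) (fun j => by simp) ?_ ?_ hζ
  · rintro j _ ⟨h, rfl⟩
    exact ⟨h * ArikiKoike.L Q j, by rw [orbitMap_mul, akAct_L]⟩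
  · refine ⟨ArikiKoike.Tw Q w, ?_⟩
    rw [orbitMap_apply, akAct_Tw, permEnd_vT]
    rfl

/-- Dimension count: the image contains the `n! r^n` independent basis tensors whose words rearrange
`ω`, which is at least the dimension of the algebra. -/
theorem orbitMap_injective (hn : 0 < n) (hω : Function.Injective ω) (hd : ∀ i, d (ω i) + 1 = r) :
    Function.Injective (B.orbitMap Q hx ω) := by
  have hr : 0 < r := by have := hd ⟨0, hn⟩; omega
  have := ArikiKoike.finite (n := n) Q hr
  let ζ : Equiv.Perm (Fin n) × (Fin n → Fin r) → Fin n → (p : P) × Fin (d p + 1) :=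
    fun a i => ⟨ω (a.1 i), Fin.cast (hd _).symm (a.2 i)⟩
  have hζ : Function.Injective ζ := by
    rintro ⟨w, k⟩ ⟨w', k'⟩ h
    obtain rfl : w = w' := Equiv.ext fun i => hω (congrArg Sigma.fst (congrFun h i))
    have : k = k' := funext fun i =>
      Fin.cast_injective _ (eq_of_heq (Sigma.mk.inj (congrFun h i)).2)
    rw [this]
  have hli : LinearIndependent ℂ (fun a => B.zT n (ζ a)) :=
    (B.zT n).linearIndependent.comp ζ hζ
  have h1 : Fintype.card (Equiv.Perm (Fin n) × (Fin n → Fin r)) ≤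
      Module.finrank ℂ (LinearMap.range (B.orbitMap Q hx ω)) := by
    have hli' : LinearIndependent ℂ (fun a => (⟨B.zT n (ζ a),
        B.zT_mem_range_orbitMap Q hx ω a.1 fun _ => rfl⟩ :
          LinearMap.range (B.orbitMap Q hx ω))) :=
      LinearIndependent.of_comp (Submodule.subtype _) hli
    exact hli'.fintype_card_le_finrank
  rw [Fintype.card_prod, Fintype.card_perm, Fintype.card_fun, Fintype.card_fin,
    Fintype.card_fin] at h1
  have h2 := ArikiKoike.finrank_le (n := n) Q hn hr
  have h3 := LinearMap.finrank_range_add_finrank_ker (B.orbitMap Q hx ω)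
  rw [← LinearMap.ker_eq_bot, ← Submodule.finrank_eq_zero (R := ℂ)]
  rw [mul_comm] at h1
  omega

theorem akAct_injective (B : ChainBasis d q x) (hn : 0 < n) (hω : Function.Injective ω) (hd : ∀ i, d (ω i) + 1 = r) :
    Function.Injective (akAct n Q x hx) := by
  intro a b h
  apply unop_injective
  apply B.orbitMap_injective Q hx ω hn hω hd
  rw [orbitMap_apply, orbitMap_apply, op_unop, op_unop, h]

/-- An endomorphism that commutes with `Sch` is given by an element of the Ariki-Koike algebra. -/
theorem centralizer_Sch [DecidableEq P] (B : ChainBasis d q x) (hω : Function.Injective ω) (hd : ∀ i, d (ω i) + 1 = r)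
    (hdr : ∀ p, d p < r) :
    Subalgebra.centralizer ℂ (Sch n x : Set (Module.End ℂ (TPow n V))) ≤ (akAct n Q x hx).range := by
  intro f hf
  rw [Subalgebra.mem_centralizer_iff] at hf
  -- The letters of `ω` have the largest possible degree, so `KT (d ∘ ω)` is the whole space and
  -- `theta` reaches every tensor.
  have hK : ∀ y, y ∈ B.KT (fun i => d (ω i)) := by
    intro y ζ hζ
    refine absurd (fun i => ?_) hζ
    have := hd i
    have := (ζ i).2.2
    have := hdr (ζ i).1
    change ((ζ i).2 : ℕ) ≤ d (ω i)
    omega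
  have h0 : f (B.vT ω) ∈ LinearMap.range (B.orbitMap Q hx ω) := by
    -- `f` commutes with the projection onto the weight space of `ω`, so `f v_ω` stays in that
    -- space, and all its basis tensors lie in `v_ω H`.
    have h1 : f (B.vT ω) = B.proj (orb ω) (f (B.vT ω)) := by
      have := LinearMap.congr_fun (hf _ (B.proj_orb_mem ω)) (B.vT ω)
      rw [Module.End.mul_apply, Module.End.mul_apply, proj_vT, if_pos (self_mem_orb ω)] at this
      exact this.symm
    rw [h1]
    have : (⊤ : Submodule ℂ (TPow n V)) ≤
        (LinearMap.range (B.orbitMap Q hx ω)).comap (B.proj (orb ω)) := by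
      rw [← (B.zT n).span_eq, Submodule.span_le]
      rintro _ ⟨ζ, rfl⟩
      rw [SetLike.mem_coe, Submodule.mem_comap, proj_zT]
      split_ifs with h
      · obtain ⟨w, hw⟩ := mem_orb.1 h
        exact B.zT_mem_range_orbitMap Q hx ω w (congrFun hw)
      · exact zero_mem _
    exact this trivial
  obtain ⟨h, hh⟩ := h0
  -- Write `y = θ_y v_ω` with `θ_y` in `Sch`. Then `f y = θ_y (f v_ω) = θ_y (v_ω h) = y h`.
  refine ⟨op h, LinearMap.ext fun y => ?_⟩
  have hS := B.theta_mem ω y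
  have h2 := LinearMap.congr_fun (hf _ hS) (B.vT ω)
  have h3 := LinearMap.congr_fun (akAct_mem Q hx _ hS (op h)) (B.vT ω)
  rw [Module.End.mul_apply, Module.End.mul_apply, B.theta_vT ω hω (hK y)] at h2 h3
  rw [orbitMap_apply] at hh
  exact h3.trans ((congrArg _ hh).trans h2)

end ChainBasis
end SchurWeyl
end

noncomputable section
namespace SchurWeyl

/-! ### Compositions, rows and parabolic subgroups -/

section FinSigma

variable {M : ℕ} (f : Fin M → ℕ)

theorem finSigma_bounds (a : Fin (∑ j, f j)) :
    ∑ j ∈ Finset.Iio (finSigmaFinEquiv.symm a).1, f j ≤ a ∧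
      (a : ℕ) < ∑ j ∈ Finset.Iic (finSigmaFinEquiv.symm a).1, f j := by
  obtain ⟨⟨p, k⟩, rfl⟩ := finSigmaFinEquiv.surjective a
  rw [Equiv.symm_apply_apply, finSigmaFinEquiv_apply]
  have h1 : ∑ j ∈ Finset.Iio p, f j = ∑ j : Fin p, f (Fin.castLE p.2.le j) := by
    symm
    refine Finset.sum_bij (fun j _ => Fin.castLE p.2.le j) ?_ ?_ ?_ ?_
    · intro j _; simp [Fin.lt_def]
    · intro a _ b _ h; exact Fin.castLE_injective _ h
    · intro b hb
      exact ⟨⟨b, Fin.lt_def.1 (Finset.mem_Iio.1 hb)⟩, Finset.mem_univ _, rfl⟩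
    · intro j _; rfl
  have h2 : ∑ j ∈ Finset.Iic p, f j = ∑ j ∈ Finset.Iio p, f j + f p := by
    rw [← Finset.Iio_insert, Finset.sum_insert (by simp), add_comm]
  rw [h2, h1]
  have := k.2
  simp only at this ⊢
  omega

theorem finSigma_fst_mono : Monotone fun a : Fin (∑ j, f j) => (finSigmaFinEquiv.symm a).1 := by
  intro a b hab
  by_contra! h
  have h1 := (finSigma_bounds f a).1
  have h2 := (finSigma_bounds f b).2
  have h3 : ∑ j ∈ Finset.Iic (finSigmaFinEquiv.symm b).1, f j ≤
      ∑ j ∈ Finset.Iio (finSigmaFinEquiv.symm a).1, f j :=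
    Finset.sum_le_sum_of_subset fun j hj => by
      rw [Finset.mem_Iic] at hj
      exact Finset.mem_Iio.2 (hj.trans_lt h)
  have := Fin.le_def.1 hab
  omega

end FinSigma

theorem block_mono {r : ℕ} (m : Fin r → ℕ+) : Monotone (block m) := finSigma_fst_mono _

namespace RComp

variable {n r : ℕ} {m : Fin r → ℕ+} (μ : RComp n m)

theorem row_mono : Monotone μ.row := fun _ _ hab =>
  finSigma_fst_mono _ (Fin.le_def.2 (Fin.le_def.1 hab))

theorem row_bounds (i : Fin n) : ∑ j ∈ Finset.Iio (μ.row i), μ.flat j ≤ i ∧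
    (i : ℕ) < ∑ j ∈ Finset.Iic (μ.row i), μ.flat j :=
  finSigma_bounds _ (Fin.cast (sum_flat μ).symm i)

theorem card_row (p : Fin (total m)) : Fintype.card {i // μ.row i = p} = μ.flat p := by
  let e : {i // μ.row i = p} ≃ {a : (p : Fin (total m)) × Fin (μ.flat p) // a.1 = p} :=
    ((finCongr (sum_flat μ).symm).trans finSigmaFinEquiv.symm).subtypeEquiv fun i => Iff.rfl
  rw [Fintype.card_congr (e.trans (Equiv.sigmaSubtype p)), Fintype.card_fin]

theorem flat_xi (a : (k : Fin r) × Fin (m k : ℕ)) : μ.flat (xi m a) = μ.1 a.1 a.2 := by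
  rw [flat, Equiv.symm_apply_apply]

theorem flat_injective : Function.Injective (flat (n := n) (m := m)) := by
  intro μ ν h
  refine Subtype.ext (funext fun k => funext fun i => ?_)
  have := congrFun h (xi m ⟨k, i⟩)
  rwa [flat_xi, flat_xi] at this

/-- The parts of a composition are the fibre sizes of its row function, and these do not change
under rearrangement. -/
theorem eq_of_row_comp {μ ν : RComp n m} (w : Equiv.Perm (Fin n))
    (h : ν.row = fun i => μ.row (w i)) : ν = μ := by
  refine flat_injective (funext fun p => ?_)
  rw [← card_row, ← card_row]
  exact Fintype.card_congr (w.subtypeEquiv fun i => by rw [h])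

instance : Finite (RComp n m) :=
  Finite.of_injective (fun μ : RComp n m => μ.row) fun _ _ h =>
    eq_of_row_comp 1 (funext fun i => congrFun h i)

/-- Let `μ` count the occurrences of each letter of `J`; bijections between fibres of equal size
glue to the permutation `w`. With `eq_of_row_comp`, orbits of words correspond to compositions. -/
theorem exists_row_comp (J : Fin n → Fin (total m)) :
    ∃ (μ : RComp n m) (w : Equiv.Perm (Fin n)), J = fun i => μ.row (w i) := by
  classical
  let μ : RComp n m := ⟨fun k i => Fintype.card {j // J j = xi m ⟨k, i⟩}, by
    rw [← Fintype.sum_sigma', Equiv.sum_comp (xi m) (fun p => Fintype.card {j // J j = p}),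
      ← Fintype.card_sigma, Fintype.card_congr (Equiv.sigmaFiberEquiv J), Fintype.card_fin]⟩
  have hc : ∀ p, Fintype.card {j // J j = p} = Fintype.card {j // μ.row j = p} := by
    intro p
    rw [card_row, flat]
    simp only [μ]
    rw [show (⟨((xi m).symm p).1, ((xi m).symm p).2⟩ : (k : Fin r) × Fin (m k : ℕ)) = (xi m).symm p
      from rfl, Equiv.apply_symm_apply]
  refine ⟨μ, (Equiv.sigmaFiberEquiv J).symm.trans ((Equiv.sigmaCongrRight fun p =>
    Fintype.equivOfCardEq (hc p)).trans (Equiv.sigmaFiberEquiv μ.row)), funext fun i => ?_⟩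
  exact ((Fintype.equivOfCardEq (hc (J i))) ⟨i, rfl⟩).2.symm

/-- `a_k` counts the positions in the blocks before `k`, and these positions form an initial segment
because the row function is monotone. -/
theorem lt_aSum_iff (i : Fin n) (k : Fin r) : (i : ℕ) < μ.aSum k ↔ block m (μ.row i) < k := by
  have ha : μ.aSum k = ∑ j ∈ Finset.univ.filter (fun j => block m j < k), μ.flat j := by
    rw [aSum, Finset.sum_filter, ← Equiv.sum_comp (xi m), Fintype.sum_sigma,
      show Finset.Iio k = Finset.univ.filter (· < k) by ext; simp, Finset.sum_filter]
    refine Finset.sum_congr rfl fun l _ => ?_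
    split_ifs with h
    · refine Finset.sum_congr rfl fun i _ => ?_
      rw [block, Equiv.symm_apply_apply, if_pos h, flat_xi]
    · refine (Finset.sum_eq_zero fun i _ => ?_).symm
      rw [block, Equiv.symm_apply_apply, if_neg h]
  obtain ⟨h1, h2⟩ := μ.row_bounds i
  constructor
  · intro h
    by_contra! hk
    have : μ.aSum k ≤ ∑ j ∈ Finset.Iio (μ.row i), μ.flat j := by
      rw [ha]
      refine Finset.sum_le_sum_of_subset fun j hj => ?_
      rw [Finset.mem_filter] at hj
      rw [Finset.mem_Iio]
      by_contra! hji
      exact absurd (hj.2.trans_le hk) (not_lt.2 (block_mono m hji))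
    omega
  · intro h
    refine h2.trans_le ?_
    rw [ha]
    refine Finset.sum_le_sum_of_subset fun j hj => ?_
    exact Finset.mem_filter.2
      ⟨Finset.mem_univ _, (block_mono m (Finset.mem_Iic.1 hj)).trans_lt h⟩

end RComp

theorem exists_descent {n : ℕ} {w : Equiv.Perm (Fin n)} (hw : w ≠ 1) :
    ∃ i : Fin (n - 1), w (hi i) < w (lo i) := by
  by_contra! h
  refine hw ?_
  have hmono : StrictMono w := by
    rcases n with _ | n
    · exact fun a => a.elim0
    · refine Fin.strictMono_iff_lt_succ.2 fun i => lt_of_le_of_ne (h i) fun h' => ?_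
      exact lo_ne_hi (k := n + 1) i (w.injective h')
  ext i
  have := hmono.id_le
  have h1 : ∀ i, i ≤ w i := fun i => hmono.le_apply
  have hsum : ∑ i, (w i : ℕ) = ∑ i : Fin n, (i : ℕ) := Equiv.sum_comp w (fun i => (i : ℕ))
  have h2 := (Finset.sum_eq_sum_iff_of_le (s := Finset.univ) (f := fun i : Fin n => (i : ℕ))
    (g := fun i => (w i : ℕ)) (fun i _ => Fin.le_def.1 (h1 i))).1 hsum.symm i (Finset.mem_univ _)
  exact h2.symm

/-- Suppose row-preserving permutations exist outside the parabolic subgroup, and choose `u` among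
them with `∑ i u(i)` maximal. Monotonicity of the rows forces a descent of `u` to lie within one
row. Multiplying by that simple reflection gives another such permutation with a larger sum. -/
theorem mem_parabolic_iff {n r : ℕ} {m : Fin r → ℕ+} (μ : RComp n m) (w : Equiv.Perm (Fin n)) :
    w ∈ μ.parabolic ↔ ∀ i, μ.row (w i) = μ.row i := by
  classical
  constructor
  · intro h
    induction h using Subgroup.closure_induction with
    | mem x hx =>
      obtain ⟨i, hi, rfl⟩ := hx
      intro j
      rw [adjSwap, Equiv.swap_apply_def]
      split_ifs with h1 h2
      · rw [h1, hi]
      · rw [h2, hi]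
      · rfl
    | one => simp
    | mul x y _ _ hx hy => intro i; rw [Equiv.Perm.mul_apply, hx, hy]
    | inv x _ hx => intro i; rw [← hx]; simp
  · intro h
    by_contra hw
    let S := Finset.univ.filter fun w : Equiv.Perm (Fin n) =>
      (∀ i, μ.row (w i) = μ.row i) ∧ w ∉ μ.parabolic
    obtain ⟨u, hu, hmax⟩ := S.exists_max_image (fun u => ∑ i : Fin n, (i : ℕ) * (u i : ℕ))
      ⟨w, Finset.mem_filter.2 ⟨Finset.mem_univ _, h, hw⟩⟩
    obtain ⟨-, hu1, hu2⟩ := Finset.mem_filter.1 hu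
    obtain ⟨i, hi'⟩ := exists_descent (w := u) (by rintro rfl; exact hu2 (one_mem _))
    have hrow : μ.row (lo i) = μ.row (hi i) := by
      refine le_antisymm (μ.row_mono (Fin.le_def.2 (by simp [lo, hi]))) ?_
      rw [← hu1 (lo i), ← hu1 (hi i)]
      exact μ.row_mono hi'.le
    have hs : adjSwap i ∈ μ.parabolic := Subgroup.subset_closure ⟨i, hrow, rfl⟩
    have hs' : ∀ j, μ.row (adjSwap i j) = μ.row j := by
      intro j
      rw [adjSwap, Equiv.swap_apply_def]
      split_ifs with h1 h2
      · rw [h1, hrow]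
      · rw [h2, hrow]
      · rfl
    have h1 := hmax (u * adjSwap i) (Finset.mem_filter.2 ⟨Finset.mem_univ _,
      fun j => by rw [Equiv.Perm.mul_apply, hu1, hs'],
      fun hc => hu2 (by simpa using mul_mem hc (inv_mem hs))⟩)
    refine absurd h1 (not_le.2 ?_)
    have hsplit : ∀ g : Fin n → ℕ, ∑ j, g j = g (lo i) + g (hi i) +
        ∑ j ∈ (Finset.univ.erase (lo i)).erase (hi i), g j := by
      intro g
      rw [← Finset.add_sum_erase _ _ (Finset.mem_univ (lo i)), ← Finset.add_sum_erase _ _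
        (Finset.mem_erase.2 ⟨(lo_ne_hi i).symm, Finset.mem_univ (hi i)⟩), add_assoc]
    rw [hsplit (fun j => (j : ℕ) * (u j : ℕ)), hsplit]
    have hrest : ∑ j ∈ (Finset.univ.erase (lo i)).erase (hi i), (j : ℕ) * ((u * adjSwap i) j : ℕ) =
        ∑ j ∈ (Finset.univ.erase (lo i)).erase (hi i), (j : ℕ) * (u j : ℕ) := by
      refine Finset.sum_congr rfl fun j hj => ?_
      rw [Finset.mem_erase, Finset.mem_erase] at hj
      rw [Equiv.Perm.mul_apply, adjSwap, Equiv.swap_apply_of_ne_of_ne hj.2.1 hj.1]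
    rw [hrest]
    have hl : (u * adjSwap i) (lo i) = u (hi i) := by
      rw [Equiv.Perm.mul_apply, adjSwap, Equiv.swap_apply_left]
    have hh : (u * adjSwap i) (hi i) = u (lo i) := by
      rw [Equiv.Perm.mul_apply, adjSwap, Equiv.swap_apply_right]
    rw [hl, hh]
    have hlt := Fin.lt_def.1 hi'
    have e1 : ((lo i : Fin n) : ℕ) = i := rfl
    have e2 : ((hi i : Fin n) : ℕ) = i + 1 := rfl
    rw [e1, e2]
    nlinarith

end SchurWeyl
end

noncomputable section
namespace SchurWeyl

open Polynomial MulOpposite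

/-! ### Permutation modules inside the weight space of `ω` -/

namespace ChainBasis

variable {P V : Type} [AddCommGroup V] [Module ℂ V] {d : P → ℕ} {q : ℕ → ℂ} {x : Module.End ℂ V}
  (B : ChainBasis d q x) {n : ℕ}

theorem chain_z (p : P) {k l : Fin (d p + 1)} (h : k ≤ l) :
    aeval x (∏ i ∈ Finset.Ioc (k : ℕ) l, (X - C (q i))) (B.z ⟨p, l⟩) = B.z ⟨p, k⟩ := by
  rw [← B.chain p l, ← B.chain p k, ← Module.End.mul_apply, ← map_mul]
  congr 2
  have hd : (l : ℕ) ≤ d p := Nat.lt_succ_iff.1 l.2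
  rw [← Finset.Ioc_union_Ioc_eq_Ioc (Fin.le_def.1 h) hd, Finset.prod_union]
  exact Finset.Ioc_disjoint_Ioc_of_le le_rfl

variable [DecidableEq P] (ω J : Fin n → P) (hd : ∀ i, d (J i) ≤ d (ω i))

/-- The vector `z_{ω i, d (J i)}`. -/
def permVec (i : Fin n) : V := B.z ⟨ω i, ⟨d (J i), Nat.lt_succ_iff.2 (hd i)⟩⟩

/-- The element of `Sch` that embeds the weight space of `J` in the weight space of `ω`. -/
def embed : Module.End ℂ (TPow n V) := B.chi ω J (B.permVec ω J hd)

theorem embed_mem : B.embed ω J hd ∈ Sch n x :=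
  B.chi_mem ω fun _ => basis_mem_coordSpan (by simp)

theorem eps_permVec (i : Fin n) : B.eps (ω i) (B.permVec ω J hd i) = B.permVec ω J hd i := by
  rw [permVec, eps_z, if_pos rfl]

variable {ω} in
theorem embed_vT (hω : Function.Injective ω) (J' : Fin n → P) :
    B.embed ω J hd (B.vT J') = ∑ w : Equiv.Perm (Fin n), if (fun i => J (w i)) = J' then
      PiTensorProduct.tprod ℂ fun i => B.permVec ω J hd (w i) else 0 :=
  B.chi_vT ω J hω (B.eps_permVec ω J hd) J'

variable {ω} in
theorem embed_vT_of_notMem (hω : Function.Injective ω) {J' : Fin n → P} (h : J' ∉ orb J) :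
    B.embed ω J hd (B.vT J') = 0 := by
  rw [embed_vT B J hd hω]
  exact Finset.sum_eq_zero fun w _ => if_neg fun h' => h (mem_orb.2 ⟨w, h'.symm⟩)

variable {ω} in
-- The underlying map of `V` sends the chain over `p`, with heights preserved, into the bottoms of
-- the chains over all `ω i` with `J i = p`. As the `ω i` are distinct, the coordinates of `t` at
-- words in the orbit of `J` can be recovered, so `embed` is injective on this weight space.
theorem repr_embed (hω : Function.Injective ω) (w : Equiv.Perm (Fin n))
    (k : (i : Fin n) → Fin (d (J (w i)) + 1)) (t : TPow n V) :
    (B.zT n).repr (B.embed ω J hd t)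
      (fun i => ⟨ω (w i), Fin.castLE (Nat.succ_le_succ (hd (w i))) (k i)⟩) =
      (B.zT n).repr t (fun i => ⟨J (w i), k i⟩) := by
  have h1 : ∀ (s : TPow n V) (ζ : Fin n → (p : P) × Fin (d p + 1)),
      (fun i => (ζ i).1) ∈ orb ω → (B.zT n).repr (B.proj (orb ω) s) ζ = (B.zT n).repr s ζ := by
    intro s ζ hζ
    have : (B.zT n).coord ζ ∘ₗ B.proj (orb ω) = (B.zT n).coord ζ := by
      refine (B.zT n).ext fun ξ => ?_
      rw [LinearMap.comp_apply, proj_zT]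
      split_ifs with h
      · rfl
      · rw [map_zero, Module.Basis.coord_apply, Module.Basis.repr_self, Finsupp.single_apply,
          if_neg]
        rintro rfl
        exact h hζ
    exact LinearMap.congr_fun this s
  set g : Module.End ℂ V := B.hom fun p => ∑ i, if J i = p then B.permVec ω J hd i else 0 with hg
  have h2 : ∀ (j : Fin n) (l : Fin (d (J j) + 1)) (u : V),
      B.z.repr (g u) ⟨ω j, Fin.castLE (Nat.succ_le_succ (hd j)) l⟩ = B.z.repr u ⟨J j, l⟩ := by
    intro j l u
    have : B.z.coord ⟨ω j, Fin.castLE (Nat.succ_le_succ (hd j)) l⟩ ∘ₗ g = B.z.coord ⟨J j, l⟩ := by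
      refine B.z.ext ?_
      rintro ⟨p, l'⟩
      have hsum : g (B.z ⟨p, l'⟩) = ∑ i, if h : J i = p then
          B.z ⟨ω i, ⟨l', l'.2.trans_le (Nat.succ_le_succ (h ▸ hd i))⟩⟩ else 0 := by
        rw [hg, hom_z, map_sum]
        refine Finset.sum_congr rfl fun i _ => ?_
        split_ifs with h
        · subst h
          exact B.chain_z (ω i) (k := ⟨l', _⟩) (l := ⟨d (J i), _⟩)
            (Fin.le_def.2 (Nat.lt_succ_iff.1 l'.2))
        · rw [map_zero]
      rw [LinearMap.comp_apply, hsum, map_sum, Finset.sum_eq_single j]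
      · rw [Module.Basis.coord_apply, Module.Basis.coord_apply, Module.Basis.repr_self]
        split_ifs with h
        · subst h
          rw [Module.Basis.repr_self, Finsupp.single_apply, Finsupp.single_apply]
          refine if_congr ?_ rfl rfl
          simp only [Sigma.mk.injEq, heq_eq_eq, true_and, Fin.ext_iff, Fin.val_castLE]
        · rw [Finsupp.single_apply, if_neg, map_zero, Finsupp.zero_apply]
          intro h'
          exact h (congrArg Sigma.fst h').symm
      · intro i _ hij
        split_ifs with h
        · rw [Module.Basis.coord_apply, Module.Basis.repr_self, Finsupp.single_apply, if_neg]
          intro h'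
          exact hij (hω (congrArg Sigma.fst h'))
        · rw [map_zero]
      · simp
    exact LinearMap.congr_fun this u
  rw [embed, chi, Module.End.mul_apply, h1 _ _ (mem_orb.2 ⟨w, rfl⟩)]
  have key : (B.zT n).coord
      (fun i => ⟨ω (w i), Fin.castLE (Nat.succ_le_succ (hd (w i))) (k i)⟩) ∘ₗ tmap (fun _ => g) =
      (B.zT n).coord (fun i => ⟨J (w i), k i⟩) := by
    ext u
    simp only [LinearMap.compMultilinearMap_apply, LinearMap.comp_apply, tmap_tprod,
      Module.Basis.coord_apply, zT_repr_tprod, h2]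
  exact LinearMap.congr_fun key t

end ChainBasis

section Hecke

variable {n r : ℕ} (Q : Fin r → ℂˣ) {V : Type} [AddCommGroup V] [Module ℂ V] {x : Module.End ℂ V}
  (hx : aeval x (∏ k : Fin r, (X - C (Q k : ℂ))) = 0)

theorem pol_aeval_X (j : Fin n) (g : ℂ[X]) :
    ArikiKoike.pol Q (aeval (MvPolynomial.X j) g) = aeval (ArikiKoike.L Q j) g := by
  rw [← aeval_algHom_apply, ArikiKoike.pol_X]

theorem akAct_pol_prod (g : Fin n → ℂ[X]) (u : Fin n → V) :
    akAct n Q x hx (op (ArikiKoike.pol Q (∏ i, aeval (MvPolynomial.X i) (g i))))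
      (PiTensorProduct.tprod ℂ u) = PiTensorProduct.tprod ℂ fun i => aeval x (g i) (u i) := by
  have key : ∀ s : Finset (Fin n), akAct n Q x hx
      (op (ArikiKoike.pol Q (∏ i ∈ s, aeval (MvPolynomial.X i) (g i)))) (PiTensorProduct.tprod ℂ u) =
        PiTensorProduct.tprod ℂ fun i => if i ∈ s then aeval x (g i) (u i) else u i := by
    intro s
    induction s using Finset.induction_on with
    | empty => simp
    | insert a s ha ih =>
      rw [Finset.prod_insert ha, mul_comm, map_mul, op_mul, map_mul, Module.End.mul_apply, ih,
        pol_aeval_X, akAct_aeval_L, place_tprod, if_neg ha]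
      congr 1
      funext i
      by_cases hi : i = a
      · subst hi; simp
      · simp [hi]
  simpa using key Finset.univ

/-- Regroups the commuting factors `L_i - Q_k` by the position `i`, so that they act factor by
factor on pure tensors. -/
theorem mMu_eq {m : Fin r → ℕ+} (μ : RComp n m) : ArikiKoike.mMu Q μ = ArikiKoike.xMu Q μ *
    ArikiKoike.pol Q (∏ i, aeval (MvPolynomial.X i)
      (∏ k : Fin r, if (i : ℕ) < μ.aSum k then X - C (Q k : ℂ) else 1)) := by
  rw [ArikiKoike.mMu]
  congr 1
  simp only [map_prod]
  rw [Finset.prod_comm, ← List.prod_ofFn]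
  simp only [← List.prod_ofFn]
  rw [map_list_prod, List.map_ofFn]
  congr 2
  funext k
  rw [Function.comp_apply, map_list_prod, List.map_ofFn]
  congr 2
  funext i
  rw [Function.comp_apply]
  split_ifs
  · simp [ArikiKoike.pol_X, MvPolynomial.algebraMap_eq]
  · simp

end Hecke

section PermutationModules

variable {n r : ℕ} {m : Fin r → ℕ+} {Q : Fin r → ℂˣ} {V : Type} [AddCommGroup V] [Module ℂ V]
  {x : Module.End ℂ V} (B : ChainBasis (fun p => (block m p : ℕ)) (qf Q) x)
  (hx : aeval x (∏ k : Fin r, (X - C (Q k : ℂ))) = 0) (ω : Fin n → Fin (total m))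

theorem block_le_of_last {ω : Fin n → Fin (total m)} (hd : ∀ i, (block m (ω i) : ℕ) + 1 = r)
    (J : Fin n → Fin (total m)) (i : Fin n) : (block m (J i) : ℕ) ≤ block m (ω i) := by
  have := hd i
  have := (block m (J i)).2
  omega

/-- `v_ω x_μ` is the sum of the `v_{ω ∘ w}` over the row-preserving `w`. By `lt_aSum_iff`, the
position `i` then receives the factors `x - Q_k` with `k` greater than the block of its row, which
lower `v_{ω (w i)}` to the height equal to that block. This is the value of `embed` at `v_μ`. -/
theorem orbitMap_mMu (hω : Function.Injective ω)
    (hd : ∀ i, (block m (ω i) : ℕ) + 1 = r)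
    (μ : RComp n m) : B.orbitMap Q hx ω (ArikiKoike.mMu Q μ) =
    B.embed ω μ.row (block_le_of_last hd _) (B.vT μ.row) := by
  classical
  rw [B.embed_vT _ _ hω, mMu_eq, B.orbitMap_mul, ArikiKoike.xMu, map_sum, map_sum,
    ← Finset.sum_filter]
  refine Finset.sum_congr ?_ fun w hw => ?_
  · ext w
    simp only [Finset.mem_filter, Finset.mem_univ, true_and, mem_parabolic_iff, funext_iff]
  · replace hw := congrFun (Finset.mem_filter.1 hw).2
    rw [B.orbitMap_apply, akAct_Tw, B.permEnd_vT, ChainBasis.vT, akAct_pol_prod]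
    congr 1
    funext i
    rw [show (w⁻¹).symm i = w i from rfl, ChainBasis.permVec, ← B.chain]
    congr 2
    rw [← Finset.prod_filter]
    refine Finset.prod_bij (fun k _ => (k : ℕ)) ?_ ?_ ?_ ?_
    · intro k hk
      rw [Finset.mem_filter, RComp.lt_aSum_iff, ← hw i] at hk
      have := hd (w i)
      rw [Finset.mem_Ioc]
      have := Fin.lt_def.1 hk.2
      exact ⟨this, by omega⟩
    · intro a _ b _ h; exact Fin.ext h
    · intro k hk
      have := hd (w i)
      rw [Finset.mem_Ioc] at hk
      refine ⟨⟨k, by omega⟩, ?_, rfl⟩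
      rw [Finset.mem_filter, RComp.lt_aSum_iff, ← hw i]
      exact ⟨Finset.mem_univ _, Fin.lt_def.2 hk.1⟩
    · intro k _; rw [qf_fin]

/-- `v_ω M^μ` is stable under the placed `x`, so the tensors `v_J` suffice; those in the orbit of
`μ` are `v_μ T_w`, and the others are killed. -/
theorem embed_mem_map_MMu (hω : Function.Injective ω)
    (hd : ∀ i, (block m (ω i) : ℕ) + 1 = r)
    (μ : RComp n m) (t : TPow n V) :
    B.embed ω μ.row (block_le_of_last hd _) t ∈
      ((ArikiKoike.MMu Q μ).restrictScalars ℂ).map (B.orbitMap Q hx ω) := by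
  refine B.range_le_of_vT (mem_Sch.1 (B.embed_mem ω _ _)).2 ?_ ?_ t
  · rintro j _ ⟨h, hh, rfl⟩
    exact ⟨h * ArikiKoike.L Q j, (ArikiKoike.MMu Q μ).smul_mem (op (ArikiKoike.L Q j)) hh, by
      rw [B.orbitMap_mul, akAct_L]⟩
  · intro J
    by_cases hJ : J ∈ ChainBasis.orb μ.row
    · obtain ⟨w, rfl⟩ := ChainBasis.mem_orb.1 hJ
      refine ⟨ArikiKoike.mMu Q μ * ArikiKoike.Tw Q w, (ArikiKoike.MMu Q μ).smul_mem
        (op (ArikiKoike.Tw Q w)) (Submodule.mem_span_singleton_self _), ?_⟩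
      rw [B.orbitMap_mul, orbitMap_mMu B hx ω hω hd, akAct_Tw, ← Sch_permEnd (B.embed_mem ω _ _),
        B.permEnd_vT]
      rfl
    · rw [B.embed_vT_of_notMem _ _ hω hJ]
      exact zero_mem _

/-- The component of the isomorphism of `V ^ ⊗ n` with the sum of the permutation modules. -/
def toMMu (hω : Function.Injective ω)
    (hd : ∀ i, (block m (ω i) : ℕ) + 1 = r)
    (hn : 0 < n) (μ : RComp n m) : TPow n V →ₗ[ℂ] ArikiKoike.MMu Q μ :=
  ((Submodule.equivMapOfInjective (B.orbitMap Q hx ω) (B.orbitMap_injective Q hx ω hn hω hd)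
    ((ArikiKoike.MMu Q μ).restrictScalars ℂ)).symm.toLinearMap ∘ₗ
      (B.embed ω μ.row (block_le_of_last hd _)).codRestrict _
        (embed_mem_map_MMu B hx ω hω hd μ) :)

theorem orbitMap_toMMu (hω : Function.Injective ω)
    (hd : ∀ i, (block m (ω i) : ℕ) + 1 = r)
    (hn : 0 < n) (μ : RComp n m) (t : TPow n V) :
    B.orbitMap Q hx ω (toMMu B hx ω hω hd hn μ t : ArikiKoike n Q) =
      B.embed ω μ.row (block_le_of_last hd _) t := by
  have := Submodule.equivMapOfInjective (B.orbitMap Q hx ω) (B.orbitMap_injective Q hx ω hn hω hd)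
    ((ArikiKoike.MMu Q μ).restrictScalars ℂ)
  exact congrArg Subtype.val (LinearEquiv.apply_symm_apply (Submodule.equivMapOfInjective
    (B.orbitMap Q hx ω) (B.orbitMap_injective Q hx ω hn hω hd)
      ((ArikiKoike.MMu Q μ).restrictScalars ℂ)) ⟨_, embed_mem_map_MMu B hx ω hω hd μ t⟩)

theorem toMMu_akAct (hω : Function.Injective ω)
    (hd : ∀ i, (block m (ω i) : ℕ) + 1 = r)
    (hn : 0 < n) (μ : RComp n m) (h : (ArikiKoike n Q)ᵐᵒᵖ) (t : TPow n V) :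
    toMMu B hx ω hω hd hn μ (akAct n Q x hx h t) = h • toMMu B hx ω hω hd hn μ t := by
  refine Subtype.ext (B.orbitMap_injective Q hx ω hn hω hd ?_)
  obtain ⟨h, rfl⟩ := op_surjective h
  rw [orbitMap_toMMu, Submodule.coe_smul, op_smul_eq_mul, B.orbitMap_mul, orbitMap_toMMu,
    ← Module.End.mul_apply, ← Module.End.mul_apply, akAct_mem Q hx _ (B.embed_mem ω _ _)]

theorem toMMu_vT (hω : Function.Injective ω)
    (hd : ∀ i, (block m (ω i) : ℕ) + 1 = r)
    (hn : 0 < n) (μ ν : RComp n m) : toMMu B hx ω hω hd hn μ (B.vT ν.row) =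
    if ν = μ then ⟨ArikiKoike.mMu Q μ, Submodule.mem_span_singleton_self _⟩ else 0 := by
  refine Subtype.ext (B.orbitMap_injective Q hx ω hn hω hd ?_)
  rw [orbitMap_toMMu]
  split_ifs with h
  · subst h
    exact (orbitMap_mMu B hx ω hω hd ν).symm
  · rw [B.embed_vT_of_notMem _ _ hω, Submodule.coe_zero, map_zero]
    intro h'
    obtain ⟨w, hw⟩ := ChainBasis.mem_orb.1 h'
    exact h (RComp.eq_of_row_comp w hw)

/-- Injective, because the component `μ` determines all coordinates at words in the orbit of `μ`,
and every word lies in such an orbit. Surjective, because `v_μ` goes to the generator `m_μ` in the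
component `μ` and to zero in the others. -/
theorem exists_equiv_SumM (B : ChainBasis (fun p => (block m p : ℕ)) (qf Q) x)
    (ω : Fin n → Fin (total m)) (hω : Function.Injective ω)
    (hd : ∀ i, (block m (ω i) : ℕ) + 1 = r)
    (hn : 0 < n) : ∃ e : TPow n V ≃ₗ[ℂ] SumM n m Q,
    ∀ (h : (ArikiKoike n Q)ᵐᵒᵖ) (v : TPow n V), e (akAct n Q x hx h v) = h • e v := by
  have := Fintype.ofFinite (RComp n m)
  let e : TPow n V →ₗ[ℂ] DirectSum (RComp n m) fun μ => ArikiKoike.MMu Q μ :=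
    ∑ μ, DirectSum.lof ℂ (RComp n m) (fun μ => ArikiKoike.MMu Q μ) μ ∘ₗ toMMu B hx ω hω hd hn μ
  have he : ∀ t μ, e t μ = toMMu B hx ω hω hd hn μ t := by
    intro t μ
    rw [LinearMap.sum_apply, DirectSum.sum_apply, Finset.sum_eq_single μ]
    · exact DirectSum.of_eq_same (β := fun μ => ArikiKoike.MMu Q μ) μ _
    · intro ν _ hν
      exact DirectSum.of_eq_of_ne (β := fun μ => ArikiKoike.MMu Q μ) _ _ _ hν.symm
    · simp
  have hsmul : ∀ (h : (ArikiKoike n Q)ᵐᵒᵖ) (v : TPow n V), e (akAct n Q x hx h v) = h • e v := by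
    intro h v
    refine DFinsupp.ext fun μ => ?_
    rw [he, toMMu_akAct, ← he]
    rfl
  have hinj : Function.Injective e := by
    refine (injective_iff_map_eq_zero e).2 fun t ht => ?_
    refine (B.zT n).ext_elem fun ζ => ?_
    obtain ⟨μ, w, hμ⟩ := RComp.exists_row_comp fun i => (ζ i).1
    have hk : ∀ i, ∃ k, ζ i = ⟨μ.row (w i), k⟩ := fun i => by
      rw [← congrFun hμ i]; exact ⟨(ζ i).2, rfl⟩
    choose k hk using hk
    obtain rfl : ζ = fun i => ⟨μ.row (w i), k i⟩ := funext hk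
    rw [← B.repr_embed _ (block_le_of_last hd _) hω, ← orbitMap_toMMu B hx ω hω hd hn, ← he, ht]
    simp
  have hsurj : Function.Surjective e := by
    rw [← LinearMap.range_eq_top, eq_top_iff]
    rintro t -
    induction t using DirectSum.induction_on with
    | zero => exact zero_mem _
    | add a b ha hb => exact add_mem (ha) (hb)
    | of μ a =>
      obtain ⟨a, ha⟩ := a
      obtain ⟨h, rfl⟩ := Submodule.mem_span_singleton.1 ha
      refine ⟨akAct n Q x hx h (B.vT μ.row), ?_⟩
      rw [hsmul]
      refine DFinsupp.ext fun ν => ?_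
      change h • e (B.vT μ.row) ν = _
      rw [he, toMMu_vT]
      split_ifs with hν
      · subst hν
        exact (DirectSum.of_eq_same (β := fun μ => ArikiKoike.MMu Q μ) μ _).symm
      · rw [smul_zero]
        exact (DirectSum.of_eq_of_ne (β := fun μ => ArikiKoike.MMu Q μ) _ _ _ (Ne.symm hν)).symm
  exact ⟨LinearEquiv.ofBijective e ⟨hinj, hsurj⟩, hsmul⟩

end PermutationModules
end SchurWeyl
end

noncomputable section
namespace SchurWeyl

/-! ### Recovering primitive elements from differences of diagonal entries -/

namespace ChainBasis

open Polynomial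

variable {P V : Type} [AddCommGroup V] [Module ℂ V] {d : P → ℕ} {q : ℕ → ℂ} {x : Module.End ℂ V}
  (B : ChainBasis d q x) {n : ℕ}

theorem ext_v {f g : Module.End ℂ V} (hf : x * f = f * x) (hg : x * g = g * x)
    (h : ∀ p, f (B.v p) = g (B.v p)) : f = g := by
  have hp : ∀ {f : Module.End ℂ V}, x * f = f * x → ∀ (a : ℂ[X]) (u : V),
      f (aeval x a u) = aeval x a (f u) := by
    intro f hf a u
    have : Commute f (aeval x a) := by
      refine Algebra.commute_of_mem_adjoin_singleton_of_commute
        (Polynomial.aeval_mem_adjoin_singleton ℂ x) hf.symm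
    exact LinearMap.congr_fun this u
  refine B.z.ext ?_
  rintro ⟨p, k⟩
  rw [← B.chain, hp hf, hp hg, h]

variable [DecidableEq P]

theorem tensorLie_eps_zT (p : P) (ζ : Fin n → (p : P) × Fin (d p + 1)) :
    tensorLie (B.eps p) (B.zT n ζ) =
      ((Finset.univ.filter fun i => (ζ i).1 = p).card : ℂ) • B.zT n ζ := by
  have h : ∀ j, place j (B.eps p) (B.zT n ζ) = if (ζ j).1 = p then B.zT n ζ else 0 := by
    intro j
    rw [zT_apply, place_tprod, eps_z]
    split_ifs
    · rw [Function.update_eq_self]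
    · exact (PiTensorProduct.tprod ℂ).map_update_zero _ j
  rw [tensorLie_apply, LinearMap.sum_apply]
  simp only [h]
  rw [Finset.sum_ite, Finset.sum_const, Finset.sum_const_zero, add_zero, Nat.cast_smul_eq_nsmul]

theorem proj_union (D D' : Finset (Fin n → P)) :
    B.proj (D ∪ D') = B.proj D + B.proj D' - B.proj D * B.proj D' := by
  rw [proj_mul_proj, eq_sub_iff_add_eq]
  exact Finset.sum_union_inter

variable [Fintype P]

/-- The words that do not contain the letter `p`. -/
def avoid (n : ℕ) (p : P) : Finset (Fin n → P) := Finset.univ.filter fun J => ∀ i, J i ≠ p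

theorem proj_univ : B.proj (Finset.univ : Finset (Fin n → P)) = 1 := by
  refine (B.zT n).ext fun ζ => ?_
  rw [proj_zT, if_pos (Finset.mem_univ _), Module.End.one_apply]

theorem sum_eps : ∑ p, B.eps p = 1 := by
  refine B.z.ext fun ζ => ?_
  rw [LinearMap.sum_apply, Module.End.one_apply]
  simp only [eps_z]
  rw [Finset.sum_ite_eq, if_pos (Finset.mem_univ _)]

/-- The operator `tensorLie (eps p)` counts the occurrences of `p` in a word. The product of the `1
- X / j` over `1 ≤ j ≤ n` is `1` at `0` and vanishes at the other possible counts. -/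
theorem proj_avoid_mem {R : Subalgebra ℂ (Module.End ℂ (TPow n V))} (p : P)
    (h : tensorLie (B.eps p) ∈ R) : B.proj (avoid n p) ∈ R := by
  have key : B.proj (avoid n p) = aeval (tensorLie (B.eps p))
      (∏ j ∈ Finset.range n, (1 - C ((j + 1 : ℂ)⁻¹) * X)) := by
    refine (B.zT n).ext fun ζ => ?_
    rw [Module.End.aeval_apply_of_hasEigenvector
      ⟨Module.End.mem_eigenspace_iff.2 (B.tensorLie_eps_zT p ζ), (B.zT n).ne_zero ζ⟩, proj_zT,
      eval_prod]
    simp only [eval_sub, eval_one, eval_mul, eval_C, eval_X, avoid, Finset.mem_filter,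
      Finset.mem_univ, true_and]
    set c := (Finset.univ.filter fun i => (ζ i).1 = p).card with hc
    have hcn : c ≤ n := (Finset.card_le_univ _).trans (by simp)
    split_ifs with hp
    · have : c = 0 := by
        rw [hc, Finset.card_eq_zero, Finset.filter_eq_empty_iff]
        exact fun i _ => hp i
      simp [this]
    · have hc0 : c ≠ 0 := by
        intro h0
        rw [hc, Finset.card_eq_zero, Finset.filter_eq_empty_iff] at h0
        exact hp fun i => h0 (Finset.mem_univ i)
      rw [Finset.prod_eq_zero (Finset.mem_range.2 (show c - 1 < n by omega)), zero_smul]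
      obtain ⟨k, hk⟩ := Nat.exists_eq_succ_of_ne_zero hc0
      rw [hk]
      push_cast
      rw [inv_mul_cancel₀ (by exact_mod_cast Nat.succ_ne_zero k), sub_self]
  rw [key]
  exact Polynomial.aeval_mem_adjoin_singleton ℂ _ |> Algebra.adjoin_le (by simpa using h)

theorem tensorLie_mul_proj_avoid (b : Module.End ℂ V) (p : P) :
    tensorLie (b * B.eps p) * B.proj (avoid n p) = 0 := by
  refine (B.zT n).ext fun ζ => ?_
  rw [Module.End.mul_apply, proj_zT]
  split_ifs with h
  · rw [tensorLie_apply, LinearMap.sum_apply]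
    refine Finset.sum_eq_zero fun j _ => ?_
    rw [zT_apply, place_tprod, Module.End.mul_apply, eps_z,
      if_neg ((Finset.mem_filter.1 h).2 j), map_zero]
    exact (PiTensorProduct.tprod ℂ).map_update_zero _ j
  · rw [map_zero]; rfl

/-- On tensors avoiding the letter `p` the term `b * eps p` acts by zero, so `b = ∑ b * eps p'` may
be replaced by a sum of differences. With more letters than factors every word avoids some letter,
so inclusion and exclusion over the projections `proj (avoid n p)` reaches the whole space. -/
theorem tensorLie_mem_of_differences {R : Subalgebra ℂ (Module.End ℂ (TPow n V))}
    (hP : n < Fintype.card P) (h1 : ∀ p, tensorLie (B.eps p) ∈ R) (b : Module.End ℂ V)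
    (h2 : ∀ p p', tensorLie (b * B.eps p - b * B.eps p') ∈ R) : tensorLie b ∈ R := by
  have h3 : ∀ p, tensorLie b * B.proj (avoid n p) ∈ R := by
    intro p
    have hb : tensorLie (n := n) b =
        ∑ p', tensorLie (b * B.eps p' - b * B.eps p) +
          Fintype.card P • tensorLie (b * B.eps p) := by
      rw [← map_sum, ← map_nsmul, ← map_add, Finset.sum_sub_distrib, ← Finset.mul_sum, sum_eps,
        mul_one, Finset.sum_const, Finset.card_univ, sub_add_cancel]
    rw [hb, add_mul, smul_mul_assoc, tensorLie_mul_proj_avoid, nsmul_zero, add_zero]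
    exact mul_mem (sum_mem fun p' _ => h2 _ _) (B.proj_avoid_mem p (h1 p))
  have h4 : ∀ S : Finset P, B.proj (S.biUnion (avoid n)) ∈ R ∧
      tensorLie b * B.proj (S.biUnion (avoid n)) ∈ R := by
    intro S
    induction S using Finset.induction_on with
    | empty => simp [proj]
    | insert p S _ ih =>
      have hp := B.proj_avoid_mem p (h1 p)
      rw [Finset.biUnion_insert, proj_union]
      refine ⟨sub_mem (add_mem hp ih.1) (mul_mem hp ih.1), ?_⟩
      rw [mul_sub, mul_add, ← mul_assoc]
      exact sub_mem (add_mem (h3 p) ih.2) (mul_mem (h3 p) ih.1)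
  have h5 : (Finset.univ : Finset P).biUnion (avoid n) = Finset.univ := by
    refine Finset.eq_univ_iff_forall.2 fun J => ?_
    rw [Finset.mem_biUnion]
    have : ¬ Function.Surjective J := fun hJ => by
      have := Fintype.card_le_of_surjective J hJ
      rw [Fintype.card_fin] at this
      omega
    rw [Function.Surjective] at this
    push Not at this
    obtain ⟨p, hp⟩ := this
    exact ⟨p, Finset.mem_univ _, Finset.mem_filter.2 ⟨Finset.mem_univ _, hp⟩⟩
  have h6 := (h4 Finset.univ).2
  rwa [h5, proj_univ, mul_one] at h6

end ChainBasis

/-! ### The image of the shifted loop algebra is `Sch` -/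

section Image

open LaurentPolynomial

variable {r : ℕ} (n : ℕ) (m : Fin r → ℕ+) (Q : Fin r → ℂˣ)

theorem rho_lie (y : GLoop m Q) : tensorLie (n := n) (vvLie m Q y) ∈ (rho m Q n).range :=
  ⟨UniversalEnvelopingAlgebra.ι ℂ y, UniversalEnvelopingAlgebra.lift_ι_apply ℂ _ _⟩

/-- The matrices over `ℂ[x, x⁻¹]` that act on `𝕍` and whose action on the tensor power is in the
image of the shifted loop algebra. -/
def goodMat : Submodule ℂ (Matrix (Fin (total m)) (Fin (total m)) ℂ[T;T⁻¹]) :=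
  ((Subalgebra.toSubmodule (rho m Q n).range).comap
    ((tensorLie (n := n)).toLinearMap ∘ₗ (stabEnd m Q).toLinearMap)).map
      (stab m Q).val.toLinearMap

variable {n m Q}

theorem mem_goodMat {A : Matrix (Fin (total m)) (Fin (total m)) ℂ[T;T⁻¹]} :
    A ∈ goodMat n m Q ↔
      ∃ h : A ∈ stab m Q, tensorLie (n := n) (stabEnd m Q ⟨A, h⟩) ∈ (rho m Q n).range := by
  constructor
  · rintro ⟨⟨A, h⟩, h', rfl⟩
    exact ⟨h, h'⟩
  · rintro ⟨h, h'⟩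
    exact ⟨⟨A, h⟩, h', rfl⟩

theorem goodMat_lie {A A' : Matrix (Fin (total m)) (Fin (total m)) ℂ[T;T⁻¹]}
    (hA : A ∈ goodMat n m Q) (hA' : A' ∈ goodMat n m Q) : A * A' - A' * A ∈ goodMat n m Q := by
  rw [mem_goodMat] at *
  obtain ⟨h, h1⟩ := hA
  obtain ⟨h', h1'⟩ := hA'
  refine ⟨sub_mem (mul_mem h h') (mul_mem h' h), ?_⟩
  have : stabEnd m Q ⟨A * A' - A' * A, sub_mem (mul_mem h h') (mul_mem h' h)⟩ =
      ⁅stabEnd m Q ⟨A, h⟩, stabEnd m Q ⟨A', h'⟩⁆ := by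
    rw [Ring.lie_def, ← map_mul, ← map_mul, ← map_sub]
    rfl
  rw [this, LieHom.map_lie, Ring.lie_def]
  exact sub_mem (mul_mem h1 h1') (mul_mem h1' h1)

theorem goodMat_E (i : Fin (total m - 1)) (t : ℤ) : matE i t ∈ goodMat n m Q := by
  refine mem_goodMat.2 ⟨matE_mem_stab m Q i t, ?_⟩
  have := rho_lie n m Q (ShiftedLoop.E _ _ i t)
  rwa [vvLie, LieHom.comp_apply, ShiftedLoop.lift_E] at this

theorem goodMat_F (i : Fin (total m - 1)) (t : ℤ) :
    matF i t + shiftCoeff (etaParam m Q) (bShift m) i • matF i (t + bShift m i) ∈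
      goodMat n m Q := by
  refine mem_goodMat.2 ⟨matF_mem_stab m Q i t, ?_⟩
  have := rho_lie n m Q (ShiftedLoop.F _ _ i t)
  rwa [vvLie, LieHom.comp_apply, ShiftedLoop.lift_F] at this

theorem goodMat_H (i : Fin (total m - 1)) (t : ℤ) : matH i t ∈ goodMat n m Q := by
  refine mem_goodMat.2 ⟨matH_mem_stab m Q i t, ?_⟩
  have := rho_lie n m Q (ShiftedLoop.H _ _ i t)
  rwa [vvLie, LieHom.comp_apply, ShiftedLoop.lift_H] at this

theorem laurent_span {N : Submodule ℂ ℂ[T;T⁻¹]} (h : ∀ t : ℤ, T t ∈ N) (g : ℂ[T;T⁻¹]) : g ∈ N := by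
  induction g using LaurentPolynomial.induction_on' with
  | add a b ha hb => exact add_mem ha hb
  | C_mul_T t c => rw [← LaurentPolynomial.smul_eq_C_mul]; exact N.smul_mem c (h t)

theorem goodMat_upper (k : ℕ) : ∀ (p q : Fin (total m)), (q : ℕ) = p + k + 1 →
    ∀ g : ℂ[T;T⁻¹], Matrix.single p q g ∈ goodMat n m Q := by
  induction k with
  | zero =>
    intro p q hpq g
    refine laurent_span (N := (goodMat n m Q).comap (Matrix.singleLinearMap ℂ p q)) (fun t => ?_) g
    have := goodMat_E (n := n) (m := m) (Q := Q) ⟨p, by omega⟩ t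
    rw [Submodule.mem_comap, Matrix.singleLinearMap_apply]
    convert this using 1
    rw [matE]
    congr 1
    exact Fin.ext hpq
  | succ k ih =>
    intro p q hpq g
    have h1 := ih p ⟨p + k + 1, by omega⟩ rfl g
    have h2 : Matrix.single ⟨p + k + 1, by omega⟩ q (1 : ℂ[T;T⁻¹]) ∈ goodMat n m Q := by
      have := goodMat_E (n := n) (m := m) (Q := Q) ⟨p + k + 1, by omega⟩ 0
      convert this using 1
      rw [matE, T_zero]
      congr 1
      exact Fin.ext hpq
    have h3 := goodMat_lie h1 h2
    rwa [single_mul_ite, single_mul_ite, if_pos rfl, if_neg, sub_zero, mul_one] at h3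
    rw [Fin.ext_iff]; omega

theorem tailPoly_self (k : ℕ) : tailPoly Q k k = 1 := by simp [tailPoly]

theorem tailPoly_mul {a b c : ℕ} (hab : a ≤ b) (hbc : b ≤ c) :
    tailPoly Q c b * tailPoly Q b a = tailPoly Q c a := by
  rw [mul_comm, tailPoly, tailPoly, tailPoly, ← Finset.Ioc_union_Ioc_eq_Ioc hab hbc,
    Finset.prod_union]
  exact Finset.Ioc_disjoint_Ioc_of_le le_rfl

/-- At the end of a block, `-Q (1 - Q⁻¹ x) = x - Q` is exactly the factor by which the polynomials
of the two blocks differ. Elsewhere the shift is zero and the tail polynomial is `1`. -/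
theorem goodMat_adj_lower (i : Fin (total m - 1)) (g : ℂ[T;T⁻¹]) :
    Matrix.single (hi i) (lo i)
      (g * Polynomial.toLaurent (tailPoly Q (block m (hi i)) (block m (lo i)))) ∈
        goodMat n m Q := by
  refine laurent_span (N := (goodMat n m Q).comap (Matrix.singleLinearMap ℂ (hi i) (lo i) ∘ₗ
    LinearMap.mulRight ℂ (Polynomial.toLaurent (tailPoly Q (block m (hi i)) (block m (lo i))))))
    (fun t => ?_) g
  rw [Submodule.mem_comap, LinearMap.comp_apply, LinearMap.mulRight_apply,
    Matrix.singleLinearMap_apply]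
  have hF := goodMat_F (n := n) (m := m) (Q := Q) i t
  by_cases h : IsBlockEnd m i
  · have hb := block_hi_of_end m h
    have hr : (block m (lo i) : ℕ) + 1 < r := hb ▸ (block m (hi i)).2
    have hη : etaParam m Q i = Q (block m (hi i)) := by
      rw [etaParam, dif_pos ⟨h, hr⟩]
      congr 1
      exact Fin.ext hb.symm
    have hb1 : bShift m i = 1 := if_pos h
    have hF' := (goodMat n m Q).smul_mem (-(Q (block m (hi i)) : ℂ)) hF
    convert hF' using 1
    rw [matF, matF, Matrix.smul_single, ← Matrix.single_add, Matrix.smul_single]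
    congr 1
    rw [hb, tailPoly_succ Q (Nat.lt_succ_self _), tailPoly_self, mul_one, ← hb, qf_fin, shiftCoeff,
      hη, hb1, if_pos one_pos, pow_one]
    simp only [map_sub, Polynomial.toLaurent_X, Polynomial.toLaurent_C, Nat.cast_one, T_add,
      LaurentPolynomial.smul_eq_C_mul]
    have hC : (C (Q (block m (hi i)) : ℂ) : ℂ[T;T⁻¹]) * C ((Q (block m (hi i)) : ℂ)⁻¹) = 1 := by
      rw [← map_mul, mul_inv_cancel₀ (Units.ne_zero _), map_one]
    rw [map_neg, map_neg]
    linear_combination (-(T t * T 1 : ℂ[T;T⁻¹])) * hC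
  · have hb1 : bShift m i = 0 := if_neg h
    rw [block_hi_of_not_end m h, tailPoly_self, map_one, mul_one]
    rw [shiftCoeff, hb1, if_neg (lt_irrefl 0), zero_smul, add_zero] at hF
    exact hF

/-- Iterated commutators along the path from `q` to `p`: the tail polynomials multiply, and the
opposite product vanishes because `p ≠ q`. -/
theorem goodMat_lower (k : ℕ) : ∀ (p q : Fin (total m)), (p : ℕ) = q + k + 1 →
    ∀ g : ℂ[T;T⁻¹], Matrix.single p q
      (g * Polynomial.toLaurent (tailPoly Q (block m p) (block m q))) ∈ goodMat n m Q := by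
  induction k with
  | zero =>
    intro p q hpq g
    have := goodMat_adj_lower (n := n) (m := m) (Q := Q) ⟨q, by omega⟩ g
    have hp : hi (⟨q, by omega⟩ : Fin (total m - 1)) = p := Fin.ext (by simp [hi, hpq])
    rw [hp] at this
    exact this
  | succ k ih =>
    intro p q hpq g
    have h1 := ih ⟨q + k + 1, by omega⟩ q rfl 1
    have h2 := goodMat_adj_lower (n := n) (m := m) (Q := Q) ⟨q + k + 1, by omega⟩ g
    have hp : hi (⟨q + k + 1, by omega⟩ : Fin (total m - 1)) = p := Fin.ext (by simp [hi, hpq]; omega)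
    have hl : lo (⟨q + k + 1, by omega⟩ : Fin (total m - 1)) = ⟨q + k + 1, by omega⟩ := rfl
    rw [hp, hl] at h2
    have h3 := goodMat_lie h2 h1
    rw [single_mul_ite, single_mul_ite, if_pos rfl, if_neg, sub_zero, one_mul, mul_assoc,
      ← map_mul, tailPoly_mul] at h3
    · exact h3
    · exact Fin.le_def.1 (block_mono m (Fin.le_def.2 (by simp only; omega)))
    · exact Fin.le_def.1 (block_mono m (Fin.le_def.2 (by simp only; omega)))
    · rw [Fin.ext_iff]; omega

theorem goodMat_diff (p q : Fin (total m)) (g : ℂ[T;T⁻¹]) :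
    Matrix.single p p g - Matrix.single q q g ∈ goodMat n m Q := by
  have hadj : ∀ i : Fin (total m - 1), Matrix.single (lo i) (lo i) g -
      Matrix.single (hi i) (hi i) g ∈ goodMat n m Q := by
    intro i
    exact laurent_span (N := (goodMat n m Q).comap (Matrix.singleLinearMap ℂ (lo i) (lo i) -
      Matrix.singleLinearMap ℂ (hi i) (hi i))) (fun t => by
        rw [Submodule.mem_comap, LinearMap.sub_apply, Matrix.singleLinearMap_apply,
          Matrix.singleLinearMap_apply]
        exact goodMat_H i t) g
  have h0 : ∀ (k : ℕ) (p q : Fin (total m)), (q : ℕ) = p + k →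
      Matrix.single p p g - Matrix.single q q g ∈ goodMat n m Q := by
    intro k
    induction k with
    | zero =>
      intro p q h
      obtain rfl : q = p := Fin.ext h
      rw [sub_self]; exact zero_mem _
    | succ k ih =>
      intro p q h
      have h1 := ih p ⟨p + k, by omega⟩ rfl
      have h2 := hadj ⟨p + k, by omega⟩
      have hq : hi (⟨p + k, by omega⟩ : Fin (total m - 1)) = q := Fin.ext (by simp [hi, h]; omega)
      rw [hq] at h2
      have h3 := add_mem h1 h2
      rwa [show lo (⟨p + k, by omega⟩ : Fin (total m - 1)) = ⟨p + k, by omega⟩ from rfl,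
        sub_add_sub_cancel] at h3
  rcases le_total p q with h | h
  · exact h0 (q - p) p q (by have := Fin.le_def.1 h; omega)
  · rw [← neg_sub]
    exact neg_mem (h0 (p - q) q p (by have := Fin.le_def.1 h; omega))

/-- With `e_q` the diagonal matrix with entry `g` at `q`, the sum of all `e_q` and of all
differences `e_p - e_q` is the number of indices times `e_p`. -/
theorem goodMat_diag_of_sum {g : ℂ[T;T⁻¹]} (h : ∑ q, Matrix.single q q g ∈ goodMat n m Q)
    (p : Fin (total m)) : Matrix.single p p g ∈ goodMat n m Q := by
  have h1 := add_mem h (sum_mem fun q (_ : q ∈ Finset.univ) => goodMat_diff (n := n) (Q := Q) p q g)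
  rw [← Finset.sum_add_distrib] at h1
  simp only [add_sub_cancel] at h1
  rw [Finset.sum_const, Finset.card_univ, Fintype.card_fin, ← Nat.cast_smul_eq_nsmul ℂ] at h1
  have h0 : ((total m : ℕ) : ℂ) ≠ 0 := Nat.cast_ne_zero.2 (by have := p.2; omega)
  have h2 := (goodMat n m Q).smul_mem ((total m : ℕ) : ℂ)⁻¹ h1
  rwa [smul_smul, inv_mul_cancel₀ h0, one_smul] at h2

theorem stabEnd_single {p q : Fin (total m)} {g : ℂ[T;T⁻¹]} (h : Matrix.single q p g ∈ stab m Q)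
    (p' : Fin (total m)) (f : ℂ[T;T⁻¹]) : stabEnd m Q ⟨_, h⟩ (vvMk m Q p' f) =
      if p = p' then vvMk m Q q (g * f) else 0 := by
  refine (congrArg (Submodule.Quotient.mk (p := IQ m Q)) (toLin_single_single m q p p' g f)).trans ?_
  split_ifs <;> rfl

theorem stabEnd_comm (A : stab m Q) (f : ℂ[T;T⁻¹]) :
    mulVV m Q f * stabEnd m Q A = stabEnd m Q A * mulVV m Q f :=
  LinearMap.ext fun v =>
    (((IQ m Q).mapQ (IQ m Q) (Matrix.toLin' A.1) A.2).map_smul f v).symm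

theorem mulVV_comm (f g : ℂ[T;T⁻¹]) : mulVV m Q f * mulVV m Q g = mulVV m Q g * mulVV m Q f := by
  rw [← map_mul, mul_comm, map_mul]

theorem mulVV_mul_eps (g : ℂ[T;T⁻¹]) (p : Fin (total m)) :
    mulVV m Q g * (vvBasis m Q).eps p =
      stabEnd m Q ⟨Matrix.single p p g, single_diag_mem_stab m Q p g⟩ := by
  refine (vvBasis m Q).ext_v ?_ (stabEnd_comm _ _) fun p' => ?_
  · rw [← mul_assoc, mulVV_comm, mul_assoc, (vvBasis m Q).eps_comm, mul_assoc]
  · rw [Module.End.mul_apply, ChainBasis.eps_v, vvBasis_v, stabEnd_single]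
    by_cases h : p' = p
    · subst h
      rw [if_pos rfl, if_pos rfl, vvMk_smul]
      rfl
    · rw [if_neg h, if_neg (Ne.symm h), map_zero]

/-- The primitive element of the identity is the scalar `n`, which lies in every unital subalgebra.
-/
theorem goodMat_diag_one (p : Fin (total m)) :
    Matrix.single p p (1 : ℂ[T;T⁻¹]) ∈ goodMat n m Q := by
  refine goodMat_diag_of_sum ?_ p
  rw [Matrix.sum_single_one]
  refine mem_goodMat.2 ⟨one_mem _, ?_⟩
  have : stabEnd m Q ⟨1, one_mem _⟩ = 1 := map_one (stabEnd m Q)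
  rw [this, tensorLie_apply]
  exact sum_mem fun j _ => by rw [map_one]; exact one_mem _

theorem goodMat_diag (hn : n < total m) (p : Fin (total m)) (g : ℂ[T;T⁻¹]) :
    Matrix.single p p g ∈ goodMat n m Q := by
  refine goodMat_diag_of_sum ?_ p
  refine mem_goodMat.2 ⟨sum_mem fun q _ => single_diag_mem_stab m Q q g, ?_⟩
  have hsum : stabEnd m Q ⟨∑ q, Matrix.single q q g,
      sum_mem fun q _ => single_diag_mem_stab m Q q g⟩ = mulVV m Q g := by
    rw [← mul_one (mulVV m Q g), ← (vvBasis m Q).sum_eps, Finset.mul_sum]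
    simp only [mulVV_mul_eps]
    rw [← map_sum]
    congr 1
    exact Subtype.ext (by simp)
  rw [hsum]
  refine (vvBasis m Q).tensorLie_mem_of_differences (by simpa using hn) (fun q => ?_) _
    fun q q' => ?_
  · obtain ⟨_, h⟩ := mem_goodMat.1 (goodMat_diag_one (n := n) (Q := Q) q)
    rw [← one_mul ((vvBasis m Q).eps q), ← map_one (mulVV m Q), mulVV_mul_eps]
    exact h
  · obtain ⟨_, h⟩ := mem_goodMat.1 (goodMat_diff (n := n) (Q := Q) q q' g)
    rw [mulVV_mul_eps, mulVV_mul_eps, ← map_sub]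
    exact h

/-- This matrix realizes `v_p ↦ z_ζ`. Above the diagonal any entry is available; below it, the tail
polynomial of `ζ` is divisible by the one from the block of `p` to the block of `q`, as
`goodMat_lower` requires. -/
theorem goodMat_chain (hn : 0 < n) (hm : ∀ k, n ≤ (m k : ℕ)) (p : Fin (total m))
    (ζ : (p : Fin (total m)) × Fin ((block m p : ℕ) + 1)) (hζ : (ζ.2 : ℕ) ≤ block m p) :
    Matrix.single ζ.1 p (Polynomial.toLaurent (tailPoly Q (block m ζ.1) ζ.2)) ∈
      goodMat n m Q := by
  obtain ⟨q, k⟩ := ζ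
  simp only at hζ ⊢
  rcases lt_trichotomy q p with h | h | h
  · have := Fin.lt_def.1 h
    exact goodMat_upper (p - q - 1) q p (by omega) _
  · subst h
    by_cases hr : n < total m
    · exact goodMat_diag hr q _
    -- If there are at most `n` indices, the block of `q` is the first one, since two distinct
    -- blocks would already contain `2 n` indices. Then the only height is zero and the entry is the
    -- constant `1`.
    · have hr1 : (block m q : ℕ) = 0 := by
        by_contra h0
        refine hr ?_
        have hlt : (⟨0, by omega⟩ : Fin r) < block m q := Fin.lt_def.2 (Nat.pos_of_ne_zero h0)
        have h2 : ∑ k ∈ {⟨0, by omega⟩, block m q}, (m k : ℕ) ≤ total m :=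
          Finset.sum_le_sum_of_subset (Finset.subset_univ _)
        rw [Finset.sum_pair hlt.ne] at h2
        have := hm ⟨0, by omega⟩
        have := hm (block m q)
        omega
      have hk : (k : ℕ) = block m q := by omega
      rw [hk, tailPoly_self, map_one]
      exact goodMat_diag_one q
  · have h' := Fin.lt_def.1 h
    rw [← tailPoly_mul hζ (Fin.le_def.1 (block_mono m h.le)), mul_comm, map_mul]
    exact goodMat_lower (q - p - 1) q p (by omega) _

theorem Sch_le_range_rho (hn : 0 < n) (hm : ∀ k, n ≤ (m k : ℕ)) :
    Sch n (mulVV m Q (T 1)) ≤ (rho m Q n).range := by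
  refine (vvBasis m Q).Sch_le fun b hb => ?_
  -- Since `b` commutes with `x`, the vector `b v_p` satisfies the relation of `v_p`. This makes the
  -- coefficients vanish for which `S` takes its default value `0`.
  have hK : ∀ p, b ((vvBasis m Q).v p) ∈ (vvBasis m Q).K (block m p) := by
    intro p
    have h1 := (vvBasis m Q).v_mem_K p
    rw [ChainBasis.mem_K_iff] at h1 ⊢
    have : Commute b (Polynomial.aeval (mulVV m Q (T 1)) (∏ i ∈ Finset.range ((block m p : ℕ) + 1),
        (Polynomial.X - Polynomial.C (qf Q i)))) :=
      Algebra.commute_of_mem_adjoin_singleton_of_commute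
        (Polynomial.aeval_mem_adjoin_singleton ℂ _) hb.symm
    have h2 := LinearMap.congr_fun this ((vvBasis m Q).v p)
    rw [Module.End.mul_apply, Module.End.mul_apply, h1, map_zero] at h2
    exact h2.symm
  classical
  let S : Fin (total m) → ((p : Fin (total m)) × Fin ((block m p : ℕ) + 1)) →
      Module.End ℂ (VV m Q) := fun p ζ =>
    if h : (ζ.2 : ℕ) ≤ block m p then
      stabEnd m Q ⟨_, (mem_goodMat.1 (goodMat_chain (Q := Q) hn hm p ζ h)).1⟩ else 0
  have hS : ∀ p ζ, tensorLie (n := n) (S p ζ) ∈ (rho m Q n).range := by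
    intro p ζ
    simp only [S]
    split_ifs with h
    · exact (mem_goodMat.1 (goodMat_chain (Q := Q) hn hm p ζ h)).2
    · rw [map_zero]; exact zero_mem _
  have hb' : b = ∑ p, ∑ ζ, (vvBasis m Q).z.repr (b ((vvBasis m Q).v p)) ζ • S p ζ := by
    refine (vvBasis m Q).ext_v hb ?_ fun p => ?_
    · rw [Finset.mul_sum, Finset.sum_mul]
      refine Finset.sum_congr rfl fun p _ => ?_
      rw [Finset.mul_sum, Finset.sum_mul]
      refine Finset.sum_congr rfl fun ζ _ => ?_
      rw [mul_smul_comm, smul_mul_assoc]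
      simp only [S]
      split_ifs
      · rw [stabEnd_comm]
      · simp
    · rw [LinearMap.sum_apply, Finset.sum_eq_single p]
      · conv_lhs => rw [← (vvBasis m Q).z.sum_repr (b ((vvBasis m Q).v p))]
        rw [LinearMap.sum_apply]
        refine Finset.sum_congr rfl fun ζ _ => ?_
        rw [LinearMap.smul_apply]
        by_cases h : (ζ.2 : ℕ) ≤ block m p
        · simp only [S, dif_pos h]
          rw [vvBasis_v, stabEnd_single, if_pos rfl, mul_one, vvBasis_z, vvZ]
        · rw [hK p ζ h, zero_smul, zero_smul]
      · intro p' _ hp'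
        rw [LinearMap.sum_apply]
        refine Finset.sum_eq_zero fun ζ _ => ?_
        rw [LinearMap.smul_apply]
        simp only [S]
        split_ifs
        · rw [vvBasis_v m Q p, stabEnd_single, if_neg hp', smul_zero]
        · simp
      · simp
  rw [hb', map_sum]
  refine sum_mem fun p _ => ?_
  rw [map_sum]
  exact sum_mem fun ζ _ => by
    rw [map_smul]; exact Subalgebra.smul_mem _ (hS p ζ) _

theorem range_rho_le : (rho m Q n).range ≤ Sch n (mulVV m Q (T 1)) := by
  rintro _ ⟨u, rfl⟩
  refine uea_lift_mem _ _ (fun y => mem_Sch.2 ⟨fun w => permEnd_tensorLie w _, fun j => ?_⟩) u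
  exact place_tensorLie j (stabEnd_comm _ _)

theorem range_rho (hn : 0 < n) (hm : ∀ k, n ≤ (m k : ℕ)) :
    (rho m Q n).range = Sch n (mulVV m Q (T 1)) :=
  le_antisymm range_rho_le (Sch_le_range_rho hn hm)

end Image
end SchurWeyl
end

noncomputable section
namespace SchurWeyl

open MulOpposite LaurentPolynomial

/-! ### Transport to the cyclotomic Schur algebra -/

section CyclotomicSchur

variable {n r : ℕ} {m : Fin r → ℕ+} {Q : Fin r → ℂˣ}

/-- Transport of endomorphisms along an isomorphism of right modules. -/
def cycSchurHom (e : TPow n (VV m Q) ≃ₗ[ℂ] SumM n m Q) :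
    CycSchur n m Q →ₐ[ℂ] Module.End ℂ (TPow n (VV m Q)) where
  toFun f := e.symm.toLinearMap ∘ₗ f.restrictScalars ℂ ∘ₗ e.toLinearMap
  map_one' := by ext; simp
  map_mul' f g := by ext; simp
  map_zero' := by ext; simp
  map_add' f g := by ext; simp
  commutes' c := by
    ext
    simp [Algebra.algebraMap_eq_smul_one]

theorem cycSchurHom_apply (e : TPow n (VV m Q) ≃ₗ[ℂ] SumM n m Q) (f : CycSchur n m Q)
    (t : TPow n (VV m Q)) : cycSchurHom e f t = e.symm (f (e t)) := rfl

/-- Conjugation by `e` identifies linearity over the Hecke algebra with commuting with the image of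
`σ`, and that commutant is `Sch`. -/
theorem cycSchurHom_range (e : TPow n (VV m Q) ≃ₗ[ℂ] SumM n m Q)
    (he : ∀ (h : (ArikiKoike n Q)ᵐᵒᵖ) (v : TPow n (VV m Q)), e (sigma n m Q h v) = h • e v) :
    (cycSchurHom e).range = Sch n (mulVV m Q (T 1)) := by
  rw [← centralizer_akAct Q (mulVV_cyc m Q)]
  ext f
  rw [Subalgebra.mem_centralizer_iff]
  constructor
  · rintro ⟨f, rfl⟩
    rintro _ ⟨h, rfl⟩
    refine LinearMap.ext fun t => e.injective ?_
    change e (sigma n m Q h (cycSchurHom e f t)) = e (cycSchurHom e f (sigma n m Q h t))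
    rw [he, cycSchurHom_apply, cycSchurHom_apply, e.apply_symm_apply, e.apply_symm_apply, he,
      map_smul]
  · intro hf
    refine ⟨{ toFun := fun s => e (f (e.symm s)), map_add' := fun a b => by simp,
              map_smul' := fun h s => ?_ }, LinearMap.ext fun t => ?_⟩
    · have h1 : h • s = e (sigma n m Q h (e.symm s)) := by rw [he, e.apply_symm_apply]
      have h2 := LinearMap.congr_fun (hf (sigma n m Q h) ⟨h, rfl⟩) (e.symm s)
      rw [Module.End.mul_apply, Module.End.mul_apply] at h2
      rw [h1, e.symm_apply_apply, ← h2, he, RingHom.id_apply]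
    · change e.symm (e (f (e.symm (e t)))) = f t
      rw [e.symm_apply_apply, e.symm_apply_apply]

theorem cycSchurHom_injective (e : TPow n (VV m Q) ≃ₗ[ℂ] SumM n m Q) :
    Function.Injective (cycSchurHom e) := by
  intro f g h
  refine LinearMap.ext fun s => ?_
  have := LinearMap.congr_fun h (e.symm s)
  rwa [cycSchurHom_apply, cycSchurHom_apply, e.symm.injective.eq_iff, e.apply_symm_apply] at this

/-- The cyclotomic Schur algebra as an algebra of endomorphisms of the tensor space. -/
def cycSchurEquiv (e : TPow n (VV m Q) ≃ₗ[ℂ] SumM n m Q)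
    (he : ∀ (h : (ArikiKoike n Q)ᵐᵒᵖ) (v : TPow n (VV m Q)), e (sigma n m Q h v) = h • e v) :
    CycSchur n m Q ≃ₐ[ℂ] Sch n (mulVV m Q (T 1)) :=
  (AlgEquiv.ofInjective (cycSchurHom e) (cycSchurHom_injective e)).trans
    (Subalgebra.equivOfEq _ _ (cycSchurHom_range e he))

theorem isQuasiHereditary_of_equiv_Sch {R : Type} [Ring R] [Algebra ℂ R]
    (hm : ∀ k, n ≤ (m k : ℕ)) (φ : R ≃ₐ[ℂ] Sch n (mulVV m Q (T 1))) : IsQuasiHereditary ℂ R :=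
  (vvBasis m Q).isQuasiHereditary_of_equiv φ (fun p => (block m p).2) (blockIdx m hm)
    (fun k i => by rw [block_blockIdx]) (blockIdx_inj m hm)

end CyclotomicSchur
end SchurWeyl
end

noncomputable section
namespace SchurWeyl

/-! ### Maps out of loop algebras, balanced tensor products and affine Hecke algebras -/

open MulOpposite LaurentPolynomial

theorem ShiftedLoop.hom_ext {M : ℕ} {η : Fin (M - 1) → ℂˣ} {b : Fin (M - 1) → ℕ} {L : Type}
    [LieRing L] [LieAlgebra ℂ L] {f g : ShiftedLoop η b →ₗ⁅ℂ⁆ L}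
    (hE : ∀ i t, f (ShiftedLoop.E η b i t) = g (ShiftedLoop.E η b i t))
    (hF : ∀ i t, f (ShiftedLoop.F η b i t) = g (ShiftedLoop.F η b i t))
    (hH : ∀ i t, f (ShiftedLoop.H η b i t) = g (ShiftedLoop.H η b i t)) (y : ShiftedLoop η b) :
    f y = g y := by
  have h : f.comp (ShiftedLoop.mkHom η b) = g.comp (ShiftedLoop.mkHom η b) := by
    refine FreeLieAlgebra.hom_ext fun a => ?_
    cases a with
    | E i t => exact hE i t
    | F i t => exact hF i t
    | H i t => exact hH i t
  obtain ⟨y, rfl⟩ := Submodule.Quotient.mk_surjective _ y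
  exact LieHom.congr_fun h y

namespace BalTensor

variable {A B M N : Type} [Ring A] [Algebra ℂ A] [Ring B] [Algebra ℂ B] [AddCommGroup M]
  [Module ℂ M] [AddCommGroup N] [Module ℂ N] {σ : Aᵐᵒᵖ →ₐ[ℂ] Module.End ℂ M} {φ : A →ₐ[ℂ] B}

variable (σ φ) in
theorem mk_surjective : Function.Surjective (mk σ φ) := (balRel σ φ).mkQ_surjective

theorem mk_balanced (a : A) (v : M) (b : B) :
    mk σ φ (v ⊗ₜ[ℂ] (φ a * b)) = mk σ φ (σ (op a) v ⊗ₜ[ℂ] b) := by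
  symm
  rw [← sub_eq_zero, ← map_sub]
  exact (Submodule.Quotient.mk_eq_zero _).2 (Submodule.subset_span ⟨a, v, b, rfl⟩)

/-- The linear map out of `M ⊗_A B` given by a balanced map. -/
def lift (f : M ⊗[ℂ] B →ₗ[ℂ] N)
    (h : ∀ a v b, f (σ (op a) v ⊗ₜ[ℂ] b) = f (v ⊗ₜ[ℂ] (φ a * b))) : BalTensor σ φ →ₗ[ℂ] N :=
  (balRel σ φ).liftQ f (by
    rw [balRel, Submodule.span_le]
    rintro _ ⟨a, v, b, rfl⟩
    rw [SetLike.mem_coe, LinearMap.mem_ker, map_sub, h, sub_self])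

theorem lift_mk (f : M ⊗[ℂ] B →ₗ[ℂ] N)
    (h : ∀ a v b, f (σ (op a) v ⊗ₜ[ℂ] b) = f (v ⊗ₜ[ℂ] (φ a * b))) (z : M ⊗[ℂ] B) :
    lift f h (mk σ φ z) = f z := rfl

end BalTensor

section AffineGenerators

variable {n : ℕ} {W : Type} [AddCommGroup W] [Module ℂ W] {x y : Module.End ℂ W}
  (hxy : x * y = 1) (hyx : y * x = 1)

theorem affAct_mk (a : FreeAlgebra ℂ (AffGen n)) : affAct n x y hxy hyx (op (AffineHecke.mk a)) =
    unop (FreeAlgebra.lift ℂ (fun g : AffGen n =>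
      match g with
      | .T i => op (permEnd (adjSwap i))
      | .X j => op (place j x)
      | .Xinv j => op (place j y)) a) :=
  congrArg unop (AffineHecke.lift_mk _ _ _ _ a)

theorem affAct_T (i : Fin (n - 1)) : affAct n x y hxy hyx
    (op (AffineHecke.mk (FreeAlgebra.ι ℂ (AffGen.T i)))) = permEnd (adjSwap i) := by
  rw [affAct_mk, FreeAlgebra.lift_ι_apply, unop_op]

theorem affAct_X (j : Fin n) : affAct n x y hxy hyx
    (op (AffineHecke.mk (FreeAlgebra.ι ℂ (AffGen.X j)))) = place j x := by
  rw [affAct_mk, FreeAlgebra.lift_ι_apply, unop_op]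

theorem affAct_Xinv (j : Fin n) : affAct n x y hxy hyx
    (op (AffineHecke.mk (FreeAlgebra.ι ℂ (AffGen.Xinv j)))) = place j y := by
  rw [affAct_mk, FreeAlgebra.lift_ι_apply, unop_op]

/-- Induction for the affine Hecke algebra. -/
theorem AffineHecke.induction {p : AffineHecke n → Prop} (h0 : ∀ c : ℂ, p (algebraMap ℂ _ c))
    (hT : ∀ i, p (mk (FreeAlgebra.ι ℂ (AffGen.T i)))) (hX : ∀ j, p (mk (FreeAlgebra.ι ℂ (AffGen.X j))))
    (hY : ∀ j, p (mk (FreeAlgebra.ι ℂ (AffGen.Xinv j)))) (hmul : ∀ a b, p a → p b → p (a * b))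
    (hadd : ∀ a b, p a → p b → p (a + b)) (a : AffineHecke n) : p a := by
  obtain ⟨a, rfl⟩ := mk_surjective a
  induction a using FreeAlgebra.induction with
  | grade0 c => rw [AlgHom.commutes]; exact h0 c
  | grade1 g =>
    cases g with
    | T i => exact hT i
    | X j => exact hX j
    | Xinv j => exact hY j
  | mul a b ha hb => rw [map_mul]; exact hmul _ _ ha hb
  | add a b ha hb => rw [map_add]; exact hadd _ _ ha hb

variable {r : ℕ} (Q : Fin r → ℂˣ)

theorem toAK_T (i : Fin (n - 1)) : AffineHecke.toAK Q
    (AffineHecke.mk (FreeAlgebra.ι ℂ (AffGen.T i))) = ArikiKoike.T Q (hi i) := by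
  rw [AffineHecke.toAK, AffineHecke.lift_mk, FreeAlgebra.lift_ι_apply]

theorem toAK_X (j : Fin n) : AffineHecke.toAK Q
    (AffineHecke.mk (FreeAlgebra.ι ℂ (AffGen.X j))) = ArikiKoike.L Q j := by
  rw [AffineHecke.toAK, AffineHecke.lift_mk, FreeAlgebra.lift_ι_apply]

theorem toAK_Xinv (j : Fin n) : AffineHecke.toAK Q
    (AffineHecke.mk (FreeAlgebra.ι ℂ (AffGen.Xinv j))) = Ring.inverse (ArikiKoike.L Q j) := by
  rw [AffineHecke.toAK, AffineHecke.lift_mk, FreeAlgebra.lift_ι_apply]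

theorem toAK_surjective : Function.Surjective (AffineHecke.toAK (n := n) Q) := by
  intro h
  rw [← AlgHom.mem_range]
  induction h using ArikiKoike.induction with
  | h0 c => exact Subalgebra.algebraMap_mem _ c
  | h1 i =>
    by_cases hi0 : (i : ℕ) = 0
    · obtain ⟨i, hi⟩ := i
      simp only at hi0
      subst hi0
      exact ⟨_, (toAK_X Q _).trans (ArikiKoike.L_zero Q hi)⟩
    · rw [ArikiKoike.eq_hi hi0]
      exact ⟨_, toAK_T Q _⟩
  | hmul a b ha hb => exact mul_mem ha hb
  | hadd a b ha hb => exact add_mem ha hb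

end AffineGenerators

/-! ### The bimodule map from `V_{n,r}` to the tensor space -/

section Comparison

variable {r : ℕ} (n : ℕ) (m : Fin r → ℕ+) (Q : Fin r → ℂˣ)

/-- The projection `VHat → 𝕍`. -/
def vvProj : VHat (total m) →ₗ[ℂ] VV m Q := (IQ m Q).mkQ.restrictScalars ℂ

theorem vvProj_surjective : Function.Surjective (vvProj m Q) := (IQ m Q).mkQ_surjective

theorem vvProj_mulHat (g : ℂ[T;T⁻¹]) (v : VHat (total m)) :
    vvProj m Q (mulHat (total m) g v) = mulVV m Q g (vvProj m Q v) := rfl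

/-- The projection on the tensor powers. -/
def vvProjT : TPow n (VHat (total m)) →ₗ[ℂ] TPow n (VV m Q) :=
  PiTensorProduct.map fun _ => vvProj m Q

theorem vvProjT_tprod (u : Fin n → VHat (total m)) : vvProjT n m Q (PiTensorProduct.tprod ℂ u) =
    PiTensorProduct.tprod ℂ fun i => vvProj m Q (u i) := PiTensorProduct.map_tprod _ _

theorem vvProjT_place {n : ℕ} (j : Fin n) {f : Module.End ℂ (VHat (total m))}
    {g : Module.End ℂ (VV m Q)} (h : ∀ v, vvProj m Q (f v) = g (vvProj m Q v))
    (t : TPow n (VHat (total m))) : vvProjT n m Q (place j f t) = place j g (vvProjT n m Q t) := by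
  have : vvProjT n m Q ∘ₗ place j f = place j g ∘ₗ vvProjT n m Q := by
    refine PiTensorProduct.ext (MultilinearMap.ext fun u => ?_)
    simp only [LinearMap.compMultilinearMap_apply, LinearMap.comp_apply, place_tprod,
      vvProjT_tprod]
    congr 1
    funext i
    by_cases hi : i = j
    · subst hi; simp [h]
    · simp [hi]
  exact LinearMap.congr_fun this t

theorem vvProjT_permEnd {n : ℕ} (w : Equiv.Perm (Fin n)) (t : TPow n (VHat (total m))) :
    vvProjT n m Q (permEnd w t) = permEnd w (vvProjT n m Q t) := by
  have : vvProjT n m Q ∘ₗ permEnd w = permEnd w ∘ₗ vvProjT n m Q := by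
    refine PiTensorProduct.ext (MultilinearMap.ext fun u => ?_)
    simp only [LinearMap.compMultilinearMap_apply, LinearMap.comp_apply, permEnd_tprod,
      vvProjT_tprod]
  exact LinearMap.congr_fun this t

theorem sigma_inverse_L {n : ℕ} (j : Fin n) : sigma n m Q (op (Ring.inverse (ArikiKoike.L Q j))) =
    place j (mulVV m Q (T (-1))) := by
  have h1 : place j (mulVV m Q (T (-1))) * sigma n m Q (op (ArikiKoike.L Q j)) = 1 := by
    rw [sigma, akAct_L, ← map_mul, ← map_mul, ← T_add, neg_add_cancel, T_zero, map_one, map_one]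
  have h2 : sigma n m Q (op (ArikiKoike.L Q j)) *
      sigma n m Q (op (Ring.inverse (ArikiKoike.L Q j))) = 1 := by
    rw [← map_mul, ← op_mul, Ring.inverse_mul_cancel _ (ArikiKoike.isUnit_L Q j), op_one, map_one]
  exact (left_inv_eq_right_inv h1 h2).symm

/-- This is the balancing condition that lets `t ⊗ h ↦ t h` descend to the tensor product over the
affine Hecke algebra. -/
theorem vvProjT_affVHat (a : AffineHecke n) : ∀ t : TPow n (VHat (total m)),
    vvProjT n m Q (affVHat n (total m) (op a) t) =
      sigma n m Q (op (AffineHecke.toAK Q a)) (vvProjT n m Q t) := by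
  induction a using AffineHecke.induction with
  | h0 c =>
    intro t
    rw [AlgHom.commutes, ← MulOpposite.algebraMap_apply, ← MulOpposite.algebraMap_apply,
      AlgHom.commutes, AlgHom.commutes, Module.algebraMap_end_apply, Module.algebraMap_end_apply,
      map_smul]
  | hT i => intro t; rw [affVHat, affAct_T, toAK_T, sigma, akAct_T_hi, vvProjT_permEnd]
  | hX j =>
    intro t
    rw [affVHat, affAct_X, toAK_X, sigma, akAct_L, vvProjT_place m Q j (vvProj_mulHat m Q _)]
  | hY j =>
    intro t
    rw [affVHat, affAct_Xinv, toAK_Xinv, sigma_inverse_L,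
      vvProjT_place m Q j (vvProj_mulHat m Q _)]
  | hmul a b ha hb =>
    intro t
    rw [op_mul, map_mul, Module.End.mul_apply, hb, ha, map_mul, op_mul, map_mul,
      Module.End.mul_apply]
  | hadd a b ha hb =>
    intro t
    rw [op_add, map_add, LinearMap.add_apply, map_add, ha, hb, map_add, op_add, map_add,
      LinearMap.add_apply]

/-- The map `VHat ^ ⊗ n ⊗ H → 𝕍 ^ ⊗ n`, `t ⊗ h ↦ t h`. -/
def actTensor : TPow n (VHat (total m)) ⊗[ℂ] ArikiKoike n Q →ₗ[ℂ] TPow n (VV m Q) :=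
  TensorProduct.lift (((sigma n m Q).toLinearMap ∘ₗ
    (MulOpposite.opLinearEquiv ℂ).toLinearMap).flip ∘ₗ vvProjT n m Q)

theorem actTensor_tmul (t : TPow n (VHat (total m))) (h : ArikiKoike n Q) :
    actTensor n m Q (t ⊗ₜ h) = sigma n m Q (op h) (vvProjT n m Q t) := rfl

/-- The map `VHat ^ ⊗ n ⊗_{affine Hecke} H → 𝕍 ^ ⊗ n`. -/
def actTilde : VTilde n m Q →ₗ[ℂ] TPow n (VV m Q) :=
  BalTensor.lift (actTensor n m Q) fun a t b => by
    rw [actTensor_tmul, actTensor_tmul, vvProjT_affVHat, op_mul, map_mul, Module.End.mul_apply]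

theorem actTilde_mk (z : TPow n (VHat (total m)) ⊗[ℂ] ArikiKoike n Q) :
    actTilde n m Q (BalTensor.mk _ _ z) = actTensor n m Q z :=
  BalTensor.lift_mk _ _ z

/-- The map `V_{n,r} → 𝕍 ^ ⊗ n`. -/
def actV : Vnr n m Q →ₗ[ℂ] TPow n (VV m Q) :=
  (TensorProduct.lid ℂ _).toLinearMap ∘ₗ (actTilde n m Q).lTensor ℂ

theorem actV_tmul (c : ℂ) (z : VTilde n m Q) : actV n m Q (c ⊗ₜ z) = c • actTilde n m Q z := rfl

/-- The map `t ↦ w ⊗ (t ⊗ 1)`. -/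
def baseV : TPow n (VHat (total m)) →ₗ[ℂ] Vnr n m Q :=
  TensorProduct.mk ℂ ℂ (VTilde n m Q) 1 ∘ₗ BalTensor.mk _ _ ∘ₗ
    (TensorProduct.mk ℂ (TPow n (VHat (total m))) (ArikiKoike n Q)).flip 1

theorem baseV_apply (t : TPow n (VHat (total m))) :
    baseV n m Q t = (1 : ℂ) ⊗ₜ[ℂ] BalTensor.mk _ _ (t ⊗ₜ[ℂ] 1) := rfl

theorem actV_baseV (t : TPow n (VHat (total m))) : actV n m Q (baseV n m Q t) = vvProjT n m Q t := by
  rw [baseV_apply, actV_tmul, one_smul, actTilde_mk, actTensor_tmul, op_one, map_one,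
    Module.End.one_apply]

theorem sigmaV_tmul (h : (ArikiKoike n Q)ᵐᵒᵖ) (c : ℂ) (t : TPow n (VHat (total m)))
    (b : ArikiKoike n Q) : sigmaV n m Q h (c ⊗ₜ[ℂ] BalTensor.mk _ _ (t ⊗ₜ[ℂ] b)) =
      c ⊗ₜ[ℂ] BalTensor.mk _ _ (t ⊗ₜ[ℂ] (b * h.unop)) := rfl

theorem sigmaV_baseV (a : AffineHecke n) (t : TPow n (VHat (total m))) :
    sigmaV n m Q (op (AffineHecke.toAK Q a)) (baseV n m Q t) =
      baseV n m Q (affVHat n (total m) (op a) t) := by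
  rw [baseV_apply, sigmaV_tmul, one_mul, unop_op, baseV_apply, ← BalTensor.mk_balanced, mul_one]

/-- Linear maps out of `V_{n,r}` that agree on the pure tensors are equal. -/
theorem Vnr_ext {N : Type} [AddCommGroup N] [Module ℂ N] {f g : Vnr n m Q →ₗ[ℂ] N}
    (h : ∀ t b, f ((1 : ℂ) ⊗ₜ[ℂ] BalTensor.mk _ _ (t ⊗ₜ[ℂ] b)) =
      g ((1 : ℂ) ⊗ₜ[ℂ] BalTensor.mk _ _ (t ⊗ₜ[ℂ] b))) : f = g := by
  refine TensorProduct.ext' fun c z => ?_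
  obtain ⟨z, rfl⟩ := BalTensor.mk_surjective _ _ z
  have key : f ∘ₗ TensorProduct.mk ℂ ℂ (VTilde n m Q) 1 ∘ₗ BalTensor.mk _ _ =
      g ∘ₗ TensorProduct.mk ℂ ℂ (VTilde n m Q) 1 ∘ₗ BalTensor.mk _ _ :=
    TensorProduct.ext' h
  have h1 := LinearMap.congr_fun key z
  have h2 : ∀ y : VTilde n m Q, c ⊗ₜ[ℂ] y = c • ((1 : ℂ) ⊗ₜ[ℂ] y) := fun y => by
    rw [TensorProduct.smul_tmul', smul_eq_mul, mul_one]
  rw [h2, map_smul, map_smul]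
  exact congrArg (c • ·) h1

/-- Every `h` is the image of some `a` in the affine Hecke algebra, so `t ⊗ h = t a ⊗ 1`. -/
theorem baseV_surjective : Function.Surjective (baseV n m Q) := by
  rw [← LinearMap.range_eq_top, ← Submodule.ker_mkQ (LinearMap.range (baseV n m Q)),
    LinearMap.ker_eq_top]
  refine Vnr_ext n m Q fun t b => ?_
  rw [LinearMap.zero_apply]
  refine (Submodule.Quotient.mk_eq_zero _).2 ?_
  obtain ⟨a, rfl⟩ := toAK_surjective Q b
  rw [← mul_one (AffineHecke.toAK Q a), BalTensor.mk_balanced]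
  exact ⟨_, rfl⟩

theorem actV_sigmaV (h : (ArikiKoike n Q)ᵐᵒᵖ) (z : Vnr n m Q) :
    actV n m Q (sigmaV n m Q h z) = sigma n m Q h (actV n m Q z) := by
  have : actV n m Q ∘ₗ sigmaV n m Q h = sigma n m Q h ∘ₗ actV n m Q := by
    refine Vnr_ext n m Q fun t b => ?_
    rw [LinearMap.comp_apply, LinearMap.comp_apply, sigmaV_tmul, actV_tmul, actV_tmul, one_smul,
      one_smul, actTilde_mk, actTilde_mk, actTensor_tmul, actTensor_tmul, op_mul, map_mul,
      Module.End.mul_apply, op_unop]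
  exact LinearMap.congr_fun this z

/-- The action on `𝕍` is induced by the unshifted loop action pulled back along the shift
homomorphism, since both agree on generators; the factor `1 - Q⁻¹ x` of the `F`'s comes from that
homomorphism. -/
theorem vvLie_eq (y : GLoop m Q) : ∃ A : stab m Q, vvLie m Q y = stabEnd m Q A ∧
    A.1 = loopMat (etaParam m Q) (shiftHom (etaParam m Q) (bShift m) y) := by
  refine ⟨_, rfl, ?_⟩
  refine ShiftedLoop.hom_ext (f := (stab m Q).val.toLieHom.comp (ShiftedLoop.lift _ _ _ _))
    (g := (loopMat (etaParam m Q)).comp (shiftHom (etaParam m Q) (bShift m)))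
    (fun i t => ?_) (fun i t => ?_) (fun i t => ?_) y
  · rw [LieHom.comp_apply, LieHom.comp_apply, ShiftedLoop.lift_E]
    simp [shiftHom, loopMat, ShiftedLoop.lift_E]
  · rw [LieHom.comp_apply, LieHom.comp_apply, ShiftedLoop.lift_F]
    simp [shiftHom, loopMat, ShiftedLoop.lift_F]
  · rw [LieHom.comp_apply, LieHom.comp_apply, ShiftedLoop.lift_H]
    simp [shiftHom, loopMat, ShiftedLoop.lift_H]

theorem vvProj_lie (y : GLoop m Q) (v : VHat (total m)) :
    vvProj m Q (matEnd (loopMat (etaParam m Q) (shiftHom (etaParam m Q) (bShift m) y)) v) =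
      vvLie m Q y (vvProj m Q v) := by
  obtain ⟨A, h1, h2⟩ := vvLie_eq m Q y
  rw [h1, ← h2]
  rfl

/-- The first summand of the coproduct acts on the trivial module by zero; only the shifted action
on the second factor remains. -/
theorem rhoV_ι (y : GLoop m Q) (c : ℂ) (t : TPow n (VHat (total m))) (b : ArikiKoike n Q) :
    rhoV n m Q (UniversalEnvelopingAlgebra.ι ℂ y) (c ⊗ₜ[ℂ] BalTensor.mk _ _ (t ⊗ₜ[ℂ] b)) =
      c ⊗ₜ[ℂ] BalTensor.mk _ _ (tensorLie (matEnd
        (loopMat (etaParam m Q) (shiftHom (etaParam m Q) (bShift m) y))) t ⊗ₜ[ℂ] b) := by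
  have h1 : deltaSharp m Q (UniversalEnvelopingAlgebra.ι ℂ y) =
      UniversalEnvelopingAlgebra.ι ℂ y ⊗ₜ[ℂ] 1 +
        1 ⊗ₜ[ℂ] UniversalEnvelopingAlgebra.ι ℂ (shiftHom (etaParam m Q) (bShift m) y) :=
    UniversalEnvelopingAlgebra.lift_ι_apply ℂ _ _
  have h2 : rhoTriv m Q (UniversalEnvelopingAlgebra.ι ℂ y) = 0 :=
    UniversalEnvelopingAlgebra.lift_ι_apply ℂ _ _
  have h3 : rhoTilde n m Q (UniversalEnvelopingAlgebra.ι ℂ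
      (shiftHom (etaParam m Q) (bShift m) y)) (BalTensor.mk _ _ (t ⊗ₜ[ℂ] b)) =
        BalTensor.mk _ _ (tensorLie (matEnd
          (loopMat (etaParam m Q) (shiftHom (etaParam m Q) (bShift m) y))) t ⊗ₜ[ℂ] b) := by
    have h4 : loopTensorRep n (etaParam m Q) (UniversalEnvelopingAlgebra.ι ℂ
      (shiftHom (etaParam m Q) (bShift m) y)) = tensorLie (matEnd
          (loopMat (etaParam m Q) (shiftHom (etaParam m Q) (bShift m) y))) :=
      UniversalEnvelopingAlgebra.lift_ι_apply ℂ _ _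
    rw [← h4]
    rfl
  rw [rhoV, AlgHom.comp_apply, AlgHom.comp_apply, h1, map_add, Algebra.TensorProduct.map_tmul,
    Algebra.TensorProduct.map_tmul, h2, TensorProduct.zero_tmul, zero_add, map_one,
    Module.endTensorEndAlgHom_apply, TensorProduct.AlgebraTensorModule.map_tmul, h3,
    Module.End.one_apply]

theorem actV_rhoV (u : UShift m Q) (z : Vnr n m Q) :
    actV n m Q (rhoV n m Q u z) = rho m Q n u (actV n m Q z) := by
  -- Pairs of operators intertwined by `actV` form a subalgebra, so it is enough to check elements
  -- of the Lie algebra.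
  let S : Subalgebra ℂ (Module.End ℂ (Vnr n m Q) × Module.End ℂ (TPow n (VV m Q))) :=
    { carrier := {f | ∀ z, actV n m Q (f.1 z) = f.2 (actV n m Q z)}
      mul_mem' := fun {f g} hf hg z => by
        rw [Prod.fst_mul, Prod.snd_mul, Module.End.mul_apply, Module.End.mul_apply, hf, hg]
      add_mem' := fun {f g} hf hg z => by
        rw [Prod.fst_add, Prod.snd_add, LinearMap.add_apply, LinearMap.add_apply, map_add, hf, hg]
      algebraMap_mem' := fun c z => by
        simp [Algebra.algebraMap_eq_smul_one] }
  let F := (rhoV n m Q).prod (rho m Q n)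
  have hF : F = UniversalEnvelopingAlgebra.lift ℂ ((UniversalEnvelopingAlgebra.lift ℂ).symm F) :=
    (Equiv.apply_symm_apply _ _).symm
  have key : F u ∈ S := by
    rw [hF]
    refine uea_lift_mem S _ (fun y => ?_) u
    change ∀ z, actV n m Q (rhoV n m Q (UniversalEnvelopingAlgebra.ι ℂ y) z) =
      rho m Q n (UniversalEnvelopingAlgebra.ι ℂ y) (actV n m Q z)
    have hy : rho m Q n (UniversalEnvelopingAlgebra.ι ℂ y) = tensorLie (vvLie m Q y) :=
      UniversalEnvelopingAlgebra.lift_ι_apply ℂ _ _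
    refine LinearMap.congr_fun (f := actV n m Q ∘ₗ rhoV n m Q (UniversalEnvelopingAlgebra.ι ℂ y))
      (g := rho m Q n (UniversalEnvelopingAlgebra.ι ℂ y) ∘ₗ actV n m Q) (Vnr_ext n m Q fun t b => ?_)
    -- The image of `ρ` commutes with that of `σ`, so `b` can be moved outside and only the
    -- projection of `t` has to be compared.
    have hc : sigma n m Q (op b) * rho m Q n (UniversalEnvelopingAlgebra.ι ℂ y) =
        rho m Q n (UniversalEnvelopingAlgebra.ι ℂ y) * sigma n m Q (op b) :=
      akAct_mem Q (mulVV_cyc m Q) _ (range_rho_le ⟨_, rfl⟩) _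
    rw [LinearMap.comp_apply, LinearMap.comp_apply, rhoV_ι, actV_tmul, actV_tmul, one_smul, one_smul,
      actTilde_mk, actTilde_mk, actTensor_tmul, actTensor_tmul, ← Module.End.mul_apply,
      ← hc, Module.End.mul_apply, hy]
    congr 1
    rw [tensorLie_apply, tensorLie_apply, LinearMap.sum_apply, LinearMap.sum_apply, map_sum]
    exact Finset.sum_congr rfl fun j _ => vvProjT_place m Q j (vvProj_lie m Q y) t
  exact key z

end Comparison
end SchurWeyl
end

noncomputable section
namespace SchurWeyl

open MulOpposite LaurentPolynomial

/-! ### The kernel of the comparison map -/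

section Kernel

variable {r : ℕ} (n : ℕ) (m : Fin r → ℕ+) (Q : Fin r → ℂˣ)

theorem dvd_of_mem_IQ {v : VHat (total m)} (hv : v ∈ IQ m Q) (p : Fin (total m)) :
    Polynomial.toLaurent (cycPoly Q (block m p)) ∣ v p := by
  induction hv using Submodule.span_induction with
  | mem v hv =>
    obtain ⟨j, rfl⟩ := hv
    by_cases h : p = j
    · subst h; simp
    · simp [h]
  | zero => simp
  | add a b _ _ ha hb => exact dvd_add ha hb
  | smul c a _ ha => exact Dvd.dvd.mul_left ha c

/-- The tensors whose image in `V_{n,r}` is in the submodule `I`. -/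
def preIV : Submodule ℂ (TPow n (VHat (total m))) := (IV n m Q).comap (baseV n m Q)

theorem mulHat_single (f g : ℂ[T;T⁻¹]) (p : Fin (total m)) :
    mulHat (total m) f (Pi.single p g) = Pi.single p (f * g) := by
  change f • (Pi.single p g : VHat (total m)) = _
  rw [← Pi.single_smul, smul_eq_mul]

theorem aeval_mulHat (g : Polynomial ℂ) : Polynomial.aeval (mulHat (total m) (T 1)) g =
    mulHat (total m) (Polynomial.toLaurent g) := by
  rw [Polynomial.aeval_algHom_apply]
  congr 1
  have h : Polynomial.aeval (T 1 : ℂ[T;T⁻¹]) = Polynomial.toLaurentAlg (R := ℂ) := by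
    ext
    simp
  rw [h]
  rfl

theorem aeval_mulVV (g : Polynomial ℂ) : Polynomial.aeval (mulVV m Q (T 1)) g =
    mulVV m Q (Polynomial.toLaurent g) := by
  rw [Polynomial.aeval_algHom_apply]
  congr 1
  have h : Polynomial.aeval (T 1 : ℂ[T;T⁻¹]) = Polynomial.toLaurentAlg (R := ℂ) := by
    ext
    simp
  rw [h]
  rfl

variable {n m Q}

theorem affVHat_mem_preIV (a : AffineHecke n) {t : TPow n (VHat (total m))}
    (ht : t ∈ preIV n m Q) : affVHat n (total m) (op a) t ∈ preIV n m Q := by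
  rw [preIV, Submodule.mem_comap, ← sigmaV_baseV]
  exact IV_stable n m Q _ ht

theorem permEnd_mem_preIV (w : Equiv.Perm (Fin n)) {t : TPow n (VHat (total m))}
    (ht : t ∈ preIV n m Q) : permEnd w t ∈ preIV n m Q := by
  obtain ⟨l, rfl⟩ := exists_word w
  induction l with
  | nil => simpa [permEnd_one] using ht
  | cons i l ih =>
    rw [List.map_cons, List.prod_cons, permEnd_mul, Module.End.mul_apply]
    have := affVHat_mem_preIV (AffineHecke.mk (FreeAlgebra.ι ℂ (AffGen.T i))) ih
    rwa [affVHat, affAct_T] at this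

theorem place_mem_preIV (j : Fin n) (g : ℂ[T;T⁻¹]) {t : TPow n (VHat (total m))}
    (ht : t ∈ preIV n m Q) : place j (mulHat (total m) g) t ∈ preIV n m Q := by
  refine laurent_span (N := (preIV n m Q).comap (LinearMap.applyₗ t ∘ₗ
    ((place j).comp (mulHat (total m))).toLinearMap)) (fun k => ?_) g
  change place j (mulHat (total m) (T k)) t ∈ preIV n m Q
  induction k using Int.induction_on with
  | zero => rw [T_zero, map_one, map_one]; exact ht
  | succ k ih =>
    have := affVHat_mem_preIV (AffineHecke.mk (FreeAlgebra.ι ℂ (AffGen.X j))) ih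
    rw [affVHat, affAct_X, ← Module.End.mul_apply, ← map_mul, ← map_mul, ← T_add, add_comm] at this
    exact this
  | pred k ih =>
    have := affVHat_mem_preIV (AffineHecke.mk (FreeAlgebra.ι ℂ (AffGen.Xinv j))) ih
    rw [affVHat, affAct_Xinv, ← Module.End.mul_apply, ← map_mul, ← map_mul, ← T_add] at this
    rwa [show -(k : ℤ) - 1 = -1 + -k by ring]

theorem vMu_cyc_mem_preIV (μ : RComp n m) (j : Fin n) :
    place j (mulHat (total m) (Polynomial.toLaurent (cycPoly Q (block m (μ.row j)))))
      (PiTensorProduct.tprod ℂ fun p => (Pi.single (μ.row p) 1 : VHat (total m))) ∈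
        preIV n m Q := by
  set a : AffineHecke n := Polynomial.aeval (AffineHecke.mk (FreeAlgebra.ι ℂ (AffGen.X j)))
    (cycPoly Q (block m (μ.row j))) with ha
  have h1 : AffineHecke.toAK Q a = ArikiKoike.Lcyc Q j (block m (μ.row j)) := by
    rw [ha, ← Polynomial.aeval_algHom_apply, toAK_X]
    rfl
  have h2 : affVHat n (total m) (op a) =
      place j (mulHat (total m) (Polynomial.toLaurent (cycPoly Q (block m (μ.row j))))) := by
    have h3 : op a = Polynomial.aeval (op (AffineHecke.mk (FreeAlgebra.ι ℂ (AffGen.X j))))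
        (cycPoly Q (block m (μ.row j))) := by
      apply unop_injective
      rw [unop_aeval_op, unop_op]
    rw [h3, ← Polynomial.aeval_algHom_apply, affVHat, affAct_X, Polynomial.aeval_algHom_apply,
      aeval_mulHat]
  rw [preIV, Submodule.mem_comap, ← h2, ← sigmaV_baseV, h1]
  refine Submodule.subset_span ⟨μ, j, 1, ?_⟩
  rw [map_one, Module.End.one_apply]
  rfl

/-- The generators of the submodule have weakly increasing words; a place permutation brings an
arbitrary word to this form. -/
theorem single_cyc_mem_preIV (J : Fin n → Fin (total m)) (a : Fin n) :
    place a (mulHat (total m) (Polynomial.toLaurent (cycPoly Q (block m (J a)))))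
      (PiTensorProduct.tprod ℂ fun i => (Pi.single (J i) 1 : VHat (total m))) ∈ preIV n m Q := by
  obtain ⟨μ, w, rfl⟩ := RComp.exists_row_comp J
  have h := permEnd_mem_preIV w⁻¹ (vMu_cyc_mem_preIV (Q := Q) μ (w a))
  rw [← Module.End.mul_apply, permEnd_place, Module.End.mul_apply, permEnd_tprod,
    show w⁻¹ (w a) = a from Equiv.symm_apply_apply w a] at h
  exact h

theorem tprod_single_mem_preIV (J : Fin n → Fin (total m)) (g : Fin n → ℂ[T;T⁻¹]) (a : Fin n)
    (h : Polynomial.toLaurent (cycPoly Q (block m (J a))) ∣ g a) :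
    PiTensorProduct.tprod ℂ (fun i => (Pi.single (J i) (g i) : VHat (total m))) ∈
      preIV n m Q := by
  obtain ⟨f, hf⟩ := h
  set c := Polynomial.toLaurent (cycPoly Q (block m (J a))) with hc
  -- Start with the block polynomial `c` in the factor `a` and `1` in all others, then multiply in
  -- the remaining coefficients one factor at a time, which stays in `preIV` by `place_mem_preIV`.
  have key : ∀ S : Finset (Fin n), PiTensorProduct.tprod ℂ (fun i =>
      (Pi.single (J i) ((if i ∈ S then (if i = a then f else g i) else 1) *
        (if i = a then c else 1)) : VHat (total m))) ∈ preIV n m Q := by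
    intro S
    induction S using Finset.induction_on with
    | empty =>
      have h1 := single_cyc_mem_preIV (Q := Q) J a
      rw [place_tprod] at h1
      convert h1 using 2
      funext i
      by_cases hi : i = a
      · subst hi
        rw [Function.update_self, mulHat_single]
        simp [hc]
      · simp [hi]
    | insert b S hb ih =>
      have h1 := place_mem_preIV b (if b = a then f else g b) ih
      rw [place_tprod] at h1
      convert h1 using 2
      funext i
      by_cases hi : i = b
      · subst hi
        rw [Function.update_self, mulHat_single]
        simp [hb]
      · rw [Function.update_of_ne hi]
        simp [hi]
  convert key Finset.univ using 2
  funext i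
  by_cases hi : i = a
  · subst hi; simp [hf, mul_comm]
  · simp [hi]

theorem tprod_mem_preIV (u : Fin n → VHat (total m)) (a : Fin n) (h : u a ∈ IQ m Q) :
    PiTensorProduct.tprod ℂ u ∈ preIV n m Q := by
  have hu : u = fun i => ∑ p, Pi.single p (u i p) :=
    funext fun i => (Finset.univ_sum_single (u i)).symm
  rw [hu, MultilinearMap.map_sum]
  exact sum_mem fun J _ => tprod_single_mem_preIV J (fun i => u i (J i)) a (dvd_of_mem_IQ m Q h _)

/-- Choose a linear section `s` of `VHat → 𝕍` and replace the factors `u_a` one by one by `s` of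
their images. Each replacement changes the tensor by one with a factor in `I_Q`, hence by an element
of `preIV`. The final tensor depends only on the image in the tensor space, so it is zero when that
image is. -/
theorem mem_preIV {t : TPow n (VHat (total m))} (ht : vvProjT n m Q t = 0) : t ∈ preIV n m Q := by
  obtain ⟨s, hs⟩ := (vvProj m Q).exists_rightInverse_of_surjective
    (LinearMap.range_eq_top.2 (vvProj_surjective m Q))
  have hs' : ∀ v, vvProj m Q (s v) = v := LinearMap.congr_fun hs
  set f : Fin n → Module.End ℂ (VHat (total m)) := fun _ => s ∘ₗ vvProj m Q with hf
  have h1 : ∀ t, t - tmap f t ∈ preIV n m Q := by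
    intro t
    have : (⊤ : Submodule ℂ (TPow n (VHat (total m)))) ≤ (preIV n m Q).comap (1 - tmap f) := by
      rw [← PiTensorProduct.span_tprod_eq_top, Submodule.span_le]
      rintro _ ⟨u, rfl⟩
      have key : ∀ S : Finset (Fin n), PiTensorProduct.tprod ℂ u - PiTensorProduct.tprod ℂ
          (fun i => if i ∈ S then s (vvProj m Q (u i)) else u i) ∈ preIV n m Q := by
        intro S
        induction S using Finset.induction_on with
        | empty => simp
        | insert a S ha ih =>
          set u' : Fin n → VHat (total m) :=
            fun i => if i ∈ S then s (vvProj m Q (u i)) else u i with hu'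
          have h2 : (fun i => if i ∈ insert a S then s (vvProj m Q (u i)) else u i) =
              Function.update u' a (s (vvProj m Q (u a))) := by
            funext i
            by_cases hi : i = a
            · subst hi; simp
            · simp [hi, hu']
          have h3 : u' = Function.update u' a (u a) := by
            rw [eq_comm, Function.update_eq_self_iff]
            simp [hu', ha]
          have h4 : PiTensorProduct.tprod ℂ u' -
              PiTensorProduct.tprod ℂ (Function.update u' a (s (vvProj m Q (u a)))) ∈
                preIV n m Q := by
            have h6 : PiTensorProduct.tprod ℂ u' -
                PiTensorProduct.tprod ℂ (Function.update u' a (s (vvProj m Q (u a)))) =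
                PiTensorProduct.tprod ℂ (Function.update u' a (u a - s (vvProj m Q (u a)))) := by
              rw [MultilinearMap.map_update_sub, ← h3]
            rw [h6]
            refine tprod_mem_preIV _ a ?_
            rw [Function.update_self]
            have h5 : vvProj m Q (u a - s (vvProj m Q (u a))) = 0 := by
              rw [map_sub, hs', sub_self]
            exact (Submodule.Quotient.mk_eq_zero _).1 h5
          rw [h2]
          have := add_mem ih h4
          rwa [sub_add_sub_cancel] at this
      have h2 := key Finset.univ
      simp only [Finset.mem_univ, if_true] at h2
      rw [SetLike.mem_coe, Submodule.mem_comap, LinearMap.sub_apply, Module.End.one_apply,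
        tmap_tprod]
      exact h2
    exact this trivial
  have h2 : tmap f = PiTensorProduct.map (fun _ => s) ∘ₗ vvProjT n m Q :=
    PiTensorProduct.map_comp _ _
  have h3 := h1 t
  rwa [h2, LinearMap.comp_apply, ht, map_zero, sub_zero] at h3

theorem ker_actV : LinearMap.ker (actV n m Q) = IV n m Q := by
  refine le_antisymm (fun z hz => ?_) ?_
  · obtain ⟨t, rfl⟩ := baseV_surjective n m Q z
    rw [LinearMap.mem_ker, actV_baseV] at hz
    exact mem_preIV hz
  · rw [IV, Submodule.span_le]
    rintro _ ⟨μ, j, h, rfl⟩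
    rw [SetLike.mem_coe, LinearMap.mem_ker, actV_sigmaV, actV_sigmaV]
    have hv : actV n m Q (vMu Q μ) = PiTensorProduct.tprod ℂ fun i => vvMk m Q (μ.row i) 1 :=
      (actV_baseV n m Q _).trans (vvProjT_tprod n m Q _)
    rw [hv, ArikiKoike.Lcyc, sigma, akAct_aeval_L, place_tprod, aeval_mulVV]
    have h0 : mulVV m Q (Polynomial.toLaurent (cycPoly Q (block m (μ.row j))))
        (vvMk m Q (μ.row j) 1) = 0 := by
      change Polynomial.toLaurent (cycPoly Q (block m (μ.row j))) • vvMk m Q (μ.row j) 1 = 0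
      rw [← vvMk_smul, mul_one]
      exact vvMk_eq_zero m Q dvd_rfl
    rw [h0, MultilinearMap.map_update_zero, map_zero]

theorem actV_surjective : Function.Surjective (actV n m Q) := by
  have h : Function.Surjective (vvProjT n m Q) := by
    rw [← LinearMap.range_eq_top, eq_top_iff, ← PiTensorProduct.span_tprod_eq_top,
      Submodule.span_le]
    rintro _ ⟨u, rfl⟩
    choose u' hu' using fun i => vvProj_surjective m Q (u i)
    exact ⟨PiTensorProduct.tprod ℂ u', by rw [vvProjT_tprod]; simp only [hu']⟩
  intro v
  obtain ⟨t, rfl⟩ := h v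
  exact ⟨_, actV_baseV n m Q t⟩

variable (n m Q) in
-- Stability under the loop algebra is not checked on generators: the submodule is the kernel of a
-- bimodule homomorphism.
theorem exists_equiv_quotient_IV :
    ∃ hI : ∀ u : UShift m Q, IV n m Q ≤ (IV n m Q).comap (rhoV n m Q u),
      ∃ e : TPow n (VV m Q) ≃ₗ[ℂ] Vnr n m Q ⧸ IV n m Q,
        (∀ (u : UShift m Q) (v : TPow n (VV m Q)),
          e (rho m Q n u v) = (IV n m Q).mapQ (IV n m Q) (rhoV n m Q u) (hI u) (e v)) ∧
        (∀ (h : (ArikiKoike n Q)ᵐᵒᵖ) (v : TPow n (VV m Q)),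
          e (sigma n m Q h v) =
            (IV n m Q).mapQ (IV n m Q) (sigmaV n m Q h) (IV_stable n m Q h) (e v)) := by
  let e' : (Vnr n m Q ⧸ IV n m Q) ≃ₗ[ℂ] TPow n (VV m Q) :=
    (Submodule.quotEquivOfEq _ _ ker_actV.symm).trans
      ((actV n m Q).quotKerEquivOfSurjective actV_surjective)
  have he : ∀ z, e'.symm (actV n m Q z) = (IV n m Q).mkQ z := by
    intro z
    rw [LinearEquiv.symm_apply_eq]
    rfl
  refine ⟨fun u z hz => ?_, e'.symm, fun u v => ?_, fun h v => ?_⟩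
  · rw [← ker_actV, LinearMap.mem_ker] at hz
    rw [Submodule.mem_comap, ← ker_actV, LinearMap.mem_ker, actV_rhoV, hz, map_zero]
  · obtain ⟨z, rfl⟩ := actV_surjective v
    rw [← actV_rhoV, he, he]
    rfl
  · obtain ⟨z, rfl⟩ := actV_surjective v
    rw [← actV_sigmaV, he, he]
    rfl

end Kernel
end SchurWeyl
end

theorem mainTheorem4 {n r : ℕ} (hn : 0 < n) (hr : 0 < r) (m : Fin r → ℕ+) (Q : Fin r → ℂˣ)
    (hm : ∀ k, n ≤ (m k : ℕ)) :
    (∃ hI : ∀ u : UShift m Q, IV n m Q ≤ (IV n m Q).comap (rhoV n m Q u),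
      ∃ e : TPow n (VV m Q) ≃ₗ[ℂ] Vnr n m Q ⧸ IV n m Q,
        (∀ (u : UShift m Q) (v : TPow n (VV m Q)),
          e (rho m Q n u v) = (IV n m Q).mapQ (IV n m Q) (rhoV n m Q u) (hI u) (e v)) ∧
        (∀ (h : (ArikiKoike n Q)ᵐᵒᵖ) (v : TPow n (VV m Q)),
          e (sigma n m Q h v) =
            (IV n m Q).mapQ (IV n m Q) (sigmaV n m Q h) (IV_stable n m Q h) (e v))) ∧
    (∃ e : TPow n (VV m Q) ≃ₗ[ℂ] SumM n m Q,
      ∀ (h : (ArikiKoike n Q)ᵐᵒᵖ) (v : TPow n (VV m Q)), e (sigma n m Q h v) = h • e v) ∧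
    (Nonempty ((rho m Q n).range ≃ₐ[ℂ] CycSchur n m Q) ∧
      IsQuasiHereditary ℂ (rho m Q n).range ∧ IsQuasiHereditary ℂ (CycSchur n m Q) ∧
      Nonempty ((sigma n m Q).range ≃ₐ[ℂ] ArikiKoike n Q)) ∧
    ((rho m Q n).range = Subalgebra.centralizer ℂ ((sigma n m Q).range : Set _) ∧
      (sigma n m Q).range = Subalgebra.centralizer ℂ ((rho m Q n).range : Set _)) := by
  -- A word of distinct letters from the last block, whose zero-based index is `r - 1`; it exists
  -- because this block has at least `n` indices.
  let ω : Fin n → Fin (total m) := blockIdx m hm ⟨r - 1, Nat.sub_lt hr one_pos⟩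
  have hω : Function.Injective ω := fun i j h => blockIdx_inj m hm _ _ i j h
  have hd : ∀ i, (block m (ω i) : ℕ) + 1 = r := fun i => by
    rw [block_blockIdx]
    exact Nat.sub_add_cancel hr
  obtain ⟨e, he⟩ := exists_equiv_SumM (mulVV_cyc m Q) (vvBasis m Q) ω hω hd hn
  have hρ := range_rho (Q := Q) hn hm
  have hinj : Function.Injective (sigma n m Q) :=
    ChainBasis.akAct_injective Q (mulVV_cyc m Q) ω (vvBasis m Q) hn hω hd
  have hρσ : (rho m Q n).range = Subalgebra.centralizer ℂ ((sigma n m Q).range : Set _) :=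
    hρ.trans (centralizer_akAct Q (mulVV_cyc m Q)).symm
  refine ⟨exists_equiv_quotient_IV n m Q, ⟨e, he⟩, ⟨⟨?_⟩, ?_, ?_, ⟨?_⟩⟩, hρσ, le_antisymm ?_ ?_⟩
  · exact (Subalgebra.equivOfEq _ _ hρ).trans (cycSchurEquiv e he).symm
  · exact isQuasiHereditary_of_equiv_Sch hm (Subalgebra.equivOfEq _ _ hρ)
  · exact isQuasiHereditary_of_equiv_Sch hm (cycSchurEquiv e he)
  -- Faithfulness identifies the image with the opposite algebra; the anti-automorphism fixing the
  -- generators removes the opposite.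
  · exact (AlgEquiv.ofInjective (sigma n m Q) hinj).symm.trans (ArikiKoike.antiEquiv Q).symm
  · rw [hρσ]
    exact Set.subset_centralizer_centralizer
  · rw [hρ]
    exact ChainBasis.centralizer_Sch Q (mulVV_cyc m Q) ω (vvBasis m Q) hω hd fun p =>
      (block m p).isLt
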